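/- Let $(M,g)$ be a connected, complete, real-analytic Riemannian manifold of dimension $n$. For a function $f:M\to\mathbb R$, the leaf of $f$ through $p\in M$ is the connected component containing $p$ of the fibre $f^{-1}(f(p))$. An analytic function $f:M\to\mathbb R$ is called an equilibrium function if $\|\nabla f\|^2$ and $\Delta f$ are constant on every leaf of $f$. A hypersurface is a smooth embedded submanifold of $M$ of codimension $1$, and an equilibrium hypersurface is a hypersurface $S\subset M$ that is a leaf of some equilibrium function. Proposition. Let $S$ be a compact equilibrium hypersurface. (1) $S$ has constant mean curvature: there is $H\in\mathbb R$ such that for every connected $A\subseteq S$ and every continuous unit normal field $\nu$ of $S$ along $A$, the mean curvature of $S$ with respect to $\nu$ is constant on $A$, equal to $H$ or to $-H$. Here the mean curvature of $S$ at $p$ with respect to $\nu(p)$ is $\operatorname{div}(\nabla h/\|\nabla h\|)(p)$, where $h$ is any smooth function near $p$ with nowhere vanishing differential whose zero set is $S$ near $p$ and with $\nabla h(p)/\|\nabla h(p)\|=\nu(p)$. (2) $S$ is a critical point of the $(n-1)$-area for all variations that preserve the enclosed $n$-volume, in the following sense. Say that a set $S'$ encloses an open set $\Omega'$ if $\partial\Omega'=S'$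 and $\Omega'$ is the interior of its closure. Let $F:(-\varepsilon,\varepsilon)\times S\to M$ be smooth with $F(0,p)=p$ for all $p\in S$, and put $S_t=F(\{t\}\times S)$. For each $t\in(-\varepsilon,\varepsilon)$ let $\Omega_t$ be an open set enclosed by $S_t$, depending continuously on $t$ in the sense that, for $x\notin S_t$, one has $x\in\Omega_t$ if and only if $y\in\Omega_s$, for all $(s,y)$ in a neighbourhood of $(t,x)$. If $\operatorname{vol}_n(\Omega_0)<\infty$ and $\operatorname{vol}_n(\Omega_t)=\operatorname{vol}_n(\Omega_0)$ for all $t\in(-\varepsilon,\varepsilon)$, then $A(t)=\operatorname{area}_{n-1}(S_t)$ is finite for all $t\in(-\varepsilon,\varepsilon)$, is differentiable at $t=0$, and $A'(0)=0$. Volume and area are the $n$- and $(n-1)$-dimensional Hausdorff measures of the Riemannian distance, normalized so as to agree with Lebesgue measure on Euclidean spaces. -/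

import Mathlib

open Set Filter Topology MeasureTheory Bundle
open scoped Manifold ContDiff

noncomputable section

/-! Throughout, `M` is an `n`-dimensional manifold modelled on `EuclideanSpace ℝ (Fin n)` whose
tangent spaces carry a Riemannian metric. -/

section Calculus

variable (n : ℕ) {M : Type*} [TopologicalSpace M] [ChartedSpace (EuclideanSpace ℝ (Fin n)) M]
  [RiemannianBundle (fun x : M ↦ TangentSpace (𝓡 n) x)]

instance tangentSpaceFiniteDimensional (x : M) : FiniteDimensional ℝ (TangentSpace (𝓡 n) x) :=
  inferInstanceAs (FiniteDimensional ℝ (EuclideanSpace ℝ (Fin n)))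

instance tangentSpaceComplete (x : M) : CompleteSpace (TangentSpace (𝓡 n) x) :=
  FiniteDimensional.complete ℝ _

/-- The Riemannian gradient `∇f` of a function: `⟨∇f(x), v⟩ = df_x(v)` for every tangent
vector `v` at `x`. -/
def grad (f : M → ℝ) (x : M) : TangentSpace (𝓡 n) x :=
  (InnerProductSpace.toDual ℝ (TangentSpace (𝓡 n) x)).symm (mvfderiv (𝓡 n) f x)

/-- The coordinate vector field `∂ᵢ` of the preferred chart at `p`, at the point with
coordinates `y`. -/
def coordField (p : M) (y : EuclideanSpace ℝ (Fin n)) (i : Fin n) :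
    TangentSpace (𝓡 n) ((extChartAt (𝓡 n) p).symm y) :=
  mfderiv 𝓘(ℝ, EuclideanSpace ℝ (Fin n)) (𝓡 n) (extChartAt (𝓡 n) p).symm y
    (EuclideanSpace.single i (1 : ℝ))

/-- The density `√ det (gᵢⱼ)` of the metric in the preferred chart at `p`. -/
def metricDensity (p : M) (y : EuclideanSpace ℝ (Fin n)) : ℝ :=
  √ (Matrix.of fun i j : Fin n ↦ inner ℝ (coordField n p y i) (coordField n p y j)).det

/-- The components of the vector field `X` in the preferred chart at `p`. -/
def coordComponents (X : (x : M) → TangentSpace (𝓡 n) x) (p : M)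
    (y : EuclideanSpace ℝ (Fin n)) : EuclideanSpace ℝ (Fin n) :=
  mfderiv (𝓡 n) 𝓘(ℝ, EuclideanSpace ℝ (Fin n)) (extChartAt (𝓡 n) p)
    ((extChartAt (𝓡 n) p).symm y) (X ((extChartAt (𝓡 n) p).symm y))

/-- The Riemannian divergence
`div X = (det g)^(-1/2) ∑ᵢ ∂ᵢ ((det g)^(1/2) Xⁱ)`, computed at `p` in the preferred chart at `p`. -/
def riemDiv (X : (x : M) → TangentSpace (𝓡 n) x) (p : M) : ℝ :=
  (metricDensity n p (extChartAt (𝓡 n) p p))⁻¹ *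
    ∑ i : Fin n, fderiv ℝ (fun y ↦ metricDensity n p y * coordComponents n X p y i)
      (extChartAt (𝓡 n) p p) (EuclideanSpace.single i (1 : ℝ))

/-- The Laplace-Beltrami operator `Δf = div ∇f`. -/
def laplaceBeltrami (f : M → ℝ) (x : M) : ℝ :=
  riemDiv n (grad n f) x

/-- The vector field `∇h / ‖∇h‖`. -/
def unitGrad (h : M → ℝ) (x : M) : TangentSpace (𝓡 n) x :=
  ‖grad n h x‖⁻¹ • grad n h x

/-- The leaf through `p` of the partition induced by `f`: the connected component containing `p`
of the fibre of `f` through `p`. -/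
def leaf {X : Type*} [TopologicalSpace X] (f : X → ℝ) (p : X) : Set X :=
  connectedComponentIn (f ⁻¹' {f p}) p

/-- An equilibrium function: an analytic function `f` such that `(∇f)²` and `Δf` are constant on
every leaf of the partition induced by `f`. -/
structure IsEquilibriumFunction (f : M → ℝ) : Prop where
  analytic : ContMDiff (𝓡 n) 𝓘(ℝ, ℝ) ω f
  gradSq_eq : ∀ p : M, ∀ q ∈ leaf f p, ‖grad n f q‖ ^ 2 = ‖grad n f p‖ ^ 2
  laplace_eq : ∀ p : M, ∀ q ∈ leaf f p, laplaceBeltrami n f q = laplaceBeltrami n f p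

/-- `h` is a smooth defining function of `S` in the open set `U`. -/
structure IsLocalDefiningFunction (S U : Set M) (h : M → ℝ) : Prop where
  isOpen : IsOpen U
  smooth : ContMDiffOn (𝓡 n) 𝓘(ℝ, ℝ) ∞ h U
  zeroSet : S ∩ U = {x ∈ U | h x = 0}
  regular : ∀ x ∈ U, mvfderiv (𝓡 n) h x ≠ 0

/-- `S` is a (smooth, embedded) submanifold of codimension one, without boundary. -/
def IsHypersurface (S : Set M) : Prop :=
  ∀ p ∈ S, ∃ U h, p ∈ U ∧ IsLocalDefiningFunction n S U h

/-- An equilibrium submanifold of codimension one: a leaf of the partition induced by some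
equilibrium function, which is a hypersurface. -/
def IsEquilibriumHypersurface (S : Set M) : Prop :=
  IsHypersurface n S ∧ ∃ f : M → ℝ, IsEquilibriumFunction n f ∧ ∃ p : M, S = leaf f p

/-- `v` is a unit normal vector of the hypersurface `S` at `p` (the opposite vector comes from the
opposite defining function). -/
def IsUnitNormal (S : Set M) (p : M) (v : TangentSpace (𝓡 n) p) : Prop :=
  ∃ U h, p ∈ U ∧ IsLocalDefiningFunction n S U h ∧ unitGrad n h p = v

/-- `H` is the mean curvature of the hypersurface `S` at `p` with respect to the unit normal `v`
at `p`: it is `div (∇h / ‖∇h‖)` at `p` for a local defining function `h` of `S` with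
`∇h / ‖∇h‖ = v` at `p`. The value depends only on `S`, `p` and `v`, and not on `h`. -/
def HasMeanCurvature (S : Set M) (p : M) (v : TangentSpace (𝓡 n) p) (H : ℝ) : Prop :=
  ∃ U h, p ∈ U ∧ IsLocalDefiningFunction n S U h ∧ unitGrad n h p = v ∧
    riemDiv n (unitGrad n h) p = H

/-- `S` has constant mean curvature. Along every connected part `A` of `S` on which a continuous
unit normal field is given (all of the connected `S` if it is two-sided), the mean curvature with
respect to that field is constant. The constant is the same for all `A`, up to the sign that the
choice of the normal field entails. -/
def HasConstantMeanCurvature [IsManifold (𝓡 n) 1 M] (S : Set M) : Prop :=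
  ∃ H : ℝ, ∀ A ⊆ S, IsPreconnected A → ∀ ν : (x : M) → TangentSpace (𝓡 n) x,
    ContinuousOn (fun x ↦ (⟨x, ν x⟩ : TangentBundle (𝓡 n) M)) A →
    (∀ p ∈ A, IsUnitNormal n S p (ν p)) →
    (∀ p ∈ A, HasMeanCurvature n S p (ν p) H) ∨ (∀ p ∈ A, HasMeanCurvature n S p (ν p) (-H))

/-- A smooth variation `F t` (`-ε < t < ε`) of `S`, that is, a smooth map
`F : (-ε, ε) × S → M` which at `t = 0` is the inclusion. Values of `F` elsewhere are irrelevant;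
the varied hypersurface is `F t '' S`. -/
structure IsVariation (S : Set M) (ε : ℝ) (F : ℝ → M → M) : Prop where
  pos : 0 < ε
  smooth : ContMDiffOn (𝓘(ℝ, ℝ).prod (𝓡 n)) (𝓡 n) ∞ (fun q : ℝ × M ↦ F q.1 q.2)
    (Ioo (-ε) ε ×ˢ S)
  zero : ∀ p ∈ S, F 0 p = p

end Calculus

section Enclosed

variable {M : Type*} [TopologicalSpace M]

/-- `S` encloses the open set `Ω`: it is the boundary of `Ω`, and `Ω` lies on one side of it
(`Ω` is the interior of its closure). -/
def Encloses (S Ω : Set M) : Prop :=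
  frontier Ω = S ∧ interior (closure Ω) = Ω

/-- `Ω t` is the set enclosed by the varied hypersurface `F t '' S`, for `-ε < t < ε`, always on
the same side: away from the moving hypersurface, membership in `Ω t` is locally constant in
space-time. -/
structure IsEnclosedFamily (S : Set M) (ε : ℝ) (F : ℝ → M → M) (Ω : ℝ → Set M) : Prop where
  encloses : ∀ t ∈ Ioo (-ε) ε, Encloses (F t '' S) (Ω t)
  continuous : ∀ t ∈ Ioo (-ε) ε, ∀ x ∉ F t '' S,
    ∀ᶠ q : ℝ × M in 𝓝 (t, x), (q.2 ∈ Ω q.1 ↔ x ∈ Ω t)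

end Enclosed

end

open Set Filter Topology MeasureTheory Bundle
open scoped Manifold ContDiff

noncomputable section

set_option linter.unusedSectionVars false

-- Let `c` be the value of `f` on `S`. Everything rests on writing `f - c = ± g ^ k` near each point
-- of `S`, where `g` is a local defining function of `S` and the exponent `k` is the same along all
-- of `S`. Given such a root, a plaque `g = r` with `r ≠ 0` lies in one leaf of `f`. There `∇f` is a
-- non-zero multiple of `∇g` depending only on `r`, and `Δf` is that multiple of `Δg` plus another
-- function of `r` times `‖∇g‖ ^ 2`. So `‖∇g‖` and `Δg` are constant on these plaques and, by
-- continuity, also on the plaque in `S`. Hence `∇g / ‖∇g‖ = ψ(g) ∇g` for a function `ψ` of one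
-- variable, and its divergence `ψ(g) Δg + ψ'(g) ‖∇g‖ ^ 2` is locally constant on `S`
-- (`exists_open_forall_unitGrad_const`). Roots are unique up to sign, so on the connected `S` this
-- divergence is constant up to sign, which is the constancy of the mean curvature.
--
-- The common exponent is found as follows. As long as `f - c` vanishes to order `j` along `S`,
-- Hadamard's lemma divides it by `h ^ j`, for any local defining function `h`. The order is finite
-- because a non-constant analytic function on a connected manifold is not flat anywhere. If `f - c
-- = h ^ k u`, then `|u| ^ (1 / k) h` is a root wherever `u ≠ 0`, and on `S` its gradient has norm
-- `|u| ^ (1 / k) ‖∇h‖`. This norm is locally constant by the first paragraph, so `u` cannot tend to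
-- zero along a plaque in `S` from a non-zero value (`IsAdaptedChart.factor_dichotomy`).
-- Connectedness of `S` makes the order uniform (`exists_forall_isLocalRoot`).
--
-- The statement on areas is proved by calibration, without computing a first variation formula.
-- Orient the root `g` to be negative in `Ω 0`, and let `X = χ ∇g / ‖∇g‖` with a cutoff `χ` equal to
-- `1` near `S`. By the divergence theorem, `Φ(t) = ∫ div X` over `Ω t` is at most the area `A(t)`
-- for small `t`, with equality at `t = 0`, where `X` is the outer unit normal. Thus `A - Φ` has a
-- local minimum at `0`. Near `S` both `A` and `Φ` are accessible: `Φ'(0) = 0`, because the volume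
-- is constant, `div X` equals a constant `H` on `S`, and `div X - H` is `O(|t|)` on a tube of width
-- `O(|t|)` whose volume tends to zero (`hasDerivAt_setIntegral_zero`). As `A` is differentiable at
-- `0`, it follows that `A'(0) = 0`.
--
-- Since volumes and areas are Hausdorff measures of the Riemannian distance, this needs an area
-- formula (`IsMetricImmersion.measure_image`), the description of the varied hypersurfaces as
-- graphs (`IsVariation.exists_isGraphFamily`), and a divergence theorem on one side of a graph
-- (`setIntegral_riemDiv_eq_graphFlux`).

local notation "𝔼" n:max => EuclideanSpace ℝ (Fin n)

/-! ### Coordinate expressions of the metric and of gradients. -/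

section ChartCalculus

variable {n : ℕ} {M : Type*} [TopologicalSpace M] [ChartedSpace (𝔼 n) M]

/-- The differential of the inverse of the preferred chart at `p`. -/
def coordDeriv (p : M) (y : 𝔼 n) : 𝔼 n →L[ℝ] TangentSpace (𝓡 n) ((extChartAt (𝓡 n) p).symm y) :=
  mfderiv 𝓘(ℝ, 𝔼 n) (𝓡 n) (extChartAt (𝓡 n) p).symm y

/-- The differential of the preferred chart at `p`. -/
def chartDeriv (p : M) (x : M) : TangentSpace (𝓡 n) x →L[ℝ] 𝔼 n :=
  mfderiv (𝓡 n) 𝓘(ℝ, 𝔼 n) (extChartAt (𝓡 n) p) x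

lemma isOpen_target (p : M) : IsOpen (extChartAt (𝓡 n) p).target := isOpen_extChartAt_target p

lemma eventually_mem_target {p : M} {y : 𝔼 n} (hy : y ∈ (extChartAt (𝓡 n) p).target) :
    ∀ᶠ z in 𝓝 y, z ∈ (extChartAt (𝓡 n) p).target := (isOpen_target p).mem_nhds hy

lemma continuousAt_symm {p : M} {y : 𝔼 n} (hy : y ∈ (extChartAt (𝓡 n) p).target) :
    ContinuousAt (extChartAt (𝓡 n) p).symm y := continuousAt_extChartAt_symm'' hy

section
variable [IsManifold (𝓡 n) 1 M]

lemma chartDeriv_coordDeriv {p : M} {y : 𝔼 n} (hy : y ∈ (extChartAt (𝓡 n) p).target) (v : 𝔼 n) :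
    chartDeriv p ((extChartAt (𝓡 n) p).symm y) (coordDeriv p y v) = v := by
  have h := mfderiv_extChartAt_comp_mfderivWithin_extChartAt_symm (I := 𝓡 n) hy
  rw [modelWithCornersSelf_coe, range_id, mfderivWithin_univ] at h
  exact DFunLike.congr_fun h v

lemma coordDeriv_chartDeriv {p : M} {y : 𝔼 n} (hy : y ∈ (extChartAt (𝓡 n) p).target)
    (v : TangentSpace (𝓡 n) ((extChartAt (𝓡 n) p).symm y)) :
    coordDeriv p y (chartDeriv p ((extChartAt (𝓡 n) p).symm y) v) = v := by
  have h := mfderivWithin_extChartAt_symm_comp_mfderiv_extChartAt (I := 𝓡 n) hy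
  rw [modelWithCornersSelf_coe, range_id, mfderivWithin_univ] at h
  exact DFunLike.congr_fun h v

lemma coordDeriv_injective {p : M} {y : 𝔼 n} (hy : y ∈ (extChartAt (𝓡 n) p).target) :
    Function.Injective (coordDeriv p y) := fun v w h ↦ by
  rw [← chartDeriv_coordDeriv hy v, h, chartDeriv_coordDeriv hy]

lemma mdifferentiableAt_symm {p : M} {y : 𝔼 n} (hy : y ∈ (extChartAt (𝓡 n) p).target) :
    MDifferentiableAt 𝓘(ℝ, 𝔼 n) (𝓡 n) (extChartAt (𝓡 n) p).symm y := by
  have := mdifferentiableWithinAt_extChartAt_symm (I := 𝓡 n) hy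
  rwa [modelWithCornersSelf_coe, range_id, mdifferentiableWithinAt_univ] at this

lemma mvfderiv_coordDeriv {p : M} {y : 𝔼 n} (hy : y ∈ (extChartAt (𝓡 n) p).target) {h : M → ℝ}
    (hh : MDifferentiableAt (𝓡 n) 𝓘(ℝ, ℝ) h ((extChartAt (𝓡 n) p).symm y)) (v : 𝔼 n) :
    mvfderiv (𝓡 n) h ((extChartAt (𝓡 n) p).symm y) (coordDeriv p y v) =
      fderiv ℝ (h ∘ (extChartAt (𝓡 n) p).symm) y v := by
  have := mfderiv_comp (I'' := 𝓘(ℝ, ℝ)) y hh (mdifferentiableAt_symm hy)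
  rw [mfderiv_eq_fderiv] at this
  rw [this]
  rfl

end

variable [RiemannianBundle (fun x : M ↦ TangentSpace (𝓡 n) x)]

lemma inner_grad (h : M → ℝ) (x : M) (v : TangentSpace (𝓡 n) x) :
    inner ℝ (grad n h x) v = mvfderiv (𝓡 n) h x v := by
  simp [grad]

/-- The Gram matrix of the metric in the preferred chart at `p`. -/
def chartGram (p : M) (y : 𝔼 n) : Matrix (Fin n) (Fin n) ℝ :=
  Matrix.of fun i j ↦ inner ℝ (coordField n p y i) (coordField n p y j)

lemma metricDensity_eq (p : M) (y : 𝔼 n) : metricDensity n p y = √ (chartGram p y).det := rfl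

lemma coordField_eq (p : M) (y : 𝔼 n) (i : Fin n) :
    coordField n p y i = coordDeriv p y (EuclideanSpace.single i 1) := rfl

lemma coordDeriv_eq_sum (p : M) (y v : 𝔼 n) : coordDeriv p y v = ∑ i, v i • coordField n p y i := by
  conv_lhs => rw [← (EuclideanSpace.basisFun (Fin n) ℝ).sum_repr v]
  rw [map_sum]
  exact Finset.sum_congr rfl fun i _ ↦ by
    simpa [coordField_eq] using (coordDeriv p y).map_smul (v i) (EuclideanSpace.single i (1 : ℝ))

lemma inner_coordDeriv (p : M) (y v w : 𝔼 n) :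
    inner ℝ (coordDeriv p y v) (coordDeriv p y w) =
      (v : Fin n → ℝ) ⬝ᵥ (chartGram p y).mulVec w := by
  rw [coordDeriv_eq_sum p y v, coordDeriv_eq_sum p y w]
  simp only [sum_inner, real_inner_smul_left]
  refine Finset.sum_congr rfl fun i _ ↦ ?_
  simp only [inner_sum, real_inner_smul_right, Matrix.mulVec, dotProduct, chartGram,
    Matrix.of_apply]
  exact congrArg _ (Finset.sum_congr rfl fun j _ ↦ mul_comm _ _)

lemma inner_coordDeriv_coordField (p : M) (y v : 𝔼 n) (i : Fin n) :
    inner ℝ (coordDeriv p y v) (coordField n p y i) = (chartGram p y).mulVec v i := by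
  rw [real_inner_comm, coordField_eq, inner_coordDeriv]
  simp

section
variable [IsManifold (𝓡 n) 1 M]

lemma chartGram_posDef {p : M} {y : 𝔼 n} (hy : y ∈ (extChartAt (𝓡 n) p).target) :
    (chartGram p y).PosDef := by
  refine Matrix.PosDef.of_dotProduct_mulVec_pos ?_ fun v hv ↦ ?_
  · ext i j
    exact real_inner_comm (coordField n p y i) (coordField n p y j)
  · have h := inner_coordDeriv p y (WithLp.toLp 2 v) (WithLp.toLp 2 v)
    simp only [star_trivial] at *
    rw [← h, real_inner_self_pos]
    intro h0
    apply hv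
    have := coordDeriv_injective hy (a₁ := WithLp.toLp 2 v) (a₂ := 0) (by rw [h0, map_zero])
    simpa using this

lemma chartGram_det_pos {p : M} {y : 𝔼 n} (hy : y ∈ (extChartAt (𝓡 n) p).target) :
    0 < (chartGram p y).det := (chartGram_posDef hy).det_pos

lemma metricDensity_pos {p : M} {y : 𝔼 n} (hy : y ∈ (extChartAt (𝓡 n) p).target) :
    0 < metricDensity n p y := Real.sqrt_pos.2 (chartGram_det_pos hy)

lemma coordDeriv_coordComponents (X : (x : M) → TangentSpace (𝓡 n) x) {p : M} {y : 𝔼 n}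
    (hy : y ∈ (extChartAt (𝓡 n) p).target) :
    coordDeriv p y (coordComponents n X p y) = X ((extChartAt (𝓡 n) p).symm y) :=
  coordDeriv_chartDeriv hy _

/-- Pairing the gradient with the coordinate fields gives the partial derivatives, so its components
solve a linear system with the Gram matrix. Smoothness of gradients is read off from this formula.
-/
lemma coordComponents_grad {p : M} {y : 𝔼 n} (hy : y ∈ (extChartAt (𝓡 n) p).target) {h : M → ℝ}
    (hh : MDifferentiableAt (𝓡 n) 𝓘(ℝ, ℝ) h ((extChartAt (𝓡 n) p).symm y)) :
    (coordComponents n (grad n h) p y : Fin n → ℝ) = (chartGram p y)⁻¹.mulVec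
      (fun i ↦ fderiv ℝ (h ∘ (extChartAt (𝓡 n) p).symm) y (EuclideanSpace.single i 1)) := by
  have h1 : (chartGram p y).mulVec (coordComponents n (grad n h) p y) =
      fun i ↦ fderiv ℝ (h ∘ (extChartAt (𝓡 n) p).symm) y (EuclideanSpace.single i 1) := by
    ext i
    rw [← inner_coordDeriv_coordField, coordDeriv_coordComponents _ hy, inner_grad,
      coordField_eq, mvfderiv_coordDeriv hy hh]
  rw [← h1, Matrix.mulVec_mulVec, Matrix.nonsing_inv_mul _ (chartGram_det_pos hy).ne'.isUnit,
    Matrix.one_mulVec]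

end

section Smooth
variable [IsManifold (𝓡 n) ω M]
  [IsContMDiffRiemannianBundle (𝓡 n) ω (𝔼 n) (fun x : M ↦ TangentSpace (𝓡 n) x)]

/-- The tangent map of the analytic inverse chart, applied along a constant vector field. -/
lemma contMDiffOn_coordDeriv (p : M) (v : 𝔼 n) :
    ContMDiffOn 𝓘(ℝ, 𝔼 n) ((𝓡 n).prod 𝓘(ℝ, 𝔼 n)) ω
      (fun y ↦ (⟨(extChartAt (𝓡 n) p).symm y, coordDeriv p y v⟩ : TangentBundle (𝓡 n) M))
      (extChartAt (𝓡 n) p).target := by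
  have h1 := (contMDiffOn_extChartAt_symm (I := 𝓡 n) (n := ω) p).contMDiffOn_tangentMapWithin
    (m := ω) (by simp) (isOpen_target p).uniqueMDiffOn
  have h2 : ContMDiffOn 𝓘(ℝ, 𝔼 n) (𝓘(ℝ, 𝔼 n).prod 𝓘(ℝ, 𝔼 n)) ω
      (fun y : 𝔼 n ↦ (⟨y, v⟩ : TangentBundle 𝓘(ℝ, 𝔼 n) (𝔼 n))) (extChartAt (𝓡 n) p).target := by
    exact fun y hy ↦ contMDiffWithinAt_vectorSpace_iff_contDiffWithinAt.2 contDiffWithinAt_const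
  have h3 := h1.comp h2 (fun y hy ↦ hy)
  refine h3.congr fun y hy ↦ ?_
  simp only [Function.comp, tangentMapWithin, coordDeriv]
  rw [mfderivWithin_of_isOpen (isOpen_target p) hy]
  rfl

lemma contDiffOn_inner_coordDeriv (p : M) (v w : 𝔼 n) :
    ContDiffOn ℝ ω (fun y ↦ inner ℝ (coordDeriv p y v) (coordDeriv p y w))
      (extChartAt (𝓡 n) p).target :=
  ((contMDiffOn_coordDeriv p v).inner_bundle (contMDiffOn_coordDeriv p w)).contDiffOn

lemma contDiffOn_chartGram (p : M) (i j : Fin n) :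
    ContDiffOn ℝ ω (fun y ↦ chartGram p y i j) (extChartAt (𝓡 n) p).target :=
  contDiffOn_inner_coordDeriv p _ _

end Smooth
end ChartCalculus

lemma ContDiffWithinAt.matrix_det {E ι : Type*} [NormedAddCommGroup E] [NormedSpace ℝ E]
    [Fintype ι] [DecidableEq ι] {k : WithTop ℕ∞} {A : E → Matrix ι ι ℝ} {s : Set E} {x : E}
    (h : ∀ i j, ContDiffWithinAt ℝ k (fun y ↦ A y i j) s x) :
    ContDiffWithinAt ℝ k (fun y ↦ (A y).det) s x := by
  simp only [Matrix.det_apply]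
  refine ContDiffWithinAt.sum fun σ _ ↦ ?_
  exact (contDiffWithinAt_prod fun i _ ↦ h _ _).const_smul _

/-- By Cramer's rule the entries of the inverse are quotients of determinants. -/
lemma ContDiffWithinAt.matrix_inv {E ι : Type*} [NormedAddCommGroup E] [NormedSpace ℝ E]
    [Fintype ι] [DecidableEq ι] {k : WithTop ℕ∞} {A : E → Matrix ι ι ℝ} {s : Set E} {x : E}
    (h : ∀ i j, ContDiffWithinAt ℝ k (fun y ↦ A y i j) s x) (hdet : (A x).det ≠ 0) (i j : ι) :
    ContDiffWithinAt ℝ k (fun y ↦ (A y)⁻¹ i j) s x := by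
  simp only [Matrix.inv_def, Matrix.smul_apply, Matrix.adjugate_apply, Ring.inverse_eq_inv', smul_eq_mul]
  refine ((ContDiffWithinAt.matrix_det h).inv hdet).mul (ContDiffWithinAt.matrix_det fun a b ↦ ?_)
  by_cases hab : a = j
  · subst hab
    simp only [Matrix.updateRow_self]
    exact contDiffWithinAt_const
  · simpa only [Matrix.updateRow_ne hab] using h a b

section ChartCalculus

variable {n : ℕ} {M : Type*} [TopologicalSpace M] [ChartedSpace (𝔼 n) M]
  [RiemannianBundle (fun x : M ↦ TangentSpace (𝓡 n) x)] [IsManifold (𝓡 n) ω M]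
  [IsContMDiffRiemannianBundle (𝓡 n) ω (𝔼 n) (fun x : M ↦ TangentSpace (𝓡 n) x)]

lemma contDiffOn_metricDensity (p : M) :
    ContDiffOn ℝ ω (metricDensity n p) (extChartAt (𝓡 n) p).target := fun y hy ↦
  (ContDiffWithinAt.matrix_det fun i j ↦ contDiffOn_chartGram p i j y hy).sqrt
    (chartGram_det_pos hy).ne'

/-- The expression of `h` in the preferred chart at `p` is smooth where `h` is. -/
lemma contDiffAt_comp_symm {p : M} {y : 𝔼 n} (hy : y ∈ (extChartAt (𝓡 n) p).target) {h : M → ℝ}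
    {k : WithTop ℕ∞} (hh : ContMDiffAt (𝓡 n) 𝓘(ℝ, ℝ) k h ((extChartAt (𝓡 n) p).symm y)) :
    ContDiffAt ℝ k (h ∘ (extChartAt (𝓡 n) p).symm) y := by
  have : ContMDiffAt 𝓘(ℝ, 𝔼 n) (𝓡 n) k (extChartAt (𝓡 n) p).symm y :=
    ((contMDiffOn_extChartAt_symm (I := 𝓡 n) (n := ω) p).contMDiffAt
      ((isOpen_target p).mem_nhds hy)).of_le le_top
  exact (hh.comp y this).contDiffAt

lemma contDiffAt_fderiv_comp_symm {p : M} {y : 𝔼 n} (hy : y ∈ (extChartAt (𝓡 n) p).target)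
    {h : M → ℝ} {k l : WithTop ℕ∞} (hkl : l + 1 ≤ k)
    (hh : ContMDiffAt (𝓡 n) 𝓘(ℝ, ℝ) k h ((extChartAt (𝓡 n) p).symm y)) (v : 𝔼 n) :
    ContDiffAt ℝ l (fun z ↦ fderiv ℝ (h ∘ (extChartAt (𝓡 n) p).symm) z v) y :=
  ((contDiffAt_comp_symm hy hh).fderiv_right hkl).clm_apply contDiffAt_const

lemma contDiffAt_coordComponents_grad {p : M} {y : 𝔼 n} (hy : y ∈ (extChartAt (𝓡 n) p).target)
    {h : M → ℝ} {k l : WithTop ℕ∞} (hkl : l + 1 ≤ k)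
    (hh : ∀ᶠ x in 𝓝 ((extChartAt (𝓡 n) p).symm y), ContMDiffAt (𝓡 n) 𝓘(ℝ, ℝ) k h x) :
    ContDiffAt ℝ l (coordComponents n (grad n h) p) y := by
  rw [contDiffAt_piLp]
  intro i
  have h1 : ContDiffAt ℝ l (fun z ↦ ∑ j, (chartGram p z)⁻¹ i j *
      fderiv ℝ (h ∘ (extChartAt (𝓡 n) p).symm) z (EuclideanSpace.single j 1)) y := by
    refine ContDiffAt.sum fun j _ ↦ ContDiffAt.mul ?_
      (contDiffAt_fderiv_comp_symm hy hkl hh.self_of_nhds _)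
    rw [← contDiffWithinAt_univ]
    refine ContDiffWithinAt.matrix_inv (fun i j ↦ ?_) (chartGram_det_pos hy).ne' i j
    exact (((contDiffOn_chartGram p i j).contDiffAt ((isOpen_target p).mem_nhds hy)).of_le
      le_top).contDiffWithinAt
  refine h1.congr_of_eventuallyEq ?_
  filter_upwards [eventually_mem_target hy, (continuousAt_symm hy).eventually hh] with z hz hhz
  have hk : k ≠ 0 := fun h0 ↦ by simp [h0] at hkl
  exact congr_fun (coordComponents_grad hz (hhz.mdifferentiableAt hk)) i

end ChartCalculus

/-! ### Derivative of the determinant and the Piola identity. -/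

section Piola

variable {E : Type*} [NormedAddCommGroup E] [NormedSpace ℝ E] [FiniteDimensional ℝ E]

lemma contDiff_clm_det : ContDiff ℝ ω (fun L : E →L[ℝ] E ↦ L.det) := by
  let b := Module.finBasis ℝ E
  have h : (fun L : E →L[ℝ] E ↦ L.det) = fun L : E →L[ℝ] E ↦ (LinearMap.toMatrix b b (L : E →ₗ[ℝ] E)).det := by
    ext L
    rw [LinearMap.det_toMatrix]
  rw [h, contDiff_iff_contDiffAt]
  intro L
  rw [← contDiffWithinAt_univ]
  refine ContDiffWithinAt.matrix_det fun i j ↦ ContDiff.contDiffWithinAt ?_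
  let φ : (E →L[ℝ] E) →ₗ[ℝ] ℝ :=
    { toFun := fun L ↦ LinearMap.toMatrix b b (L : E →ₗ[ℝ] E) i j
      map_add' := fun L L' ↦ by simp
      map_smul' := fun c L ↦ by simp }
  exact (LinearMap.toContinuousLinearMap φ).contDiff

/-- Jacobi's formula at the identity. -/
lemma hasDerivAt_det_one_add_smul (L : E →L[ℝ] E) :
    HasDerivAt (fun t : ℝ ↦ (ContinuousLinearMap.id ℝ E + t • L).det)
      (LinearMap.trace ℝ E (L : E →ₗ[ℝ] E)) 0 := by
  let b := Module.finBasis ℝ E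
  have h : ∀ t : ℝ, (ContinuousLinearMap.id ℝ E + t • L).det =
      (1 + t • LinearMap.toMatrix b b (L : E →ₗ[ℝ] E)).det := by
    intro t
    have h1 : LinearMap.toMatrix b b ((ContinuousLinearMap.id ℝ E + t • L : E →L[ℝ] E) : E →ₗ[ℝ] E) =
        1 + t • LinearMap.toMatrix b b (L : E →ₗ[ℝ] E) := by
      rw [← LinearMap.toMatrix_id b, ← map_smul, ← map_add]
      rfl
    rw [← h1, LinearMap.det_toMatrix]
  simp_rw [h]
  refine HasDerivAt.congr_of_eventuallyEq ?_ (Eventually.of_forall fun t ↦ Matrix.det_one_add_smul t _)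
  rw [LinearMap.trace_eq_matrix_trace ℝ b]
  set q := (Matrix.det (1 + (Polynomial.X : Polynomial ℝ) •
    (LinearMap.toMatrix b b (L : E →ₗ[ℝ] E)).map Polynomial.C)).divX.divX
  have h2 := (((hasDerivAt_id (0 : ℝ)).const_mul
    (LinearMap.toMatrix b b (L : E →ₗ[ℝ] E)).trace).const_add 1).add
      ((q.hasDerivAt 0).mul ((hasDerivAt_id (0 : ℝ)).pow 2))
  convert h2 using 1
  · ext t
    simp
  · simp

/-- The factorization `A + t L = A (1 + t A⁻¹ L)` reduces this to Jacobi's formula at the identity.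
-/
lemma hasFDerivAt_clm_det (A : E ≃L[ℝ] E) (L : E →L[ℝ] E) :
    fderiv ℝ (fun L : E →L[ℝ] E ↦ L.det) A L = (A : E →L[ℝ] E).det *
      LinearMap.trace ℝ E (((A.symm : E →L[ℝ] E).comp L : E →L[ℝ] E) : E →ₗ[ℝ] E) := by
  have h1 : HasFDerivAt (fun L : E →L[ℝ] E ↦ L.det) (fderiv ℝ (fun L : E →L[ℝ] E ↦ L.det) A)
      ((A : E →L[ℝ] E) + (0 : ℝ) • L) := by
    rw [zero_smul, add_zero]
    exact (contDiff_clm_det.differentiable (by simp)).differentiableAt.hasFDerivAt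
  have h2 : HasDerivAt (fun t : ℝ ↦ (A : E →L[ℝ] E) + t • L) L 0 := by
    simpa using ((hasDerivAt_id (0 : ℝ)).smul_const L).const_add (A : E →L[ℝ] E)
  have h3 := h1.comp_hasDerivAt (0 : ℝ) h2
  have h4 := (hasDerivAt_det_one_add_smul ((A.symm : E →L[ℝ] E).comp L)).const_mul
    (A : E →L[ℝ] E).det
  refine h3.unique (h4.congr_of_eventuallyEq (Eventually.of_forall fun t ↦ ?_))
  have : (A : E →L[ℝ] E) + t • L =
      (A : E →L[ℝ] E).comp (ContinuousLinearMap.id ℝ E + t • (A.symm : E →L[ℝ] E).comp L) := by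
    ext v
    simp
  simp only [Function.comp, this]
  exact LinearMap.det_comp _ _

/-- The Piola identity: how the divergence of a vector density changes under a change of
coordinates. -/
lemma piola {τ Zp Zq : E → E} {y₀ : E} (A : E ≃L[ℝ] E) (hτ : ContDiffAt ℝ ω τ y₀)
    (hA : fderiv ℝ τ y₀ = A) (hp : DifferentiableAt ℝ Zp y₀) (hq : DifferentiableAt ℝ Zq (τ y₀))
    (h : ∀ᶠ y in 𝓝 y₀, fderiv ℝ τ y (Zp y) = |(fderiv ℝ τ y).det| • Zq (τ y)) :
    LinearMap.trace ℝ E (fderiv ℝ Zp y₀ : E →ₗ[ℝ] E) =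
      |(A : E →L[ℝ] E).det| * LinearMap.trace ℝ E (fderiv ℝ Zq (τ y₀) : E →ₗ[ℝ] E) := by
  have hd : (A : E →L[ℝ] E).det ≠ 0 := (LinearEquiv.isUnit_det' A.toLinearEquiv).ne_zero
  have hτ' : DifferentiableAt ℝ (fderiv ℝ τ) y₀ :=
    (hτ.fderiv_right (m := ω) (by simp)).differentiableAt (by simp)
  set A' := fderiv ℝ (fderiv ℝ τ) y₀ with hA'
  have hsymm : ∀ v w, A' v w = A' w v := hτ.isSymmSndFDerivAt_of_omega
  have h1 : HasFDerivAt (fun y ↦ fderiv ℝ τ y (Zp y))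
      ((A : E →L[ℝ] E).comp (fderiv ℝ Zp y₀) + A'.flip (Zp y₀)) y₀ := by
    have := hτ'.hasFDerivAt.clm_apply hp.hasFDerivAt
    rwa [hA] at this
  -- `s` is the sign of the Jacobian determinant, which is constant near `y₀`; it makes the absolute
  -- value differentiable.
  obtain ⟨s, hs, hs'⟩ : ∃ s : ℝ, |(A : E →L[ℝ] E).det| = s * (A : E →L[ℝ] E).det ∧
      ∀ᶠ y in 𝓝 y₀, |(fderiv ℝ τ y).det| = s * (fderiv ℝ τ y).det := by
    have hc : ContinuousAt (fun y ↦ (fderiv ℝ τ y).det) y₀ :=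
      contDiff_clm_det.continuous.continuousAt.comp hτ'.continuousAt
    rcases lt_or_gt_of_ne hd with hneg | hpos
    · refine ⟨-1, by rw [abs_of_neg hneg]; ring, ?_⟩
      filter_upwards [hc.eventually_lt continuousAt_const (by rw [hA]; exact hneg)] with y hy
      rw [abs_of_neg hy]; ring
    · refine ⟨1, by rw [abs_of_pos hpos]; ring, ?_⟩
      filter_upwards [continuousAt_const.eventually_lt hc (by rw [hA]; exact hpos)] with y hy
      rw [abs_of_pos hy]; ring
  have hJ : HasFDerivAt (fun y ↦ s * (fderiv ℝ τ y).det)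
      (s • (fderiv ℝ (fun L : E →L[ℝ] E ↦ L.det) A).comp A') y₀ := by
    have h2 : HasFDerivAt (fun L : E →L[ℝ] E ↦ L.det) (fderiv ℝ (fun L : E →L[ℝ] E ↦ L.det) A)
        (fderiv ℝ τ y₀) := by
      rw [hA]
      exact (contDiff_clm_det.differentiable (by simp)).differentiableAt.hasFDerivAt
    exact (h2.comp y₀ hτ'.hasFDerivAt).const_mul s
  have hζ : HasFDerivAt (fun y ↦ Zq (τ y)) ((fderiv ℝ Zq (τ y₀)).comp (A : E →L[ℝ] E)) y₀ := by
    have := hq.hasFDerivAt.comp y₀ (hτ.differentiableAt (by simp)).hasFDerivAt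
    rwa [hA] at this
  have h2 := hJ.smul hζ
  have h3 : HasFDerivAt (fun y ↦ fderiv ℝ τ y (Zp y)) _ y₀ :=
    h2.congr_of_eventuallyEq (by
      filter_upwards [h, hs'] with y hy hy'
      rw [hy, hy']
      rfl)
  have h4 := h1.unique h3
  have h5 := h.self_of_nhds
  rw [hA, hs] at h5
  rw [hA] at h4
  set J := s * (A : E →L[ℝ] E).det with hJdef
  have hJ0 : J ≠ 0 := by rw [← hs]; exact abs_ne_zero.2 hd
  -- The differentiated relation, solved for the derivative of `Zp`; the symmetry of the second
  -- derivative of `τ` gives the last term its form. By Jacobi's formula the trace of the rank-one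
  -- first term equals that of the last one, and only the conjugated derivative of `Zq` remains.
  have h6 : fderiv ℝ Zp y₀ = (s • (fderiv ℝ (fun L : E →L[ℝ] E ↦ L.det) A).comp A').smulRight
      (J⁻¹ • Zp y₀) + J • ((A.symm : E →L[ℝ] E).comp ((fderiv ℝ Zq (τ y₀)).comp (A : E →L[ℝ] E))) -
      (A.symm : E →L[ℝ] E).comp (A' (Zp y₀)) := by
    ext v
    have h7 := congrArg A.symm (DFunLike.congr_fun h4 v)
    have h8 : A.symm (Zq (τ y₀)) = J⁻¹ • Zp y₀ := by
      rw [eq_inv_smul_iff₀ hJ0, ← map_smul, ← h5]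
      exact A.symm_apply_apply _
    simp only [add_apply, ContinuousLinearMap.comp_apply,
      ContinuousLinearMap.flip_apply, map_add, ContinuousLinearEquiv.coe_coe,
      ContinuousLinearEquiv.symm_apply_apply, smul_apply, map_smul,
      ContinuousLinearMap.smulRight_apply, h8] at h7
    simp only [add_apply, sub_apply,
      smul_apply, ContinuousLinearMap.comp_apply,
      ContinuousLinearMap.smulRight_apply, ContinuousLinearEquiv.coe_coe]
    rw [hsymm (Zp y₀) v, eq_sub_iff_add_eq, h7]
    abel
  have t1 : LinearMap.trace ℝ E (((s • (fderiv ℝ (fun L : E →L[ℝ] E ↦ L.det) A).comp A').smulRight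
      (J⁻¹ • Zp y₀) : E →L[ℝ] E) : E →ₗ[ℝ] E) = LinearMap.trace ℝ E
        (((A.symm : E →L[ℝ] E).comp (A' (Zp y₀)) : E →L[ℝ] E) : E →ₗ[ℝ] E) := by
    rw [ContinuousLinearMap.coe_smulRight, LinearMap.trace_smulRight]
    simp only [ContinuousLinearMap.coe_coe, smul_apply,
      ContinuousLinearMap.comp_apply, map_smul, hasFDerivAt_clm_det, smul_eq_mul]
    rw [← mul_assoc s, ← hJdef, inv_mul_cancel_left₀ hJ0]
  have t2 : LinearMap.trace ℝ E
      (((A.symm : E →L[ℝ] E).comp ((fderiv ℝ Zq (τ y₀)).comp (A : E →L[ℝ] E)) : E →L[ℝ] E) :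
        E →ₗ[ℝ] E) = LinearMap.trace ℝ E (fderiv ℝ Zq (τ y₀) : E →ₗ[ℝ] E) := by
    have := LinearMap.trace_conj' (fderiv ℝ Zq (τ y₀) : E →ₗ[ℝ] E) A.symm.toLinearEquiv
    rw [← this]
    rfl
  rw [hs, h6, ContinuousLinearMap.toLinearMap_sub, ContinuousLinearMap.toLinearMap_add, map_sub, map_add, t1,
    ContinuousLinearMap.toLinearMap_smul, map_smul, t2, smul_eq_mul]
  ring

end Piola

/-! ### Divergence in charts: Leibniz rule and independence of the chart. -/

section Divergence

variable {n : ℕ} {M : Type*} [TopologicalSpace M] [ChartedSpace (𝔼 n) M]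
  [RiemannianBundle (fun x : M ↦ TangentSpace (𝓡 n) x)]

/-- The Riemannian divergence of `X` at the point with coordinates `y` in the preferred chart
at `p`. -/
def chartDiv (X : (x : M) → TangentSpace (𝓡 n) x) (p : M) (y : 𝔼 n) : ℝ :=
  (metricDensity n p y)⁻¹ * ∑ i : Fin n, fderiv ℝ
    (fun z ↦ metricDensity n p z * coordComponents n X p z i) y (EuclideanSpace.single i (1 : ℝ))

lemma riemDiv_eq_chartDiv (X : (x : M) → TangentSpace (𝓡 n) x) (p : M) :
    riemDiv n X p = chartDiv X p (extChartAt (𝓡 n) p p) := rfl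

lemma chartDiv_congr {X X' : (x : M) → TangentSpace (𝓡 n) x} {p : M} {y : 𝔼 n}
    (hy : y ∈ (extChartAt (𝓡 n) p).target)
    (h : ∀ᶠ x in 𝓝 ((extChartAt (𝓡 n) p).symm y), X x = X' x) :
    chartDiv X p y = chartDiv X' p y := by
  unfold chartDiv
  congr 1
  refine Finset.sum_congr rfl fun i _ ↦ ?_
  rw [Filter.EventuallyEq.fderiv_eq]
  filter_upwards [(continuousAt_symm hy).eventually h] with z hz
  simp only [coordComponents]
  rw [hz]

lemma riemDiv_congr {X X' : (x : M) → TangentSpace (𝓡 n) x} {p : M}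
    (h : ∀ᶠ x in 𝓝 p, X x = X' x) : riemDiv n X p = riemDiv n X' p :=
  chartDiv_congr (mem_extChartAt_target p) (by rwa [extChartAt_to_inv])

lemma sum_fderiv_eq_trace {Z : 𝔼 n → 𝔼 n} {y : 𝔼 n} (h : DifferentiableAt ℝ Z y) :
    ∑ i : Fin n, fderiv ℝ (fun z ↦ Z z i) y (EuclideanSpace.single i (1 : ℝ)) =
      LinearMap.trace ℝ (𝔼 n) (fderiv ℝ Z y : 𝔼 n →ₗ[ℝ] 𝔼 n) := by
  rw [LinearMap.trace_eq_sum_inner _ (EuclideanSpace.basisFun (Fin n) ℝ)]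
  refine Finset.sum_congr rfl fun i _ ↦ ?_
  have := ((EuclideanSpace.proj (𝕜 := ℝ) i : 𝔼 n →L[ℝ] ℝ).hasFDerivAt.comp y h.hasFDerivAt).fderiv
  have h2 : fderiv ℝ (fun z ↦ Z z i) y = _ := this
  rw [h2]
  simp [EuclideanSpace.inner_single_left]

section
variable [IsManifold (𝓡 n) ω M]
  [IsContMDiffRiemannianBundle (𝓡 n) ω (𝔼 n) (fun x : M ↦ TangentSpace (𝓡 n) x)]

lemma differentiableAt_metricDensity {p : M} {y : 𝔼 n} (hy : y ∈ (extChartAt (𝓡 n) p).target) :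
    DifferentiableAt ℝ (metricDensity n p) y :=
  ((contDiffOn_metricDensity p).contDiffAt ((isOpen_target p).mem_nhds hy)).differentiableAt
    (by simp)

lemma chartDiv_eq_trace {X : (x : M) → TangentSpace (𝓡 n) x} {p : M} {y : 𝔼 n}
    (hy : y ∈ (extChartAt (𝓡 n) p).target)
    (hX : DifferentiableAt ℝ (coordComponents n X p) y) :
    chartDiv X p y = (metricDensity n p y)⁻¹ * LinearMap.trace ℝ (𝔼 n)
      (fderiv ℝ (fun z ↦ metricDensity n p z • coordComponents n X p z) y : 𝔼 n →ₗ[ℝ] 𝔼 n) := by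
  have h : DifferentiableAt ℝ (fun z ↦ metricDensity n p z • coordComponents n X p z) y :=
    (differentiableAt_metricDensity hy).smul hX
  rw [← sum_fderiv_eq_trace h]
  rfl

lemma fderiv_apply_eq_sum (L : 𝔼 n →L[ℝ] ℝ) (v : 𝔼 n) :
    L v = ∑ i, v i * L (EuclideanSpace.single i (1 : ℝ)) := by
  conv_lhs => rw [← (EuclideanSpace.basisFun (Fin n) ℝ).sum_repr v]
  rw [map_sum]
  simp

/-- Leibniz rule for the divergence. -/
lemma chartDiv_smul {X : (x : M) → TangentSpace (𝓡 n) x} {a : M → ℝ} {p : M} {y : 𝔼 n}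
    (hy : y ∈ (extChartAt (𝓡 n) p).target)
    (ha : MDifferentiableAt (𝓡 n) 𝓘(ℝ, ℝ) a ((extChartAt (𝓡 n) p).symm y))
    (hX : DifferentiableAt ℝ (coordComponents n X p) y) :
    chartDiv (fun x ↦ a x • X x) p y = a ((extChartAt (𝓡 n) p).symm y) * chartDiv X p y +
      mvfderiv (𝓡 n) a ((extChartAt (𝓡 n) p).symm y) (X ((extChartAt (𝓡 n) p).symm y)) := by
  have hD := differentiableAt_metricDensity hy
  have hD0 := (metricDensity_pos hy).ne'
  have ha' : DifferentiableAt ℝ (a ∘ (extChartAt (𝓡 n) p).symm) y :=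
    mdifferentiableAt_iff_differentiableAt.1 (ha.comp y (mdifferentiableAt_symm hy))
  have hXi : ∀ i, DifferentiableAt ℝ (fun z ↦ coordComponents n X p z i) y := fun i ↦
    ((EuclideanSpace.proj (𝕜 := ℝ) i : 𝔼 n →L[ℝ] ℝ).differentiableAt.comp y hX)
  have key : ∀ i, fderiv ℝ (fun z ↦ metricDensity n p z * coordComponents n (fun x ↦ a x • X x) p z i)
      y (EuclideanSpace.single i (1 : ℝ)) = a ((extChartAt (𝓡 n) p).symm y) *
        fderiv ℝ (fun z ↦ metricDensity n p z * coordComponents n X p z i) y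
          (EuclideanSpace.single i (1 : ℝ)) + metricDensity n p y * (coordComponents n X p y i *
            fderiv ℝ (a ∘ (extChartAt (𝓡 n) p).symm) y (EuclideanSpace.single i (1 : ℝ))) := by
    intro i
    have h1 : (fun z ↦ metricDensity n p z * coordComponents n (fun x ↦ a x • X x) p z i) =
        (a ∘ (extChartAt (𝓡 n) p).symm) * fun z ↦ metricDensity n p z * coordComponents n X p z i := by
      ext z
      simp only [coordComponents, map_smul, Pi.mul_apply, Function.comp]
      exact mul_left_comm _ _ _
    have h2 : DifferentiableAt ℝ (fun z ↦ metricDensity n p z * coordComponents n X p z i) y :=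
      hD.mul (hXi i)
    rw [h1, fderiv_mul ha' h2]
    simp only [add_apply, smul_apply, smul_eq_mul, Function.comp_apply]
    ring
  rw [← coordDeriv_coordComponents X hy, mvfderiv_coordDeriv hy ha,
    fderiv_apply_eq_sum (fderiv ℝ _ y)]
  simp only [chartDiv, key, Finset.sum_add_distrib, ← Finset.mul_sum]
  field_simp

lemma riemDiv_smul {X : (x : M) → TangentSpace (𝓡 n) x} {a : M → ℝ} {p : M}
    (ha : MDifferentiableAt (𝓡 n) 𝓘(ℝ, ℝ) a p)
    (hX : DifferentiableAt ℝ (coordComponents n X p) (extChartAt (𝓡 n) p p)) :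
    riemDiv n (fun x ↦ a x • X x) p = a p * riemDiv n X p + mvfderiv (𝓡 n) a p (X p) := by
  have hy := mem_extChartAt_target (I := 𝓡 n) p
  have hp := extChartAt_to_inv (I := 𝓡 n) p
  have := chartDiv_smul hy (a := a) (X := X) (by rwa [hp]) hX
  rwa [hp] at this

lemma inner_eq_chartDeriv {q x : M} (hx : x ∈ (extChartAt (𝓡 n) q).source)
    (v w : TangentSpace (𝓡 n) x) :
    inner ℝ v w = (chartDeriv q x v : Fin n → ℝ) ⬝ᵥ
      (chartGram q (extChartAt (𝓡 n) q x)).mulVec (chartDeriv q x w) := by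
  obtain ⟨y, hy, rfl⟩ : ∃ y ∈ (extChartAt (𝓡 n) q).target, (extChartAt (𝓡 n) q).symm y = x :=
    ⟨_, (extChartAt (𝓡 n) q).map_source hx, (extChartAt (𝓡 n) q).left_inv hx⟩
  rw [(extChartAt (𝓡 n) q).right_inv hy, ← inner_coordDeriv, coordDeriv_chartDeriv hy,
    coordDeriv_chartDeriv hy]

lemma coordComponents_extChartAt (X : (x : M) → TangentSpace (𝓡 n) x) {q x : M}
    (hx : x ∈ (extChartAt (𝓡 n) q).source) :
    coordComponents n X q (extChartAt (𝓡 n) q x) = chartDeriv q x (X x) := by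
  have h := (extChartAt (𝓡 n) q).left_inv hx
  change (fun z : M ↦ chartDeriv q z (X z)) ((extChartAt (𝓡 n) q).symm (extChartAt (𝓡 n) q x)) = _
  rw [h]

lemma contDiffAt_transition {p q : M} {y : 𝔼 n} (hy : y ∈ (extChartAt (𝓡 n) p).target)
    (hq : (extChartAt (𝓡 n) p).symm y ∈ (extChartAt (𝓡 n) q).source) :
    ContDiffAt ℝ ω (extChartAt (𝓡 n) q ∘ (extChartAt (𝓡 n) p).symm) y := by
  have h1 : ContMDiffAt 𝓘(ℝ, 𝔼 n) (𝓡 n) ω (extChartAt (𝓡 n) p).symm y :=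
    (contMDiffOn_extChartAt_symm (I := 𝓡 n) (n := ω) p).contMDiffAt
      ((isOpen_target p).mem_nhds hy)
  have h2 : ContMDiffAt (𝓡 n) 𝓘(ℝ, 𝔼 n) ω (extChartAt (𝓡 n) q) ((extChartAt (𝓡 n) p).symm y) :=
    contMDiffAt_extChartAt' (by simpa using hq)
  exact (h2.comp y h1).contDiffAt

lemma fderiv_transition {p q : M} {y : 𝔼 n} (hy : y ∈ (extChartAt (𝓡 n) p).target)
    (hq : (extChartAt (𝓡 n) p).symm y ∈ (extChartAt (𝓡 n) q).source) (v : 𝔼 n) :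
    fderiv ℝ (extChartAt (𝓡 n) q ∘ (extChartAt (𝓡 n) p).symm) y v =
      chartDeriv q ((extChartAt (𝓡 n) p).symm y) (coordDeriv p y v) := by
  have h2 : MDifferentiableAt (𝓡 n) 𝓘(ℝ, 𝔼 n) (extChartAt (𝓡 n) q) ((extChartAt (𝓡 n) p).symm y) :=
    mdifferentiableAt_extChartAt (by simpa using hq)
  rw [← mfderiv_eq_fderiv, mfderiv_comp y h2 (mdifferentiableAt_symm hy)]
  rfl

/-- The Gram matrices in two charts are congruent through the Jacobian matrix of the transition;
take determinants and square roots. -/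
lemma metricDensity_transition {p q : M} {y : 𝔼 n} (hy : y ∈ (extChartAt (𝓡 n) p).target)
    (hq : (extChartAt (𝓡 n) p).symm y ∈ (extChartAt (𝓡 n) q).source) :
    metricDensity n p y = |(fderiv ℝ (extChartAt (𝓡 n) q ∘ (extChartAt (𝓡 n) p).symm) y).det| *
      metricDensity n q (extChartAt (𝓡 n) q ((extChartAt (𝓡 n) p).symm y)) := by
  set A := fderiv ℝ (extChartAt (𝓡 n) q ∘ (extChartAt (𝓡 n) p).symm) y with hA
  let b := (EuclideanSpace.basisFun (Fin n) ℝ).toBasis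
  set A' := LinearMap.toMatrix b b (A : 𝔼 n →ₗ[ℝ] 𝔼 n) with hA'
  have hent : ∀ i j, A' i j = A (EuclideanSpace.single j 1) i := by
    intro i j
    rw [hA', LinearMap.toMatrix_apply]
    simp [b]
  have hG : chartGram p y = A'.transpose *
      (chartGram q (extChartAt (𝓡 n) q ((extChartAt (𝓡 n) p).symm y)) * A') := by
    ext i j
    change inner ℝ (coordDeriv p y _) (coordDeriv p y _) = _
    rw [inner_eq_chartDeriv hq, ← fderiv_transition hy hq, ← fderiv_transition hy hq, ← hA]
    simp only [Matrix.mul_apply, Matrix.transpose_apply, hent, dotProduct, Matrix.mulVec]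
  rw [metricDensity_eq, hG, Matrix.det_mul, Matrix.det_mul, Matrix.det_transpose,
    metricDensity_eq]
  have hdet : A'.det = A.det := LinearMap.det_toMatrix b _
  rw [hdet, ← mul_assoc, mul_comm _ A.det, ← mul_assoc,  Real.sqrt_mul (mul_self_nonneg _), Real.sqrt_mul_self_eq_abs]

/-- The divergence may be computed in any chart. -/
lemma chartDiv_eq_riemDiv {X : (x : M) → TangentSpace (𝓡 n) x} {p : M} {y : 𝔼 n}
    (hy : y ∈ (extChartAt (𝓡 n) p).target)
    (hp : DifferentiableAt ℝ (coordComponents n X p) y)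
    (hq : DifferentiableAt ℝ (coordComponents n X ((extChartAt (𝓡 n) p).symm y))
      (extChartAt (𝓡 n) ((extChartAt (𝓡 n) p).symm y) ((extChartAt (𝓡 n) p).symm y))) :
    chartDiv X p y = riemDiv n X ((extChartAt (𝓡 n) p).symm y) := by
  set q := (extChartAt (𝓡 n) p).symm y with hqdef
  have hqs : (extChartAt (𝓡 n) p).symm y ∈ (extChartAt (𝓡 n) q).source :=
    mem_extChartAt_source q
  set τ := extChartAt (𝓡 n) q ∘ (extChartAt (𝓡 n) p).symm with hτdef
  have hτ : ContDiffAt ℝ ω τ y := contDiffAt_transition hy hqs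
  have hinj : Function.Injective (fderiv ℝ τ y) := by
    intro v w hvw
    rw [fderiv_transition hy hqs, fderiv_transition hy hqs] at hvw
    have hz : q = (extChartAt (𝓡 n) q).symm (extChartAt (𝓡 n) q q) := by rw [extChartAt_to_inv]
    have hi : ∀ x ∈ (extChartAt (𝓡 n) q).source, Function.Injective (chartDeriv (n := n) q x) := by
      intro x hx
      obtain ⟨z, hz, rfl⟩ : ∃ z ∈ (extChartAt (𝓡 n) q).target, (extChartAt (𝓡 n) q).symm z = x :=
        ⟨_, (extChartAt (𝓡 n) q).map_source hx, (extChartAt (𝓡 n) q).left_inv hx⟩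
      intro a b hab
      rw [← coordDeriv_chartDeriv hz a, hab, coordDeriv_chartDeriv hz]
    exact coordDeriv_injective hy (hi _ hqs hvw)
  let A : 𝔼 n ≃L[ℝ] 𝔼 n :=
    (LinearEquiv.ofInjectiveEndo (fderiv ℝ τ y : 𝔼 n →ₗ[ℝ] 𝔼 n) hinj).toContinuousLinearEquiv
  have hA : fderiv ℝ τ y = A := by ext v; rfl
  have hsq : extChartAt (𝓡 n) q q ∈ (extChartAt (𝓡 n) q).target := mem_extChartAt_target q
  have hev : ∀ᶠ z in 𝓝 y, (extChartAt (𝓡 n) p).symm z ∈ (extChartAt (𝓡 n) q).source :=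
    (continuousAt_symm hy).eventually ((isOpen_extChartAt_source q).mem_nhds hqs)
  -- The components of `X` times the metric density transform as a vector density, so the Piola
  -- identity applies; its Jacobian cancels against the one relating the two metric densities.
  have hpi := piola (Zp := fun z ↦ metricDensity n p z • coordComponents n X p z)
    (Zq := fun z ↦ metricDensity n q z • coordComponents n X q z) A hτ hA
    ((differentiableAt_metricDensity hy).smul hp) ((differentiableAt_metricDensity hsq).smul hq) (by
      filter_upwards [hev, eventually_mem_target hy] with z hz hzt
      rw [map_smul, metricDensity_transition hzt hz, fderiv_transition hzt hz,
        coordDeriv_coordComponents X hzt, ← coordComponents_extChartAt X hz, mul_smul]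
      rfl)
  rw [chartDiv_eq_trace hy hp, hpi, riemDiv_eq_chartDiv, chartDiv_eq_trace hsq hq,
    metricDensity_transition hy hqs, ← hA, mul_inv, mul_assoc]
  have hd : |(fderiv ℝ τ y).det| ≠ 0 := by
    rw [hA]; exact abs_ne_zero.2 (LinearEquiv.isUnit_det' A.toLinearEquiv).ne_zero
  rw [mul_left_comm, inv_mul_cancel_left₀ hd]
  rfl

end
end Divergence

/-! ### Square models of injective linear maps. -/

section LinearAlgebra

/-- An injective linear map into an inner product space has a square model: an endomorphism inducing
the same inner product, whose determinant is given by the Gram determinant. -/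
lemma exists_square_model {d : ℕ} {F : Type*} [NormedAddCommGroup F] [InnerProductSpace ℝ F]
    (L : 𝔼 d →ₗ[ℝ] F) (hL : Function.Injective L) :
    ∃ A : 𝔼 d →L[ℝ] 𝔼 d, (∀ v, ‖A v‖ = ‖L v‖) ∧ Function.Injective A ∧
      |A.det| = √ (Matrix.of fun i j : Fin d ↦ inner ℝ (L (EuclideanSpace.single i 1))
        (L (EuclideanSpace.single j 1))).det := by
  have hfr : Module.finrank ℝ (LinearMap.range L) = d := by
    rw [LinearMap.finrank_range_of_inj hL, finrank_euclideanSpace_fin]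
  -- In orthonormal coordinates on its range, `L` becomes an endomorphism `A` with the same inner
  -- products, so the Gram matrix is `Aᵀ A`.
  let e := ((stdOrthonormalBasis ℝ (LinearMap.range L)).reindex (finCongr hfr)).repr
  let A : 𝔼 d →ₗ[ℝ] 𝔼 d := e.toLinearEquiv.toLinearMap.comp L.rangeRestrict
  have hi : ∀ v w, inner ℝ (A v) (A w) = inner ℝ (L v) (L w) := fun v w ↦
    e.inner_map_map (L.rangeRestrict v) (L.rangeRestrict w)
  have hn : ∀ v, ‖A v‖ = ‖L v‖ := fun v ↦ e.norm_map (L.rangeRestrict v)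
  refine ⟨LinearMap.toContinuousLinearMap A, hn, ?_, ?_⟩
  · intro v w h
    apply hL
    have h1 : ‖A (v - w)‖ = 0 := by
      rw [map_sub, show A v = A w from h, sub_self, norm_zero]
    rw [hn, norm_eq_zero, map_sub] at h1
    exact sub_eq_zero.1 h1
  · let b := (EuclideanSpace.basisFun (Fin d) ℝ).toBasis
    have h1 : (Matrix.of fun i j : Fin d ↦ inner ℝ (L (EuclideanSpace.single i 1))
        (L (EuclideanSpace.single j 1))) =
        (LinearMap.toMatrix b b A).transpose * LinearMap.toMatrix b b A := by
      ext i j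
      have hent : ∀ i j, LinearMap.toMatrix b b A i j = A (EuclideanSpace.single j 1) i := by
        intro i j
        rw [LinearMap.toMatrix_apply]
        simp [b]
      rw [Matrix.of_apply, ← hi]
      simp only [Matrix.mul_apply, Matrix.transpose_apply, hent, PiLp.inner_apply]
      exact Finset.sum_congr rfl fun k _ ↦ mul_comm _ _
    rw [h1, Matrix.det_mul, Matrix.det_transpose, LinearMap.det_toMatrix, Real.sqrt_mul_self_eq_abs]
    rfl

end LinearAlgebra

/-! ### Comparison of the Riemannian distance with the norm in a chart. -/

section Distance

variable {n : ℕ} {M : Type*} [MetricSpace M] [ChartedSpace (𝔼 n) M]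
  [RiemannianBundle (fun x : M ↦ TangentSpace (𝓡 n) x)] [IsManifold (𝓡 n) ω M]
  [IsContMDiffRiemannianBundle (𝓡 n) ω (𝔼 n) (fun x : M ↦ TangentSpace (𝓡 n) x)]

lemma exists_coordModel {p : M} {y₀ : 𝔼 n} (hy : y₀ ∈ (extChartAt (𝓡 n) p).target) :
    ∃ A : 𝔼 n →L[ℝ] 𝔼 n, (∀ v, ‖A v‖ = ‖coordDeriv p y₀ v‖) ∧ Function.Injective A ∧
      |A.det| = metricDensity n p y₀ :=
  exists_square_model (F := TangentSpace (𝓡 n) ((extChartAt (𝓡 n) p).symm y₀))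
    (coordDeriv p y₀).toLinearMap (coordDeriv_injective hy)

lemma norm_chartDeriv {p x : M} (hx : x ∈ (extChartAt (𝓡 n) p).source)
    (v : TangentSpace (𝓡 n) x) :
    ‖coordDeriv p (extChartAt (𝓡 n) p x) (chartDeriv p x v)‖ = ‖v‖ := by
  rw [norm_eq_sqrt_real_inner, norm_eq_sqrt_real_inner v, inner_eq_chartDeriv hx,
    ← inner_coordDeriv]

/-- The Gram matrix is continuous, and the norm at `y₀` dominates a multiple of the Euclidean norm;
so a small additive change of the matrix is a small relative change of the squared norm. -/
lemma eventually_norm_coordDeriv {p : M} {y₀ : 𝔼 n} (hy : y₀ ∈ (extChartAt (𝓡 n) p).target)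
    {ε : ℝ} (hε : 0 < ε) (hε1 : ε < 1) :
    ∀ᶠ y in 𝓝 y₀, ∀ v, (1 - ε) * ‖coordDeriv p y₀ v‖ ≤ ‖coordDeriv p y v‖ ∧
      ‖coordDeriv p y v‖ ≤ (1 + ε) * ‖coordDeriv p y₀ v‖ := by
  obtain ⟨A, hA, hAi, -⟩ := exists_coordModel hy
  obtain ⟨K, hK, hKA⟩ := LinearMap.exists_antilipschitzWith (A : 𝔼 n →ₗ[ℝ] 𝔼 n)
    (LinearMap.ker_eq_bot.2 hAi)
  have hKv : ∀ v, ‖v‖ ≤ K * ‖coordDeriv p y₀ v‖ := by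
    intro v
    have := hKA.le_mul_norm (map_zero _) v
    rwa [← hA]
  -- `n * n * K ^ 2` is the loss in passing from the entries of the Gram matrix to the quadratic
  -- form; the `+ 1` keeps `C` positive in every case.
  set C : ℝ := (n * n : ℝ) * K ^ 2 + 1 with hC
  have hC0 : 0 < C := by positivity
  have hev : ∀ᶠ y in 𝓝 y₀, ∀ i j, |chartGram p y i j - chartGram p y₀ i j| ≤ ε / C := by
    rw [eventually_all]; intro i
    rw [eventually_all]; intro j
    have hc : ContinuousAt (fun y ↦ chartGram p y i j) y₀ :=
      (contDiffOn_chartGram p i j).continuousOn.continuousAt ((isOpen_target p).mem_nhds hy)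
    filter_upwards [Metric.continuousAt_iff'.1 hc (ε / C) (by positivity)] with y hy
    rw [← Real.dist_eq]
    exact hy.le
  filter_upwards [hev] with y hy v
  set N := ‖coordDeriv p y₀ v‖
  have hsq : |‖coordDeriv p y v‖ ^ 2 - N ^ 2| ≤ ε * N ^ 2 := by
    have h1 : ‖coordDeriv p y v‖ ^ 2 - N ^ 2 =
        ∑ i, ∑ j, v i * ((chartGram p y i j - chartGram p y₀ i j) * v j) := by
      rw [← real_inner_self_eq_norm_sq, ← real_inner_self_eq_norm_sq, inner_coordDeriv,
        inner_coordDeriv]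
      simp only [dotProduct, Matrix.mulVec, Finset.mul_sum, ← Finset.sum_sub_distrib]
      exact Finset.sum_congr rfl fun i _ ↦ Finset.sum_congr rfl fun j _ ↦ by ring
    have h2 : ∀ i, |v i| ≤ ‖v‖ := fun i ↦ PiLp.norm_apply_le v i
    calc |‖coordDeriv p y v‖ ^ 2 - N ^ 2|
        ≤ ∑ i : Fin n, ∑ j : Fin n, ε / C * ‖v‖ ^ 2 := by
          rw [h1]
          refine (Finset.abs_sum_le_sum_abs _ _).trans (Finset.sum_le_sum fun i _ ↦ ?_)
          refine (Finset.abs_sum_le_sum_abs _ _).trans (Finset.sum_le_sum fun j _ ↦ ?_)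
          rw [abs_mul, abs_mul]
          calc |v i| * (|chartGram p y i j - chartGram p y₀ i j| * |v j|)
              ≤ ‖v‖ * (ε / C * ‖v‖) := by
                gcongr
                exacts [h2 i, hy i j, h2 j]
            _ = ε / C * ‖v‖ ^ 2 := by ring
      _ = ε / C * ((n * n) * ‖v‖ ^ 2) := by simp; ring
      _ ≤ ε / C * ((n * n) * (K * N) ^ 2) := by gcongr; exact hKv v
      _ = ε * N ^ 2 * (((n * n : ℝ) * K ^ 2) / C) := by ring
      _ ≤ ε * N ^ 2 * 1 := by
          gcongr
          rw [div_le_one hC0, hC]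
          linarith
      _ = ε * N ^ 2 := mul_one _
  have hN : 0 ≤ N := norm_nonneg _
  rw [abs_le] at hsq
  constructor
  · refine le_of_sq_le_sq ?_ (norm_nonneg _)
    nlinarith [mul_nonneg hε.le (sq_nonneg N), mul_nonneg (mul_nonneg hε.le (sub_nonneg.2 hε1.le)) (sq_nonneg N)]
  · refine le_of_sq_le_sq ?_ (by positivity)
    nlinarith [mul_nonneg hε.le (sq_nonneg N), mul_nonneg (sq_nonneg ε) (sq_nonneg N)]

variable [IsRiemannianManifold (𝓡 n) M]

/-- Near a point, the inverse of a chart is nearly isometric from the norm given by the metric at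
that point to the Riemannian distance. -/
lemma exists_ball_dist_symm {p : M} {y₀ : 𝔼 n} (hy₀ : y₀ ∈ (extChartAt (𝓡 n) p).target)
    {ε : ℝ} (hε : 0 < ε) (hε1 : ε < 1) :
    ∃ r > 0, Metric.ball y₀ r ⊆ (extChartAt (𝓡 n) p).target ∧
      ∀ y ∈ Metric.ball y₀ r, ∀ z ∈ Metric.ball y₀ r,
      (1 - ε) * ‖coordDeriv p y₀ (y - z)‖ ≤
        dist ((extChartAt (𝓡 n) p).symm y) ((extChartAt (𝓡 n) p).symm z) ∧
      dist ((extChartAt (𝓡 n) p).symm y) ((extChartAt (𝓡 n) p).symm z) ≤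
        (1 + ε) * ‖coordDeriv p y₀ (y - z)‖ := by
  set κ := extChartAt (𝓡 n) p with hκ
  obtain ⟨A, hA, -, -⟩ := exists_coordModel hy₀
  obtain ⟨r₁, hr₁, hball⟩ := Metric.eventually_nhds_iff_ball.1
    ((eventually_norm_coordDeriv hy₀ hε hε1).and (eventually_mem_target hy₀))
  -- upper bound
  have hupper : ∀ y ∈ Metric.ball y₀ r₁, ∀ z ∈ Metric.ball y₀ r₁,
      dist (κ.symm y) (κ.symm z) ≤ (1 + ε) * ‖coordDeriv p y₀ (y - z)‖ := by
    intro y hy z hz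
    -- The segment stays in the ball, where its speed is nearly the norm at `y₀`; the length of its
    -- image bounds the distance.
    let η : ℝ → 𝔼 n := fun t ↦ y + t • (z - y)
    have hη : ∀ t ∈ Icc (0 : ℝ) 1, η t ∈ Metric.ball y₀ r₁ := by
      intro t ht
      exact (convex_ball y₀ r₁).add_smul_sub_mem hy hz ht
    have hηd : ContDiff ℝ 1 η := by fun_prop
    have hηd' : ∀ t, HasDerivAt η (z - y) t := by
      intro t
      simpa [η] using ((hasDerivAt_id t).smul_const (z - y)).const_add y
    have hγ : ContMDiffOn 𝓘(ℝ, ℝ) (𝓡 n) 1 (κ.symm ∘ η) (Icc 0 1) :=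
      (contMDiffOn_extChartAt_symm (I := 𝓡 n) (n := 1) p).comp hηd.contMDiff.contMDiffOn
        fun t ht ↦ (hball _ (hη t ht)).2
    have h1 := Manifold.riemannianEDist_le_pathELength hγ (x := κ.symm y) (y := κ.symm z)
      (by simp [η]) (by simp [η]) zero_le_one
    rw [← IsRiemannianManifold.out (I := 𝓡 n), Manifold.pathELength_eq_lintegral_mfderiv_Icc] at h1
    have h2 : ∫⁻ t in Icc (0 : ℝ) 1, ‖mfderiv 𝓘(ℝ, ℝ) (𝓡 n) (κ.symm ∘ η) t 1‖ₑ ≤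
        ∫⁻ t in Icc (0 : ℝ) 1, ENNReal.ofReal ((1 + ε) * ‖coordDeriv p y₀ (y - z)‖) := by
      refine setLIntegral_mono' measurableSet_Icc fun t ht ↦ ?_
      have h3 : mfderiv 𝓘(ℝ, ℝ) (𝓡 n) (κ.symm ∘ η) t 1 = coordDeriv p (η t) (z - y) := by
        rw [mfderiv_comp t (mdifferentiableAt_symm (hball _ (hη t ht)).2)
          (hηd' t).differentiableAt.mdifferentiableAt]
        change coordDeriv p (η t) (mfderiv 𝓘(ℝ, ℝ) 𝓘(ℝ, 𝔼 n) η t 1) = _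
        rw [mfderiv_eq_fderiv]
        congr 1
        exact (hηd' t).deriv
      rw [h3, ← ofReal_norm]
      refine ENNReal.ofReal_le_ofReal (((hball _ (hη t ht)).1 _).2.trans_eq ?_)
      rw [← neg_sub y z, map_neg, norm_neg]
    have h4 := h1.trans h2
    rw [setLIntegral_const, Real.volume_Icc, sub_zero, ENNReal.ofReal_one, mul_one, edist_dist] at h4
    exact (ENNReal.ofReal_le_ofReal_iff (by positivity)).1 h4
  -- lower bound
  have hU : κ.source ∩ κ ⁻¹' Metric.ball y₀ r₁ ∈ 𝓝 (κ.symm y₀) := by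
    have hs := κ.map_target hy₀
    refine inter_mem ((isOpen_extChartAt_source p).mem_nhds hs) ?_
    have hc : ContinuousAt κ (κ.symm y₀) := continuousAt_extChartAt' hs
    refine hc.preimage_mem_nhds ?_
    rw [κ.right_inv hy₀]
    exact Metric.ball_mem_nhds _ hr₁
  obtain ⟨ρ, hρ, hρU⟩ := Metric.mem_nhds_iff.1 hU
  -- Two points within `ρ / 3` of the centre have distance below `2 * ρ / 3`, and a curve between
  -- them of length at most `2 * ρ / 3` stays in the ball of radius `ρ`. So nearly minimal curves
  -- can be read in the chart, where speeds are comparable to the norm at `y₀`.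
  have hlower : ∀ x ∈ Metric.ball (κ.symm y₀) (ρ / 3), ∀ x' ∈ Metric.ball (κ.symm y₀) (ρ / 3),
      (1 - ε) * ‖coordDeriv p y₀ (κ x' - κ x)‖ ≤ dist x x' := by
    intro x hx x' hx'
    have hd : dist x x' < 2 * ρ / 3 := by
      have := dist_triangle_right x x' (κ.symm y₀)
      rw [Metric.mem_ball] at hx hx'
      linarith
    refine le_of_forall_gt_imp_ge_of_dense fun L hL ↦ ?_
    wlog hL2 : L ≤ 2 * ρ / 3 generalizing L
    · exact (this _ hd le_rfl).trans (not_le.1 hL2).le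
    have hL0 : 0 ≤ L := dist_nonneg.trans hL.le
    have h0 : Manifold.riemannianEDist (𝓡 n) x x' < ENNReal.ofReal L := by
      rw [← IsRiemannianManifold.out, edist_dist]
      exact (ENNReal.ofReal_lt_ofReal_iff_of_nonneg dist_nonneg).2 hL
    obtain ⟨γ, hγ0, hγ1, hγ, hlen⟩ := Manifold.exists_lt_of_riemannianEDist_lt h0
    have hin : ∀ t ∈ Icc (0 : ℝ) 1, γ t ∈ κ.source ∩ κ ⁻¹' Metric.ball y₀ r₁ := by
      intro t ht
      apply hρU
      have h5 : edist x (γ t) < ENNReal.ofReal L := by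
        rw [IsRiemannianManifold.out (I := 𝓡 n)]
        refine (Manifold.riemannianEDist_le_pathELength (hγ.mono (Icc_subset_Icc_right ht.2)) hγ0 rfl
          ht.1).trans_lt ((Manifold.pathELength_mono le_rfl ht.2).trans_lt hlen)
      rw [edist_dist, ENNReal.ofReal_lt_ofReal_iff_of_nonneg dist_nonneg] at h5
      rw [Metric.mem_ball]
      have := dist_triangle_left (γ t) (κ.symm y₀) x
      rw [Metric.mem_ball] at hx
      linarith
    have hmap : ∀ t ∈ Icc (0 : ℝ) 1, γ t ∈ (chartAt (𝔼 n) p).source := fun t ht ↦ by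
      simpa [hκ] using (hin t ht).1
    have hκγ : ContDiffOn ℝ 1 (κ ∘ γ) (Icc 0 1) := contMDiffOn_iff_contDiffOn.1
      ((contMDiffOn_extChartAt (I := 𝓡 n) (n := 1)).comp hγ hmap)
    have h6 := enorm_sub_le_lintegral_derivWithin_Icc_of_contDiffOn_Icc
      (A.contDiff.comp_contDiffOn hκγ) zero_le_one
    have h7 : ∫⁻ t in Icc (0 : ℝ) 1, ‖derivWithin (A ∘ (κ ∘ γ)) (Icc 0 1) t‖ₑ ≤
        ∫⁻ t in Icc (0 : ℝ) 1, ENNReal.ofReal (1 - ε)⁻¹ *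
          ‖mfderivWithin 𝓘(ℝ, ℝ) (𝓡 n) γ (Icc 0 1) t 1‖ₑ := by
      refine setLIntegral_mono' measurableSet_Icc fun t ht ↦ ?_
      have hu := uniqueDiffOn_Icc (zero_lt_one' ℝ) t ht
      have h8 : derivWithin (A ∘ (κ ∘ γ)) (Icc 0 1) t =
          A (chartDeriv p (γ t) (mfderivWithin 𝓘(ℝ, ℝ) (𝓡 n) γ (Icc 0 1) t 1)) := by
        have hd1 := (hκγ.differentiableOn one_ne_zero t ht).hasDerivWithinAt
        rw [(A.hasFDerivAt.comp_hasDerivWithinAt t hd1).derivWithin hu]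
        congr 1
        have h10 := mfderiv_comp_mfderivWithin t
          (mdifferentiableAt_extChartAt (I := 𝓡 n) (hmap t ht))
          (hγ.mdifferentiableOn one_ne_zero t ht) (uniqueMDiffWithinAt_iff_uniqueDiffWithinAt.2 hu)
        rw [mfderivWithin_eq_fderivWithin] at h10
        exact DFunLike.congr_fun h10 (1 : ℝ)
      rw [h8, ← ofReal_norm, ← ofReal_norm, ← ENNReal.ofReal_mul (by
        rw [inv_nonneg]; linarith), hA]
      refine ENNReal.ofReal_le_ofReal ?_
      rw [le_inv_mul_iff₀ (by linarith), ← norm_chartDeriv (hin t ht).1]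
      exact ((hball _ (hin t ht).2).1 _).1
    rw [lintegral_const_mul' _ _ ENNReal.ofReal_ne_top,
      ← Manifold.pathELength_eq_lintegral_mfderivWithin_Icc] at h7
    have h9 := (h6.trans h7).trans (mul_le_mul_right hlen.le _)
    rw [← ENNReal.ofReal_mul (by rw [inv_nonneg]; linarith), ← ofReal_norm,
      ENNReal.ofReal_le_ofReal_iff (mul_nonneg (by rw [inv_nonneg]; linarith) hL0),
      le_inv_mul_iff₀ (by linarith)] at h9
    simpa only [Function.comp, hγ0, hγ1, ← map_sub, hA] using h9
  have hcont : κ.symm ⁻¹' Metric.ball (κ.symm y₀) (ρ / 3) ∈ 𝓝 y₀ :=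
    (continuousAt_symm hy₀).preimage_mem_nhds (Metric.ball_mem_nhds _ (by positivity))
  obtain ⟨r₂, hr₂, hr₂s⟩ := Metric.mem_nhds_iff.1 hcont
  refine ⟨min r₁ r₂, lt_min hr₁ hr₂, fun y hy ↦ (hball y (Metric.ball_subset_ball
    (min_le_left _ _) hy)).2, fun y hy z hz ↦ ⟨?_, hupper _ (Metric.ball_subset_ball
    (min_le_left _ _) hy) _ (Metric.ball_subset_ball (min_le_left _ _) hz)⟩⟩
  have := hlower _ (hr₂s (Metric.ball_subset_ball (min_le_right _ _) hz)) _
    (hr₂s (Metric.ball_subset_ball (min_le_right _ _) hy))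
  rw [κ.right_inv (hball y (Metric.ball_subset_ball (min_le_left _ _) hy)).2,
    κ.right_inv (hball z (Metric.ball_subset_ball (min_le_left _ _) hz)).2, dist_comm] at this
  exact this

end Distance

/-! ### The area formula for Hausdorff measure. -/

section AreaFormula

open scoped NNReal ENNReal

lemma LipschitzOnWith.euclideanHausdorffMeasure_image_le {X Y : Type*} [EMetricSpace X]
    [MeasurableSpace X] [BorelSpace X] [EMetricSpace Y] [MeasurableSpace Y] [BorelSpace Y]
    {f : X → Y} {s : Set X} {K : ℝ≥0} (h : LipschitzOnWith K f s) (d : ℕ) :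
    μHE[d] (f '' s) ≤ (K : ℝ≥0∞) ^ d * μHE[d] s := by
  simp only [Measure.euclideanHausdorffMeasure_def, Measure.smul_apply]
  have := h.hausdorffMeasure_image_le (d := d) (Nat.cast_nonneg d)
  rw [ENNReal.rpow_natCast] at this
  rw [mul_smul_comm]
  exact smul_le_smul_of_nonneg_left this (by simp)

variable {d : ℕ} {X : Type*} [MetricSpace X] [MeasurableSpace X] [BorelSpace X]

/-- A map that is nearly isometric with respect to the norm `‖A ·‖` nearly multiplies areas by
`|det A|`. -/
lemma euclideanHausdorffMeasure_image_bounds {ψ : 𝔼 d → X} {s : Set (𝔼 d)} {A : 𝔼 d →L[ℝ] 𝔼 d}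
    (hA : Function.Injective A) {ε : ℝ} (hε : 0 < ε) (hε1 : ε < 1)
    (h : ∀ y ∈ s, ∀ z ∈ s, (1 - ε) * ‖A (y - z)‖ ≤ dist (ψ y) (ψ z) ∧
      dist (ψ y) (ψ z) ≤ (1 + ε) * ‖A (y - z)‖) :
    μHE[d] (ψ '' s) ≤ ENNReal.ofReal ((1 + ε) ^ d) * (ENNReal.ofReal |A.det| * volume s) ∧
    ENNReal.ofReal ((1 - ε) ^ d) * (ENNReal.ofReal |A.det| * volume s) ≤ μHE[d] (ψ '' s) := by
  let B := (LinearEquiv.ofInjectiveEndo (A : 𝔼 d →ₗ[ℝ] 𝔼 d) hA).symm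
  have hBA : ∀ v, B (A v) = v := fun v ↦
    (LinearEquiv.ofInjectiveEndo (A : 𝔼 d →ₗ[ℝ] 𝔼 d) hA).symm_apply_apply v
  have hvol : μHE[d] (A '' s) = ENNReal.ofReal |A.det| * volume s := by
    rw [EuclideanSpace.euclideanHausdorffMeasure_eq_volume]
    exact Measure.addHaar_image_continuousLinearMap volume A s
  have hinj : InjOn ψ s := by
    intro y hy z hz hyz
    have h1 := (h y hy z hz).1
    rw [hyz, dist_self] at h1
    have h2 : ‖A (y - z)‖ = 0 := le_antisymm
      (nonpos_of_mul_nonpos_right h1 (by linarith)) (norm_nonneg _)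
    rw [norm_eq_zero] at h2
    have := hA (h2.trans (map_zero A).symm)
    exact sub_eq_zero.1 this
  constructor
  -- `ψ ∘ A⁻¹` is `(1 + ε)`-Lipschitz on `A '' s`, whose measure is `|det A|` times that of `s`. The
  -- lower bound comes in the same way from the inverse map, with constant `(1 - ε)⁻¹`.
  · have hL : LipschitzOnWith (1 + ε).toNNReal (ψ ∘ B) (A '' s) := by
      refine LipschitzOnWith.of_dist_le_mul ?_
      rintro _ ⟨y, hy, rfl⟩ _ ⟨z, hz, rfl⟩
      simp only [Function.comp, hBA]
      rw [Real.coe_toNNReal _ (by linarith), dist_eq_norm, ← map_sub]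
      exact (h y hy z hz).2
    have h1 := hL.euclideanHausdorffMeasure_image_le d
    rw [hvol] at h1
    have h2 : (ψ ∘ B) '' (A '' s) = ψ '' s := by
      rw [image_image]
      simp only [Function.comp, hBA]
    rw [h2] at h1
    rwa [ENNReal.ofReal_pow (by linarith)]
  · have hL : LipschitzOnWith (1 - ε)⁻¹.toNNReal (A ∘ Function.invFunOn ψ s) (ψ '' s) := by
      refine LipschitzOnWith.of_dist_le_mul ?_
      rintro _ ⟨y, hy, rfl⟩ _ ⟨z, hz, rfl⟩
      simp only [Function.comp, hinj.leftInvOn_invFunOn hy, hinj.leftInvOn_invFunOn hz]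
      rw [Real.coe_toNNReal _ (by rw [inv_nonneg]; linarith), dist_eq_norm, ← map_sub,
        le_inv_mul_iff₀ (by linarith)]
      exact (h y hy z hz).1
    have h1 := hL.euclideanHausdorffMeasure_image_le d
    have h2 : (A ∘ Function.invFunOn ψ s) '' (ψ '' s) = A '' s := by
      rw [image_image]
      exact image_congr fun y hy ↦ by simp only [Function.comp, hinj.leftInvOn_invFunOn hy]
    rw [h2, hvol] at h1
    calc ENNReal.ofReal ((1 - ε) ^ d) * (ENNReal.ofReal |A.det| * volume s)
        ≤ ENNReal.ofReal ((1 - ε) ^ d) * (ENNReal.ofReal (1 - ε)⁻¹ ^ d * μHE[d] (ψ '' s)) := by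
          exact mul_le_mul_right h1 _
      _ = μHE[d] (ψ '' s) := by
          rw [← mul_assoc, ← ENNReal.ofReal_pow (by rw [inv_nonneg]; linarith),
            ← ENNReal.ofReal_mul (pow_nonneg (by linarith) _), ← mul_pow,
            mul_inv_cancel₀ (by linarith), one_pow, ENNReal.ofReal_one, one_mul]

/-- `ψ` is an immersion of `U` with area density `J`, in the metric sense: near each point `y` it is
nearly isometric for a norm `‖A ·‖` with `|det A| = J y`. -/
structure IsMetricImmersion (ψ : 𝔼 d → X) (U : Set (𝔼 d)) (J : 𝔼 d → ℝ) : Prop where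
  continuousOn_density : ContinuousOn J U
  injOn : InjOn ψ U
  approx : ∀ y ∈ U, ∃ A : 𝔼 d →L[ℝ] 𝔼 d, Function.Injective A ∧ |A.det| = J y ∧
    ∀ ε : ℝ, 0 < ε → ε < 1 → ∃ r > 0, ∀ z ∈ Metric.ball y r, ∀ z' ∈ Metric.ball y r,
      (1 - ε) * ‖A (z - z')‖ ≤ dist (ψ z) (ψ z') ∧ dist (ψ z) (ψ z') ≤ (1 + ε) * ‖A (z - z')‖

namespace IsMetricImmersion

variable {ψ : 𝔼 d → X} {U : Set (𝔼 d)} {J : 𝔼 d → ℝ}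

lemma continuousOn (h : IsMetricImmersion ψ U J) : ContinuousOn ψ U := by
  intro y hy
  refine ContinuousAt.continuousWithinAt ?_
  obtain ⟨A, -, -, hA⟩ := h.approx y hy
  obtain ⟨r, hr, hb⟩ := hA (1 / 2) (by norm_num) (by norm_num)
  rw [Metric.continuousAt_iff']
  intro ε hε
  have hc : ContinuousAt (fun z ↦ (1 + 1 / 2) * ‖A (z - y)‖) y := by fun_prop
  have h0 : ∀ᶠ z in 𝓝 y, (1 + 1 / 2) * ‖A (z - y)‖ < ε :=
    hc.eventually_lt continuousAt_const (by simpa)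
  filter_upwards [h0, Metric.ball_mem_nhds y hr] with z hz hzr
  exact (hb z hzr y (Metric.mem_ball_self hr)).2.trans_lt hz

lemma density_pos (h : IsMetricImmersion ψ U J) {y : 𝔼 d} (hy : y ∈ U) : 0 < J y := by
  obtain ⟨A, hAi, hAJ, -⟩ := h.approx y hy
  rw [← hAJ]
  exact abs_pos.2
    (LinearEquiv.isUnit_det' (LinearEquiv.ofInjectiveEndo (A : 𝔼 d →ₗ[ℝ] 𝔼 d) hAi)).ne_zero

/-- Of the `d + 1` factors, `d` come from the Lipschitz constants and one from the variation of `J`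
near `y`. -/
lemma local_bounds (h : IsMetricImmersion ψ U J) {y : 𝔼 d} (hy : y ∈ U) {ε : ℝ}
    (hε : 0 < ε) (hε1 : ε < 1) : ∃ V, IsOpen V ∧ y ∈ V ∧ ∀ s ⊆ U ∩ V, MeasurableSet s →
      μHE[d] (ψ '' s) ≤ ENNReal.ofReal ((1 + ε) ^ (d + 1)) * ∫⁻ z in s, ENNReal.ofReal (J z) ∧
      ENNReal.ofReal ((1 - ε) ^ (d + 1)) * ∫⁻ z in s, ENNReal.ofReal (J z) ≤ μHE[d] (ψ '' s) := by
  obtain ⟨A, hAi, hAJ, hA⟩ := h.approx y hy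
  obtain ⟨r, hr, hb⟩ := hA ε hε hε1
  have hJ := h.density_pos hy
  have hc := h.continuousOn_density y hy
  have h1 : ∀ᶠ z in 𝓝[U] y, J y ≤ (1 + ε) * J z := by
    have : Tendsto (fun z ↦ (1 + ε) * J z) (𝓝[U] y) (𝓝 ((1 + ε) * J y)) := hc.const_mul _
    exact (this.eventually_const_lt (by nlinarith)).mono fun z hz ↦ hz.le
  have h2 : ∀ᶠ z in 𝓝[U] y, (1 - ε) * J z ≤ J y := by
    have : Tendsto (fun z ↦ (1 - ε) * J z) (𝓝[U] y) (𝓝 ((1 - ε) * J y)) := hc.const_mul _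
    exact (this.eventually_lt_const (by nlinarith)).mono fun z hz ↦ hz.le
  obtain ⟨V, hV, hyV, hVs⟩ := mem_nhdsWithin.1 (h1.and h2)
  refine ⟨V ∩ Metric.ball y r, hV.inter Metric.isOpen_ball, ⟨hyV, Metric.mem_ball_self hr⟩,
    fun s hs hsm ↦ ?_⟩
  obtain ⟨hu, hl⟩ := euclideanHausdorffMeasure_image_bounds (ψ := ψ) (s := s) hAi hε hε1
    (fun z hz z' hz' ↦ hb z (hs hz).2.2 z' (hs hz').2.2)
  rw [hAJ] at hu hl
  have hconst : ENNReal.ofReal (J y) * volume s = ∫⁻ _ in s, ENNReal.ofReal (J y) :=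
    (setLIntegral_const _ _).symm
  have hb : ∀ z ∈ s, J y ≤ (1 + ε) * J z ∧ (1 - ε) * J z ≤ J y := fun z hz ↦
    hVs ⟨(hs hz).2.1, (hs hz).1⟩
  constructor
  · refine hu.trans ?_
    rw [pow_succ, ENNReal.ofReal_mul (by positivity), mul_assoc]
    refine mul_le_mul_right ?_ _
    rw [hconst, ← lintegral_const_mul' _ _ ENNReal.ofReal_ne_top]
    refine setLIntegral_mono' hsm fun z hz ↦ ?_
    rw [← ENNReal.ofReal_mul (by linarith)]
    exact ENNReal.ofReal_le_ofReal (hb z hz).1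
  · refine le_trans ?_ hl
    rw [pow_succ, ENNReal.ofReal_mul (pow_nonneg (by linarith) _), mul_assoc]
    refine mul_le_mul_right ?_ _
    rw [hconst, ← lintegral_const_mul' _ _ ENNReal.ofReal_ne_top]
    refine setLIntegral_mono' hsm fun z hz ↦ ?_
    rw [← ENNReal.ofReal_mul (by linarith)]
    exact ENNReal.ofReal_le_ofReal (hb z hz).2

lemma measurableSet_image (h : IsMetricImmersion ψ U J) {s : Set (𝔼 d)} (hs : MeasurableSet s)
    (hsU : s ⊆ U) : MeasurableSet (ψ '' s) :=
  hs.image_of_continuousOn_injOn (h.continuousOn.mono hsU) (h.injOn.mono hsU)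

/-- The local constants do not depend on the point, so the bounds add up over a countable measurable
partition of `s` subordinate to the neighbourhoods `V`. -/
lemma global_bounds (h : IsMetricImmersion ψ U J) {s : Set (𝔼 d)} (hs : MeasurableSet s)
    (hsU : s ⊆ U) {ε : ℝ} (hε : 0 < ε) (hε1 : ε < 1) :
    μHE[d] (ψ '' s) ≤ ENNReal.ofReal ((1 + ε) ^ (d + 1)) * ∫⁻ z in s, ENNReal.ofReal (J z) ∧
      ENNReal.ofReal ((1 - ε) ^ (d + 1)) * ∫⁻ z in s, ENNReal.ofReal (J z) ≤ μHE[d] (ψ '' s) := by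
  choose! V hVo hyV hV using fun y (hy : y ∈ U) ↦ h.local_bounds hy hε hε1
  obtain ⟨t, htU, htc, hcov⟩ := TopologicalSpace.countable_cover_nhdsWithin (s := U) (f := V)
    fun y hy ↦ mem_nhdsWithin_of_mem_nhds ((hVo y hy).mem_nhds (hyV y hy))
  rcases t.eq_empty_or_nonempty with rfl | hne
  · have : s = ∅ := by
      refine subset_empty_iff.1 (hsU.trans (hcov.trans ?_))
      simp
    simp [this]
  obtain ⟨f, hf⟩ := htc.exists_eq_range hne
  have hfU : ∀ k, f k ∈ U := fun k ↦ htU (hf ▸ mem_range_self k)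
  let D : ℕ → Set (𝔼 d) := disjointed fun k ↦ s ∩ V (f k)
  have hDm : ∀ k, MeasurableSet (D k) :=
    MeasurableSet.disjointed fun k ↦ hs.inter (hVo _ (hfU k)).measurableSet
  have hDs : ∀ k, D k ⊆ s ∩ V (f k) := fun k ↦ disjointed_subset _ _
  have hDu : ⋃ k, D k = s := by
    rw [iUnion_disjointed]
    refine subset_antisymm (iUnion_subset fun k ↦ inter_subset_left) fun x hx ↦ ?_
    obtain ⟨y, hy, hxy⟩ := mem_iUnion₂.1 (hcov (hsU hx))
    rw [hf] at hy
    obtain ⟨k, rfl⟩ := hy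
    exact mem_iUnion.2 ⟨k, hx, hxy⟩
  have hDd : Pairwise (Function.onFun Disjoint D) := disjoint_disjointed _
  have hsum : μHE[d] (ψ '' s) = ∑' k, μHE[d] (ψ '' D k) := by
    rw [← hDu, image_iUnion, measure_iUnion]
    · intro j k hjk
      have hsub : ∀ k, D k ⊆ U := fun k ↦ (hDs k).trans (inter_subset_left.trans hsU)
      exact (hDd hjk).image h.injOn (hsub j) (hsub k)
    · exact fun k ↦ h.measurableSet_image (hDm k) ((hDs k).trans (inter_subset_left.trans hsU))
  have hint : ∫⁻ z in s, ENNReal.ofReal (J z) = ∑' k, ∫⁻ z in D k, ENNReal.ofReal (J z) := by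
    rw [← lintegral_iUnion hDm hDd, hDu]
  have hk := fun k ↦ hV (f k) (hfU k) (D k)
    (fun x hx ↦ ⟨hsU (hDs k hx).1, (hDs k hx).2⟩) (hDm k)
  rw [hsum, hint, ← ENNReal.tsum_mul_left, ← ENNReal.tsum_mul_left]
  exact ⟨ENNReal.tsum_le_tsum fun k ↦ (hk k).1, ENNReal.tsum_le_tsum fun k ↦ (hk k).2⟩

/-- The area formula. -/
theorem measure_image (h : IsMetricImmersion ψ U J) {s : Set (𝔼 d)} (hs : MeasurableSet s)
    (hsU : s ⊆ U) : μHE[d] (ψ '' s) = ∫⁻ z in s, ENNReal.ofReal (J z) := by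
  set I := ∫⁻ z in s, ENNReal.ofReal (J z)
  have hlim : ∀ σ : ℝ, Tendsto (fun ε : ℝ ↦ ENNReal.ofReal ((1 + σ * ε) ^ (d + 1)) * I) (𝓝[>] 0)
      (𝓝 I) := by
    intro σ
    have h1 : Tendsto (fun ε : ℝ ↦ ENNReal.ofReal ((1 + σ * ε) ^ (d + 1))) (𝓝[>] 0) (𝓝 1) := by
      have hc : Continuous fun ε : ℝ ↦ ENNReal.ofReal ((1 + σ * ε) ^ (d + 1)) :=
        ENNReal.continuous_ofReal.comp (by fun_prop)
      have := hc.tendsto 0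
      simp only [mul_zero, add_zero, one_pow, ENNReal.ofReal_one] at this
      exact this.mono_left nhdsWithin_le_nhds
    simpa using ENNReal.Tendsto.mul_const h1 (Or.inl one_ne_zero)
  have hev : ∀ᶠ ε in 𝓝[>] (0 : ℝ), 0 < ε ∧ ε < 1 :=
    Ioo_mem_nhdsGT zero_lt_one
  refine le_antisymm (ge_of_tendsto (hlim 1) ?_) (le_of_tendsto (hlim (-1)) ?_)
  · filter_upwards [hev] with ε hε
    rw [one_mul]
    exact (h.global_bounds hs hsU hε.1 hε.2).1
  · filter_upwards [hev] with ε hε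
    rw [neg_one_mul, ← sub_eq_add_neg]
    exact (h.global_bounds hs hsU hε.1 hε.2).2

lemma map_withDensity (h : IsMetricImmersion ψ U J) {s : Set (𝔼 d)} (hs : MeasurableSet s)
    (hsU : s ⊆ U) :
    ((volume.restrict s).withDensity fun z ↦ ENNReal.ofReal (J z)).map ψ =
      (μHE[d] : Measure X).restrict (ψ '' s) := by
  ext B hB
  have hψ : AEMeasurable ψ ((volume.restrict s).withDensity fun z ↦ ENNReal.ofReal (J z)) :=
    ((h.continuousOn.mono hsU).aemeasurable hs).mono_ac (withDensity_absolutelyContinuous _ _)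
  have hm : MeasurableSet (s ∩ ψ ⁻¹' B) := by
    have := (h.continuousOn.mono hsU).domRestrict.measurable hB
    exact MeasurableSet.subtype_image hs this |> fun h ↦ by
      convert h using 1
      ext x
      simp [and_comm]
  have hnull : (volume.restrict s).withDensity (fun z ↦ ENNReal.ofReal (J z)) sᶜ = 0 := by
    apply withDensity_absolutelyContinuous
    rw [Measure.restrict_apply hs.compl, compl_inter_self, measure_empty]
  rw [Measure.map_apply_of_aemeasurable hψ hB, Measure.restrict_apply hB,
    ← measure_inter_conull hnull, inter_comm,
    withDensity_apply _ hm, Measure.restrict_restrict hm, inter_assoc, inter_comm _ s, ← inter_assoc, inter_self,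
    show B ∩ ψ '' s = ψ '' (s ∩ ψ ⁻¹' B) by rw [image_inter_preimage, inter_comm],
    h.measure_image hm (inter_subset_left.trans hsU)]

lemma setIntegral_image (h : IsMetricImmersion ψ U J) {s : Set (𝔼 d)} (hs : MeasurableSet s)
    (hsU : s ⊆ U) {f : X → ℝ} (hf : Measurable f) :
    ∫ x in ψ '' s, f x ∂μHE[d] = ∫ z in s, J z * f (ψ z) := by
  have hψ : AEMeasurable ψ ((volume.restrict s).withDensity fun z ↦ ENNReal.ofReal (J z)) :=
    ((h.continuousOn.mono hsU).aemeasurable hs).mono_ac (withDensity_absolutelyContinuous _ _)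
  have hJ : AEMeasurable (fun z ↦ ENNReal.ofReal (J z)) (volume.restrict s) :=
    ((h.continuousOn_density.mono hsU).aemeasurable hs).ennreal_ofReal
  rw [← h.map_withDensity hs hsU, integral_map hψ hf.aestronglyMeasurable,
    integral_withDensity_eq_integral_toReal_smul₀ hJ (by simp)]
  refine setIntegral_congr_fun hs fun z hz ↦ ?_
  simp only [ENNReal.toReal_ofReal (h.density_pos (hsU hz)).le, smul_eq_mul]

end IsMetricImmersion
end AreaFormula

/-! ### Immersions read in charts, and their area densities. -/

section Immersion

variable {n d : ℕ} {M : Type*} [TopologicalSpace M] [ChartedSpace (𝔼 n) M]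
  [RiemannianBundle (fun x : M ↦ TangentSpace (𝓡 n) x)] [IsManifold (𝓡 n) ω M]
  [IsContMDiffRiemannianBundle (𝓡 n) ω (𝔼 n) (fun x : M ↦ TangentSpace (𝓡 n) x)]

lemma contDiffWithinAt_inner_coordDeriv {F : Type*} [NormedAddCommGroup F] [NormedSpace ℝ F]
    {p : M} {y v w : F → 𝔼 n} {k : WithTop ℕ∞} {s : Set F} {a : F}
    (ha : y a ∈ (extChartAt (𝓡 n) p).target) (hy : ContDiffWithinAt ℝ k y s a)
    (hv : ContDiffWithinAt ℝ k v s a) (hw : ContDiffWithinAt ℝ k w s a) :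
    ContDiffWithinAt ℝ k (fun b ↦ inner ℝ (coordDeriv p (y b) (v b)) (coordDeriv p (y b) (w b)))
      s a := by
  simp only [inner_coordDeriv, dotProduct, Matrix.mulVec]
  rw [contDiffWithinAt_piLp] at hv hw
  refine ContDiffWithinAt.sum fun i _ ↦ (hv i).mul (ContDiffWithinAt.sum fun j _ ↦ ?_)
  refine ContDiffWithinAt.mul ?_ (hw j)
  exact (((contDiffOn_chartGram p i j).contDiffAt ((isOpen_target p).mem_nhds ha)).of_le
    le_top).comp_contDiffWithinAt a hy

/-- The area density of the map `φ`, read in the preferred chart at `p`. -/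
def areaDensity (p : M) (φ : 𝔼 d → 𝔼 n) (x : 𝔼 d) : ℝ :=
  √ (Matrix.of fun i j : Fin d ↦ inner ℝ (coordDeriv p (φ x) (fderiv ℝ φ x (EuclideanSpace.single i 1)))
    (coordDeriv p (φ x) (fderiv ℝ φ x (EuclideanSpace.single j 1)))).det

lemma areaDensity_id (p : M) (y : 𝔼 n) : areaDensity p (id : 𝔼 n → 𝔼 n) y = metricDensity n p y := by
  simp only [areaDensity, fderiv_id]
  rfl

end Immersion

section Immersion

variable {n d : ℕ} {M : Type*} [MetricSpace M] [ChartedSpace (𝔼 n) M]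
  [RiemannianBundle (fun x : M ↦ TangentSpace (𝓡 n) x)] [IsManifold (𝓡 n) ω M]
  [IsContMDiffRiemannianBundle (𝓡 n) ω (𝔼 n) (fun x : M ↦ TangentSpace (𝓡 n) x)]
  [IsRiemannianManifold (𝓡 n) M]

lemma le_mul_of_chain {ε a K w d e N : ℝ} (hK : 0 < K) (ha : 0 ≤ a)
    (hc0 : 0 ≤ ε / ((a + 1) * K)) (he : 0 ≤ e) (hw : w ≤ a * d) (hd : d ≤ ε / ((a + 1) * K) * e)
    (heN : e ≤ K * N) : w ≤ ε * N := by
  have hd' : d ≤ ε / ((a + 1) * K) * (K * N) := hd.trans (mul_le_mul_of_nonneg_left heN hc0)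
  have h0 : 0 ≤ ε / ((a + 1) * K) * (K * N) :=
    mul_nonneg hc0 (he.trans heN)
  have h1 : w ≤ (a + 1) * (ε / ((a + 1) * K) * (K * N)) := by
    nlinarith [mul_le_mul_of_nonneg_left hd' ha]
  have h2 : (a + 1) * (ε / ((a + 1) * K) * (K * N)) = ε * N := by field_simp
  rwa [h2] at h1

/-- Strict differentiability makes `φ` nearly linear on pairs of nearby points, and the inverse
chart is nearly isometric for the norm at `φ x`. The two relative errors `ε / 3` compound to at most
`ε`. -/
lemma isMetricImmersion_symm_comp {p : M} {φ : 𝔼 d → 𝔼 n} {V : Set (𝔼 d)} (hV : IsOpen V)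
    (hφ : ContDiffOn ℝ 1 φ V) (hmaps : MapsTo φ V (extChartAt (𝓡 n) p).target) (hinj : InjOn φ V)
    (himm : ∀ x ∈ V, Function.Injective (fderiv ℝ φ x)) :
    IsMetricImmersion (fun x ↦ (extChartAt (𝓡 n) p).symm (φ x)) V (areaDensity p φ) where
  continuousOn_density := by
    intro x hx
    have hx' := hV.mem_nhds hx
    have h1 : ∀ i, ContDiffWithinAt ℝ 0 (fun z ↦ fderiv ℝ φ z (EuclideanSpace.single i 1)) V x :=
      fun i ↦ ((((hφ.contDiffAt hx').fderiv_right (m := 0) (by simp)).clm_apply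
        contDiffAt_const)).contDiffWithinAt
    refine (ContDiffWithinAt.continuousWithinAt (n := 0) (ContDiffWithinAt.matrix_det fun i j ↦
      contDiffWithinAt_inner_coordDeriv (hmaps hx) ((hφ x hx).of_le zero_le_one) (h1 i)
        (h1 j))).sqrt
  injOn := by
    intro x hx x' hx' h
    exact hinj hx hx' ((extChartAt (𝓡 n) p).symm.injOn (hmaps hx) (hmaps hx') h)
  approx := by
    intro x hx
    set B := (coordDeriv p (φ x)).comp (fderiv ℝ φ x) with hB
    have hBi : Function.Injective B := (coordDeriv_injective (hmaps hx)).comp (himm x hx)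
    obtain ⟨A, hA, hAi, hAd⟩ := exists_square_model
      (F := TangentSpace (𝓡 n) ((extChartAt (𝓡 n) p).symm (φ x))) B.toLinearMap hBi
    refine ⟨A, hAi, hAd, fun ε hε hε1 ↦ ?_⟩
    obtain ⟨A', hA', -, -⟩ := exists_coordModel (hmaps hx)
    obtain ⟨K, hK, hKA⟩ := LinearMap.exists_antilipschitzWith (A : 𝔼 d →ₗ[ℝ] 𝔼 d)
      (LinearMap.ker_eq_bot.2 hAi)
    obtain ⟨r, hr, -, hdist⟩ := exists_ball_dist_symm (hmaps hx) (ε := ε / 3) (by linarith)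
      (by linarith)
    have hstrict : HasStrictFDerivAt φ (fderiv ℝ φ x) x :=
      (hφ.contDiffAt (hV.mem_nhds hx)).hasStrictFDerivAt one_ne_zero
    -- `‖A'‖` turns errors in coordinates into lengths, and `K` bounds the coordinate norm by `‖A
    -- ·‖`. With this `c` the linearization error is at most `ε / 3` times `‖A (z - z')‖`.
    set c : ℝ := ε / 3 / ((‖A'‖ + 1) * K) with hc
    have hc0 : 0 < c := by positivity
    have h1 := hstrict.isLittleO.bound hc0
    obtain ⟨r₁, hr₁, hb₁⟩ := Metric.eventually_nhds_iff_ball.1 h1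
    have h2 : φ ⁻¹' Metric.ball (φ x) r ∈ 𝓝 x :=
      hstrict.continuousAt.preimage_mem_nhds (Metric.ball_mem_nhds _ hr)
    obtain ⟨r₂, hr₂, hb₂⟩ := Metric.mem_nhds_iff.1 h2
    refine ⟨min r₁ r₂, lt_min hr₁ hr₂, fun z hz z' hz' ↦ ?_⟩
    have h3 : ‖φ z - φ z' - fderiv ℝ φ x (z - z')‖ ≤ c * ‖z - z'‖ := by
      have : (z, z') ∈ Metric.ball (x, x) r₁ := by
        rw [← ball_prod_same]
        exact ⟨Metric.ball_subset_ball (min_le_left _ _) hz,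
          Metric.ball_subset_ball (min_le_left _ _) hz'⟩
      exact hb₁ (z, z') this
    obtain ⟨hl, hu⟩ := hdist _ (hb₂ (Metric.ball_subset_ball (min_le_right _ _) hz)) _
      (hb₂ (Metric.ball_subset_ball (min_le_right _ _) hz'))
    have hN : ‖A (z - z')‖ = ‖A' (fderiv ℝ φ x (z - z'))‖ := by rw [hA, hA']; rfl
    rw [← hA'] at hl hu
    set N := ‖A (z - z')‖ with hNdef
    have hN0 : 0 ≤ N := norm_nonneg _
    have h4 : ‖A' (φ z - φ z') - A' (fderiv ℝ φ x (z - z'))‖ ≤ ε / 3 * N := by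
      rw [← map_sub]
      have h5 : ‖z - z'‖ ≤ K * N := hKA.le_mul_norm (map_zero _) _
      have h6 := A'.le_opNorm (φ z - φ z' - fderiv ℝ φ x (z - z'))
      exact le_mul_of_chain (by positivity) (norm_nonneg _) hc0.le (norm_nonneg _) h6 h3 h5
    have h6 := norm_sub_norm_le (A' (φ z - φ z')) (A' (fderiv ℝ φ x (z - z')))
    have h7 := norm_sub_norm_le (A' (fderiv ℝ φ x (z - z'))) (A' (φ z - φ z'))
    rw [norm_sub_rev] at h7
    rw [← hN] at h6 h7
    set P := ‖A' (φ z - φ z')‖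
    have h8 : P ≤ (1 + ε / 3) * N := by linarith
    have h9 : (1 - ε / 3) * N ≤ P := by linarith
    constructor
    · have h10 := mul_le_mul_of_nonneg_left h9 (show 0 ≤ 1 - ε / 3 by linarith)
      refine le_trans ?_ (h10.trans hl)
      nlinarith [mul_nonneg (mul_nonneg hε.le hε.le) hN0, mul_nonneg hε.le hN0]
    · have h10 := mul_le_mul_of_nonneg_left h8 (show 0 ≤ 1 + ε / 3 by linarith)
      refine (hu.trans h10).trans ?_
      nlinarith [mul_nonneg (mul_nonneg hε.le (sub_nonneg.2 hε1.le)) hN0, mul_nonneg hε.le hN0]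

lemma isMetricImmersion_symm (p : M) :
    IsMetricImmersion (extChartAt (𝓡 n) p).symm (extChartAt (𝓡 n) p).target
      (metricDensity n p) := by
  have h := isMetricImmersion_symm_comp (p := p) (φ := (id : 𝔼 n → 𝔼 n)) (isOpen_target p)
    contDiff_id.contDiffOn (fun x hx ↦ hx) (injOn_id _)
    (fun x _ ↦ by rw [fderiv_id]; exact Function.injective_id)
  have h2 : areaDensity p (id : 𝔼 n → 𝔼 n) = metricDensity n p := funext (areaDensity_id p)
  rwa [h2] at h

end Immersion

/-! ### Division of smooth functions by a coordinate. -/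

section Hadamard

variable {E : Type*} [NormedAddCommGroup E] [NormedSpace ℝ E]

/-- Hadamard's lemma: a smooth function vanishing on `{0} × V` is divisible by the first
coordinate. -/
lemma exists_smooth_quotient {δ : ℝ} {V : Set E} (hV : IsOpen V) {φ : ℝ × E → ℝ}
    (hφ : ContDiffOn ℝ ∞ φ (Ioo (-δ) δ ×ˢ V)) (h0 : ∀ x ∈ V, φ (0, x) = 0) :
    ∃ u : ℝ × E → ℝ, ContDiffOn ℝ ∞ u (Ioo (-δ) δ ×ˢ V) ∧
      ∀ q ∈ Ioo (-δ) δ ×ˢ V, φ q = q.1 * u q := by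
  set B := Ioo (-δ) δ ×ˢ V with hB
  have hBo : IsOpen B := isOpen_Ioo.prod hV
  -- The quotient is the integral of the derivative of `φ` along the segment from the hyperplane.
  -- Running through the segment with `σ` keeps the endpoints and makes the integrand compactly
  -- supported in time, so the integral is a convolution with the constant `1`, which is smooth in
  -- the parameters.
  set σ : ℝ → ℝ := Real.smoothTransition with hσ
  have hσs : ContDiff ℝ ∞ σ := Real.smoothTransition.contDiff
  have hσ' : ContDiff ℝ ∞ (deriv σ) := by
    have : ContDiff ℝ (∞ + 1) σ := hσs
    exact (contDiff_succ_iff_deriv.1 this).2.2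
  have hmem : ∀ q ∈ B, ∀ θ : ℝ, (σ θ * q.1, q.2) ∈ B := by
    intro q hq θ
    have h1 := Real.smoothTransition.nonneg θ
    have h2 := Real.smoothTransition.le_one θ
    have h3 := abs_lt.2 hq.1
    refine ⟨abs_lt.1 ?_, hq.2⟩
    rw [abs_mul, abs_of_nonneg h1]
    exact (mul_le_of_le_one_left (abs_nonneg _) h2).trans_lt h3
  have hsupp : ∀ θ, θ ∉ Icc (0 : ℝ) 1 → deriv σ θ = 0 := by
    intro θ hθ
    rcases lt_or_ge θ 0 with h | h
    · have : σ =ᶠ[𝓝 θ] fun _ ↦ 0 := by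
        filter_upwards [Iio_mem_nhds h] with x hx
        exact Real.smoothTransition.zero_of_nonpos (le_of_lt hx)
      rw [this.deriv_eq, deriv_const]
    · have h1 : 1 < θ := by
        by_contra h1
        exact hθ ⟨h, not_lt.1 h1⟩
      have : σ =ᶠ[𝓝 θ] fun _ ↦ 1 := by
        filter_upwards [Ioi_mem_nhds h1] with x hx
        exact Real.smoothTransition.one_of_one_le (le_of_lt hx)
      rw [this.deriv_eq, deriv_const]
  have hφd : ContDiffOn ℝ ∞ (fun q ↦ fderiv ℝ φ q (1, 0)) B := by
    have : ContDiffOn ℝ ∞ (fderiv ℝ φ) B := hφ.fderiv_of_isOpen hBo (by simp)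
    exact this.clm_apply contDiffOn_const
  let g : ℝ × E → ℝ → ℝ := fun q θ ↦ deriv σ θ * fderiv ℝ φ (σ θ * q.1, q.2) (1, 0)
  have hg : ContDiffOn ℝ ∞ ↿g (B ×ˢ univ) := by
    have h1 : ContDiffOn ℝ ∞ (fun z : (ℝ × E) × ℝ ↦ deriv σ z.2) (B ×ˢ univ) :=
      (hσ'.comp contDiff_snd).contDiffOn
    have h2 : ContDiff ℝ ∞ (fun z : (ℝ × E) × ℝ ↦ (σ z.2 * z.1.1, z.1.2)) :=
      ((hσs.comp contDiff_snd).mul (contDiff_fst.comp contDiff_fst)).prodMk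
        (contDiff_snd.comp contDiff_fst)
    have h3 := hφd.comp h2.contDiffOn (s := B ×ˢ univ) fun z hz ↦ hmem _ hz.1 _
    exact h1.mul h3
  have hu := contDiffOn_convolution_right_with_param_comp (μ := (volume : Measure ℝ))
    (ContinuousLinearMap.mul ℝ ℝ)
    (v := fun _ : ℝ × E ↦ (0 : ℝ)) contDiffOn_const (f := fun _ : ℝ ↦ (1 : ℝ)) (g := g) (n := ⊤)
    (k := Icc 0 1) hBo isCompact_Icc (fun q θ _ hθ ↦ by simp [g, hsupp θ hθ])
    (continuous_const.locallyIntegrable) hg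
  refine ⟨_, hu, fun q hq ↦ ?_⟩
  have hc : Continuous (g q) := by
    have := hg.continuousOn.comp_continuous (f := fun θ ↦ (q, θ)) (by fun_prop) fun θ ↦ ⟨hq, mem_univ _⟩
    exact this
  have hint : (∫ θ in (0 : ℝ)..1, g q θ * q.1) = φ (σ 1 * q.1, q.2) - φ (σ 0 * q.1, q.2) := by
    refine intervalIntegral.integral_eq_sub_of_hasDerivAt
      (f := fun θ ↦ φ (σ θ * q.1, q.2)) (fun θ _ ↦ ?_)
      (Continuous.intervalIntegrable (by fun_prop) _ _)
    have h1 : HasDerivAt (fun θ ↦ (σ θ * q.1, q.2)) (deriv σ θ * q.1, (0 : E)) θ :=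
      (((hσs.differentiable (by simp)) θ).hasDerivAt.mul_const _).prodMk (hasDerivAt_const _ _)
    have h2 : HasFDerivAt φ (fderiv ℝ φ (σ θ * q.1, q.2)) (σ θ * q.1, q.2) :=
      ((hφ.contDiffAt (hBo.mem_nhds (hmem q hq θ))).differentiableAt (by simp)).hasFDerivAt
    have h3 := h2.comp_hasDerivAt θ h1
    have h4 : fderiv ℝ φ (σ θ * q.1, q.2) (deriv σ θ * q.1, 0) = g q θ * q.1 := by
      have : (deriv σ θ * q.1, (0 : E)) = (deriv σ θ * q.1) • ((1 : ℝ), (0 : E)) := by simp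
      rw [this, map_smul, smul_eq_mul]
      simp only [g]
      ring
    rw [h4] at h3
    exact h3
  rw [show σ 1 = 1 from Real.smoothTransition.one, show σ 0 = 0 from Real.smoothTransition.zero,
    one_mul, zero_mul, h0 _ hq.2, sub_zero, intervalIntegral.integral_mul_const] at hint
  rw [← hint, mul_comm]
  congr 1
  rw [MeasureTheory.convolution]
  simp only [ContinuousLinearMap.mul_apply', one_mul]
  rw [integral_sub_left_eq_self (g q) volume 0, intervalIntegral.integral_of_le zero_le_one,
    ← integral_Icc_eq_integral_Ioc]
  refine setIntegral_eq_integral_of_forall_compl_eq_zero fun θ hθ ↦ ?_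
  simp [g, hsupp θ hθ]

end Hadamard

/-! ### Inverse functions and straightening. -/

section InverseFunction

variable {E F : Type*} [NormedAddCommGroup E] [NormedSpace ℝ E] [CompleteSpace E]
  [NormedAddCommGroup F] [NormedSpace ℝ F] 

/-- The inverse function theorem, with a smooth local inverse on an open set. -/
lemma exists_smooth_inverse {G : E → F} {O : Set E} (hO : IsOpen O) (hG : ContDiffOn ℝ ∞ G O)
    {a : E} (ha : a ∈ O) (A : E ≃L[ℝ] F) (hA : fderiv ℝ G a = A) :
    ∃ Φ : OpenPartialHomeomorph E F, a ∈ Φ.source ∧ Φ.source ⊆ O ∧ (∀ x, Φ x = G x) ∧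
      ContDiffOn ℝ ∞ Φ.symm Φ.target := by
  have hGa : ContDiffAt ℝ ∞ G a := hG.contDiffAt (hO.mem_nhds ha)
  have hd : HasFDerivAt G (A : E →L[ℝ] F) a := hA ▸ (hGa.differentiableAt (by simp)).hasFDerivAt
  let Φ₀ := hGa.toOpenPartialHomeomorph G hd (by simp)
  have hΦ₀ : ∀ x, Φ₀ x = G x := fun x ↦ rfl
  have hfd : ContinuousOn (fderiv ℝ G) O :=
    (hG.fderiv_of_isOpen hO (m := 0) (by simp)).continuousOn
  -- The inverse is known to be smooth only at images of points where the derivative of `G` is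
  -- invertible; this is an open condition, and the source is shrunk to it.
  let O' := O ∩ fderiv ℝ G ⁻¹' range ((↑) : (E ≃L[ℝ] F) → (E →L[ℝ] F))
  have hO' : IsOpen O' := hfd.isOpen_inter_preimage hO ContinuousLinearEquiv.isOpen
  refine ⟨Φ₀.restrOpen O' hO', ⟨hGa.mem_toOpenPartialHomeomorph_source hd _, ha, A, hA.symm⟩,
    fun x hx ↦ ?_, fun x ↦ rfl, ?_⟩
  · exact hx.2.1
  · intro y hy
    set Φ := Φ₀.restrOpen O' hO'
    have hx : Φ.symm y ∈ Φ.source := Φ.map_target hy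
    obtain ⟨A', hA'⟩ := hx.2.2
    have hcd : ContDiffAt ℝ ∞ G (Φ.symm y) := hG.contDiffAt (hO.mem_nhds hx.2.1)
    refine (Φ.contDiffAt_symm (f₀' := A') hy ?_ hcd).contDiffWithinAt
    rw [hA']
    exact (hcd.differentiableAt (by simp)).hasFDerivAt

/-- The linear map `(s, x) ↦ (a s + L x, x)`. -/
def shearEquiv {E : Type*} [NormedAddCommGroup E] [NormedSpace ℝ E] (a : ℝ) (ha : a ≠ 0)
    (L : E →L[ℝ] ℝ) : (ℝ × E) ≃L[ℝ] (ℝ × E) :=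
  ContinuousLinearEquiv.equivOfInverse
    ((a • ContinuousLinearMap.fst ℝ ℝ E + L.comp (ContinuousLinearMap.snd ℝ ℝ E)).prod
      (ContinuousLinearMap.snd ℝ ℝ E))
    ((a⁻¹ • (ContinuousLinearMap.fst ℝ ℝ E - L.comp (ContinuousLinearMap.snd ℝ ℝ E))).prod
      (ContinuousLinearMap.snd ℝ ℝ E))
    (fun q ↦ by ext <;> simp [ha]) (fun q ↦ by ext <;> simp [ha])

/-- A function with non-zero derivative in the first variable can serve as first coordinate. -/
lemma exists_straightening {E : Type*} [NormedAddCommGroup E] [NormedSpace ℝ E] [CompleteSpace E]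
    {h : ℝ × E → ℝ} {O : Set (ℝ × E)} (hO : IsOpen O) (hh : ContDiffOn ℝ ∞ h O) {a : ℝ × E}
    (ha : a ∈ O) (hne : fderiv ℝ h a (1, 0) ≠ 0) :
    ∃ Φ : OpenPartialHomeomorph (ℝ × E) (ℝ × E), a ∈ Φ.source ∧ Φ.source ⊆ O ∧
      (∀ x, Φ x = (h x, x.2)) ∧ ContDiffOn ℝ ∞ Φ.symm Φ.target := by
  refine exists_smooth_inverse hO (hh.prodMk contDiff_snd.contDiffOn) ha
    (shearEquiv _ hne ((fderiv ℝ h a).comp (ContinuousLinearMap.inr ℝ ℝ E))) ?_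
  have hd : HasFDerivAt h (fderiv ℝ h a) a :=
    ((hh.contDiffAt (hO.mem_nhds ha)).differentiableAt (by simp)).hasFDerivAt
  rw [(hd.prodMk hasFDerivAt_snd).fderiv]
  ext q <;> simp [shearEquiv, ← Prod.zero_eq_mk]

end InverseFunction

/-! ### Splitting off one coordinate. -/

section Split

/-- Splitting off the `i`-th coordinate. -/
def splitCoord {m : ℕ} (i : Fin (m + 1)) : (ℝ × 𝔼 m) ≃L[ℝ] 𝔼 (m + 1) :=
  LinearEquiv.toContinuousLinearEquiv
    { toFun := fun q ↦ WithLp.toLp 2 (Fin.insertNth i q.1 (q.2 : Fin m → ℝ))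
      invFun := fun y ↦ (y i, WithLp.toLp 2 fun j ↦ y (i.succAbove j))
      map_add' := fun q q' ↦ by
        ext j
        refine Fin.succAboveCases i ?_ (fun j ↦ ?_) j <;> simp
      map_smul' := fun c q ↦ by
        ext j
        refine Fin.succAboveCases i ?_ (fun j ↦ ?_) j <;> simp
      left_inv := fun q ↦ by ext <;> simp
      right_inv := fun y ↦ by
        ext j
        refine Fin.succAboveCases i ?_ (fun j ↦ ?_) j <;> simp }

lemma splitCoord_apply {m : ℕ} (i : Fin (m + 1)) (q : ℝ × 𝔼 m) :
    splitCoord i q = WithLp.toLp 2 (Fin.insertNth i q.1 (q.2 : Fin m → ℝ)) := rfl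

lemma splitCoord_symm_snd {m : ℕ} (i : Fin (m + 1)) (y : 𝔼 (m + 1)) (j : Fin m) :
    ((splitCoord i).symm y).2 j = y (i.succAbove j) := rfl

lemma splitCoord_one_zero {m : ℕ} (i : Fin (m + 1)) :
    splitCoord i ((1 : ℝ), (0 : 𝔼 m)) = EuclideanSpace.single i 1 := by
  ext j
  refine Fin.succAboveCases i ?_ (fun j ↦ ?_) j <;> simp [splitCoord_apply]

lemma measurePreserving_splitCoord {m : ℕ} (i : Fin (m + 1)) :
    MeasurePreserving (splitCoord i) (volume : Measure (ℝ × 𝔼 m)) volume := by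
  have h1 := (MeasureTheory.volume_preserving_piFinSuccAbove (fun _ : Fin (m + 1) ↦ ℝ) i).symm
  have h2 := EuclideanSpace.volume_preserving_symm_measurableEquiv_toLp (Fin (m + 1))
  have h3 := EuclideanSpace.volume_preserving_symm_measurableEquiv_toLp (Fin m)
  have h4 := (MeasurePreserving.id (volume : Measure ℝ)).prod h3
  exact (h2.symm.comp h1).comp h4

end Split

/-! ### Charts with a given function as first coordinate. -/

section AdaptedChart

variable {m : ℕ} {M : Type*} [TopologicalSpace M] [ChartedSpace (𝔼 (m + 1)) M]

/-- The coordinates of `x` in the preferred chart at `p`, with the `i`-th one split off. -/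
def splitChart (p : M) (i : Fin (m + 1)) (x : M) : ℝ × 𝔼 m :=
  (splitCoord i).symm (extChartAt (𝓡 (m + 1)) p x)

/-- The point with split coordinates `q` in the preferred chart at `p`. -/
def splitPoint (p : M) (i : Fin (m + 1)) (q : ℝ × 𝔼 m) : M :=
  (extChartAt (𝓡 (m + 1)) p).symm (splitCoord i q)

/-- `e` is a smooth chart near `p`, onto a box, which has `h` as first coordinate, and whose other
coordinates are those of the preferred chart at `p` except the `i`-th one. -/
structure IsAdaptedChart (p : M) (h : M → ℝ) (i : Fin (m + 1))
    (e : OpenPartialHomeomorph M (ℝ × 𝔼 m)) (δ : ℝ) : Prop where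
  pos : 0 < δ
  mem : p ∈ e.source
  eq_zero : h p = 0
  source_subset : e.source ⊆ (extChartAt (𝓡 (m + 1)) p).source
  target : e.target = Ioo (-δ) δ ×ˢ Metric.ball (splitChart p i p).2 δ
  apply : ∀ x ∈ e.source, e x = (h x, (splitChart p i x).2)
  smooth : ContMDiffOn (𝓡 (m + 1)) 𝓘(ℝ, ℝ × 𝔼 m) ∞ e e.source
  smooth_symm : ContMDiffOn 𝓘(ℝ, ℝ × 𝔼 m) (𝓡 (m + 1)) ∞ e.symm e.target

lemma splitPoint_splitChart {p x : M} (hx : x ∈ (extChartAt (𝓡 (m + 1)) p).source)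
    (i : Fin (m + 1)) : splitPoint p i (splitChart p i x) = x := by
  rw [splitPoint, splitChart, ContinuousLinearEquiv.apply_symm_apply,
    (extChartAt (𝓡 (m + 1)) p).left_inv hx]

lemma splitChart_splitPoint {p : M} {i : Fin (m + 1)} {q : ℝ × 𝔼 m}
    (hq : splitCoord i q ∈ (extChartAt (𝓡 (m + 1)) p).target) :
    splitChart p i (splitPoint p i q) = q := by
  rw [splitPoint, splitChart, (extChartAt (𝓡 (m + 1)) p).right_inv hq,
    ContinuousLinearEquiv.symm_apply_apply]

variable [RiemannianBundle (fun x : M ↦ TangentSpace (𝓡 (m + 1)) x)] [IsManifold (𝓡 (m + 1)) ω M]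
  [IsContMDiffRiemannianBundle (𝓡 (m + 1)) ω (𝔼 (m + 1))
    (fun x : M ↦ TangentSpace (𝓡 (m + 1)) x)]

lemma contMDiffOn_splitPoint (p : M) (i : Fin (m + 1)) {k : WithTop ℕ∞} :
    ContMDiffOn 𝓘(ℝ, ℝ × 𝔼 m) (𝓡 (m + 1)) k (splitPoint p i)
      (splitCoord i ⁻¹' (extChartAt (𝓡 (m + 1)) p).target) := by
  have h1 : ContMDiffOn 𝓘(ℝ, 𝔼 (m + 1)) (𝓡 (m + 1)) k (extChartAt (𝓡 (m + 1)) p).symm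
    (extChartAt (𝓡 (m + 1)) p).target := (contMDiffOn_extChartAt_symm (n := ω) p).of_le le_top
  exact h1.comp (splitCoord i).contDiff.contMDiff.contMDiffOn fun q hq ↦ hq

lemma contMDiffOn_splitChart (p : M) (i : Fin (m + 1)) {k : WithTop ℕ∞} :
    ContMDiffOn (𝓡 (m + 1)) 𝓘(ℝ, ℝ × 𝔼 m) k (splitChart p i)
      (extChartAt (𝓡 (m + 1)) p).source := by
  have h1 : ContMDiffOn (𝓡 (m + 1)) 𝓘(ℝ, 𝔼 (m + 1)) k (extChartAt (𝓡 (m + 1)) p)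
    (extChartAt (𝓡 (m + 1)) p).source := by
      rw [extChartAt_source]
      exact (contMDiffOn_extChartAt (n := ω)).of_le le_top
  exact (splitCoord i).symm.contDiff.contMDiff.comp_contMDiffOn h1

/-- Around a zero where its differential does not vanish, a smooth function has an adapted chart. -/
lemma exists_isAdaptedChart {p : M} {U : Set M} {h : M → ℝ} (hU : IsOpen U) (hp : p ∈ U)
    (hh : ContMDiffOn (𝓡 (m + 1)) 𝓘(ℝ, ℝ) ∞ h U) (h0 : h p = 0)
    (hd : mvfderiv (𝓡 (m + 1)) h p ≠ 0) :
    ∃ (i : Fin (m + 1)) (e : OpenPartialHomeomorph M (ℝ × 𝔼 m)) (δ : ℝ), IsAdaptedChart p h i e δ ∧ e.source ⊆ U := by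
  set κ := extChartAt (𝓡 (m + 1)) p with hκ
  set y₀ := κ p with hy₀
  have hps : p ∈ κ.source := mem_extChartAt_source p
  have hy₀t : y₀ ∈ κ.target := κ.map_source hps
  have hsymm : κ.symm y₀ = p := κ.left_inv hps
  have hkp : MDifferentiableAt (𝓡 (m + 1)) 𝓘(ℝ, ℝ) h p :=
    (hh.contMDiffAt (hU.mem_nhds hp)).mdifferentiableAt (by simp)
  -- The coordinate fields span the tangent space, so some partial derivative of `h` is non-zero;
  -- that coordinate is the one replaced by `h`.
  obtain ⟨i, hi⟩ : ∃ i, fderiv ℝ (h ∘ κ.symm) y₀ (EuclideanSpace.single i 1) ≠ 0 := by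
    by_contra! hcon
    refine hd (ContinuousLinearMap.ext fun v ↦ ?_)
    have hkp' : MDifferentiableAt (𝓡 (m + 1)) 𝓘(ℝ, ℝ) h (κ.symm y₀) := by rwa [hsymm]
    have key : ∀ w, mvfderiv (𝓡 (m + 1)) h (κ.symm y₀) w = 0 := by
      intro w
      rw [← coordDeriv_chartDeriv hy₀t w, mvfderiv_coordDeriv hy₀t hkp', fderiv_apply_eq_sum]
      exact Finset.sum_eq_zero fun j _ ↦ by rw [hcon j, mul_zero]
    rw [hsymm] at key
    exact key v
  set ι := splitCoord (m := m) i with hι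
  set O : Set (ℝ × 𝔼 m) := ι ⁻¹' (κ.target ∩ κ.symm ⁻¹' U) with hOdef
  have hO : IsOpen O :=
    ((continuousOn_extChartAt_symm p).isOpen_inter_preimage (isOpen_target p) hU).preimage
      ι.continuous
  set a := ι.symm y₀ with ha_def
  have hιa : ι a = y₀ := ι.apply_symm_apply y₀
  have ha : a ∈ O := by
    rw [hOdef, mem_preimage, hιa]
    exact ⟨hy₀t, by rwa [mem_preimage, hsymm]⟩
  have hhat : ContDiffOn ℝ ∞ (fun q ↦ h (κ.symm (ι q))) O := by
    intro q hq
    have h1 := contDiffAt_comp_symm hq.1 (hh.contMDiffAt (hU.mem_nhds hq.2))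
    exact (h1.comp q ι.contDiff.contDiffAt).contDiffWithinAt
  have hne : fderiv ℝ (fun q ↦ h (κ.symm (ι q))) a (1, 0) ≠ 0 := by
    have h1 := ι.comp_right_fderiv (f := h ∘ κ.symm) (x := a)
    have h2 : fderiv ℝ (fun q ↦ h (κ.symm (ι q))) a = _ := h1
    rw [h2, ContinuousLinearMap.comp_apply, hιa]
    have : (ι : (ℝ × 𝔼 m) →L[ℝ] 𝔼 (m + 1)) (1, 0) = EuclideanSpace.single i 1 :=
      splitCoord_one_zero i
    rwa [this]
  obtain ⟨Φ, haΦ, hΦO, hΦ, hΦs⟩ := exists_straightening hO hhat ha hne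
  have hΦa : Φ a = (0, a.2) := by rw [hΦ, hιa, hsymm, h0]
  have hnhds : Φ.target ∈ 𝓝 ((0 : ℝ), a.2) := by
    rw [← hΦa]; exact Φ.open_target.mem_nhds (Φ.map_source haΦ)
  obtain ⟨δ, hδ, hball⟩ := Metric.mem_nhds_iff.1 hnhds
  have hbox : Ioo (-δ) δ ×ˢ Metric.ball a.2 δ ⊆ Φ.target := by
    refine Subset.trans ?_ hball
    rw [← ball_prod_same, Real.ball_eq_Ioo, zero_sub, zero_add]
  set B : Set (ℝ × 𝔼 m) := Ioo (-δ) δ ×ˢ Metric.ball a.2 δ with hB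
  have hBo : IsOpen B := isOpen_Ioo.prod Metric.isOpen_ball
  have hst : ∀ q ∈ B, ι (Φ.symm q) ∈ κ.target ∧ κ.symm (ι (Φ.symm q)) ∈ U := fun q hq ↦
    hΦO (Φ.map_target (hbox hq))
  have hκc : ContinuousOn (fun x ↦ ι.symm (κ x)) κ.source :=
    ι.symm.continuous.comp_continuousOn (continuousOn_extChartAt p)
  have hs1 : IsOpen (κ.source ∩ (fun x ↦ ι.symm (κ x)) ⁻¹' (Φ.source ∩ Φ ⁻¹' B)) :=
    hκc.isOpen_inter_preimage (isOpen_extChartAt_source p) (Φ.isOpen_inter_preimage hBo)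
  let e : OpenPartialHomeomorph M (ℝ × 𝔼 m) :=
    { toFun := fun x ↦ Φ (ι.symm (κ x))
      invFun := fun q ↦ κ.symm (ι (Φ.symm q))
      source := κ.source ∩ (fun x ↦ ι.symm (κ x)) ⁻¹' (Φ.source ∩ Φ ⁻¹' B)
      target := B
      map_source' := fun x hx ↦ hx.2.2
      map_target' := fun q hq ↦ by
        have h1 : κ (κ.symm (ι (Φ.symm q))) = ι (Φ.symm q) := κ.right_inv (hst q hq).1
        refine ⟨κ.map_target (hst q hq).1, ?_⟩
        rw [mem_preimage, h1, ι.symm_apply_apply]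
        refine ⟨Φ.map_target (hbox hq), ?_⟩
        rw [mem_preimage, Φ.right_inv (hbox hq)]
        exact hq
      left_inv' := fun x hx ↦ by
        rw [Φ.left_inv hx.2.1, ι.apply_symm_apply]
        exact κ.left_inv hx.1
      right_inv' := fun q hq ↦ by
        rw [κ.right_inv (hst q hq).1, ι.symm_apply_apply, Φ.right_inv (hbox hq)]
      open_source := hs1
      open_target := hBo
      continuousOn_toFun := Φ.continuousOn.comp (hκc.mono inter_subset_left) fun x hx ↦ hx.2.1
      continuousOn_invFun := (continuousOn_extChartAt_symm p).comp
        (ι.continuous.comp_continuousOn (Φ.continuousOn_symm.mono hbox)) fun q hq ↦ (hst q hq).1 }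
  have hsrcU : e.source ⊆ U := by
    intro x hx
    have h1 := hΦO hx.2.1
    simp only [hOdef, mem_preimage, ι.apply_symm_apply, mem_inter_iff] at h1
    rw [← κ.left_inv hx.1]
    exact h1.2
  have happ : ∀ x ∈ e.source, e x = (h x, (splitChart p i x).2) := by
    intro x hx
    change Φ (ι.symm (κ x)) = _
    rw [hΦ, ι.apply_symm_apply, κ.left_inv hx.1]
    rfl
  refine ⟨i, e, δ, ⟨hδ, ?_, h0, inter_subset_left, rfl, happ, ?_, ?_⟩, hsrcU⟩
  · refine ⟨hps, haΦ, ?_⟩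
    change Φ a ∈ B
    rw [hΦa]
    exact ⟨⟨by linarith, hδ⟩, Metric.mem_ball_self hδ⟩
  · have h1 : ContMDiffOn (𝓡 (m + 1)) 𝓘(ℝ, ℝ × 𝔼 m) ∞ (fun x ↦ (h x, (splitChart p i x).2))
        e.source := by
      refine ContMDiffOn.prodMk_space (hh.mono hsrcU) ?_
      exact (contDiff_snd.contMDiff.comp_contMDiffOn (contMDiffOn_splitChart p i)).mono
        inter_subset_left
    exact h1.congr happ
  · have h1 : ContMDiffOn 𝓘(ℝ, ℝ × 𝔼 m) (𝓡 (m + 1)) ∞ (splitPoint p i ∘ Φ.symm) B :=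
      (contMDiffOn_splitPoint p i).comp (hΦs.mono hbox).contMDiffOn fun q hq ↦ (hst q hq).1
    exact h1

end AdaptedChart

/-! ### Regularity of vector fields and of their divergences. -/

section Fields

variable {n : ℕ} {M : Type*} [TopologicalSpace M] [ChartedSpace (𝔼 n) M]
  [RiemannianBundle (fun x : M ↦ TangentSpace (𝓡 n) x)]

/-- The vector field `X` is `C^k` at `x`, in every preferred chart around `x`. -/
def ContDiffFieldAt (k : WithTop ℕ∞) (X : (x : M) → TangentSpace (𝓡 n) x) (x : M) : Prop :=
  ∀ p : M, x ∈ (extChartAt (𝓡 n) p).source →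
    ContDiffAt ℝ k (coordComponents n X p) (extChartAt (𝓡 n) p x)

lemma ContDiffFieldAt.of_le {k l : WithTop ℕ∞} {X : (x : M) → TangentSpace (𝓡 n) x} {x : M}
    (h : ContDiffFieldAt k X x) (hl : l ≤ k) : ContDiffFieldAt l X x :=
  fun p hp ↦ (h p hp).of_le hl

lemma norm_grad_sq (h : M → ℝ) (x : M) :
    mvfderiv (𝓡 n) h x (grad n h x) = ‖grad n h x‖ ^ 2 := by
  rw [← inner_grad, real_inner_self_eq_norm_sq]

lemma grad_ne_zero_iff {h : M → ℝ} {x : M} : grad n h x ≠ 0 ↔ mvfderiv (𝓡 n) h x ≠ 0 := by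
  rw [grad, Ne, LinearIsometryEquiv.map_eq_zero_iff]

lemma mvfderiv_congr {h h' : M → ℝ} {x : M} (hh : h =ᶠ[𝓝 x] h') :
    mvfderiv (𝓡 n) h x = mvfderiv (𝓡 n) h' x := by
  exact hh.mfderiv_eq

lemma grad_congr {h h' : M → ℝ} {x : M} (hh : h =ᶠ[𝓝 x] h') : grad n h x = grad n h' x := by
  rw [grad, grad, mvfderiv_congr hh]

lemma mvfderiv_comp_real {φ : ℝ → ℝ} {φ' : ℝ} {h : M → ℝ} {x : M}
    (hφ : HasDerivAt φ φ' (h x)) (hh : MDifferentiableAt (𝓡 n) 𝓘(ℝ, ℝ) h x) :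
    mvfderiv (𝓡 n) (fun y ↦ φ (h y)) x = φ' • mvfderiv (𝓡 n) h x := by
  have h1 : HasMFDerivAt 𝓘(ℝ, ℝ) 𝓘(ℝ, ℝ) φ (h x) (ContinuousLinearMap.toSpanSingleton ℝ φ') :=
    hφ.hasFDerivAt.hasMFDerivAt
  have h2 := h1.comp x hh.hasMFDerivAt
  ext v
  simp only [mvfderiv]
  have h3 := h2.mfderiv
  change NormedSpace.fromTangentSpace _ (mfderiv (𝓡 n) 𝓘(ℝ, ℝ) (φ ∘ h) x v) = _
  rw [h3]
  exact mul_comm (G := ℝ) _ _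

lemma grad_comp_real {φ : ℝ → ℝ} {φ' : ℝ} {h : M → ℝ} {x : M}
    (hφ : HasDerivAt φ φ' (h x)) (hh : MDifferentiableAt (𝓡 n) 𝓘(ℝ, ℝ) h x) :
    grad n (fun y ↦ φ (h y)) x = φ' • grad n h x := by
  rw [grad, mvfderiv_comp_real hφ hh, map_smul]
  rfl

variable [IsManifold (𝓡 n) ω M]
  [IsContMDiffRiemannianBundle (𝓡 n) ω (𝔼 n) (fun x : M ↦ TangentSpace (𝓡 n) x)]

lemma contMDiffAt_of_comp_symm {a : M → ℝ} {p x : M} {k : WithTop ℕ∞}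
    (hx : x ∈ (extChartAt (𝓡 n) p).source)
    (h : ContDiffAt ℝ k (a ∘ (extChartAt (𝓡 n) p).symm) (extChartAt (𝓡 n) p x)) :
    ContMDiffAt (𝓡 n) 𝓘(ℝ, ℝ) k a x := by
  have h1 : ContMDiffAt (𝓡 n) 𝓘(ℝ, 𝔼 n) k (extChartAt (𝓡 n) p) x := by
    rw [extChartAt_source] at hx
    exact (contMDiffAt_extChartAt' (n := ω) hx).of_le le_top
  refine (h.contMDiffAt.comp x h1).congr_of_eventuallyEq ?_
  filter_upwards [(isOpen_extChartAt_source (I := 𝓡 n) p).mem_nhds hx] with y hy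
  simp only [Function.comp, (extChartAt (𝓡 n) p).left_inv hy]

lemma contDiffFieldAt_grad {h : M → ℝ} {k l : WithTop ℕ∞} (hkl : l + 1 ≤ k) {x : M}
    (hh : ∀ᶠ y in 𝓝 x, ContMDiffAt (𝓡 n) 𝓘(ℝ, ℝ) k h y) :
    ContDiffFieldAt l (grad n h) x := by
  intro p hp
  refine contDiffAt_coordComponents_grad ((extChartAt (𝓡 n) p).map_source hp) hkl ?_
  rwa [(extChartAt (𝓡 n) p).left_inv hp]

lemma ContDiffFieldAt.smul {X : (x : M) → TangentSpace (𝓡 n) x} {a : M → ℝ} {k : WithTop ℕ∞}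
    {x : M} (hX : ContDiffFieldAt k X x) (ha : ContMDiffAt (𝓡 n) 𝓘(ℝ, ℝ) k a x) :
    ContDiffFieldAt k (fun y ↦ a y • X y) x := by
  intro p hp
  have h1 : coordComponents n (fun y ↦ a y • X y) p =
      fun y ↦ (a ∘ (extChartAt (𝓡 n) p).symm) y • coordComponents n X p y := by
    ext1 y
    exact map_smul (mfderiv (𝓡 n) 𝓘(ℝ, 𝔼 n) (extChartAt (𝓡 n) p) ((extChartAt (𝓡 n) p).symm y)) _ _
  rw [h1]
  have h2 : ContDiffAt ℝ k (a ∘ (extChartAt (𝓡 n) p).symm) (extChartAt (𝓡 n) p x) :=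
    contDiffAt_comp_symm ((extChartAt (𝓡 n) p).map_source hp)
      (by rwa [(extChartAt (𝓡 n) p).left_inv hp])
  exact h2.smul (hX p hp)

lemma ContDiffFieldAt.contMDiffAt_inner {X Y : (x : M) → TangentSpace (𝓡 n) x} {k : WithTop ℕ∞}
    {x : M} (hX : ContDiffFieldAt k X x) (hY : ContDiffFieldAt k Y x) :
    ContMDiffAt (𝓡 n) 𝓘(ℝ, ℝ) k (fun y ↦ inner ℝ (X y) (Y y)) x := by
  have hx := mem_extChartAt_source (I := 𝓡 n) x
  have hy := (extChartAt (𝓡 n) x).map_source hx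
  refine contMDiffAt_of_comp_symm hx ?_
  have h1 : ContDiffWithinAt ℝ k (fun z ↦ inner ℝ (coordDeriv x z (coordComponents n X x z))
      (coordDeriv x z (coordComponents n Y x z))) univ (extChartAt (𝓡 n) x x) :=
    contDiffWithinAt_inner_coordDeriv (p := x) (y := fun z ↦ z) (v := coordComponents n X x)
      (w := coordComponents n Y x) (a := extChartAt (𝓡 n) x x) hy contDiffWithinAt_id
      (hX x hx).contDiffWithinAt (hY x hx).contDiffWithinAt
  rw [contDiffWithinAt_univ] at h1
  have h2 : ∀ z ∈ (extChartAt (𝓡 n) x).target,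
      inner ℝ (X ((extChartAt (𝓡 n) x).symm z)) (Y ((extChartAt (𝓡 n) x).symm z)) =
      inner ℝ (coordDeriv x z (coordComponents n X x z))
        (coordDeriv x z (coordComponents n Y x z)) := by
    intro z hz
    rw [coordDeriv_coordComponents X hz, coordDeriv_coordComponents Y hz]
  exact h1.congr_of_eventuallyEq ((eventually_mem_target hy).mono h2)

/-- The divergence of a `C^{k+1}` field is `C^k`. -/
lemma contMDiffAt_riemDiv {X : (x : M) → TangentSpace (𝓡 n) x} {k : WithTop ℕ∞} {x : M}
    (hX : ∀ᶠ y in 𝓝 x, ContDiffFieldAt (k + 1) X y) :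
    ContMDiffAt (𝓡 n) 𝓘(ℝ, ℝ) k (riemDiv n X) x := by
  have hx := mem_extChartAt_source (I := 𝓡 n) x
  have hy := (extChartAt (𝓡 n) x).map_source hx
  refine contMDiffAt_of_comp_symm hx ?_
  have hD : ContDiffAt ℝ ω (metricDensity n x) (extChartAt (𝓡 n) x x) :=
    (contDiffOn_metricDensity x).contDiffAt ((isOpen_target x).mem_nhds hy)
  have h1 : ContDiffAt ℝ k (chartDiv X x) (extChartAt (𝓡 n) x x) := by
    refine ((hD.of_le le_top).inv (metricDensity_pos hy).ne').mul (ContDiffAt.sum fun i _ ↦ ?_)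
    have h2 : ContDiffAt ℝ (k + 1) (fun y ↦ metricDensity n x y * coordComponents n X x y i)
        (extChartAt (𝓡 n) x x) := by
      have := (hX.self_of_nhds x hx)
      rw [contDiffAt_piLp] at this
      exact (hD.of_le le_top).mul (this i)
    exact (h2.fderiv_right le_rfl).clm_apply contDiffAt_const
  refine h1.congr_of_eventuallyEq ?_
  have h3 : ∀ᶠ y in 𝓝 (extChartAt (𝓡 n) x x),
      ContDiffFieldAt (k + 1) X ((extChartAt (𝓡 n) x).symm y) := by
    refine (continuousAt_symm hy).eventually ?_
    rwa [(extChartAt (𝓡 n) x).left_inv hx]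
  filter_upwards [h3, eventually_mem_target hy] with z hz hzt
  -- `riemDiv` uses a different chart at each point; independence of the chart identifies it near
  -- `x` with the expression in the single chart at `x`, which is visibly smooth.
  refine (chartDiv_eq_riemDiv hzt ?_ ?_).symm
  · have := hz x ((extChartAt (𝓡 n) x).map_target hzt)
    rw [(extChartAt (𝓡 n) x).right_inv hzt] at this
    exact this.differentiableAt (by simp)
  · exact (hz _ (mem_extChartAt_source _)).differentiableAt (by simp)

lemma ContDiffFieldAt.differentiableAt {X : (x : M) → TangentSpace (𝓡 n) x} {k : WithTop ℕ∞}
    {x : M} (hX : ContDiffFieldAt k X x) (hk : k ≠ 0) :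
    DifferentiableAt ℝ (coordComponents n X x) (extChartAt (𝓡 n) x x) :=
  (hX x (mem_extChartAt_source x)).differentiableAt hk

end Fields

/-! ### Equilibrium functions on the plaques of an adapted chart. -/

section Plaques

variable {m : ℕ} {M : Type*} [TopologicalSpace M] [ChartedSpace (𝔼 (m + 1)) M]
  {p : M} {h : M → ℝ} {i : Fin (m + 1)} {e : OpenPartialHomeomorph M (ℝ × 𝔼 m)} {δ : ℝ}

namespace IsAdaptedChart

lemma mem_target (he : IsAdaptedChart p h i e δ) {q : ℝ × 𝔼 m} :
    q ∈ e.target ↔ q.1 ∈ Ioo (-δ) δ ∧ q.2 ∈ Metric.ball (splitChart p i p).2 δ := by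
  rw [he.target]; rfl

lemma apply_symm (he : IsAdaptedChart p h i e δ) {q : ℝ × 𝔼 m} (hq : q ∈ e.target) :
    h (e.symm q) = q.1 := by
  have := he.apply _ (e.map_target hq)
  rw [e.right_inv hq] at this
  exact (congrArg Prod.fst this).symm

lemma splitChart_symm (he : IsAdaptedChart p h i e δ) {q : ℝ × 𝔼 m} (hq : q ∈ e.target) :
    (splitChart p i (e.symm q)).2 = q.2 := by
  have := he.apply _ (e.map_target hq)
  rw [e.right_inv hq] at this
  exact (congrArg Prod.snd this).symm

lemma apply_self (he : IsAdaptedChart p h i e δ) : e p = (0, (splitChart p i p).2) := by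
  rw [he.apply _ he.mem, he.eq_zero]

/-- The plaque at height `r` is connected, and `f` is constant on it. -/
lemma mem_leaf (he : IsAdaptedChart p h i e δ) {f : M → ℝ} {r : ℝ} {x₁ x₂ : 𝔼 m} {φ : ℝ → ℝ}
    (hf : ∀ x ∈ e.source, f x = φ (h x)) (h₁ : (r, x₁) ∈ e.target) (h₂ : (r, x₂) ∈ e.target) :
    e.symm (r, x₂) ∈ leaf f (e.symm (r, x₁)) := by
  set B := Metric.ball (splitChart p i p).2 δ
  have ht : ∀ x ∈ B, (r, x) ∈ e.target := fun x hx ↦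
    he.mem_target.2 ⟨(he.mem_target.1 h₁).1, hx⟩
  have hpre : IsPreconnected ((fun x ↦ e.symm (r, x)) '' B) := by
    refine (convex_ball _ _).isPreconnected.image _ ?_
    exact e.continuousOn_symm.comp (by fun_prop) ht
  have hsub : (fun x ↦ e.symm (r, x)) '' B ⊆ f ⁻¹' {f (e.symm (r, x₁))} := by
    rintro _ ⟨x, hx, rfl⟩
    rw [mem_preimage, mem_singleton_iff, hf _ (e.map_target (ht x hx)), hf _ (e.map_target h₁),
      he.apply_symm (ht x hx), he.apply_symm h₁]
  exact hpre.subset_connectedComponentIn (mem_image_of_mem _ (he.mem_target.1 h₁).2) hsub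
    (mem_image_of_mem _ (he.mem_target.1 h₂).2)

end IsAdaptedChart

lemma eq_of_eventually_punctured {F G : ℝ → ℝ} {a : ℝ} (hF : ContinuousAt F a)
    (hG : ContinuousAt G a) (h : ∀ᶠ r in 𝓝[≠] a, F r = G r) : F a = G a :=
  tendsto_nhds_unique (hF.tendsto.mono_left nhdsWithin_le_nhds)
    ((hG.tendsto.mono_left nhdsWithin_le_nhds).congr' (h.mono fun _ hr ↦ hr.symm))

variable [RiemannianBundle (fun x : M ↦ TangentSpace (𝓡 (m + 1)) x)] [IsManifold (𝓡 (m + 1)) ω M]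
  [IsContMDiffRiemannianBundle (𝓡 (m + 1)) ω (𝔼 (m + 1))
    (fun x : M ↦ TangentSpace (𝓡 (m + 1)) x)]

set_option maxHeartbeats 400000 in
/-- If an equilibrium function is, up to constants, a power of a regular function `g`, then `‖∇g‖`
and `div (∇g / ‖∇g‖)` are constant along the zero set of `g`. -/
lemma exists_open_forall_unitGrad_const {f : M → ℝ} (hf : IsEquilibriumFunction (m + 1) f) {g : M → ℝ}
    {U : Set M} (hU : IsOpen U) (hpU : p ∈ U)
    (hg : ContMDiffOn (𝓡 (m + 1)) 𝓘(ℝ, ℝ) ∞ g U) (hgp : g p = 0)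
    (hd : ∀ x ∈ U, mvfderiv (𝓡 (m + 1)) g x ≠ 0) {σ c : ℝ} (hσ : σ ≠ 0) {k : ℕ} (hk : 1 ≤ k)
    (hfg : ∀ x ∈ U, f x - c = σ * g x ^ k) :
    ∃ W, IsOpen W ∧ p ∈ W ∧ W ⊆ U ∧ ∀ x ∈ W, g x = 0 → ‖grad (m + 1) g x‖ = ‖grad (m + 1) g p‖ ∧
      riemDiv (m + 1) (unitGrad (m + 1) g) x = riemDiv (m + 1) (unitGrad (m + 1) g) p := by
  obtain ⟨i, e, δ, he, heU⟩ := exists_isAdaptedChart hU hpU hg hgp (hd p hpU)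
  set X := grad (m + 1) g with hX
  have hgs : ∀ x ∈ e.source, ∀ᶠ y in 𝓝 x, ContMDiffAt (𝓡 (m + 1)) 𝓘(ℝ, ℝ) ∞ g y := fun x hx ↦ by
    filter_upwards [e.open_source.mem_nhds hx] with y hy
    exact hg.contMDiffAt (hU.mem_nhds (heU hy))
  have hmd : ∀ x ∈ e.source, MDifferentiableAt (𝓡 (m + 1)) 𝓘(ℝ, ℝ) g x := fun x hx ↦
    (hgs x hx).self_of_nhds.mdifferentiableAt (by simp)
  have hXs : ∀ x ∈ e.source, ContDiffFieldAt ∞ X x := fun x hx ↦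
    contDiffFieldAt_grad (by simp) (hgs x hx)
  have hA : ∀ x ∈ e.source, ContMDiffAt (𝓡 (m + 1)) 𝓘(ℝ, ℝ) ∞ (fun y ↦ ‖X y‖ ^ 2) x := by
    intro x hx
    have := (hXs x hx).contMDiffAt_inner (hXs x hx)
    simpa only [real_inner_self_eq_norm_sq] using this
  have hApos : ∀ x ∈ e.source, 0 < ‖X x‖ := fun x hx ↦
    norm_pos_iff.2 (grad_ne_zero_iff.2 (hd x (heU hx)))
  have hΔ : ∀ x ∈ e.source, ContMDiffAt (𝓡 (m + 1)) 𝓘(ℝ, ℝ) ∞ (riemDiv (m + 1) X) x := fun x hx ↦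
    contMDiffAt_riemDiv ((e.open_source.eventually_mem hx).mono fun y hy ↦ hXs y hy)
  set a : M → ℝ := fun x ↦ σ * (k * g x ^ (k - 1)) with ha
  have hgf : ∀ x ∈ e.source, grad (m + 1) f x = a x • X x := by
    intro x hx
    have h1 : f =ᶠ[𝓝 x] fun y ↦ (fun t : ℝ ↦ c + σ * t ^ k) (g y) := by
      filter_upwards [e.open_source.mem_nhds hx] with y hy
      simp only [← hfg y (heU hy), add_sub_cancel]
    have h2 : HasDerivAt (fun t : ℝ ↦ c + σ * t ^ k) (σ * (k * g x ^ (k - 1))) (g x) :=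
      ((hasDerivAt_pow k (g x)).const_mul σ).const_add c
    rw [grad_congr h1, grad_comp_real h2 (hmd x hx)]
  have hLf : ∀ x ∈ e.source, laplaceBeltrami (m + 1) f x = a x * riemDiv (m + 1) X x +
      σ * (k * ((k - 1 : ℕ) * g x ^ (k - 1 - 1))) * ‖X x‖ ^ 2 := by
    intro x hx
    have h2 : HasDerivAt (fun t : ℝ ↦ σ * (k * t ^ (k - 1)))
        (σ * (k * ((k - 1 : ℕ) * g x ^ (k - 1 - 1)))) (g x) :=
      ((hasDerivAt_pow (k - 1) (g x)).const_mul (k : ℝ)).const_mul σ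
    have h3 : MDifferentiableAt (𝓡 (m + 1)) 𝓘(ℝ, ℝ) a x := by
      have : ContMDiffAt 𝓘(ℝ, ℝ) 𝓘(ℝ, ℝ) ∞ (fun t : ℝ ↦ σ * (k * t ^ (k - 1))) (g x) :=
        ContDiffAt.contMDiffAt (by fun_prop)
      exact (this.comp x (hgs x hx).self_of_nhds).mdifferentiableAt (by simp)
    rw [laplaceBeltrami, riemDiv_congr ((e.open_source.eventually_mem hx).mono fun y hy ↦ hgf y hy),
      riemDiv_smul h3 ((hXs x hx).differentiableAt (by simp))]
    congr 1
    rw [ha, mvfderiv_comp_real h2 (hmd x hx)]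
    change _ * mvfderiv (𝓡 (m + 1)) g x (X x) = _
    rw [hX, norm_grad_sq]
  have hfh : ∀ x ∈ e.source, f x = (fun t ↦ c + σ * t ^ k) (g x) := fun x hx ↦ by
    simp only [← hfg x (heU hx), add_sub_cancel]
  -- On a plaque off the zero set, the factor between `∇f` and `∇g` is a non-zero constant. It
  -- cancels from the gradient norms, and then, these being equal, from the Laplacians.
  have hpunct : ∀ r x₁ x₂, r ≠ 0 → (r, x₁) ∈ e.target → (r, x₂) ∈ e.target →
      ‖X (e.symm (r, x₁))‖ ^ 2 = ‖X (e.symm (r, x₂))‖ ^ 2 ∧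
      riemDiv (m + 1) X (e.symm (r, x₁)) = riemDiv (m + 1) X (e.symm (r, x₂)) := by
    intro r x₁ x₂ hr h₁ h₂
    have hs₁ := e.map_target h₁
    have hs₂ := e.map_target h₂
    have hleaf := he.mem_leaf (φ := fun t ↦ c + σ * t ^ k) hfh h₂ h₁
    have e1 := hf.gradSq_eq _ _ hleaf
    have e2 := hf.laplace_eq _ _ hleaf
    have hne : σ * (k * r ^ (k - 1)) ≠ 0 :=
      mul_ne_zero hσ (mul_ne_zero (by exact_mod_cast (by omega : k ≠ 0)) (pow_ne_zero _ hr))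
    rw [hgf _ hs₁, hgf _ hs₂, norm_smul, norm_smul, mul_pow, mul_pow] at e1
    rw [hLf _ hs₁, hLf _ hs₂] at e2
    simp only [ha, he.apply_symm h₁, he.apply_symm h₂] at e1 e2
    have hN := mul_left_cancel₀ (pow_ne_zero 2 (norm_ne_zero_iff.2 hne)) e1
    rw [hN, add_left_inj] at e2
    exact ⟨hN, mul_left_cancel₀ hne e2⟩
  have hcont : ∀ {F : M → ℝ}, (∀ x ∈ e.source, ContMDiffAt (𝓡 (m + 1)) 𝓘(ℝ, ℝ) ∞ F x) → ∀ {q},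
      q ∈ e.target → ContinuousAt (fun r ↦ F (e.symm (r, q.2))) q.1 := by
    intro F hF q hq
    have h1 : ContinuousAt F (e.symm q) := (hF _ (e.map_target hq)).continuousAt
    have h2 : ContinuousAt e.symm (q.1, q.2) :=
      e.continuousOn_symm.continuousAt (e.open_target.mem_nhds hq)
    have h3 : ContinuousAt (fun r : ℝ ↦ e.symm (r, q.2)) q.1 :=
      h2.comp (f := fun r : ℝ ↦ (r, q.2)) (by fun_prop)
    exact ContinuousAt.comp (g := F) h1 h3
  have hev : ∀ᶠ r in 𝓝[≠] (0 : ℝ), r ≠ 0 ∧ r ∈ Ioo (-δ) δ :=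
    (eventually_mem_nhdsWithin).and
      (nhdsWithin_le_nhds (Ioo_mem_nhds (by linarith [he.pos]) he.pos))
  -- For `k > 1` the gradient of `f` vanishes on the zero plaque, so nothing about `g` can be read
  -- off there directly. The equalities pass to the limit `r → 0` along the transversals over `x₁`
  -- and `x₂`.
  have hall : ∀ r x₁ x₂, (r, x₁) ∈ e.target → (r, x₂) ∈ e.target →
      ‖X (e.symm (r, x₁))‖ ^ 2 = ‖X (e.symm (r, x₂))‖ ^ 2 ∧
      riemDiv (m + 1) X (e.symm (r, x₁)) = riemDiv (m + 1) X (e.symm (r, x₂)) := by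
    intro r x₁ x₂ h₁ h₂
    rcases eq_or_ne r 0 with rfl | hr
    · have hp := fun r hr hδ ↦ hpunct r x₁ x₂ hr (he.mem_target.2 ⟨hδ, (he.mem_target.1 h₁).2⟩)
        (he.mem_target.2 ⟨hδ, (he.mem_target.1 h₂).2⟩)
      have key : ∀ F : M → ℝ, (∀ x ∈ e.source, ContMDiffAt (𝓡 (m + 1)) 𝓘(ℝ, ℝ) ∞ F x) →
          (∀ r, r ≠ 0 → r ∈ Ioo (-δ) δ → F (e.symm (r, x₁)) = F (e.symm (r, x₂))) →
          F (e.symm (0, x₁)) = F (e.symm (0, x₂)) := fun F hF hFr ↦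
        eq_of_eventually_punctured (F := fun r ↦ F (e.symm (r, x₁)))
          (G := fun r ↦ F (e.symm (r, x₂))) (a := 0) (hcont hF h₁) (hcont hF h₂)
          (hev.mono fun r hr ↦ hFr r hr.1 hr.2)
      exact ⟨key _ hA fun r hr hδ ↦ (hp r hr hδ).1, key _ hΔ fun r hr hδ ↦ (hp r hr hδ).2⟩
    · exact hpunct r x₁ x₂ hr h₁ h₂
  set x₀ := (splitChart p i p).2 with hx₀
  have hx₀t : ∀ {r}, r ∈ Ioo (-δ) δ → (r, x₀) ∈ e.target := fun hr ↦
    he.mem_target.2 ⟨hr, Metric.mem_ball_self he.pos⟩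
  -- By `hall`, `‖∇g‖ ^ 2` is the function `B` of `g`. So the unit gradient is `ψ(g) ∇g`, to which
  -- the Leibniz rule applies.
  obtain ⟨B, hB⟩ : ∃ B : ℝ → ℝ, ∀ r, B r = ‖X (e.symm (r, x₀))‖ ^ 2 := ⟨_, fun _ ↦ rfl⟩
  set ψ : ℝ → ℝ := fun r ↦ (√(B r))⁻¹ with hψ
  have hψd : ∀ r ∈ Ioo (-δ) δ, DifferentiableAt ℝ ψ r := by
    intro r hr
    have hs := e.map_target (hx₀t hr)
    have h1 : ContMDiffAt 𝓘(ℝ, ℝ) (𝓡 (m + 1)) ∞ (fun r ↦ e.symm (r, x₀)) r := by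
      have h0 := he.smooth_symm.contMDiffAt (e.open_target.mem_nhds (hx₀t hr))
      have h00 : ContDiff ℝ ∞ (fun r : ℝ ↦ (r, x₀)) := contDiff_id.prodMk contDiff_const
      exact h0.comp (f := fun r : ℝ ↦ (r, x₀)) r h00.contMDiff.contMDiffAt
    have h2 : ContMDiffAt 𝓘(ℝ, ℝ) 𝓘(ℝ, ℝ) ∞ (fun r ↦ ‖X (e.symm (r, x₀))‖ ^ 2) r :=
      (hA _ hs).comp (f := fun r ↦ e.symm (r, x₀)) r h1
    have h3 : DifferentiableAt ℝ B r := by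
      rw [funext hB]
      exact h2.contDiffAt.differentiableAt (by simp)
    have hpos : 0 < B r := by rw [hB]; exact pow_pos (hApos _ hs) 2
    exact (h3.sqrt hpos.ne').inv (Real.sqrt_pos.2 hpos).ne'
  have hsrc : ∀ x ∈ e.source, g x ∈ Ioo (-δ) δ ∧ ‖X x‖ ^ 2 = ‖X (e.symm (g x, x₀))‖ ^ 2 ∧
      riemDiv (m + 1) X x = riemDiv (m + 1) X (e.symm (g x, x₀)) := by
    intro x hx
    have h1 := e.map_source hx
    rw [he.apply x hx] at h1
    have h2 : e.symm (g x, (splitChart p i x).2) = x := by rw [← he.apply x hx, e.left_inv hx]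
    have h3 := hall _ _ _ h1 (hx₀t (he.mem_target.1 h1).1)
    rw [h2] at h3
    exact ⟨(he.mem_target.1 h1).1, h3⟩
  have hu : ∀ x ∈ e.source, unitGrad (m + 1) g x = ψ (g x) • X x := by
    intro x hx
    have h1 : √(B (g x)) = ‖X x‖ := by
      rw [hB, ← (hsrc x hx).2.1, Real.sqrt_sq (norm_nonneg _)]
    change _ = (√(B (g x)))⁻¹ • X x
    rw [h1]
    rfl
  have hdiv : ∀ x ∈ e.source, riemDiv (m + 1) (unitGrad (m + 1) g) x =
      ψ (g x) * riemDiv (m + 1) X x + deriv ψ (g x) * ‖X x‖ ^ 2 := by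
    intro x hx
    have hψx := hψd _ (hsrc x hx).1
    have h3 : MDifferentiableAt (𝓡 (m + 1)) 𝓘(ℝ, ℝ) (fun y ↦ ψ (g y)) x :=
      hψx.mdifferentiableAt.comp x (hmd x hx)
    rw [riemDiv_congr ((e.open_source.eventually_mem hx).mono fun y hy ↦ hu y hy),
      riemDiv_smul h3 ((hXs x hx).differentiableAt (by simp)),
      mvfderiv_comp_real hψx.hasDerivAt (hmd x hx)]
    change _ + _ * mvfderiv (𝓡 (m + 1)) g x (X x) = _
    rw [hX, norm_grad_sq]
  refine ⟨e.source, e.open_source, he.mem, heU, fun x hx hgx ↦ ?_⟩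
  have h1 := hsrc x hx
  have h2 := hsrc p he.mem
  rw [hgx] at h1
  rw [hgp] at h2
  have hN : ‖X x‖ ^ 2 = ‖X p‖ ^ 2 := h1.2.1.trans h2.2.1.symm
  refine ⟨(sq_eq_sq₀ (norm_nonneg _) (norm_nonneg _)).1 hN, ?_⟩
  rw [hdiv x hx, hdiv p he.mem, hgx, hgp, hN, h1.2.2, h2.2.2]

end Plaques

/-! ### Identity theorem and flatness of analytic functions. -/

section AnalyticContinuation

variable {n : ℕ} {M : Type*} [TopologicalSpace M] [ChartedSpace (𝔼 n) M]
  [RiemannianBundle (fun x : M ↦ TangentSpace (𝓡 n) x)] [IsManifold (𝓡 n) ω M]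
  [IsContMDiffRiemannianBundle (𝓡 n) ω (𝔼 n) (fun x : M ↦ TangentSpace (𝓡 n) x)]

lemma analyticOnNhd_comp_symm {f : M → ℝ} (hf : ContMDiff (𝓡 n) 𝓘(ℝ, ℝ) ω f) (p : M) :
    AnalyticOnNhd ℝ (f ∘ (extChartAt (𝓡 n) p).symm) (extChartAt (𝓡 n) p).target := fun _ hy ↦
  analyticWithinAt_univ.1 (contDiffWithinAt_omega_iff_analyticWithinAt.1
    (contDiffWithinAt_univ.2 (contDiffAt_comp_symm hy (hf _))))

lemma eventually_nhds_of_symm {p x : M} (hx : x ∈ (extChartAt (𝓡 n) p).source) {P : M → Prop}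
    (h : ∀ᶠ y in 𝓝 (extChartAt (𝓡 n) p x), P ((extChartAt (𝓡 n) p).symm y)) :
    ∀ᶠ x' in 𝓝 x, P x' := by
  have hc : ContinuousAt (extChartAt (𝓡 n) p) x :=
    (continuousOn_extChartAt p).continuousAt ((isOpen_extChartAt_source p).mem_nhds hx)
  filter_upwards [hc.eventually h, (isOpen_extChartAt_source (I := 𝓡 n) p).mem_nhds hx]
    with x' h1 h2
  rwa [(extChartAt (𝓡 n) p).left_inv h2] at h1

/-- The identity theorem for analytic functions on a connected manifold. -/
lemma eq_const_of_eventually_eq [PreconnectedSpace M] {f : M → ℝ}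
    (hf : ContMDiff (𝓡 n) 𝓘(ℝ, ℝ) ω f) {c : ℝ} {p : M} (hp : ∀ᶠ x in 𝓝 p, f x = c) (x : M) :
    f x = c := by
  set A : Set M := {x | ∀ᶠ y in 𝓝 x, f y = c}
  have hAo : IsOpen A := isOpen_setOfPred_eventually_nhds
  have hAc : IsClosed A := by
    refine isClosed_of_closure_subset fun x hx ↦ ?_
    set κ := extChartAt (𝓡 n) x
    have hxs : x ∈ κ.source := mem_extChartAt_source x
    obtain ⟨r, hr, hball⟩ := Metric.isOpen_iff.1 (isOpen_target x) (κ x) (κ.map_source hxs)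
    have hU : κ.source ∩ κ ⁻¹' Metric.ball (κ x) r ∈ 𝓝 x :=
      ((continuousOn_extChartAt x).isOpen_inter_preimage (isOpen_extChartAt_source x)
        Metric.isOpen_ball).mem_nhds ⟨hxs, Metric.mem_ball_self hr⟩
    obtain ⟨x', ⟨hx's, hx'b⟩, hx'A⟩ := mem_closure_iff_nhds.1 hx _ hU
    have h1 : f ∘ κ.symm =ᶠ[𝓝 (κ x')] fun _ ↦ c := by
      have : ContinuousAt κ.symm (κ x') := continuousAt_symm (κ.map_source hx's)
      have h0 : ∀ᶠ y in 𝓝 (κ.symm (κ x')), f y = c := by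
        rw [κ.left_inv hx's]
        exact hx'A
      exact this.eventually h0
    have h2 : EqOn (f ∘ κ.symm) (fun _ ↦ c) (Metric.ball (κ x) r) :=
      ((analyticOnNhd_comp_symm hf x).mono hball).eqOn_of_preconnected_of_eventuallyEq
        analyticOnNhd_const (convex_ball _ _).isPreconnected hx'b h1
    exact eventually_nhds_of_symm hxs ((Metric.isOpen_ball.eventually_mem
      (Metric.mem_ball_self hr)).mono fun y hy ↦ h2 hy)
  have : A = univ := IsClopen.eq_univ ⟨hAc, hAo⟩ ⟨p, hp⟩
  have hx : x ∈ A := this ▸ mem_univ x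
  exact hx.self_of_nhds

/-- An analytic function on a ball which is flat at the centre vanishes. -/
lemma AnalyticOnNhd.eq_zero_of_flat {E : Type*} [NormedAddCommGroup E] [NormedSpace ℝ E]
    {F : E → ℝ} {a : E} {r : ℝ} (hF : AnalyticOnNhd ℝ F (Metric.ball a r))
    (hflat : ∀ j : ℕ, F =O[𝓝 a] fun y ↦ ‖y - a‖ ^ j) {y : E} (hy : y ∈ Metric.ball a r) :
    F y = 0 := by
  have hr : 0 < r := Metric.pos_of_mem_ball hy
  set L : ℝ → E := fun t ↦ a + t • (y - a) with hL
  have hLa : AnalyticOnNhd ℝ L univ := fun t _ ↦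
    analyticAt_const.add (analyticAt_id.smul analyticAt_const)
  set I := L ⁻¹' Metric.ball a r
  have hI : IsPreconnected I := by
    have : L = AffineMap.lineMap a y := by
      ext1 t
      rw [AffineMap.lineMap_apply_module', add_comm]
    simp only [I, this]
    exact ((convex_ball a r).affine_preimage _).isPreconnected
  have hG : AnalyticOnNhd ℝ (F ∘ L) I := hF.comp (hLa.mono (subset_univ _)) fun t ht ↦ ht
  have hL0 : L 0 = a := by simp [hL]
  have h0 : (0 : ℝ) ∈ I := by
    change L 0 ∈ Metric.ball a r
    rw [hL0]
    exact Metric.mem_ball_self hr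
  have h1 : (1 : ℝ) ∈ I := by
    change L 1 ∈ Metric.ball a r
    simpa [hL] using hy
  have hev : ∀ᶠ t in 𝓝 (0 : ℝ), (F ∘ L) t = 0 := by
    by_contra hcon
    -- Restricted to the line through `a` and `y`, a function not vanishing identically near `0` has
    -- the form `t ^ N g(t)` with `g 0 ≠ 0`. This contradicts flatness to order `N + 1`.
    obtain ⟨N, g, hg, hg0, hfg⟩ := (hG 0 h0).exists_eventuallyEq_pow_smul_nonzero_iff.2 hcon
    have hLc : Tendsto L (𝓝 0) (𝓝 a) := by
      have := (hLa 0 (mem_univ _)).continuousAt.tendsto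
      rwa [hL0] at this
    have hO := (hflat (N + 1)).comp_tendsto hLc
    obtain ⟨C, hC⟩ := hO.bound
    have hlim : ∀ᶠ t in 𝓝[≠] (0 : ℝ), ‖g t‖ ≤ C * (|t| * ‖y - a‖ ^ (N + 1)) := by
      filter_upwards [nhdsWithin_le_nhds hC, nhdsWithin_le_nhds hfg, eventually_mem_nhdsWithin]
        with t ht1 ht2 ht3
      have ht3' : 0 < |t| ^ N := pow_pos (abs_pos.2 ht3) N
      rw [ht2] at ht1
      simp only [Function.comp, hL, sub_zero, norm_smul, Real.norm_eq_abs, smul_eq_mul,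
        add_sub_cancel_left, mul_pow, abs_mul, abs_pow, abs_norm, abs_abs] at ht1
      rw [Real.norm_eq_abs]
      refine le_of_mul_le_mul_left ?_ ht3'
      calc |t| ^ N * |g t| ≤ _ := ht1
        _ = _ := by ring
    have h2 := le_of_tendsto_of_tendsto
      (hg.continuousAt.norm.tendsto.mono_left nhdsWithin_le_nhds)
      ((show ContinuousAt (fun t : ℝ ↦ C * (|t| * ‖y - a‖ ^ (N + 1))) 0 by fun_prop).tendsto.mono_left
        nhdsWithin_le_nhds) hlim
    simp only [abs_zero, zero_mul, mul_zero] at h2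
    exact hg0 (norm_le_zero_iff.1 h2)
  have h3 := hG.eqOn_zero_of_preconnected_of_eventuallyEq_zero hI h0 hev h1
  simpa [hL] using h3

end AnalyticContinuation

/-! ### Order of vanishing along a hypersurface. -/

section VanishingOrder

variable {m : ℕ} {M : Type*} [TopologicalSpace M] [ChartedSpace (𝔼 (m + 1)) M]

/-- `f - c` vanishes to order `j` along the hypersurface `S` near `q`. -/
def VanishesToOrder (m : ℕ) {M : Type*} [TopologicalSpace M] [ChartedSpace (𝔼 (m + 1)) M] (S : Set M) (f : M → ℝ) (c : ℝ) (j : ℕ) (q : M) : Prop :=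
  ∃ U h, q ∈ U ∧ IsLocalDefiningFunction (m + 1) S U h ∧
    (fun x ↦ f x - c) =O[𝓝 q] fun x ↦ h x ^ j

namespace IsLocalDefiningFunction

variable {S U U' : Set M} {h h' : M → ℝ}

lemma eq_zero_iff {n : ℕ} [ChartedSpace (𝔼 n) M] (H : IsLocalDefiningFunction n S U h) {x : M}
    (hx : x ∈ U) : h x = 0 ↔ x ∈ S := by
  have := H.zeroSet
  constructor
  · intro h0
    exact (this.symm ▸ (show x ∈ {x ∈ U | h x = 0} from ⟨hx, h0⟩) : x ∈ S ∩ U).1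
  · intro hS
    exact (this ▸ (show x ∈ S ∩ U from ⟨hS, hx⟩) : x ∈ {x ∈ U | h x = 0}).2

lemma contMDiffAt {n : ℕ} [ChartedSpace (𝔼 n) M] (H : IsLocalDefiningFunction n S U h) {x : M}
    (hx : x ∈ U) : ContMDiffAt (𝓡 n) 𝓘(ℝ, ℝ) ∞ h x := H.smooth.contMDiffAt (H.isOpen.mem_nhds hx)

lemma mono {n : ℕ} [ChartedSpace (𝔼 n) M] (H : IsLocalDefiningFunction n S U h) {W : Set M}
    (hW : IsOpen W) (hWU : W ⊆ U) : IsLocalDefiningFunction n S W h where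
  isOpen := hW
  smooth := H.smooth.mono hWU
  zeroSet := by
    ext x
    constructor
    · rintro ⟨hxS, hxW⟩
      exact ⟨hxW, (H.eq_zero_iff (hWU hxW)).2 hxS⟩
    · rintro ⟨hxW, hx0⟩
      exact ⟨(H.eq_zero_iff (hWU hxW)).1 hx0, hxW⟩
  regular := fun x hx ↦ H.regular x (hWU hx)

variable [RiemannianBundle (fun x : M ↦ TangentSpace (𝓡 (m + 1)) x)] [IsManifold (𝓡 (m + 1)) ω M]
  [IsContMDiffRiemannianBundle (𝓡 (m + 1)) ω (𝔼 (m + 1))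
    (fun x : M ↦ TangentSpace (𝓡 (m + 1)) x)]

lemma exists_adapted (H : IsLocalDefiningFunction (m + 1) S U h) {p : M} (hpS : p ∈ S)
    (hpU : p ∈ U) {W : Set M} (hW : W ∈ 𝓝 p) :
    ∃ (i : Fin (m + 1)) (e : OpenPartialHomeomorph M (ℝ × 𝔼 m)) (δ : ℝ),
      IsAdaptedChart p h i e δ ∧ e.source ⊆ U ∩ W := by
  obtain ⟨W', hW'W, hW'o, hpW'⟩ := mem_nhds_iff.1 hW
  obtain ⟨i, e, δ, he, hes⟩ := exists_isAdaptedChart (H.isOpen.inter hW'o) ⟨hpU, hpW'⟩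
    (H.smooth.mono inter_subset_left) ((H.eq_zero_iff hpU).2 hpS) (H.regular p hpU)
  exact ⟨i, e, δ, he, fun x hx ↦ ⟨(hes hx).1, hW'W (hes hx).2⟩⟩

/-- A smooth function vanishing on the hypersurface is bounded by a multiple of any local defining
function. -/
lemma isBigO (H : IsLocalDefiningFunction (m + 1) S U h) {p : M} (hpS : p ∈ S) (hpU : p ∈ U)
    {f : M → ℝ} (hf : ContMDiffAt (𝓡 (m + 1)) 𝓘(ℝ, ℝ) 1 f p) (hf0 : ∀ᶠ x in 𝓝 p, x ∈ S → f x = 0) :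
    f =O[𝓝 p] h := by
  obtain ⟨i, e, δ, he, hes⟩ := H.exists_adapted hpS hpU hf0
  have hpt : e p ∈ e.target := e.map_source he.mem
  have hpe : e.symm (e p) = p := e.left_inv he.mem
  have h1 : ContDiffAt ℝ 1 (f ∘ e.symm) (e p) := by
    have h2 := (he.smooth_symm.contMDiffAt (e.open_target.mem_nhds hpt)).of_le (m := 1) (by simp)
    rw [← hpe] at hf
    exact (hf.comp (e p) h2).contDiffAt
  obtain ⟨K, t, ht, hK⟩ := h1.exists_lipschitzOnWith
  -- In adapted coordinates `x` is compared with its projection `(0, (e x).2)` to the hypersurface,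
  -- which is at distance exactly `|h x|`; the Lipschitz bound then applies.
  have hproj : ∀ᶠ x in 𝓝 p, e x ∈ t ∧ (0, (e x).2) ∈ t := by
    have h2 : ContinuousAt e p := e.continuousAt he.mem
    have h3 : ContinuousAt (fun x ↦ ((0 : ℝ), (e x).2)) p := by fun_prop
    refine (h2.eventually ht).and (h3.eventually ?_)
    have : ((0 : ℝ), (e p).2) = e p := by rw [he.apply_self]
    rwa [← this] at ht
  refine Asymptotics.IsBigO.of_bound K ?_
  filter_upwards [hproj, e.open_source.mem_nhds he.mem] with x hx hxs
  have hxt := e.map_source hxs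
  have h0t : ((0 : ℝ), (e x).2) ∈ e.target := he.mem_target.2
    ⟨⟨by linarith [he.pos], he.pos⟩, (he.mem_target.1 hxt).2⟩
  have h4 := hK.dist_le_mul _ hx.1 _ hx.2
  have h5 : f (e.symm (0, (e x).2)) = 0 := by
    have h6 := e.map_target h0t
    refine (hes h6).2 ((H.eq_zero_iff (hes h6).1).1 ?_)
    rw [he.apply_symm h0t]
  simp only [Function.comp, e.left_inv hxs, h5, Real.dist_eq, sub_zero] at h4
  have h7 : dist (e x) (0, (e x).2) = |h x| := by
    rw [Prod.dist_eq, dist_self, he.apply x hxs, Real.dist_eq, sub_zero, max_eq_left (abs_nonneg _)]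
  rw [h7] at h4
  exact h4

end IsLocalDefiningFunction

end VanishingOrder

section

variable {n : ℕ} {M : Type*} [TopologicalSpace M] [ChartedSpace (𝔼 n) M]

variable [RiemannianBundle (fun x : M ↦ TangentSpace (𝓡 n) x)] [IsManifold (𝓡 n) ω M]
  [IsContMDiffRiemannianBundle (𝓡 n) ω (𝔼 n) (fun x : M ↦ TangentSpace (𝓡 n) x)]

lemma contMDiffAt_norm_grad_sq {h : M → ℝ} {x : M}
    (hh : ∀ᶠ y in 𝓝 x, ContMDiffAt (𝓡 n) 𝓘(ℝ, ℝ) ∞ h y) :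
    ContMDiffAt (𝓡 n) 𝓘(ℝ, ℝ) ∞ (fun y ↦ ‖grad n h y‖ ^ 2) x := by
  have h1 : ContDiffFieldAt ∞ (grad n h) x := contDiffFieldAt_grad (k := ∞) (by simp) hh
  have h2 := h1.contMDiffAt_inner h1
  simpa only [real_inner_self_eq_norm_sq] using h2

end

section VanishingOrder

variable {m : ℕ} {M : Type*} [TopologicalSpace M] [ChartedSpace (𝔼 (m + 1)) M]
  [RiemannianBundle (fun x : M ↦ TangentSpace (𝓡 (m + 1)) x)] [IsManifold (𝓡 (m + 1)) ω M]
  [IsContMDiffRiemannianBundle (𝓡 (m + 1)) ω (𝔼 (m + 1))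
    (fun x : M ↦ TangentSpace (𝓡 (m + 1)) x)]
  {S U : Set M} {f h : M → ℝ} {c : ℝ} {j : ℕ} {p q : M} {i : Fin (m + 1)}
  {e : OpenPartialHomeomorph M (ℝ × 𝔼 m)} {δ : ℝ}

namespace IsAdaptedChart

lemma zero_mem_target (he : IsAdaptedChart p h i e δ) {x : 𝔼 m}
    (hx : x ∈ Metric.ball (splitChart p i p).2 δ) : ((0 : ℝ), x) ∈ e.target :=
  he.mem_target.2 ⟨⟨by linarith [he.pos], he.pos⟩, hx⟩

lemma symm_zero_mem (he : IsAdaptedChart p h i e δ) (H : IsLocalDefiningFunction (m + 1) S U h)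
    (heU : e.source ⊆ U) {x : 𝔼 m} (hx : x ∈ Metric.ball (splitChart p i p).2 δ) :
    e.symm (0, x) ∈ S :=
  (H.eq_zero_iff (heU (e.map_target (he.zero_mem_target hx)))).1
    (he.apply_symm (he.zero_mem_target hx))

lemma symm_zero_of_mem (he : IsAdaptedChart p h i e δ) (H : IsLocalDefiningFunction (m + 1) S U h)
    (heU : e.source ⊆ U) {y : M} (hy : y ∈ e.source) (hyS : y ∈ S) :
    (e y).2 ∈ Metric.ball (splitChart p i p).2 δ ∧ e.symm (0, (e y).2) = y := by
  refine ⟨(he.mem_target.1 (e.map_source hy)).2, ?_⟩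
  have : ((0 : ℝ), (e y).2) = e y := by
    rw [he.apply y hy, (H.eq_zero_iff (heU hy)).2 hyS]
  rw [this, e.left_inv hy]

lemma contDiffOn_comp_symm (he : IsAdaptedChart p h i e δ)
    (hf : ContMDiffOn (𝓡 (m + 1)) 𝓘(ℝ, ℝ) ∞ f e.source) : ContDiffOn ℝ ∞ (f ∘ e.symm) e.target :=
  (hf.comp he.smooth_symm fun _ hz ↦ e.map_target hz).contDiffOn

end IsAdaptedChart

namespace VanishesToOrder

/-- The order does not depend on the choice of the defining function, since any one is bounded by a
multiple of any other. -/
lemma isBigO (hv : VanishesToOrder m S f c j q) (hq : q ∈ S)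
    (H : IsLocalDefiningFunction (m + 1) S U h) (hqU : q ∈ U) :
    (fun x ↦ f x - c) =O[𝓝 q] fun x ↦ h x ^ j := by
  obtain ⟨U', h', hqU', H', hO⟩ := hv
  refine hO.trans ((H.isBigO hq hqU ((H'.contMDiffAt hqU').of_le (by simp)) ?_).pow j)
  filter_upwards [H'.isOpen.mem_nhds hqU'] with x hx hxS
  exact (H'.eq_zero_iff hx).2 hxS

lemma eventually (hv : VanishesToOrder m S f c j q) : ∀ᶠ x in 𝓝 q, VanishesToOrder m S f c j x := by
  obtain ⟨U, h, hqU, H, hO⟩ := hv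
  obtain ⟨C, hC⟩ := hO.bound
  filter_upwards [hC.eventually_nhds, H.isOpen.mem_nhds hqU] with x hx hxU
  exact ⟨U, h, hxU, H, Asymptotics.IsBigO.of_bound C hx⟩

end VanishesToOrder

/-- On the transversal over `x`, `r ^ j u` is `O(r ^ (j + 1))`, so `u = O(r)` for `r ≠ 0`; let `r`
tend to zero. -/
lemma IsAdaptedChart.factor_eq_zero (he : IsAdaptedChart p h i e δ)
    (H : IsLocalDefiningFunction (m + 1) S U h) (heU : e.source ⊆ U) {x : 𝔼 m}
    (hx : x ∈ Metric.ball (splitChart p i p).2 δ) {u : ℝ × 𝔼 m → ℝ} (hu : ContinuousAt u (0, x))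
    (hfu : ∀ᶠ z in 𝓝 (0, x), f (e.symm z) - c = z.1 ^ j * u z)
    (hv : VanishesToOrder m S f c (j + 1) (e.symm (0, x))) : u (0, x) = 0 := by
  have h0 := he.zero_mem_target hx
  obtain ⟨C, hC⟩ := (hv.isBigO (he.symm_zero_mem H heU hx) H (heU (e.map_target h0))).bound
  have hcurve : Tendsto (fun r : ℝ ↦ (r, x)) (𝓝 0) (𝓝 (0, x)) :=
    (show Continuous fun r : ℝ ↦ (r, x) by fun_prop).tendsto 0
  have h1 := (e.continuousOn_symm.continuousAt (e.open_target.mem_nhds h0)).tendsto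
  have hlim : ∀ᶠ r in 𝓝[≠] (0 : ℝ), ‖u (r, x)‖ ≤ C * |r| := by
    filter_upwards [nhdsWithin_le_nhds ((h1.comp hcurve).eventually hC),
      nhdsWithin_le_nhds (hcurve.eventually hfu),
      nhdsWithin_le_nhds (hcurve.eventually (e.open_target.mem_nhds h0)),
      eventually_mem_nhdsWithin] with r h2 h3 h4 h5
    simp only [Function.comp] at h2 h3
    rw [h3, he.apply_symm h4, norm_mul, norm_pow, norm_pow, pow_succ] at h2
    rw [Real.norm_eq_abs] at h2 ⊢
    refine le_of_mul_le_mul_left ?_ (pow_pos (abs_pos.2 h5) j)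
    calc |r| ^ j * |u (r, x)| ≤ C * (|r| ^ j * |r|) := h2
      _ = _ := by ring
  have h2 := le_of_tendsto_of_tendsto
    ((hu.tendsto.comp hcurve).norm.mono_left nhdsWithin_le_nhds)
    ((show ContinuousAt (fun r : ℝ ↦ C * |r|) 0 by fun_prop).tendsto.mono_left
      nhdsWithin_le_nhds) hlim
  simp only [abs_zero, mul_zero] at h2
  exact norm_le_zero_iff.1 h2

lemma exists_factor_succ {u : ℝ × 𝔼 m → ℝ}
    {V : Set (𝔼 m)} (hV : IsOpen V)
    (hus : ContDiffOn ℝ ∞ u (Ioo (-δ) δ ×ˢ V))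
    (hu : ∀ z ∈ Ioo (-δ) δ ×ˢ V, f (e.symm z) - c = z.1 ^ j * u z) (hu0 : ∀ x ∈ V, u (0, x) = 0) :
    ∃ u' : ℝ × 𝔼 m → ℝ, ContDiffOn ℝ ∞ u' (Ioo (-δ) δ ×ˢ V) ∧
      ∀ z ∈ Ioo (-δ) δ ×ˢ V, f (e.symm z) - c = z.1 ^ (j + 1) * u' z := by
  obtain ⟨u', hu's, hu'⟩ := exists_smooth_quotient hV hus hu0
  refine ⟨u', hu's, fun z hz ↦ ?_⟩
  rw [hu z hz, hu' z hz]
  ring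

/-- Vanishing to one order more forces the cofactor to vanish on the hypersurface, and Hadamard's
lemma splits off another power of the first coordinate. -/
lemma IsAdaptedChart.exists_factor (he : IsAdaptedChart p h i e δ)
    (H : IsLocalDefiningFunction (m + 1) S U h) (heU : e.source ⊆ U)
    (hf : ContMDiff (𝓡 (m + 1)) 𝓘(ℝ, ℝ) ∞ f) (hv : ∀ k ≤ j, ∀ q ∈ S, VanishesToOrder m S f c k q) :
    ∃ u : ℝ × 𝔼 m → ℝ, ContDiffOn ℝ ∞ u e.target ∧
      ∀ z ∈ e.target, f (e.symm z) - c = z.1 ^ j * u z := by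
  induction j with
  | zero =>
    refine ⟨fun z ↦ f (e.symm z) - c,
      (he.contDiffOn_comp_symm hf.contMDiffOn).sub contDiffOn_const, fun z _ ↦ ?_⟩
    rw [pow_zero, one_mul]
  | succ j ih =>
    obtain ⟨u, hus, hu⟩ := ih fun k hk ↦ hv k (by omega)
    have hu0 : ∀ x ∈ Metric.ball (splitChart p i p).2 δ, u (0, x) = 0 := fun x hx ↦
      have h0 := e.open_target.mem_nhds (he.zero_mem_target hx)
      he.factor_eq_zero H heU hx (hus.contDiffAt h0).continuousAt
        (Filter.mem_of_superset h0 fun z hz ↦ hu z hz)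
        (hv _ le_rfl _ (he.symm_zero_mem H heU hx))
    rw [he.target] at hus hu ⊢
    exact exists_factor_succ Metric.isOpen_ball hus hu hu0

/-- Converse to the factorization: a continuous cofactor is locally bounded. -/
lemma IsAdaptedChart.vanishesToOrder (he : IsAdaptedChart p h i e δ)
    (H : IsLocalDefiningFunction (m + 1) S U h) (heU : e.source ⊆ U) {x : 𝔼 m}
    (hx : x ∈ Metric.ball (splitChart p i p).2 δ) {u : ℝ × 𝔼 m → ℝ} (hu : ContinuousAt u (0, x))
    (hfu : ∀ᶠ z in 𝓝 (0, x), f (e.symm z) - c = z.1 ^ j * u z) :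
    VanishesToOrder m S f c j (e.symm (0, x)) := by
  have h0 := he.zero_mem_target hx
  have hs := e.map_target h0
  have hc : Tendsto e (𝓝 (e.symm (0, x))) (𝓝 (0, x)) := by
    have := (e.continuousAt hs).tendsto
    rwa [e.right_inv h0] at this
  refine ⟨U, h, heU hs, H, ?_⟩
  have h1 : (fun y ↦ u (e y)) =O[𝓝 (e.symm (0, x))] fun _ ↦ (1 : ℝ) :=
    (hu.tendsto.comp hc).isBigO_one ℝ
  have h2 : (fun y ↦ f y - c) =ᶠ[𝓝 (e.symm (0, x))] fun y ↦ h y ^ j * u (e y) := by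
    filter_upwards [hc.eventually hfu, e.open_source.mem_nhds hs] with y h3 h4
    rw [e.left_inv h4] at h3
    rw [h3, he.apply y h4]
  refine h2.trans_isBigO ?_
  simpa using (Asymptotics.isBigO_refl (fun y ↦ h y ^ j) (𝓝 (e.symm (0, x)))).mul h1

/-- A non-constant analytic function does not vanish to infinite order along a hypersurface. -/
lemma exists_not_vanishesToOrder [PreconnectedSpace M] (hf : ContMDiff (𝓡 (m + 1)) 𝓘(ℝ, ℝ) ω f)
    (hne : ∃ x, f x ≠ c) (H : IsLocalDefiningFunction (m + 1) S U h) (hpS : p ∈ S) (hpU : p ∈ U) :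
    ∃ j, ¬ VanishesToOrder m S f c j p := by
  by_contra! hcon
  obtain ⟨x, hx⟩ := hne
  refine hx (eq_const_of_eventually_eq hf (p := p) ?_ x)
  set κ := extChartAt (𝓡 (m + 1)) p
  have hps : p ∈ κ.source := mem_extChartAt_source p
  have hpt := κ.map_source hps
  obtain ⟨r, hr, hball⟩ := Metric.isOpen_iff.1 (isOpen_target p) (κ p) hpt
  have hF : AnalyticOnNhd ℝ (fun y ↦ (f ∘ κ.symm) y - c) (Metric.ball (κ p) r) :=
    ((analyticOnNhd_comp_symm hf p).mono hball).sub analyticOnNhd_const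
  have htend : Tendsto κ.symm (𝓝 (κ p)) (𝓝 p) := by
    have := (continuousAt_symm hpt).tendsto
    rwa [κ.left_inv hps] at this
  -- As `h` vanishes at `p`, it is bounded by the distance to `p`; so vanishing to order `j` along
  -- the hypersurface implies flatness to order `j` at the point.
  have hh : (h ∘ κ.symm) =O[𝓝 (κ p)] fun y ↦ y - κ p := by
    have h1 : ContMDiffAt (𝓡 (m + 1)) 𝓘(ℝ, ℝ) ∞ h (κ.symm (κ p)) := by
      rw [κ.left_inv hps]; exact H.contMDiffAt hpU
    have h2 := ((contDiffAt_comp_symm hpt h1).differentiableAt (by simp)).isBigO_sub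
    have h3 : h (κ.symm (κ p)) = 0 := by rw [κ.left_inv hps]; exact (H.eq_zero_iff hpU).2 hpS
    refine h2.congr_left fun y ↦ ?_
    change _ - h (κ.symm (κ p)) = _
    rw [h3, sub_zero]
  refine eventually_nhds_of_symm hps ?_
  filter_upwards [Metric.ball_mem_nhds (κ p) hr] with y hy
  refine sub_eq_zero.1 (hF.eq_zero_of_flat (fun j ↦ ?_) hy)
  have h4 := ((hcon j).isBigO hpS H hpU).comp_tendsto htend
  refine h4.trans ?_
  have h5 := hh.norm_right.pow j
  exact h5

end VanishingOrder

/-! ### Local roots of an equilibrium function with a common exponent. -/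

section Dichotomy

variable {m : ℕ} {M : Type*} [TopologicalSpace M] [ChartedSpace (𝔼 (m + 1)) M]
  [RiemannianBundle (fun x : M ↦ TangentSpace (𝓡 (m + 1)) x)] [IsManifold (𝓡 (m + 1)) ω M]
  [IsContMDiffRiemannianBundle (𝓡 (m + 1)) ω (𝔼 (m + 1))
    (fun x : M ↦ TangentSpace (𝓡 (m + 1)) x)]
  {S U : Set M} {f h : M → ℝ} {c : ℝ} {k : ℕ} {p q : M} {i : Fin (m + 1)}
  {e : OpenPartialHomeomorph M (ℝ × 𝔼 m)} {δ : ℝ}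

/-- Where the cofactor `u` of `h ^ k` in `f - c` does not vanish, `f - c` is up to sign the `k`-th
power of the local defining function `|u|^(1/k) h`. -/
lemma IsAdaptedChart.exists_root (he : IsAdaptedChart p h i e δ)
    (H : IsLocalDefiningFunction (m + 1) S U h) (heU : e.source ⊆ U) {u : ℝ × 𝔼 m → ℝ}
    (hus : ContDiffOn ℝ ∞ u e.target) (hu : ∀ z ∈ e.target, f (e.symm z) - c = z.1 ^ k * u z)
    (hk : 1 ≤ k) {y : M} (hy : y ∈ e.source) (hyS : y ∈ S) (hyu : u (e y) ≠ 0) :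
    ∃ (W : Set M) (g : M → ℝ) (σ : ℝ), y ∈ W ∧ W ⊆ e.source ∧
      IsLocalDefiningFunction (m + 1) S W g ∧ (σ = 1 ∨ σ = -1) ∧
      (∀ x ∈ W, f x - c = σ * g x ^ k) ∧
      ∀ x ∈ W, x ∈ S → ‖grad (m + 1) g x‖ = |u (e x)| ^ (k : ℝ)⁻¹ * ‖grad (m + 1) h x‖ := by
  obtain ⟨σ, hσ1, hvy⟩ : ∃ σ : ℝ, (σ = 1 ∨ σ = -1) ∧ 0 < σ * u (e y) := by
    rcases lt_or_gt_of_ne hyu with h1 | h1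
    · exact ⟨-1, Or.inr rfl, by linarith⟩
    · exact ⟨1, Or.inl rfl, by linarith⟩
  have hσσ : σ * σ = 1 := by rcases hσ1 with h1 | h1 <;> rw [h1] <;> norm_num
  set v : M → ℝ := fun x ↦ σ * u (e x) with hv
  have hvs : ContMDiffOn (𝓡 (m + 1)) 𝓘(ℝ, ℝ) ∞ v e.source := by
    have h1 : ContMDiffOn (𝓡 (m + 1)) 𝓘(ℝ, ℝ) ∞ (fun x ↦ u (e x)) e.source :=
      hus.contMDiffOn.comp he.smooth fun x hx ↦ e.map_source hx
    exact contMDiffOn_const.mul h1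
  set W₀ := e.source ∩ v ⁻¹' Ioi 0 with hW₀
  have hW₀o : IsOpen W₀ := hvs.continuousOn.isOpen_inter_preimage e.open_source isOpen_Ioi
  set b : M → ℝ := fun x ↦ v x ^ (k : ℝ)⁻¹ with hb
  have hbs : ContMDiffOn (𝓡 (m + 1)) 𝓘(ℝ, ℝ) ∞ b W₀ := by
    intro x hx
    have h1 : ContDiffAt ℝ ∞ (fun t : ℝ ↦ t ^ (k : ℝ)⁻¹) (v x) :=
      contDiffAt_id.rpow_const_of_ne (ne_of_gt hx.2)
    exact h1.contMDiffAt.comp_contMDiffWithinAt x ((hvs x hx.1).mono inter_subset_left)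
  set g : M → ℝ := fun x ↦ b x * h x with hg
  have hgs : ContMDiffOn (𝓡 (m + 1)) 𝓘(ℝ, ℝ) ∞ g W₀ :=
    hbs.mul (H.smooth.mono (inter_subset_left.trans heU))
  have hbpos : ∀ x ∈ W₀, 0 < b x := fun x hx ↦ Real.rpow_pos_of_pos hx.2 _
  have hmdb : ∀ x ∈ W₀, MDifferentiableAt (𝓡 (m + 1)) 𝓘(ℝ, ℝ) b x := fun x hx ↦
    (hbs.contMDiffAt (hW₀o.mem_nhds hx)).mdifferentiableAt (by simp)
  have hmdh : ∀ x ∈ W₀, MDifferentiableAt (𝓡 (m + 1)) 𝓘(ℝ, ℝ) h x := fun x hx ↦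
    (H.contMDiffAt (heU hx.1)).mdifferentiableAt (by simp)
  have hder : ∀ x ∈ W₀, x ∈ S → mvfderiv (𝓡 (m + 1)) g x = b x • mvfderiv (𝓡 (m + 1)) h x := by
    intro x hx hxS
    have h0 : h x = 0 := (H.eq_zero_iff (heU hx.1)).2 hxS
    rw [hg, mvfderiv_fun_mul (hmdb x hx) (hmdh x hx), h0, zero_smul, add_zero]
  have hyW₀ : y ∈ W₀ := ⟨hy, hvy⟩
  have hngs : ContinuousAt (fun x ↦ ‖grad (m + 1) g x‖ ^ 2) y := (contMDiffAt_norm_grad_sq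
    ((hW₀o.eventually_mem hyW₀).mono fun x hx ↦ hgs.contMDiffAt (hW₀o.mem_nhds hx))).continuousAt
  have hgrad : ∀ x ∈ W₀, x ∈ S → grad (m + 1) g x = b x • grad (m + 1) h x := by
    intro x hx hxS
    rw [grad, hder x hx hxS, map_smul]
    rfl
  have hgy : 0 < ‖grad (m + 1) g y‖ ^ 2 := by
    have h2 : 0 < ‖grad (m + 1) h y‖ := norm_pos_iff.2 (grad_ne_zero_iff.2 (H.regular y (heU hy)))
    rw [hgrad y hyW₀ hyS, norm_smul, Real.norm_of_nonneg (hbpos y hyW₀).le]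
    generalize ‖grad (m + 1) h y‖ = t at h2 ⊢
    exact pow_pos (mul_pos (hbpos y hyW₀) h2) 2
  -- Off `S` the gradient of `b h` also involves that of `b`, so non-vanishing is only obtained near
  -- `y`, by continuity.
  obtain ⟨W, hWs, hWo, hyW⟩ := eventually_nhds_iff.1
    ((hngs.eventually (lt_mem_nhds hgy)).and (hW₀o.eventually_mem hyW₀))
  refine ⟨W, g, σ, hyW, fun x hx ↦ (hWs x hx).2.1, ⟨hWo, hgs.mono fun x hx ↦ (hWs x hx).2, ?_, ?_⟩,
    hσ1, fun x hx ↦ ?_, fun x hx hxS ↦ ?_⟩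
  · ext x
    constructor
    · rintro ⟨hxS, hxW⟩
      refine ⟨hxW, ?_⟩
      simp only [hg, (H.eq_zero_iff (heU (hWs x hxW).2.1)).2 hxS, mul_zero]
    · rintro ⟨hxW, hx0⟩
      refine ⟨(H.eq_zero_iff (heU (hWs x hxW).2.1)).1 ?_, hxW⟩
      exact (mul_eq_zero.1 hx0).resolve_left (hbpos x (hWs x hxW).2).ne'
  · intro x hx
    rw [← grad_ne_zero_iff]
    intro h0
    have := (hWs x hx).1
    rw [h0] at this
    simp at this
  · obtain ⟨-, hxs, hxv⟩ := hWs x hx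
    have h1 := hu (e x) (e.map_source hxs)
    rw [e.left_inv hxs, he.apply x hxs] at h1
    have hbk : b x ^ k = v x := Real.rpow_inv_natCast_pow (le_of_lt hxv) (by omega)
    have h2 : v x = σ * u (h x, (splitChart p i x).2) := by rw [hv, ← he.apply x hxs]
    rw [h1, hg, mul_pow, hbk, h2, ← mul_assoc, ← mul_assoc, hσσ, one_mul, mul_comm]
  · obtain ⟨-, hxs, hxv⟩ := hWs x hx
    rw [hgrad x ⟨hxs, hxv⟩ hxS, norm_smul, Real.norm_of_nonneg (hbpos x ⟨hxs, hxv⟩).le]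
    have h1 : |σ| = 1 := by rcases hσ1 with h1 | h1 <;> rw [h1] <;> norm_num
    have h2 : |u (e x)| = |v x| := by simp only [hv, abs_mul, h1, one_mul]
    have h3 : 0 < v x := hxv
    rw [h2, abs_of_pos h3]

end Dichotomy

section Dichotomy

variable {m : ℕ} {M : Type*} [TopologicalSpace M] [ChartedSpace (𝔼 (m + 1)) M]
  [RiemannianBundle (fun x : M ↦ TangentSpace (𝓡 (m + 1)) x)] [IsManifold (𝓡 (m + 1)) ω M]
  [IsContMDiffRiemannianBundle (𝓡 (m + 1)) ω (𝔼 (m + 1))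
    (fun x : M ↦ TangentSpace (𝓡 (m + 1)) x)]
  {S U : Set M} {f h : M → ℝ} {c : ℝ} {k : ℕ} {p q : M} {i : Fin (m + 1)}
  {e : OpenPartialHomeomorph M (ℝ × 𝔼 m)} {δ : ℝ}

lemma continuousAt_norm_grad {x : M} (hh : ∀ᶠ y in 𝓝 x, ContMDiffAt (𝓡 (m + 1)) 𝓘(ℝ, ℝ) ∞ h y) :
    ContinuousAt (fun y ↦ ‖grad (m + 1) h y‖) x := by
  have := (contMDiffAt_norm_grad_sq hh).continuousAt.sqrt
  simpa only [Real.sqrt_sq (norm_nonneg _)] using this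

/-- Along a plaque, the leading coefficient of an equilibrium function vanishes everywhere or
nowhere. -/
lemma IsAdaptedChart.factor_dichotomy (hf : IsEquilibriumFunction (m + 1) f)
    (he : IsAdaptedChart p h i e δ)
    (H : IsLocalDefiningFunction (m + 1) S U h) (heU : e.source ⊆ U) {u : ℝ × 𝔼 m → ℝ}
    (hus : ContDiffOn ℝ ∞ u e.target) (hu : ∀ z ∈ e.target, f (e.symm z) - c = z.1 ^ k * u z)
    (hk : 1 ≤ k) : (∀ x ∈ Metric.ball (splitChart p i p).2 δ, u (0, x) = 0) ∨
      ∀ x ∈ Metric.ball (splitChart p i p).2 δ, u (0, x) ≠ 0 := by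
  set B := Metric.ball (splitChart p i p).2 δ
  by_contra! hcon
  obtain ⟨⟨x₁, hx₁, hux₁⟩, x₂, hx₂, hux₂⟩ := hcon
  -- Where `u ≠ 0`, `N` is the norm on `S` of the gradient of the root `|u| ^ (1 / k) h`, hence
  -- locally constant; where `u = 0`, it is zero. So the set where `N` takes a given non-zero value
  -- is open and closed in the ball.
  obtain ⟨N, hN⟩ : ∃ N : 𝔼 m → ℝ, ∀ x, N x = |u (0, x)| ^ (k : ℝ)⁻¹ *
    ‖grad (m + 1) h (e.symm (0, x))‖ := ⟨_, fun _ ↦ rfl⟩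
  have hk0 : (k : ℝ)⁻¹ ≠ 0 := inv_ne_zero (by exact_mod_cast (by omega : k ≠ 0))
  have hN0 : ∀ x, N x ≠ 0 → u (0, x) ≠ 0 := by
    intro x hx h0
    rw [hN, h0, abs_zero, Real.zero_rpow hk0, zero_mul] at hx
    exact hx rfl
  have hcurve : ∀ x ∈ B, ContinuousAt (fun x' ↦ e.symm ((0 : ℝ), x')) x := fun x hx ↦
    ContinuousAt.comp (f := fun x' : 𝔼 m ↦ ((0 : ℝ), x'))
      (e.continuousOn_symm.continuousAt (e.open_target.mem_nhds (he.zero_mem_target hx)))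
      (by fun_prop)
  have hNc : ∀ x ∈ B, ContinuousAt N x := by
    intro x hx
    have ht := he.zero_mem_target hx
    rw [funext hN]
    have h1 : ContinuousAt (fun x' ↦ u (0, x')) x :=
      ContinuousAt.comp (f := fun x' : 𝔼 m ↦ ((0 : ℝ), x'))
        (hus.contDiffAt (e.open_target.mem_nhds ht)).continuousAt (by fun_prop)
    have h2 : ContinuousAt (fun y ↦ ‖grad (m + 1) h y‖) (e.symm (0, x)) :=
      continuousAt_norm_grad ((H.isOpen.eventually_mem (heU (e.map_target ht))).mono
        fun y hy ↦ H.contMDiffAt hy)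
    have h3 : ContinuousAt (fun x' ↦ ‖grad (m + 1) h (e.symm (0, x'))‖) x :=
      ContinuousAt.comp (g := fun y ↦ ‖grad (m + 1) h y‖) h2 (hcurve x hx)
    exact (h1.abs.rpow_const (Or.inr (inv_nonneg.2 (Nat.cast_nonneg k)))).mul h3
  have ha : N x₁ ≠ 0 := by
    rw [hN]
    exact mul_ne_zero (Real.rpow_pos_of_pos (abs_pos.2 hux₁) _).ne' (norm_ne_zero_iff.2
      (grad_ne_zero_iff.2 (H.regular _ (heU (e.map_target (he.zero_mem_target hx₁))))))
  set O := {x | x ∈ B ∧ N x = N x₁} with hO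
  have hOo : IsOpen O := by
    rw [isOpen_iff_mem_nhds]
    rintro x ⟨hxB, hxN⟩
    have ht := he.zero_mem_target hxB
    have hux : u (e (e.symm (0, x))) ≠ 0 := by
      rw [e.right_inv ht]
      exact hN0 x (by rwa [hxN])
    obtain ⟨W, g, σ, hyW, hWe, G, hσ, hfg, hng⟩ := he.exists_root H heU hus hu hk
      (e.map_target ht) (he.symm_zero_mem H heU hxB) hux
    have hσ0 : σ ≠ 0 := by rcases hσ with h1 | h1 <;> rw [h1] <;> norm_num
    obtain ⟨W', hW'o, hyW', hW'W, hconst⟩ := exists_open_forall_unitGrad_const hf G.isOpen hyW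
      G.smooth ((G.eq_zero_iff hyW).2 (he.symm_zero_mem H heU hxB)) G.regular hσ0 hk hfg
    filter_upwards [(hcurve x hxB).eventually (hW'o.mem_nhds hyW'),
      Metric.isOpen_ball.mem_nhds hxB] with x' hx' hx'B
    refine ⟨hx'B, ?_⟩
    have hS' := he.symm_zero_mem H heU hx'B
    have h1 := (hconst _ hx' ((G.eq_zero_iff (hW'W hx')).2 hS')).1
    rw [hng _ (hW'W hx') hS', hng _ hyW (he.symm_zero_mem H heU hxB), e.right_inv ht,
      e.right_inv (he.zero_mem_target hx'B), ← hN, ← hN] at h1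
    rw [h1, hxN]
  have hsub : B ⊆ O := by
    refine (convex_ball _ _).isPreconnected.subset_of_closure_inter_subset hOo ⟨x₁, hx₁, hx₁, rfl⟩ ?_
    rintro x ⟨hxc, hxB⟩
    refine ⟨hxB, ?_⟩
    have h1 : ∃ᶠ x' in 𝓝 x, N x' = N x₁ :=
      (mem_closure_iff_frequently.1 hxc).mono fun x' hx' ↦ hx'.2
    by_contra hne
    exact h1 ((hNc x hxB).eventually_ne hne)
  exact hN0 x₂ (by rw [(hsub hx₂).2]; exact ha) hux₂

/-- `g` is a local defining function of `S`, of which `f - c` is up to sign the `k`-th power. -/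
def IsLocalRoot (S : Set M) (f : M → ℝ) (c : ℝ) (k : ℕ) (W : Set M) (g : M → ℝ) : Prop :=
  IsLocalDefiningFunction (m + 1) S W g ∧
    ∃ σ : ℝ, (σ = 1 ∨ σ = -1) ∧ ∀ x ∈ W, f x - c = σ * g x ^ k

/-- The dichotomy for the cofactor, expressed on `S` alone: near `q`, order `k + 1` holds at all
points of `S` or at none, and in the second case the cofactor has a root. For `k = 0` the cofactor
is `f - c` itself, which vanishes on `S`. -/
lemma vanishesToOrder_succ_or_exists_root (hf : IsEquilibriumFunction (m + 1) f)
    (hfc : ∀ x ∈ S, f x = c) (hS : IsHypersurface (m + 1) S)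
    (hv : ∀ j ≤ k, ∀ q ∈ S, VanishesToOrder m S f c j q) (hq : q ∈ S) :
    (∀ᶠ q' in 𝓝 q, q' ∈ S → VanishesToOrder m S f c (k + 1) q') ∨
      1 ≤ k ∧ (∀ᶠ q' in 𝓝 q, q' ∈ S → ¬ VanishesToOrder m S f c (k + 1) q') ∧
      ∃ W g, q ∈ W ∧ IsLocalRoot (m := m) S f c k W g := by
  obtain ⟨U, h, hqU, H⟩ := hS q hq
  obtain ⟨i, e, δ, he, hes⟩ := H.exists_adapted hq hqU univ_mem
  have heU : e.source ⊆ U := fun x hx ↦ (hes hx).1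
  have hfs : ContMDiff (𝓡 (m + 1)) 𝓘(ℝ, ℝ) ∞ f := hf.analytic.of_le le_top
  obtain ⟨u, hus, hu⟩ := he.exists_factor H heU hfs hv
  have hcase : (∀ x ∈ Metric.ball (splitChart q i q).2 δ, u (0, x) = 0) ∨
      1 ≤ k ∧ ∀ x ∈ Metric.ball (splitChart q i q).2 δ, u (0, x) ≠ 0 := by
    rcases Nat.eq_zero_or_pos k with rfl | hk
    · left
      intro x hx
      have h1 := hu _ (he.zero_mem_target hx)
      rw [pow_zero, one_mul, hfc _ (he.symm_zero_mem H heU hx), sub_self] at h1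
      exact h1.symm
    · exact (he.factor_dichotomy hf H heU hus hu hk).imp_right fun h ↦ ⟨hk, h⟩
  have hnhds : ∀ x ∈ Metric.ball (splitChart q i q).2 δ, e.target ∈ 𝓝 ((0 : ℝ), x) := fun x hx ↦
    e.open_target.mem_nhds (he.zero_mem_target hx)
  rcases hcase with h0 | ⟨hk, h0⟩
  · left
    rw [he.target] at hus hu
    obtain ⟨u', hu's, hu'⟩ := exists_factor_succ Metric.isOpen_ball hus hu h0
    rw [← he.target] at hu's hu'
    filter_upwards [e.open_source.mem_nhds he.mem] with q' hq' hq'S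
    obtain ⟨hb, hs⟩ := he.symm_zero_of_mem H heU hq' hq'S
    rw [← hs]
    exact he.vanishesToOrder H heU hb (hu's.contDiffAt (hnhds _ hb)).continuousAt
      (Filter.mem_of_superset (hnhds _ hb) fun z hz ↦ hu' z hz)
  · right
    refine ⟨hk, ?_, ?_⟩
    · filter_upwards [e.open_source.mem_nhds he.mem] with q' hq' hq'S hv'
      obtain ⟨hb, hs⟩ := he.symm_zero_of_mem H heU hq' hq'S
      rw [← hs] at hv'
      exact h0 _ hb (he.factor_eq_zero H heU hb (hus.contDiffAt (hnhds _ hb)).continuousAt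
        (Filter.mem_of_superset (hnhds _ hb) fun z hz ↦ hu z hz) hv')
    · obtain ⟨W, g, σ, hW, -, G, hσ, hfg, -⟩ := he.exists_root H heU hus hu hk he.mem hq
        (by rw [he.apply_self]; exact h0 _ (Metric.mem_ball_self he.pos))
      exact ⟨W, g, hW, G, σ, hσ, hfg⟩

/-- Near an equilibrium hypersurface, `f - c` is up to sign a power of a local defining function,
with the same exponent everywhere. -/
theorem exists_forall_isLocalRoot [PreconnectedSpace M] (hf : IsEquilibriumFunction (m + 1) f) {p₀ : M}
    (hSl : S = leaf f p₀) (hS : IsHypersurface (m + 1) S) :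
    ∃ k, 1 ≤ k ∧ ∀ q ∈ S, ∃ W g, q ∈ W ∧ IsLocalRoot (m := m) S f (f p₀) k W g := by
  have hp₀ : p₀ ∈ S := by
    rw [hSl]
    exact mem_connectedComponentIn rfl
  have hfc : ∀ x ∈ S, f x = f p₀ := fun x hx ↦ by
    rw [hSl] at hx
    have := connectedComponentIn_subset (f ⁻¹' {f p₀}) p₀ hx
    exact this
  have hpre : IsPreconnected S := by
    rw [hSl]
    exact isPreconnected_connectedComponentIn
  -- If `f` were constant, its leaf would be all of `M`, and a defining function of `M` vanishes
  -- identically on an open set.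
  have hne : ∃ x, f x ≠ f p₀ := by
    by_contra! hcon
    have hS' : S = univ := by
      rw [hSl, leaf, show f ⁻¹' {f p₀} = univ from eq_univ_of_forall hcon,
        connectedComponentIn_univ]
      exact PreconnectedSpace.connectedComponent_eq_univ p₀
    obtain ⟨U, h, hU, H⟩ := hS p₀ hp₀
    refine H.regular p₀ hU ?_
    have : h =ᶠ[𝓝 p₀] fun _ ↦ 0 := by
      filter_upwards [H.isOpen.mem_nhds hU] with x hx
      exact (H.eq_zero_iff hx).2 (hS' ▸ mem_univ x)
    rw [mvfderiv_congr this, mvfderiv_const]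
  have hex : ∃ j, ∃ q ∈ S, ¬ VanishesToOrder m S f (f p₀) j q := by
    obtain ⟨U, h, hU, H⟩ := hS p₀ hp₀
    obtain ⟨j, hj⟩ := exists_not_vanishesToOrder hf.analytic hne H hp₀ hU
    exact ⟨j, p₀, hp₀, hj⟩
  classical
  obtain ⟨q₀, hq₀, hnq₀⟩ := Nat.find_spec hex
  have hmin : ∀ j < Nat.find hex, ∀ q ∈ S, VanishesToOrder m S f (f p₀) j q := by
    intro j hj q hq
    by_contra hcon
    exact Nat.find_min hex hj ⟨q, hq, hcon⟩
  -- Order `0` only expresses boundedness and always holds, so the first failing order is `k + 1`,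
  -- with `k` the largest order attained along all of `S`.
  obtain ⟨k, hk⟩ : ∃ k, Nat.find hex = k + 1 := by
    refine Nat.exists_eq_succ_of_ne_zero fun h0 ↦ hnq₀ ?_
    rw [h0]
    obtain ⟨U, h, hU, H⟩ := hS q₀ hq₀
    refine ⟨U, h, hU, H, ?_⟩
    simp only [pow_zero]
    have : ContinuousAt (fun x ↦ f x - f p₀) q₀ :=
      hf.analytic.continuous.continuousAt.sub continuousAt_const
    exact this.tendsto.isBigO_one ℝ
  rw [hk] at hnq₀ hmin
  have hloc := fun q hq ↦ vanishesToOrder_succ_or_exists_root (q := q) (k := k) hf hfc hS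
    (fun j hj ↦ hmin j (Nat.lt_succ_of_le hj)) hq
  -- `T₁` and `T₂` are open, cover `S` and do not meet on it. As `q₀` is not in `T₁`, connectedness
  -- excludes order `k + 1` at every point of `S`.
  set T₁ := {q | VanishesToOrder m S f (f p₀) (k + 1) q}
  set T₂ := {q | ∀ᶠ q' in 𝓝 q, q' ∈ S → ¬ VanishesToOrder m S f (f p₀) (k + 1) q'}
  have hT₁ : IsOpen T₁ := isOpen_iff_mem_nhds.2 fun q hq ↦ VanishesToOrder.eventually hq
  have hT₂ : IsOpen T₂ := isOpen_setOfPred_eventually_nhds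
  have hcov : S ⊆ T₁ ∪ T₂ := fun q hq ↦
    (hloc q hq).imp (fun h1 ↦ h1.self_of_nhds hq) fun h1 ↦ h1.2.1
  have hdisj : S ∩ (T₁ ∩ T₂) = ∅ := by
    refine eq_empty_of_forall_notMem fun q hq ↦ ?_
    have h2 : q ∈ T₂ := hq.2.2
    exact h2.self_of_nhds hq.1 hq.2.1
  have hST₂ : S ⊆ T₂ := (isPreconnected_iff_subset_of_disjoint.1 hpre T₁ T₂ hT₁ hT₂ hcov
    hdisj).resolve_left fun h1 ↦ hnq₀ (h1 hq₀)
  have hroot : ∀ q ∈ S, 1 ≤ k ∧ ∃ W g, q ∈ W ∧ IsLocalRoot (m := m) S f (f p₀) k W g := by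
    intro q hq
    rcases hloc q hq with h1 | h1
    · exact absurd (h1.self_of_nhds hq) ((hST₂ hq : ∀ᶠ q' in 𝓝 q, _).self_of_nhds hq)
    · exact ⟨h1.1, h1.2.2⟩
  exact ⟨k, (hroot q₀ hq₀).1, fun q hq ↦ (hroot q hq).2⟩

end Dichotomy

/-- With the discrete topology on `α`, local constancy along `S` is continuity. -/
lemma IsPreconnected.eq_of_eventually_eq {X α : Type*} [TopologicalSpace X] {S : Set X}
    (hS : IsPreconnected S) {η : X → α} (h : ∀ q ∈ S, ∀ᶠ x in 𝓝 q, x ∈ S → η x = η q) {x y : X}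
    (hx : x ∈ S) (hy : y ∈ S) : η x = η y := by
  let : TopologicalSpace α := ⊥
  have : DiscreteTopology α := ⟨rfl⟩
  refine hS.constant (fun q hq ↦ ?_) hx hy
  refine tendsto_nhds_of_eventually_eq ?_
  rw [eventually_nhdsWithin_iff]
  exact h q hq

/-! ### Change of sign of a defining function, and continuity along normal fields. -/

section Field

variable {n : ℕ} {M : Type*} [TopologicalSpace M] [ChartedSpace (𝔼 n) M]
  [RiemannianBundle (fun x : M ↦ TangentSpace (𝓡 n) x)]

lemma riemDiv_neg (X : (x : M) → TangentSpace (𝓡 n) x) (p : M) :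
    riemDiv n (fun x ↦ -X x) p = -riemDiv n X p := by
  have h1 : ∀ y i, coordComponents n (fun x ↦ -X x) p y i = -coordComponents n X p y i := by
    intro y i
    have : coordComponents n (fun x ↦ -X x) p y = -coordComponents n X p y :=
      map_neg (mfderiv (𝓡 n) 𝓘(ℝ, 𝔼 n) (extChartAt (𝓡 n) p) ((extChartAt (𝓡 n) p).symm y)) _
    rw [this]
    rfl
  simp only [riemDiv, h1, mul_neg]
  rw [← mul_neg, ← Finset.sum_neg_distrib]
  congr 1
  refine Finset.sum_congr rfl fun i _ ↦ ?_
  rw [fderiv_fun_neg]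
  rfl

lemma grad_neg (g : M → ℝ) (x : M) : grad n (fun y ↦ -g y) x = -grad n g x := by
  rw [grad, mvfderiv_fun_neg, map_neg]
  rfl

lemma unitGrad_neg (g : M → ℝ) (x : M) : unitGrad n (fun y ↦ -g y) x = -unitGrad n g x := by
  rw [unitGrad, grad_neg, norm_neg, smul_neg]
  rfl

lemma unitGrad_congr {g g' : M → ℝ} {x : M} (h : g =ᶠ[𝓝 x] g') :
    unitGrad n g x = unitGrad n g' x := by
  rw [unitGrad, unitGrad, grad_congr h]

lemma riemDiv_unitGrad_congr {g g' : M → ℝ} {x : M} (h : g =ᶠ[𝓝 x] g') :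
    riemDiv n (unitGrad n g) x = riemDiv n (unitGrad n g') x :=
  riemDiv_congr (h.eventuallyEq_nhds.mono fun _ hy ↦ unitGrad_congr hy)

lemma riemDiv_unitGrad_neg (g : M → ℝ) (x : M) :
    riemDiv n (unitGrad n fun y ↦ -g y) x = -riemDiv n (unitGrad n g) x := by
  rw [← riemDiv_neg]
  exact riemDiv_congr (.of_forall fun y ↦ unitGrad_neg g y)

lemma norm_unitGrad {g : M → ℝ} {x : M} (h : mvfderiv (𝓡 n) g x ≠ 0) : ‖unitGrad n g x‖ = 1 := by
  have h1 : ‖grad n g x‖ ≠ 0 := norm_ne_zero_iff.2 (grad_ne_zero_iff.2 h)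
  rw [unitGrad, norm_smul, norm_inv, norm_norm, inv_mul_cancel₀ h1]

lemma IsLocalDefiningFunction.neg {S U : Set M} {g : M → ℝ}
    (G : IsLocalDefiningFunction n S U g) : IsLocalDefiningFunction n S U fun x ↦ -g x where
  isOpen := G.isOpen
  smooth := G.smooth.neg
  zeroSet := by simpa only [neg_eq_zero] using G.zeroSet
  regular := fun x hx ↦ by
    rw [mvfderiv_fun_neg]
    exact neg_ne_zero.2 (G.regular x hx)

variable [IsManifold (𝓡 n) ω M]
  [IsContMDiffRiemannianBundle (𝓡 n) ω (𝔼 n) (fun x : M ↦ TangentSpace (𝓡 n) x)]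

/-- This pairing is the fibre component of the tangent map of `g` along `ν`. Its sign will tell
which of the two unit normals `ν` follows. -/
lemma continuousWithinAt_mvfderiv_apply {g : M → ℝ} {W A : Set M} (hW : IsOpen W)
    (hg : ContMDiffOn (𝓡 n) 𝓘(ℝ, ℝ) ∞ g W) {ν : (x : M) → TangentSpace (𝓡 n) x}
    {p : M} (hp : p ∈ W)
    (hν : ContinuousWithinAt (fun x ↦ (⟨x, ν x⟩ : TangentBundle (𝓡 n) M)) A p) :
    ContinuousWithinAt (fun x ↦ mvfderiv (𝓡 n) g x (ν x)) A p := by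
  have h1 := hg.continuousOn_tangentMapWithin (by simp) hW.uniqueMDiffOn
  have hopen : IsOpen (Bundle.TotalSpace.proj ⁻¹' W : Set (TangentBundle (𝓡 n) M)) :=
    hW.preimage (FiberBundle.continuous_proj _ _)
  have h2 : ContinuousAt (tangentMapWithin (𝓡 n) 𝓘(ℝ, ℝ) g W)
      (⟨p, ν p⟩ : TangentBundle (𝓡 n) M) := h1.continuousAt (hopen.mem_nhds hp)
  have h3 : ContinuousWithinAt (fun x ↦ tangentBundleModelSpaceHomeomorph 𝓘(ℝ, ℝ)
      (tangentMapWithin (𝓡 n) 𝓘(ℝ, ℝ) g W (⟨x, ν x⟩ : TangentBundle (𝓡 n) M))) A p :=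
    (tangentBundleModelSpaceHomeomorph 𝓘(ℝ, ℝ)).continuous.continuousAt.comp_continuousWithinAt
      (ContinuousAt.comp_continuousWithinAt (x := p)
        (f := fun x ↦ (⟨x, ν x⟩ : TangentBundle (𝓡 n) M)) h2 hν)
  have h4 : ContinuousWithinAt (fun x ↦ (tangentBundleModelSpaceHomeomorph 𝓘(ℝ, ℝ)
      (tangentMapWithin (𝓡 n) 𝓘(ℝ, ℝ) g W (⟨x, ν x⟩ : TangentBundle (𝓡 n) M))).2) A p :=
    (continuous_snd (X := ℝ) (Y := ℝ)).continuousAt.comp_continuousWithinAt h3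
  have key : ∀ x ∈ W, mvfderiv (𝓡 n) g x (ν x) = (tangentBundleModelSpaceHomeomorph 𝓘(ℝ, ℝ)
      (tangentMapWithin (𝓡 n) 𝓘(ℝ, ℝ) g W (⟨x, ν x⟩ : TangentBundle (𝓡 n) M))).2 := by
    intro x hx
    rw [tangentBundleModelSpaceHomeomorph_coe]
    change _ = mfderivWithin (𝓡 n) 𝓘(ℝ, ℝ) g W x (ν x)
    rw [mfderivWithin_of_isOpen hW hx]
    rfl
  refine h4.congr_of_eventuallyEq ?_ (key p hp)
  exact nhdsWithin_le_nhds ((hW.eventually_mem hp).mono key)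

end Field

/-! ### Uniqueness of local roots and of unit normals up to sign. -/

section NormalField

variable {m : ℕ} {M : Type*} [TopologicalSpace M] [ChartedSpace (𝔼 (m + 1)) M]
  [RiemannianBundle (fun x : M ↦ TangentSpace (𝓡 (m + 1)) x)] [IsManifold (𝓡 (m + 1)) ω M]
  [IsContMDiffRiemannianBundle (𝓡 (m + 1)) ω (𝔼 (m + 1))
    (fun x : M ↦ TangentSpace (𝓡 (m + 1)) x)]
  {S U W W' : Set M} {f g g' h : M → ℝ} {c : ℝ} {k : ℕ} {p q : M}

/-- Once `s` is straightened, the complement of its zero set is dense near `q`. There `d` vanishes,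
and by continuity it vanishes everywhere near `q`. -/
lemma eventually_eq_zero_of_mul_eq_zero {s d : M → ℝ} (hU : IsOpen U) (hq : q ∈ U)
    (hs : ContMDiffOn (𝓡 (m + 1)) 𝓘(ℝ, ℝ) ∞ s U) (hd : ContinuousOn d U) (hs0 : s q = 0)
    (hsq : mvfderiv (𝓡 (m + 1)) s q ≠ 0) (hsd : ∀ x ∈ U, s x * d x = 0) :
    ∀ᶠ x in 𝓝 q, d x = 0 := by
  obtain ⟨i, e, δ, he, hes⟩ := exists_isAdaptedChart hU hq hs hs0 hsq
  filter_upwards [e.open_source.mem_nhds he.mem] with x hx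
  by_cases hsx : s x = 0
  · have hxt := e.map_source hx
    have hex : e x = (0, (e x).2) := by rw [he.apply x hx, hsx]
    rw [hex] at hxt
    have hcurve : Tendsto (fun r : ℝ ↦ (r, (e x).2)) (𝓝 0) (𝓝 (0, (e x).2)) :=
      (show Continuous fun r : ℝ ↦ (r, (e x).2) by fun_prop).tendsto 0
    have hc : ContinuousAt (fun r : ℝ ↦ d (e.symm (r, (e x).2))) 0 := by
      have h1 : ContinuousAt d (e.symm (0, (e x).2)) :=
        hd.continuousAt (hU.mem_nhds (hes (e.map_target hxt)))
      have h2 : ContinuousAt e.symm (0, (e x).2) :=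
        e.continuousOn_symm.continuousAt (e.open_target.mem_nhds hxt)
      exact h1.tendsto.comp (h2.tendsto.comp hcurve)
    have h3 : d (e.symm (0, (e x).2)) = 0 := eq_of_eventually_punctured hc (continuousAt_const (y := (0 : ℝ))) (by
      filter_upwards [nhdsWithin_le_nhds (hcurve.eventually (e.open_target.mem_nhds hxt)),
        eventually_mem_nhdsWithin] with r hr hr0
      refine (mul_eq_zero.1 (hsd _ (hes (e.map_target hr)))).resolve_left ?_
      rw [he.apply_symm hr]
      exact hr0)
    rwa [← hex, e.left_inv hx] at h3
  · exact (mul_eq_zero.1 (hsd x (hes hx))).resolve_left hsx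

namespace IsLocalRoot

lemma abs_pow (G : IsLocalRoot (m := m) S f c k W g) {x : M} (hx : x ∈ W) :
    |f x - c| = |g x| ^ k := by
  obtain ⟨-, σ, hσ, h⟩ := G
  have : |σ| = 1 := by rcases hσ with h1 | h1 <;> rw [h1] <;> norm_num
  rw [h x hx, abs_mul, this, one_mul, _root_.abs_pow]

lemma neg (G : IsLocalRoot (m := m) S f c k W g) :
    IsLocalRoot (m := m) S f c k W fun x ↦ -g x := by
  obtain ⟨G, σ, hσ, h⟩ := G
  refine ⟨G.neg, σ * (-1) ^ k, ?_, fun x hx ↦ ?_⟩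
  · rcases neg_one_pow_eq_or ℝ k with h1 | h1 <;> rcases hσ with h2 | h2 <;> rw [h1, h2] <;> norm_num
  · rw [h x hx, neg_pow (g x), ← mul_assoc, mul_assoc σ, ← mul_pow]
    norm_num

lemma mono (G : IsLocalRoot (m := m) S f c k W g) (hW' : IsOpen W') (h : W' ⊆ W) :
    IsLocalRoot (m := m) S f c k W' g :=
  ⟨G.1.mono hW' h, G.2.choose, G.2.choose_spec.1, fun x hx ↦ G.2.choose_spec.2 x (h hx)⟩

/-- Local roots of `f - c` are unique up to sign. -/
lemma eventually_eq_or_neg (hk : 1 ≤ k) (G : IsLocalRoot (m := m) S f c k W g)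
    (G' : IsLocalRoot (m := m) S f c k W' g') (hqW : q ∈ W) (hqW' : q ∈ W') (hq : q ∈ S) :
    g' =ᶠ[𝓝 q] g ∨ g' =ᶠ[𝓝 q] fun x ↦ -g x := by
  have hUo : IsOpen (W ∩ W') := G.1.isOpen.inter G'.1.isOpen
  have hU : q ∈ W ∩ W' := ⟨hqW, hqW'⟩
  have hgs := G.1.smooth.mono (inter_subset_left (t := W'))
  have hgs' := G'.1.smooth.mono (inter_subset_right (s := W))
  have h0 := (G.1.eq_zero_iff hqW).2 hq
  have h0' := (G'.1.eq_zero_iff hqW').2 hq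
  have habs : ∀ x ∈ W ∩ W', |g' x| = |g x| := fun x hx ↦ by
    have h1 := (G.abs_pow hx.1).symm.trans (G'.abs_pow hx.2)
    exact ((pow_left_inj₀ (abs_nonneg _) (abs_nonneg _) (by omega)).1 h1).symm
  -- The squares of `g` and `g'` agree. The sum and the difference cannot both have zero
  -- differential at `q`, so one factor is regular and the other vanishes identically near `q`.
  have hmul : ∀ x ∈ W ∩ W', (g' x + g x) * (g' x - g x) = 0 := fun x hx ↦ by
    have := congrArg (· ^ 2) (habs x hx)
    simp only [sq_abs] at this
    linear_combination this
  have hmd : ∀ {a : M → ℝ}, ContMDiffOn (𝓡 (m + 1)) 𝓘(ℝ, ℝ) ∞ a (W ∩ W') →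
      MDifferentiableAt (𝓡 (m + 1)) 𝓘(ℝ, ℝ) a q := fun ha ↦
    (ha.contMDiffAt (hUo.mem_nhds hU)).mdifferentiableAt (by simp)
  by_cases hs : mvfderiv (𝓡 (m + 1)) (fun x ↦ g' x + g x) q = 0
  · right
    have hd : mvfderiv (𝓡 (m + 1)) (fun x ↦ g' x - g x) q ≠ 0 := by
      intro hd
      rw [mvfderiv_fun_add (hmd hgs') (hmd hgs)] at hs
      rw [mvfderiv_fun_sub (hmd hgs') (hmd hgs), sub_eq_zero] at hd
      rw [hd, ← two_smul ℝ, smul_eq_zero] at hs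
      exact G.1.regular q hqW (hs.resolve_left (by norm_num))
    have := eventually_eq_zero_of_mul_eq_zero hUo hU (hgs'.sub hgs)
      (hgs'.add hgs).continuousOn (by simp [h0, h0']) hd
      (fun x hx ↦ by rw [mul_comm]; exact hmul x hx)
    exact this.mono fun x hx ↦ eq_neg_of_add_eq_zero_left hx
  · left
    have := eventually_eq_zero_of_mul_eq_zero hUo hU (hgs'.add hgs)
      (hgs'.sub hgs).continuousOn (by simp [h0, h0']) hs hmul
    exact this.mono fun x hx ↦ sub_eq_zero.1 hx

lemma eventually_riemDiv_eq (hf : IsEquilibriumFunction (m + 1) f) (hk : 1 ≤ k)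
    (G : IsLocalRoot (m := m) S f c k W g) (hqW : q ∈ W) (hq : q ∈ S) :
    ∀ᶠ x in 𝓝 q, x ∈ S → riemDiv (m + 1) (unitGrad (m + 1) g) x =
      riemDiv (m + 1) (unitGrad (m + 1) g) q := by
  obtain ⟨G, σ, hσ, hfg⟩ := G
  have hσ0 : σ ≠ 0 := by rcases hσ with h1 | h1 <;> rw [h1] <;> norm_num
  obtain ⟨W', hW'o, hq', hW', h⟩ := exists_open_forall_unitGrad_const hf G.isOpen hqW G.smooth
    ((G.eq_zero_iff hqW).2 hq) G.regular hσ0 hk hfg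
  filter_upwards [hW'o.mem_nhds hq'] with x hx hxS
  exact (h x hx ((G.eq_zero_iff (hW' hx)).2 hxS)).2

end IsLocalRoot

/-- The divergence of the unit gradient of the local roots is constant up to sign. -/
lemma exists_forall_riemDiv_eq (hf : IsEquilibriumFunction (m + 1) f) (hk : 1 ≤ k)
    (hS : IsPreconnected S)
    (hroot : ∀ q ∈ S, ∃ W g, q ∈ W ∧ IsLocalRoot (m := m) S f c k W g) :
    ∃ H : ℝ, ∀ q ∈ S, ∀ W g, q ∈ W → IsLocalRoot (m := m) S f c k W g →
      riemDiv (m + 1) (unitGrad (m + 1) g) q = H ∨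
      riemDiv (m + 1) (unitGrad (m + 1) g) q = -H := by
  choose! W g hqW G using hroot
  -- Changing the sign of a root changes the sign of the divergence, so its absolute value is a
  -- well-defined function on `S`; it is locally constant.
  have huniq : ∀ q ∈ S, ∀ W' g', q ∈ W' → IsLocalRoot (m := m) S f c k W' g' →
      |riemDiv (m + 1) (unitGrad (m + 1) g') q| = |riemDiv (m + 1) (unitGrad (m + 1) (g q)) q| := by
    intro q hq W' g' hq' G'
    rcases (G q hq).eventually_eq_or_neg hk G' (hqW q hq) hq' hq with h1 | h1
    · rw [riemDiv_unitGrad_congr h1]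
    · rw [riemDiv_unitGrad_congr h1, riemDiv_unitGrad_neg, abs_neg]
  have hloc : ∀ q ∈ S, ∀ᶠ x in 𝓝 q, x ∈ S → |riemDiv (m + 1) (unitGrad (m + 1) (g x)) x| =
      |riemDiv (m + 1) (unitGrad (m + 1) (g q)) q| := by
    intro q hq
    filter_upwards [(G q hq).eventually_riemDiv_eq hf hk (hqW q hq) hq,
      (G q hq).1.isOpen.mem_nhds (hqW q hq)] with x hx hxW hxS
    rw [← huniq x hxS _ _ hxW (G q hq), hx hxS]
  rcases S.eq_empty_or_nonempty with rfl | ⟨q₀, hq₀⟩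
  · exact ⟨0, fun q hq ↦ absurd hq (notMem_empty q)⟩
  refine ⟨riemDiv (m + 1) (unitGrad (m + 1) (g q₀)) q₀, fun q hq W' g' hq' G' ↦ ?_⟩
  rw [← abs_eq_abs, huniq q hq W' g' hq' G']
  exact hS.eq_of_eventually_eq
    (η := fun x ↦ |riemDiv (m + 1) (unitGrad (m + 1) (g x)) x|) hloc hq hq₀

/-- The unit gradients of two local defining functions agree up to sign. -/
lemma IsLocalDefiningFunction.unitGrad_eq_or_neg (H : IsLocalDefiningFunction (m + 1) S U h)
    (G : IsLocalDefiningFunction (m + 1) S W g) (hpU : p ∈ U) (hpW : p ∈ W) (hp : p ∈ S) :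
    unitGrad (m + 1) g p = unitGrad (m + 1) h p ∨ unitGrad (m + 1) g p = -unitGrad (m + 1) h p := by
  set κ := extChartAt (𝓡 (m + 1)) p
  have hps : p ∈ κ.source := mem_extChartAt_source p
  have hpt := κ.map_source hps
  have hsymm : κ.symm (κ p) = p := κ.left_inv hps
  have hO : g =O[𝓝 p] h := by
    refine H.isBigO hp hpU ((G.contMDiffAt hpW).of_le (by simp)) ?_
    filter_upwards [G.isOpen.mem_nhds hpW] with x hx hxS
    exact (G.eq_zero_iff hx).2 hxS
  have htend : Tendsto κ.symm (𝓝 (κ p)) (𝓝 p) := by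
    have := (continuousAt_symm hpt).tendsto
    rwa [hsymm] at this
  have hd : ∀ {a : M → ℝ}, ContMDiffAt (𝓡 (m + 1)) 𝓘(ℝ, ℝ) ∞ a p →
      MDifferentiableAt (𝓡 (m + 1)) 𝓘(ℝ, ℝ) a (κ.symm (κ p)) := fun ha ↦ by
    rw [hsymm]; exact ha.mdifferentiableAt (by simp)
  have hd' : ∀ {a : M → ℝ}, ContMDiffAt (𝓡 (m + 1)) 𝓘(ℝ, ℝ) ∞ a p →
      DifferentiableAt ℝ (a ∘ κ.symm) (κ p) := fun ha ↦ by
    rw [← hsymm] at ha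
    exact (contDiffAt_comp_symm hpt ha).differentiableAt (by simp)
  -- `g = O(h)` at `p`, so a direction in which `h` has zero derivative is one for `g`. With the
  -- kernel of `dh` contained in that of `dg`, the gradients are parallel.
  have hker : ∀ w, fderiv ℝ (h ∘ κ.symm) (κ p) w = 0 → fderiv ℝ (g ∘ κ.symm) (κ p) w = 0 := by
    intro w hw
    have hL : HasDerivAt (fun t : ℝ ↦ κ p + t • w) w 0 := by
      simpa using ((hasDerivAt_id (0 : ℝ)).smul_const w).const_add (κ p)
    have hL0 : κ p + (0 : ℝ) • w = κ p := by simp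
    have key : ∀ {a : M → ℝ}, ContMDiffAt (𝓡 (m + 1)) 𝓘(ℝ, ℝ) ∞ a p →
        HasDerivAt (fun t : ℝ ↦ (a ∘ κ.symm) (κ p + t • w)) (fderiv ℝ (a ∘ κ.symm) (κ p) w) 0 := by
      intro a ha
      have h1 := (hd' ha).hasFDerivAt
      rw [← hL0] at h1
      have h2 := h1.comp_hasDerivAt (0 : ℝ) hL
      rw [hL0] at h2
      exact h2
    have h1 := key (H.contMDiffAt hpU)
    have h2 := key (G.contMDiffAt hpW)
    rw [hw, hasDerivAt_iff_isLittleO_nhds_zero] at h1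
    have h3 : Tendsto (fun t : ℝ ↦ κ.symm (κ p + t • w)) (𝓝 0) (𝓝 p) := by
      have h4 := hL.continuousAt.tendsto
      rw [hL0] at h4
      exact htend.comp h4
    have h4 := hO.comp_tendsto h3
    have e1 : (h ∘ κ.symm) (κ p) = 0 := by
      simp only [Function.comp, hsymm]; exact (H.eq_zero_iff hpU).2 hp
    have e2 : (g ∘ κ.symm) (κ p) = 0 := by
      simp only [Function.comp, hsymm]; exact (G.eq_zero_iff hpW).2 hp
    have h5 : HasDerivAt (fun t : ℝ ↦ (g ∘ κ.symm) (κ p + t • w)) 0 0 := by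
      rw [hasDerivAt_iff_isLittleO_nhds_zero]
      simp only [hL0, zero_add, smul_zero, sub_zero, e1, e2] at h1 ⊢
      exact h4.trans_isLittleO h1
    exact h2.unique h5
  have hker' : ∀ v : TangentSpace (𝓡 (m + 1)) (κ.symm (κ p)),
      inner ℝ (grad (m + 1) h (κ.symm (κ p))) v = 0 →
      inner ℝ (grad (m + 1) g (κ.symm (κ p))) v = 0 := by
    intro v hv
    rw [inner_grad, ← coordDeriv_chartDeriv hpt v, mvfderiv_coordDeriv hpt] at hv ⊢
    · exact hker _ hv
    · exact hd (G.contMDiffAt hpW)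
    · exact hd (H.contMDiffAt hpU)
  rw [hsymm] at hker'
  have hX : grad (m + 1) h p ≠ 0 := grad_ne_zero_iff.2 (H.regular p hpU)
  have hY : grad (m + 1) g p ≠ 0 := grad_ne_zero_iff.2 (G.regular p hpW)
  simp only [unitGrad]
  generalize grad (m + 1) h p = X at hX hker'
  generalize grad (m + 1) g p = Y at hY hker'
  have hXX : inner ℝ X X ≠ (0 : ℝ) := inner_self_ne_zero.2 hX
  set μ : ℝ := inner ℝ X Y / inner ℝ X X with hμ
  have hX0 : inner ℝ X (Y - μ • X) = (0 : ℝ) := by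
    rw [inner_sub_right, inner_smul_right, hμ, div_mul_cancel₀ _ hXX, sub_self]
  have hY0 := hker' _ hX0
  have hv : Y - μ • X = 0 := by
    rw [← inner_self_eq_zero (𝕜 := ℝ)]
    rw [inner_sub_left, inner_smul_left, hX0, hY0]
    simp
  have hYX : Y = μ • X := sub_eq_zero.1 hv
  have hμ0 : μ ≠ 0 := by
    rintro h0
    rw [h0, zero_smul] at hYX
    exact hY hYX
  rw [hYX, norm_smul, mul_inv, smul_smul, mul_right_comm, ← smul_smul]
  rcases lt_or_gt_of_ne hμ0 with h1 | h1
  · right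
    rw [Real.norm_of_nonpos h1.le, inv_neg, neg_mul, inv_mul_cancel₀ hμ0, neg_one_smul]
  · left
    rw [Real.norm_of_nonneg h1.le, inv_mul_cancel₀ hμ0, one_smul]

end NormalField

/-! ### Constant mean curvature. -/

section ConstantMeanCurvature

variable {m : ℕ} {M : Type*} [TopologicalSpace M] [ChartedSpace (𝔼 (m + 1)) M]
  [RiemannianBundle (fun x : M ↦ TangentSpace (𝓡 (m + 1)) x)] [IsManifold (𝓡 (m + 1)) ω M]
  [IsContMDiffRiemannianBundle (𝓡 (m + 1)) ω (𝔼 (m + 1))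
    (fun x : M ↦ TangentSpace (𝓡 (m + 1)) x)]
  {S W W' : Set M} {f g g' : M → ℝ} {c : ℝ} {k : ℕ} {p q : M}

lemma mvfderiv_unitGrad {x : M} (h : mvfderiv (𝓡 (m + 1)) g x ≠ 0) :
    0 < mvfderiv (𝓡 (m + 1)) g x (unitGrad (m + 1) g x) := by
  rw [← inner_grad, unitGrad, inner_smul_right, real_inner_self_eq_norm_sq]
  have h1 : 0 < ‖grad (m + 1) g x‖ := norm_pos_iff.2 (grad_ne_zero_iff.2 h)
  generalize ‖grad (m + 1) g x‖ = t at h1 ⊢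
  positivity

/-- An unit normal vector is the unit gradient of a local root. -/
lemma exists_isLocalRoot_unitGrad_eq (hp : p ∈ S)
    (hroot : ∃ W g, p ∈ W ∧ IsLocalRoot (m := m) S f c k W g) {v : TangentSpace (𝓡 (m + 1)) p}
    (hv : IsUnitNormal (m + 1) S p v) :
    ∃ W g, p ∈ W ∧ IsLocalRoot (m := m) S f c k W g ∧ unitGrad (m + 1) g p = v := by
  obtain ⟨W, g, hpW, G⟩ := hroot
  obtain ⟨U, h, hpU, H, rfl⟩ := hv
  rcases H.unitGrad_eq_or_neg G.1 hpU hpW hp with h1 | h1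
  · exact ⟨W, g, hpW, G, h1⟩
  · refine ⟨W, fun x ↦ -g x, hpW, G.neg, ?_⟩
    rw [unitGrad_neg, h1, neg_neg]

/-- The roots agree up to sign, and the minus sign would make a unit vector equal to its opposite.
-/
lemma IsLocalRoot.eventually_eq_of_unitGrad_eq (hk : 1 ≤ k)
    (G : IsLocalRoot (m := m) S f c k W g) (G' : IsLocalRoot (m := m) S f c k W' g')
    (hqW : q ∈ W) (hqW' : q ∈ W') (hq : q ∈ S)
    (h : unitGrad (m + 1) g' q = unitGrad (m + 1) g q) : g' =ᶠ[𝓝 q] g := by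
  refine (G.eventually_eq_or_neg hk G' hqW hqW' hq).resolve_right fun h1 ↦ ?_
  rw [unitGrad_congr h1, unitGrad_neg] at h
  have h2 := norm_unitGrad (G.1.regular q hqW)
  have h3 : unitGrad (m + 1) g q = 0 := by
    have h4 : (2 : ℝ) • unitGrad (m + 1) g q = 0 := by
      rw [two_smul]
      nth_rw 1 [← h]
      exact neg_add_cancel _
    exact (smul_eq_zero.1 h4).resolve_left two_ne_zero
  rw [h3, norm_zero] at h2
  exact zero_ne_one h2

/-- At each point of `A` the unit gradient is `ν` or `-ν`. The sign is that of `dg(ν)`, which is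
continuous along `A` and positive at `p`. -/
lemma IsLocalRoot.eventually_unitGrad_eq (G : IsLocalRoot (m := m) S f c k W g) {A : Set M}
    (hAS : A ⊆ S) {ν : (x : M) → TangentSpace (𝓡 (m + 1)) x} (hpW : p ∈ W)
    (hν : ContinuousWithinAt (fun x ↦ (⟨x, ν x⟩ : TangentBundle (𝓡 (m + 1)) M)) A p)
    (hn : ∀ x ∈ A, IsUnitNormal (m + 1) S x (ν x)) (hgp : unitGrad (m + 1) g p = ν p) :
    ∀ᶠ x in 𝓝 p, x ∈ A → unitGrad (m + 1) g x = ν x := by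
  have h1 := continuousWithinAt_mvfderiv_apply G.1.isOpen G.1.smooth hpW hν
  have h2 : 0 < mvfderiv (𝓡 (m + 1)) g p (ν p) := by
    rw [← hgp]
    exact mvfderiv_unitGrad (G.1.regular p hpW)
  have h3 := eventually_nhdsWithin_iff.1 (h1.eventually (lt_mem_nhds h2))
  filter_upwards [h3, G.1.isOpen.mem_nhds hpW] with x hx hxW hxA
  obtain ⟨U, h, hxU, H, hh⟩ := hn x hxA
  rcases H.unitGrad_eq_or_neg G.1 hxU hxW (hAS hxA) with h4 | h4
  · rw [h4, hh]
  · exfalso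
    have h5 := hx hxA
    rw [← hh, ← neg_neg (unitGrad (m + 1) h x), ← h4, map_neg] at h5
    have h6 := mvfderiv_unitGrad (G.1.regular x hxW)
    linarith

/-- At each point of `A` the root oriented by `ν` witnesses the mean curvature. At nearby points the
oriented roots have the same germ, so the value is locally constant along `A`; up to sign it is the
constant of `exists_forall_riemDiv_eq`, which does not depend on `A`. -/
theorem hasConstantMeanCurvature_of_isLocalRoot (hf : IsEquilibriumFunction (m + 1) f) (hk : 1 ≤ k)
    (hS : IsPreconnected S)
    (hroot : ∀ q ∈ S, ∃ W g, q ∈ W ∧ IsLocalRoot (m := m) S f c k W g) :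
    HasConstantMeanCurvature (m + 1) S := by
  obtain ⟨H, hH⟩ := exists_forall_riemDiv_eq hf hk hS hroot
  refine ⟨H, fun A hAS hA ν hν hn ↦ ?_⟩
  choose! W g hpW G hg using fun p (hp : p ∈ A) ↦
    exists_isLocalRoot_unitGrad_eq (hAS hp) (hroot p (hAS hp)) (hn p hp)
  have hmc : ∀ p ∈ A, HasMeanCurvature (m + 1) S p (ν p)
      (riemDiv (m + 1) (unitGrad (m + 1) (g p)) p) := fun p hp ↦
    ⟨W p, g p, hpW p hp, (G p hp).1, hg p hp, rfl⟩
  have hloc : ∀ p ∈ A, ∀ᶠ x in 𝓝 p, x ∈ A → riemDiv (m + 1) (unitGrad (m + 1) (g x)) x =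
      riemDiv (m + 1) (unitGrad (m + 1) (g p)) p := by
    intro p hp
    filter_upwards [(G p hp).eventually_unitGrad_eq hAS (hpW p hp) (hν p hp) hn (hg p hp),
      (G p hp).eventually_riemDiv_eq hf hk (hpW p hp) (hAS hp),
      (G p hp).1.isOpen.mem_nhds (hpW p hp)] with x hx1 hx2 hx3 hxA
    rw [← hx2 (hAS hxA)]
    refine riemDiv_unitGrad_congr ((G p hp).eventually_eq_of_unitGrad_eq hk (G x hxA) hx3
      (hpW x hxA) (hAS hxA) ?_)
    rw [hg x hxA, hx1 hxA]
  rcases A.eq_empty_or_nonempty with rfl | ⟨p₀, hp₀⟩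
  · exact Or.inl fun p hp ↦ absurd hp (notMem_empty p)
  have hconst : ∀ p ∈ A, riemDiv (m + 1) (unitGrad (m + 1) (g p)) p =
      riemDiv (m + 1) (unitGrad (m + 1) (g p₀)) p₀ := fun p hp ↦
    hA.eq_of_eventually_eq (η := fun x ↦ riemDiv (m + 1) (unitGrad (m + 1) (g x)) x) hloc hp hp₀
  rcases hH p₀ (hAS hp₀) _ _ (hpW p₀ hp₀) (G p₀ hp₀) with h1 | h1
  · left
    intro p hp
    rw [← h1, ← hconst p hp]
    exact hmc p hp
  · right
    intro p hp
    rw [← h1, ← hconst p hp]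
    exact hmc p hp

end ConstantMeanCurvature

/-! ### Smooth dependence of integrals on parameters. -/

section ParametricIntegral

variable {P E : Type*} [NormedAddCommGroup P] [NormedSpace ℝ P] [NormedAddCommGroup E]
  [NormedSpace ℝ E] [FiniteDimensional ℝ E] [MeasurableSpace E] [BorelSpace E]
  {μ : Measure E} [μ.IsAddHaarMeasure]

/-- Integrals of smooth functions with support in a fixed compact set depend smoothly on
parameters. -/
lemma contDiffOn_integral_of_compact {s : Set P} (hs : IsOpen s) {k : Set E} (hk : IsCompact k)
    {g : P → E → ℝ} (h0 : ∀ p x, p ∈ s → x ∉ k → g p x = 0)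
    (hg : ContDiffOn ℝ ∞ (fun q : P × E ↦ g q.1 q.2) (s ×ˢ univ)) :
    ContDiffOn ℝ ∞ (fun p ↦ ∫ x, g p x ∂μ) s := by
  -- The integral is the value at the origin of a convolution with the constant `1`.
  have hu := contDiffOn_convolution_right_with_param_comp (μ := μ)
    (ContinuousLinearMap.mul ℝ ℝ)
    (v := fun _ : P ↦ (0 : E)) contDiffOn_const (f := fun _ : E ↦ (1 : ℝ)) (g := g) (n := ⊤)
    (k := k) hs hk h0 (continuous_const.locallyIntegrable) hg
  refine hu.congr fun p _ ↦ ?_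
  rw [MeasureTheory.convolution]
  simp only [ContinuousLinearMap.mul_apply', one_mul]
  rw [integral_sub_left_eq_self (g p) μ 0]

end ParametricIntegral

/-! ### The divergence theorem on either side of a graph. -/

section GraphFlux

variable {m : ℕ} {w : 𝔼 m → ℝ}

/-- The shear `(r, x) ↦ (w x + r, x)`. -/
def graphShear (hw : Continuous w) : (ℝ × 𝔼 m) ≃ₜ (ℝ × 𝔼 m) where
  toFun q := (w q.2 + q.1, q.2)
  invFun q := (q.1 - w q.2, q.2)
  left_inv q := by simp
  right_inv q := by simp
  continuous_toFun := by fun_prop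
  continuous_invFun := by fun_prop

lemma measurePreserving_graphShear (hw : Continuous w) :
    MeasurePreserving (graphShear hw) (volume : Measure (ℝ × 𝔼 m)) volume := by
  have h1 : MeasurePreserving (fun q : 𝔼 m × ℝ ↦ (q.1, w q.1 + q.2))
      (volume.prod volume) (volume.prod volume) :=
    (MeasurePreserving.id (volume : Measure (𝔼 m))).skew_product
      (g := fun x r ↦ w x + r) (by fun_prop)
      (Eventually.of_forall fun x ↦ (measurePreserving_add_left volume (w x)).map_eq)
  have h2 := (Measure.measurePreserving_swap (μ := (volume : Measure (𝔼 m)))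
    (ν := (volume : Measure ℝ))).comp
      (h1.comp (Measure.measurePreserving_swap (μ := (volume : Measure ℝ))
        (ν := (volume : Measure (𝔼 m)))))
  exact h2

lemma integral_fderiv_apply_eq_zero {B : 𝔼 m → ℝ} (hB : ContDiff ℝ 1 B)
    (hBs : HasCompactSupport B) (v : 𝔼 m) : ∫ x, fderiv ℝ B x v = 0 := by
  have hc : Continuous fun x ↦ fderiv ℝ B x v := hB.continuous_fderiv_apply (by simp) |>.comp
    (continuous_id.prodMk continuous_const)
  have hi : Integrable fun x ↦ fderiv ℝ B x v :=
    hc.integrable_of_hasCompactSupport (hBs.fderiv_apply ℝ v)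
  have := integral_mul_fderiv_eq_neg_fderiv_mul_of_integrable (μ := (volume : Measure (𝔼 m)))
    (f := fun _ ↦ (1 : ℝ)) (g := B) (v := v) (by simp) (by simpa using hi)
    (by simpa using hB.continuous.integrable_of_hasCompactSupport hBs) (fun x _ ↦ by fun_prop)
    (fun x _ ↦ hB.differentiable (by simp) x)
  simpa using this

variable {V₀ : ℝ × 𝔼 m → ℝ} {V : Fin m → ℝ × 𝔼 m → ℝ}

/-- The divergence theorem below the graph of a function on Euclidean space. -/
lemma integral_subgraph_div (hw : ContDiff ℝ 1 w) (hV₀ : ContDiff ℝ 1 V₀)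
    (hV₀s : HasCompactSupport V₀) (hV : ∀ j, ContDiff ℝ 1 (V j))
    (hVs : ∀ j, HasCompactSupport (V j)) :
    ∫ q in {q : ℝ × 𝔼 m | q.1 < w q.2}, (fderiv ℝ V₀ q (1, 0) +
        ∑ j, fderiv ℝ (V j) q (0, EuclideanSpace.single j 1)) =
      ∫ x, (V₀ (w x, x) - ∑ j, fderiv ℝ w x (EuclideanSpace.single j 1) * V j (w x, x)) := by
  set Θ := graphShear hw.continuous with hΘ
  have hΘd : ContDiff ℝ 1 Θ := (hw.comp contDiff_snd |>.add contDiff_fst).prodMk contDiff_snd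
  have hΘ' : ∀ q, HasFDerivAt Θ ((((fderiv ℝ w q.2).comp (ContinuousLinearMap.snd ℝ ℝ (𝔼 m))) +
      ContinuousLinearMap.fst ℝ ℝ (𝔼 m)).prod (ContinuousLinearMap.snd ℝ ℝ (𝔼 m))) q := fun q ↦
    ((((hw.differentiable (by simp) q.2).hasFDerivAt.comp q hasFDerivAt_snd).add
      hasFDerivAt_fst).prodMk hasFDerivAt_snd)
  have hcomp : ∀ {U : ℝ × 𝔼 m → ℝ}, ContDiff ℝ 1 U → ∀ q v, fderiv ℝ (U ∘ Θ) q v =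
      fderiv ℝ U (Θ q) (fderiv ℝ w q.2 v.2 + v.1, v.2) := by
    intro U hU q v
    rw [((hU.differentiable (by simp) (Θ q)).hasFDerivAt.comp q (hΘ' q)).fderiv]
    rfl
  set A : ℝ × 𝔼 m → ℝ := V₀ ∘ Θ with hA
  set B : Fin m → ℝ × 𝔼 m → ℝ := fun j ↦ V j ∘ Θ with hB
  have hAd : ContDiff ℝ 1 A := hV₀.comp hΘd
  have hBd : ∀ j, ContDiff ℝ 1 (B j) := fun j ↦ (hV j).comp hΘd
  have hAs : HasCompactSupport A := hV₀s.comp_homeomorph Θ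
  have hBs : ∀ j, HasCompactSupport (B j) := fun j ↦ (hVs j).comp_homeomorph Θ
  set e : Fin m → 𝔼 m := fun j ↦ EuclideanSpace.single j 1 with he
  -- After the shear the domain is a half-space, and each horizontal derivative acquires a vertical
  -- one with coefficient `∂ⱼw`. Vertical derivatives integrate to boundary values on the graph,
  -- since `∂ⱼw` does not depend on the height; horizontal ones integrate to zero on every slice.
  have hT : ∀ q, fderiv ℝ V₀ (Θ q) (1, 0) + ∑ j, fderiv ℝ (V j) (Θ q) (0, e j) =
      (fderiv ℝ A q (1, 0) - ∑ j, fderiv ℝ w q.2 (e j) * fderiv ℝ (B j) q (1, 0)) +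
        ∑ j, fderiv ℝ (B j) q (0, e j) := by
    intro q
    rw [hA, hcomp hV₀]
    have : ∀ j, fderiv ℝ (B j) q (0, e j) = fderiv ℝ w q.2 (e j) * fderiv ℝ (B j) q (1, 0) +
        fderiv ℝ (V j) (Θ q) (0, e j) := by
      intro j
      rw [hB]
      simp only
      rw [hcomp (hV j), hcomp (hV j)]
      have : (fderiv ℝ w q.2 (e j) + (0 : ℝ), e j) =
        fderiv ℝ w q.2 (e j) • ((1 : ℝ), (0 : 𝔼 m)) + (0, e j) := by simp
      simp only
      rw [this, map_add, map_smul, smul_eq_mul]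
      simp
    simp only [this, Finset.sum_add_distrib]
    simp only [map_zero, zero_add]
    ring
  have hfc : ∀ {U : ℝ × 𝔼 m → ℝ}, ContDiff ℝ 1 U → ∀ v, Continuous fun q ↦ fderiv ℝ U q v :=
    fun hU v ↦ hU.continuous_fderiv_apply (by simp) |>.comp (continuous_id.prodMk continuous_const)
  have hwc : ∀ v, Continuous fun q : ℝ × 𝔼 m ↦ fderiv ℝ w q.2 v := fun v ↦
    (hw.continuous_fderiv_apply (by simp)).comp (continuous_snd.prodMk continuous_const)
  have hi0 : Integrable fun q ↦ fderiv ℝ A q (1, 0) :=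
    (hfc hAd _).integrable_of_hasCompactSupport (hAs.fderiv_apply ℝ _)
  have hi1 : ∀ j, Integrable fun q : ℝ × 𝔼 m ↦ fderiv ℝ w q.2 (e j) * fderiv ℝ (B j) q (1, 0) :=
    fun j ↦ ((hwc _).mul (hfc (hBd j) _)).integrable_of_hasCompactSupport
      ((hBs j).fderiv_apply ℝ _).mul_left
  have hi2 : ∀ j, Integrable fun q : ℝ × 𝔼 m ↦ fderiv ℝ (B j) q (0, e j) :=
    fun j ↦ (hfc (hBd j) _).integrable_of_hasCompactSupport ((hBs j).fderiv_apply ℝ _)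
  have hI1 : Integrable fun q : ℝ × 𝔼 m ↦ fderiv ℝ A q (1, 0) -
      ∑ j, fderiv ℝ w q.2 (e j) * fderiv ℝ (B j) q (1, 0) :=
    hi0.sub (integrable_finsetSum _ fun j _ ↦ hi1 j)
  have hI2 : Integrable fun q : ℝ × 𝔼 m ↦ ∑ j, fderiv ℝ (B j) q (0, e j) :=
    integrable_finsetSum _ fun j _ ↦ hi2 j
  have hset : Θ ⁻¹' {q : ℝ × 𝔼 m | q.1 < w q.2} = Iio 0 ×ˢ univ := by
    ext q
    simp [hΘ, graphShear]
  have hslice : ∀ {U : ℝ × 𝔼 m → ℝ}, HasCompactSupport U → ∀ x, HasCompactSupport fun r ↦ U (r, x) :=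
    fun {U} hU x ↦ HasCompactSupport.intro (hU.image continuous_fst) fun r hr ↦ by
      by_contra h
      exact hr ⟨(r, x), subset_tsupport U h, rfl⟩
  have hslice' : ∀ {U : ℝ × 𝔼 m → ℝ}, HasCompactSupport U → ∀ r, HasCompactSupport fun x ↦ U (r, x) :=
    fun {U} hU r ↦ HasCompactSupport.intro (hU.image continuous_snd) fun x hx ↦ by
      by_contra h
      exact hx ⟨(r, x), subset_tsupport U h, rfl⟩
  have hline : ∀ {U : ℝ × 𝔼 m → ℝ}, ContDiff ℝ 1 U → HasCompactSupport U → ∀ x,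
      ∫ r in Iio (0 : ℝ), fderiv ℝ U (r, x) (1, 0) = U (0, x) := by
    intro U hU hUs x
    have hd : ∀ r, deriv (fun r ↦ U (r, x)) r = fderiv ℝ U (r, x) (1, 0) := fun r ↦
      ((hU.differentiable (by simp) (r, x)).hasFDerivAt.comp_hasDerivAt r
        ((hasDerivAt_id r).prodMk (hasDerivAt_const r x))).deriv
    simp only [← hd]
    rw [← integral_Iic_eq_integral_Iio]
    exact (hslice hUs x).integral_Iic_deriv_eq (hU.comp (contDiff_id.prodMk contDiff_const)) 0
  have hi1' : ∀ {U : ℝ × 𝔼 m → ℝ}, ContDiff ℝ 1 U → HasCompactSupport U → ∀ x,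
      IntegrableOn (fun r ↦ fderiv ℝ U (r, x) (1, 0)) (Iio (0 : ℝ)) := fun hU hUs x ↦
    (((hfc hU _).comp (continuous_id.prodMk continuous_const)).integrable_of_hasCompactSupport
      (hslice (hUs.fderiv_apply ℝ (1, 0)) x)).integrableOn
  rw [← (measurePreserving_graphShear hw.continuous).setIntegral_preimage_emb
    Θ.measurableEmbedding, ← hΘ, hset]
  have hvol : (volume : Measure (ℝ × 𝔼 m)) = volume.prod volume := rfl
  rw [hvol] at hI1 hI2
  refine (integral_congr_ae (Eventually.of_forall fun q ↦ hT q)).trans ?_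
  rw [hvol, integral_add hI1.integrableOn hI2.integrableOn]
  have e2 : ∫ q in (Iio (0 : ℝ) ×ˢ (univ : Set (𝔼 m))), ∑ j, fderiv ℝ (B j) q (0, e j)
      ∂(volume.prod volume) = 0 := by
    rw [setIntegral_prod _ hI2.integrableOn]
    refine integral_eq_zero_of_ae (Eventually.of_forall fun r ↦ ?_)
    have hd : ∀ j x, fderiv ℝ (fun x ↦ B j (r, x)) x (e j) = fderiv ℝ (B j) (r, x) (0, e j) := by
      intro j x
      have := ((hBd j).differentiable (by simp) (r, x)).hasFDerivAt.comp (f := fun x ↦ (r, x)) x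
        ((hasFDerivAt_const r x).prodMk (hasFDerivAt_id x))
      rw [show (fun x ↦ B j (r, x)) = B j ∘ fun x ↦ (r, x) from rfl, this.fderiv]
      rfl
    have hBr : ∀ j, ContDiff ℝ 1 fun x ↦ B j (r, x) := fun j ↦
      (hBd j).comp (contDiff_const.prodMk contDiff_id)
    simp only [Measure.restrict_univ, Pi.zero_apply]
    rw [integral_finsetSum]
    · refine Finset.sum_eq_zero fun j _ ↦ ?_
      simp only [← hd]
      exact integral_fderiv_apply_eq_zero (hBr j) (hslice' (hBs j) r) _
    · intro j _
      exact ((hfc (hBd j) _).comp (continuous_const.prodMk continuous_id)).integrable_of_hasCompactSupport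
        (hslice' ((hBs j).fderiv_apply ℝ _) r)
  rw [e2, add_zero, ← Measure.prod_restrict, integral_prod_symm _ (by
    rw [Measure.prod_restrict]; exact hI1.integrableOn), Measure.restrict_univ]
  refine integral_congr_ae (Eventually.of_forall fun x ↦ ?_)
  simp only
  rw [integral_sub (hi1' hAd hAs x) (integrable_finsetSum _ fun j _ ↦
      (hi1' (hBd j) (hBs j) x).const_mul _), integral_finsetSum _ (fun j _ ↦
      (hi1' (hBd j) (hBs j) x).const_mul _), hline hAd hAs]
  simp only [integral_const_mul, hline (hBd _) (hBs _)]
  simp [hA, hB, hΘ, graphShear, he]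

/-- The formula below the graph of a constant that exceeds all heights in the supports, so that
there is no boundary term. -/
lemma integral_div_eq_zero (hV₀ : ContDiff ℝ 1 V₀)
    (hV₀s : HasCompactSupport V₀) (hV : ∀ j, ContDiff ℝ 1 (V j))
    (hVs : ∀ j, HasCompactSupport (V j)) :
    ∫ q : ℝ × 𝔼 m, (fderiv ℝ V₀ q (1, 0) +
        ∑ j, fderiv ℝ (V j) q (0, EuclideanSpace.single j 1)) = 0 := by
  obtain ⟨R, hR⟩ : ∃ R : ℝ, ∀ q ∈ tsupport V₀ ∪ ⋃ j, tsupport (V j), q.1 < R := by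
    obtain ⟨R, hR⟩ := ((hV₀s.union (isCompact_iUnion hVs)).image
      (continuous_fst (X := ℝ) (Y := 𝔼 m))).bddAbove
    exact ⟨R + 1, fun q hq ↦ (hR ⟨q, hq, rfl⟩).trans_lt (by linarith)⟩
  have h0 : ∀ q : ℝ × 𝔼 m, R ≤ q.1 → q ∉ tsupport V₀ ∧ ∀ j, q ∉ tsupport (V j) := fun q hq ↦
    ⟨fun h ↦ (hR q (Or.inl h)).not_ge hq,
      fun j h ↦ (hR q (Or.inr (mem_iUnion.2 ⟨j, h⟩))).not_ge hq⟩
  have := integral_subgraph_div (w := fun _ ↦ R) contDiff_const hV₀ hV₀s hV hVs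
  rw [setIntegral_eq_integral_of_forall_compl_eq_zero] at this
  · rw [this]
    refine integral_eq_zero_of_ae (Eventually.of_forall fun x ↦ ?_)
    have h1 := h0 (R, x) le_rfl
    simp [image_eq_zero_of_notMem_tsupport h1.1]
  · intro q hq
    have h1 := h0 q (not_lt.1 hq)
    have h2 : fderiv ℝ V₀ q = 0 := by
      by_contra h
      exact h1.1 (support_fderiv_subset ℝ h)
    have h3 : ∀ j, fderiv ℝ (V j) q = 0 := by
      intro j
      by_contra h
      exact h1.2 j (support_fderiv_subset ℝ h)
    simp [h2, h3]

/-- The divergence theorem on either side of a graph over a ball, for fields with support over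
the ball. -/
lemma setIntegral_div_of_graphOn {x₀ : 𝔼 m} {ρ : ℝ} (hw : ContDiffOn ℝ 1 w (Metric.ball x₀ ρ))
    (hV₀ : ContDiff ℝ 1 V₀)
    (hV₀s : HasCompactSupport V₀) (hV : ∀ j, ContDiff ℝ 1 (V j))
    (hVs : ∀ j, HasCompactSupport (V j)) (hV₀t : tsupport V₀ ⊆ univ ×ˢ Metric.ball x₀ ρ)
    (hVt : ∀ j, tsupport (V j) ⊆ univ ×ˢ Metric.ball x₀ ρ) {σ : ℝ} (hσ : σ = 1 ∨ σ = -1) :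
    ∫ q in {q : ℝ × 𝔼 m | q.2 ∈ Metric.ball x₀ ρ ∧ σ * (q.1 - w q.2) < 0}, (fderiv ℝ V₀ q (1, 0) +
        ∑ j, fderiv ℝ (V j) q (0, EuclideanSpace.single j 1)) =
      σ * ∫ x in Metric.ball x₀ ρ,
        (V₀ (w x, x) - ∑ j, fderiv ℝ w x (EuclideanSpace.single j 1) * V j (w x, x)) := by
  set B := Metric.ball x₀ ρ with hB
  set K : Set (𝔼 m) := Prod.snd '' (tsupport V₀ ∪ ⋃ j, tsupport (V j)) with hK
  have hKc : IsCompact K := (hV₀s.isCompact.union (isCompact_iUnion fun j ↦ (hVs j).isCompact)).image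
    continuous_snd
  have hKB : K ⊆ B := by
    rintro _ ⟨q, hq | hq, rfl⟩
    · exact (hV₀t hq).2
    · obtain ⟨j, hj⟩ := mem_iUnion.1 hq
      exact (hVt j hj).2
  -- `w` is controlled only on the ball. A cutoff equal to `1` near the projection `K` of the
  -- supports makes it globally `C¹` without changing either side of the formula.
  obtain ⟨θ, hθK, hθB, hθ⟩ : ∃ θ : 𝔼 m → ℝ, (∀ x ∈ K, θ =ᶠ[𝓝 x] fun _ ↦ 1) ∧ tsupport θ ⊆ B ∧
      ContDiff ℝ 1 θ := by
    obtain ⟨L, hL, hKL, hLB⟩ := exists_compact_between hKc Metric.isOpen_ball hKB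
    obtain ⟨φ, h1, h0, h2⟩ := exists_contMDiffMap_one_nhds_of_subset_interior 𝓘(ℝ, 𝔼 m) (n := 1) hKc.isClosed hKL
    refine ⟨φ, fun x hx ↦ ?_, ?_, φ.contMDiff.contDiff⟩
    · exact (eventually_nhdsSet_iff_forall.1 h1) x hx
    · refine Subset.trans (closure_minimal (fun x hx ↦ ?_) hL.isClosed) hLB
      by_contra h
      exact hx (h0 x h)
  have hwd : ContDiff ℝ 1 fun x ↦ θ x * w x := by
    rw [contDiff_iff_contDiffAt]
    intro x
    by_cases hx : x ∈ tsupport θ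
    · exact hθ.contDiffAt.mul (hw.contDiffAt (Metric.isOpen_ball.mem_nhds (hθB hx)))
    · refine contDiffAt_const (c := (0 : ℝ)) |>.congr_of_eventuallyEq ?_
      filter_upwards [notMem_tsupport_iff_eventuallyEq.1 hx] with y hy
      simp [hy]
  have heq : ∀ x ∈ K, θ x * w x = w x ∧ fderiv ℝ (fun x ↦ θ x * w x) x = fderiv ℝ w x := by
    intro x hx
    have : (fun x ↦ θ x * w x) =ᶠ[𝓝 x] w := by
      filter_upwards [hθK x hx] with y hy
      simp [hy]
    exact ⟨this.eq_of_nhds, this.fderiv_eq⟩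
  have hout : ∀ q : ℝ × 𝔼 m, q.2 ∉ K → q ∉ tsupport V₀ ∧ ∀ j, q ∉ tsupport (V j) := fun q hq ↦
    ⟨fun h ↦ hq ⟨q, Or.inl h, rfl⟩, fun j h ↦ hq ⟨q, Or.inr (mem_iUnion.2 ⟨j, h⟩), rfl⟩⟩
  set T : ℝ × 𝔼 m → ℝ := fun q ↦ fderiv ℝ V₀ q (1, 0) +
        ∑ j, fderiv ℝ (V j) q (0, EuclideanSpace.single j 1) with hT
  have hT0 : ∀ q : ℝ × 𝔼 m, q.2 ∉ K → T q = 0 := by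
    intro q hq
    have h1 := hout q hq
    have h2 : fderiv ℝ V₀ q = 0 := by
      by_contra h
      exact h1.1 (support_fderiv_subset ℝ h)
    have h3 : ∀ j, fderiv ℝ (V j) q = 0 := by
      intro j
      by_contra h
      exact h1.2 j (support_fderiv_subset ℝ h)
    simp [hT, h2, h3]
  have hTi : Integrable T := by
    have hfc : ∀ {U : ℝ × 𝔼 m → ℝ}, ContDiff ℝ 1 U → HasCompactSupport U → ∀ v,
        Integrable fun q ↦ fderiv ℝ U q v := fun hU hUs v ↦
      ((hU.continuous_fderiv_apply (by simp)).comp (continuous_id.prodMk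
        continuous_const)).integrable_of_hasCompactSupport (hUs.fderiv_apply ℝ _)
    exact (hfc hV₀ hV₀s _).add (integrable_finsetSum _ fun j _ ↦ hfc (hV j) (hVs j) _)
  have hmain := integral_subgraph_div hwd hV₀ hV₀s hV hVs
  have htot := integral_div_eq_zero hV₀ hV₀s hV hVs
  have hflux : ∫ x, (V₀ (θ x * w x, x) - ∑ j, fderiv ℝ (fun x ↦ θ x * w x) x
      (EuclideanSpace.single j 1) * V j (θ x * w x, x)) = ∫ x in B,
        (V₀ (w x, x) - ∑ j, fderiv ℝ w x (EuclideanSpace.single j 1) * V j (w x, x)) := by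
    rw [← setIntegral_eq_integral_of_forall_compl_eq_zero (s := B)]
    · refine setIntegral_congr_fun measurableSet_ball fun x _ ↦ ?_
      by_cases hx : x ∈ K
      · simp only [(heq x hx).1, (heq x hx).2]
      · have h0 : ∀ s : ℝ, V₀ (s, x) = 0 ∧ ∀ j, V j (s, x) = 0 := fun s ↦
          ⟨image_eq_zero_of_notMem_tsupport (hout (s, x) hx).1,
            fun j ↦ image_eq_zero_of_notMem_tsupport ((hout (s, x) hx).2 j)⟩
        simp [(h0 _).1, (h0 _).2]
    · intro x hx
      have h0 : ∀ s : ℝ, V₀ (s, x) = 0 ∧ ∀ j, V j (s, x) = 0 := fun s ↦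
          ⟨image_eq_zero_of_notMem_tsupport (hout (s, x) fun h ↦ hx (hKB h)).1,
            fun j ↦ image_eq_zero_of_notMem_tsupport ((hout (s, x) fun h ↦ hx (hKB h)).2 j)⟩
      simp [(h0 _).1, (h0 _).2]
  rw [hflux] at hmain
  have hmeas : MeasurableSet {q : ℝ × 𝔼 m | q.1 < θ q.2 * w q.2} :=
    (isOpen_lt continuous_fst (hwd.continuous.comp continuous_snd)).measurableSet
  have hgraph : volume {q : ℝ × 𝔼 m | q.1 = θ q.2 * w q.2} = 0 := by
    have hm : MeasurableSet {q : ℝ × 𝔼 m | q.1 = θ q.2 * w q.2} :=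
      (isClosed_eq continuous_fst (hwd.continuous.comp continuous_snd)).measurableSet
    rw [← (measurePreserving_graphShear hwd.continuous).measure_preimage hm.nullMeasurableSet]
    have : (graphShear hwd.continuous) ⁻¹' {q : ℝ × 𝔼 m | q.1 = θ q.2 * w q.2} =
        {0} ×ˢ univ := by
      ext q
      simp [graphShear]
    rw [this, Measure.volume_eq_prod, Measure.prod_prod]
    simp
  have hmeas' : MeasurableSet {q : ℝ × 𝔼 m | q.2 ∈ B ∧ σ * (q.1 - w q.2) < 0} := by
    have hc : ContinuousOn (fun q : ℝ × 𝔼 m ↦ σ * (q.1 - w q.2)) (univ ×ˢ B) :=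
      continuousOn_const.mul (continuousOn_fst.sub (hw.continuousOn.comp continuousOn_snd
        fun q hq ↦ hq.2))
    have := hc.isOpen_inter_preimage (isOpen_univ.prod Metric.isOpen_ball) (isOpen_Iio (a := (0 : ℝ)))
    convert this.measurableSet using 1
    ext q
    simp
  rw [← integral_indicator hmeas']
  rcases hσ with rfl | rfl
  · rw [one_mul, ← hmain, ← integral_indicator hmeas]
    refine integral_congr_ae (Eventually.of_forall fun q ↦ ?_)
    by_cases hq : q.2 ∈ K
    · simp [indicator, (heq _ hq).1, hKB hq]
    · have := hT0 q hq
      simp only [hT] at this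
      simp only [indicator, this, ite_self]
  -- The upper side follows from the lower one, because the total integral of the divergence is zero
  -- and the graph is a null set.
  · have hcompl := integral_add_compl hmeas hTi
    rw [htot, hmain] at hcompl
    rw [neg_one_mul, neg_eq_of_add_eq_zero_right hcompl, ← integral_indicator hmeas.compl]
    have hne : ∀ᵐ q : ℝ × 𝔼 m, q.1 ≠ θ q.2 * w q.2 := by
      rw [ae_iff]
      simpa using hgraph
    refine integral_congr_ae ?_
    filter_upwards [hne] with q hne
    by_cases hq : q.2 ∈ K
    · rw [(heq _ hq).1] at hne
      simp only [indicator, mem_compl_iff, mem_ofPred_eq, (heq _ hq).1, hKB hq, true_and, hT]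
      congr 1
      simp only [not_lt, eq_iff_iff]
      constructor
      · intro h; linarith
      · intro h
        have := lt_of_le_of_ne h hne.symm
        linarith
    · have := hT0 q hq
      simp only [hT] at this
      simp only [indicator, this, ite_self, hT]

end GraphFlux

/-! ### Gram determinants. -/

section GramDeterminant

variable {V ι κ : Type*} [NormedAddCommGroup V] [InnerProductSpace ℝ V] [Fintype ι] [Fintype κ]
  [DecidableEq ι] [DecidableEq κ]

/-- Hadamard's inequality for Gram determinants: adding a vector `u` multiplies the determinant by
at most `‖u‖ ^ 2`. -/
lemma det_gram_sumElim_le {τ : ι → V} (hτ : LinearIndependent ℝ τ) (u : V) :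
    (Matrix.gram ℝ (Sum.elim τ fun _ : PUnit.{1} ↦ u)).det ≤ ‖u‖ ^ 2 * (Matrix.gram ℝ τ).det := by
  have hpos : (Matrix.gram ℝ τ).PosDef := Matrix.posDef_gram_of_linearIndependent hτ
  let _ : Invertible (Matrix.gram ℝ τ) := hpos.isUnit.invertible
  have hblock : Matrix.gram ℝ (Sum.elim τ fun _ : PUnit.{1} ↦ u) =
      Matrix.fromBlocks (Matrix.gram ℝ τ) (Matrix.of fun i _ ↦ inner ℝ (τ i) u)
        (Matrix.of fun _ j ↦ inner ℝ u (τ j)) (Matrix.of fun _ _ ↦ inner ℝ u u) := by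
    ext a b
    rcases a with a | a <;> rcases b with b | b <;> rfl
  -- By the Schur complement the additional factor is `‖u‖ ^ 2` minus a positive semidefinite form
  -- in the products of `u` with the `τ i`.
  rw [hblock, Matrix.det_fromBlocks₁₁, mul_comm]
  refine mul_le_mul_of_nonneg_right ?_ hpos.det_pos.le
  rw [Matrix.det_unique, Matrix.sub_apply, Matrix.of_apply, real_inner_self_eq_norm_sq]
  have h1 : 0 ≤ (fun i ↦ inner ℝ (τ i) u) ⬝ᵥ ((Matrix.gram ℝ τ)⁻¹).mulVec fun i ↦ inner ℝ (τ i) u := by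
    have := hpos.inv.posSemidef.dotProduct_mulVec_nonneg fun i ↦ inner ℝ (τ i) u
    simpa using this
  have h2 : ((Matrix.of fun (_ : PUnit.{1}) j ↦ inner ℝ u (τ j)) * ⅟(Matrix.gram ℝ τ) *
      Matrix.of fun i (_ : PUnit.{1}) ↦ inner ℝ (τ i) u) default default =
      (fun i ↦ inner ℝ (τ i) u) ⬝ᵥ ((Matrix.gram ℝ τ)⁻¹).mulVec fun i ↦ inner ℝ (τ i) u := by
    rw [Matrix.mul_assoc, Matrix.invOf_eq_nonsing_inv, Matrix.mul_apply]
    simp only [Matrix.of_apply, dotProduct, real_inner_comm u]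
    rfl
  linarith

lemma det_gram_sumElim_eq {τ : ι → V} (u : V) (hu : ∀ i, inner ℝ u (τ i) = 0) :
    (Matrix.gram ℝ (Sum.elim τ fun _ : PUnit.{1} ↦ u)).det = ‖u‖ ^ 2 * (Matrix.gram ℝ τ).det := by
  have hblock : Matrix.gram ℝ (Sum.elim τ fun _ : PUnit.{1} ↦ u) =
      Matrix.fromBlocks (Matrix.gram ℝ τ) 0 0 (Matrix.of fun _ _ ↦ inner ℝ u u) := by
    ext a b
    rcases a with a | a <;> rcases b with b | b
    · rfl
    · exact (real_inner_comm _ _).trans (hu a)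
    · exact hu b
    · rfl
  rw [hblock, Matrix.det_fromBlocks_zero₁₂, Matrix.det_unique (n := PUnit), mul_comm,
    Matrix.of_apply, real_inner_self_eq_norm_sq]

lemma gram_sum_smul (f : ι → V) (C : Matrix ι κ ℝ) :
    Matrix.gram ℝ (fun b ↦ ∑ a, C a b • f a) = C.transpose * Matrix.gram ℝ f * C := by
  ext b b'
  rw [Matrix.mul_assoc, Matrix.mul_apply]
  simp only [Matrix.gram_apply, sum_inner, inner_sum, real_inner_smul_left, real_inner_smul_right,
    Matrix.mul_apply, Matrix.transpose_apply, Finset.mul_sum]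
  rw [Finset.sum_comm]
  refine Finset.sum_congr rfl fun a _ ↦ Finset.sum_congr rfl fun a' _ ↦ ?_
  rw [real_inner_comm]
  ring

end GramDeterminant

/-! ### Flux through a graph compared with its area. -/

section GraphFlux

lemma sum_splitCoord_smul {m : ℕ} {V : Type*} [AddCommGroup V] [Module ℝ V] (i : Fin (m + 1))
    (q : ℝ × 𝔼 m) (c : Fin (m + 1) → V) :
    ∑ j, splitCoord i q j • c j = ∑ j, q.2 j • c (i.succAbove j) + q.1 • c i := by
  rw [Fin.sum_univ_succAbove _ i, add_comm]
  simp [splitCoord_apply]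

variable {m : ℕ} {M : Type*} [TopologicalSpace M] [ChartedSpace (𝔼 (m + 1)) M]
  [RiemannianBundle (fun x : M ↦ TangentSpace (𝓡 (m + 1)) x)] [IsManifold (𝓡 (m + 1)) ω M]
  [IsContMDiffRiemannianBundle (𝓡 (m + 1)) ω (𝔼 (m + 1))
    (fun x : M ↦ TangentSpace (𝓡 (m + 1)) x)]

/-- The split components of a vector field in the preferred chart at `p`. -/
def splitComponents (Y : (x : M) → TangentSpace (𝓡 (m + 1)) x) (p : M) (i : Fin (m + 1))
    (q : ℝ × 𝔼 m) : ℝ × 𝔼 m :=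
  (splitCoord i).symm (coordComponents (m + 1) Y p (splitCoord i q))

/-- The map parametrizing the graph of `w` in split coordinates. -/
def graphMap (i : Fin (m + 1)) (w : 𝔼 m → ℝ) (x : 𝔼 m) : 𝔼 (m + 1) := splitCoord i (w x, x)

/-- The density of the flux of the vector field `Y` through the graph of `w`, in the split
coordinates of the preferred chart at `p`. -/
def graphFlux (Y : (x : M) → TangentSpace (𝓡 (m + 1)) x) (p : M) (i : Fin (m + 1)) (w : 𝔼 m → ℝ)
    (x : 𝔼 m) : ℝ :=
  metricDensity (m + 1) p (graphMap i w x) * ((splitComponents Y p i (w x, x)).1 -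
    fderiv ℝ w x (splitComponents Y p i (w x, x)).2)

lemma hasFDerivAt_graphMap (i : Fin (m + 1)) {w : 𝔼 m → ℝ} {x : 𝔼 m} (hw : DifferentiableAt ℝ w x) :
    HasFDerivAt (graphMap i w) ((splitCoord i : (ℝ × 𝔼 m) →L[ℝ] 𝔼 (m + 1)).comp
      ((fderiv ℝ w x).prod (ContinuousLinearMap.id ℝ (𝔼 m)))) x :=
  (splitCoord i : (ℝ × 𝔼 m) →L[ℝ] 𝔼 (m + 1)).hasFDerivAt.comp x
    (hw.hasFDerivAt.prodMk (hasFDerivAt_id x))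

lemma fderiv_graphMap (i : Fin (m + 1)) {w : 𝔼 m → ℝ} {x : 𝔼 m} (hw : DifferentiableAt ℝ w x)
    (v : 𝔼 m) : fderiv ℝ (graphMap i w) x v = splitCoord i (fderiv ℝ w x v, v) := by
  rw [(hasFDerivAt_graphMap i hw).fderiv]
  rfl

lemma areaDensity_eq_gram (p : M) (i : Fin (m + 1)) (w : 𝔼 m → ℝ) (x : 𝔼 m) :
    areaDensity p (graphMap i w) x = √ (Matrix.gram ℝ fun j : Fin m ↦ coordDeriv p (graphMap i w x)
      (fderiv ℝ (graphMap i w) x (EuclideanSpace.single j 1))).det := rfl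

/-- Up to sign, the flux density is the volume of the parallelepiped spanned by the tangent frame of
the graph and `Y`. With respect to the coordinate fields these vectors form the matrix `C`, of
determinant `Z.1 - dw(Z.2)`. -/
lemma graphFlux_sq {Y : (x : M) → TangentSpace (𝓡 (m + 1)) x} {p : M} {i : Fin (m + 1)}
    {w : 𝔼 m → ℝ} {x : 𝔼 m} (hy : graphMap i w x ∈ (extChartAt (𝓡 (m + 1)) p).target)
    (hw : DifferentiableAt ℝ w x) :
    graphFlux Y p i w x ^ 2 = (Matrix.gram ℝ (Sum.elim (fun j : Fin m ↦ coordDeriv p (graphMap i w x)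
      (fderiv ℝ (graphMap i w) x (EuclideanSpace.single j 1)))
      fun _ : PUnit.{1} ↦ Y ((extChartAt (𝓡 (m + 1)) p).symm (graphMap i w x)))).det := by
  set Z := splitComponents Y p i (w x, x) with hZ
  set E : Fin m ⊕ PUnit.{1} ≃ Fin (m + 1) :=
    (Equiv.optionEquivSumPUnit (Fin m)).symm.trans (finSuccEquiv' i).symm with hE
  have hEl : ∀ j, E (Sum.inl j) = i.succAbove j := fun j ↦ by simp [hE]
  have hEr : ∀ a, E (Sum.inr a) = i := fun j ↦ by simp [hE]
  set C : Matrix (Fin m ⊕ PUnit.{1}) (Fin m ⊕ PUnit.{1}) ℝ := Matrix.fromBlocks 1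
    (Matrix.of fun j _ ↦ Z.2 j) (Matrix.of fun _ j ↦ fderiv ℝ w x (EuclideanSpace.single j 1))
    (Matrix.of fun _ _ ↦ Z.1) with hC
  have hfam : (Sum.elim (fun j : Fin m ↦ coordDeriv p (graphMap i w x)
      (fderiv ℝ (graphMap i w) x (EuclideanSpace.single j 1)))
      fun _ : PUnit.{1} ↦ Y ((extChartAt (𝓡 (m + 1)) p).symm (graphMap i w x))) =
      fun b ↦ ∑ a, C a b • coordField (m + 1) p (graphMap i w x) (E a) := by
    funext b
    rw [Fintype.sum_sum_type]
    rcases b with j | b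
    · simp only [Sum.elim_inl, fderiv_graphMap i hw, coordDeriv_eq_sum, hC, hEl, hEr,
        Matrix.fromBlocks_apply₁₁, Matrix.fromBlocks_apply₂₁, Matrix.of_apply]
      refine (sum_splitCoord_smul i _ _).trans ?_
      congr 1
      · refine Finset.sum_congr rfl fun j' _ ↦ ?_
        congr 1
        simp [Matrix.one_apply]
      · exact (Finset.sum_const _).trans (one_smul _ _) |>.symm
    · have h1 : Y ((extChartAt (𝓡 (m + 1)) p).symm (graphMap i w x)) =
          coordDeriv p (graphMap i w x) (splitCoord i Z) := by
        rw [hZ, splitComponents, ContinuousLinearEquiv.apply_symm_apply]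
        exact (coordDeriv_coordComponents Y hy).symm
      simp only [Sum.elim_inr, h1, coordDeriv_eq_sum, hC, hEl, hEr,
        Matrix.fromBlocks_apply₁₂, Matrix.fromBlocks_apply₂₂, Matrix.of_apply]
      refine (sum_splitCoord_smul i _ _).trans ?_
      congr 1
      exact (Finset.sum_const _).trans (one_smul _ _) |>.symm
  have hdetC : C.det = Z.1 - fderiv ℝ w x Z.2 := by
    rw [hC, Matrix.det_fromBlocks_one₁₁, Matrix.det_unique, Matrix.sub_apply, Matrix.mul_apply,
      fderiv_apply_eq_sum (fderiv ℝ w x) Z.2]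
    simp [mul_comm]
  have hgram : Matrix.gram ℝ (fun a ↦ coordField (m + 1) p (graphMap i w x) (E a)) =
      (chartGram p (graphMap i w x)).submatrix E E := rfl
  rw [hfam, gram_sum_smul, Matrix.det_mul, Matrix.det_mul, Matrix.det_transpose, hdetC, hgram,
    Matrix.det_submatrix_equiv_self, graphFlux, mul_pow, metricDensity_eq,
    Real.sq_sqrt (chartGram_det_pos hy).le]
  ring

lemma injective_fderiv_graphMap (i : Fin (m + 1)) {w : 𝔼 m → ℝ} {x : 𝔼 m}
    (hw : DifferentiableAt ℝ w x) : Function.Injective (fderiv ℝ (graphMap i w) x) := by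
  intro v v' h
  rw [fderiv_graphMap i hw, fderiv_graphMap i hw] at h
  exact congrArg Prod.snd ((splitCoord i).injective h)

/-- The flux density is at most the area density times the length of the field. -/
lemma abs_graphFlux_le {Y : (x : M) → TangentSpace (𝓡 (m + 1)) x} {p : M} {i : Fin (m + 1)}
    {w : 𝔼 m → ℝ} {x : 𝔼 m} (hy : graphMap i w x ∈ (extChartAt (𝓡 (m + 1)) p).target)
    (hw : DifferentiableAt ℝ w x) :
    |graphFlux Y p i w x| ≤ ‖Y ((extChartAt (𝓡 (m + 1)) p).symm (graphMap i w x))‖ *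
      areaDensity p (graphMap i w) x := by
  have hli : LinearIndependent ℝ fun j : Fin m ↦ coordDeriv p (graphMap i w x)
      (fderiv ℝ (graphMap i w) x (EuclideanSpace.single j 1)) := by
    have h := (EuclideanSpace.basisFun (Fin m) ℝ).toBasis.linearIndependent.map'
      (((coordDeriv p (graphMap i w x)).comp (fderiv ℝ (graphMap i w) x)).toLinearMap)
      (LinearMap.ker_eq_bot.2 ((coordDeriv_injective hy).comp (injective_fderiv_graphMap i hw)))
    have e : ((coordDeriv p (graphMap i w x)).comp (fderiv ℝ (graphMap i w) x)).toLinearMap ∘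
        (EuclideanSpace.basisFun (Fin m) ℝ).toBasis = fun j : Fin m ↦ coordDeriv p (graphMap i w x)
          (fderiv ℝ (graphMap i w) x (EuclideanSpace.single j 1)) := by
      funext j
      simp only [Function.comp_apply, OrthonormalBasis.coe_toBasis, EuclideanSpace.basisFun_apply]
      rfl
    rw [e] at h
    exact h
  have h1 := det_gram_sumElim_le hli (Y ((extChartAt (𝓡 (m + 1)) p).symm (graphMap i w x)))
  rw [← graphFlux_sq hy hw] at h1
  rw [areaDensity_eq_gram, ← Real.sqrt_sq (norm_nonneg (Y _)), ← Real.sqrt_mul (sq_nonneg _),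
    ← Real.sqrt_sq_eq_abs]
  exact Real.sqrt_le_sqrt h1

/-- For a field normal to the graph the Gram matrix is block diagonal, so Hadamard's inequality is
an equality. -/
lemma abs_graphFlux_eq {Y : (x : M) → TangentSpace (𝓡 (m + 1)) x} {p : M} {i : Fin (m + 1)}
    {w : 𝔼 m → ℝ} {x : 𝔼 m} (hy : graphMap i w x ∈ (extChartAt (𝓡 (m + 1)) p).target)
    (hw : DifferentiableAt ℝ w x)
    (hY : ∀ v, inner ℝ (Y ((extChartAt (𝓡 (m + 1)) p).symm (graphMap i w x)))
      (coordDeriv p (graphMap i w x) (fderiv ℝ (graphMap i w) x v)) = 0) :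
    |graphFlux Y p i w x| = ‖Y ((extChartAt (𝓡 (m + 1)) p).symm (graphMap i w x))‖ *
      areaDensity p (graphMap i w) x := by
  have h1 := det_gram_sumElim_eq (Y ((extChartAt (𝓡 (m + 1)) p).symm (graphMap i w x)))
    fun j ↦ hY (EuclideanSpace.single j 1)
  rw [← graphFlux_sq hy hw] at h1
  rw [areaDensity_eq_gram, ← Real.sqrt_sq (norm_nonneg (Y _)), ← Real.sqrt_mul (sq_nonneg _),
    ← Real.sqrt_sq_eq_abs, h1]

end GraphFlux

/-! ### The divergence theorem for vector fields supported in a chart box. -/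

section ChartFlux

variable {m : ℕ} {M : Type*} [MetricSpace M] [MeasurableSpace M] [BorelSpace M]
  [ChartedSpace (𝔼 (m + 1)) M]
  [RiemannianBundle (fun x : M ↦ TangentSpace (𝓡 (m + 1)) x)] [IsManifold (𝓡 (m + 1)) ω M]
  [IsContMDiffRiemannianBundle (𝓡 (m + 1)) ω (𝔼 (m + 1))
    (fun x : M ↦ TangentSpace (𝓡 (m + 1)) x)] [IsRiemannianManifold (𝓡 (m + 1)) M]

lemma riemDiv_eq_zero_of_notMem {Y : (x : M) → TangentSpace (𝓡 (m + 1)) x} {K : Set M}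
    (hK : IsClosed K) (hY : ∀ x ∉ K, Y x = 0) {x : M} (hx : x ∉ K) : riemDiv (m + 1) Y x = 0 := by
  have h1 : riemDiv (m + 1) Y x = riemDiv (m + 1) (fun _ ↦ 0) x := by
    refine riemDiv_congr ?_
    filter_upwards [hK.isOpen_compl.mem_nhds hx] with y hy
    exact hY y hy
  have h2 : ∀ y : 𝔼 (m + 1), coordComponents (m + 1) (fun z : M ↦ (0 : TangentSpace (𝓡 (m + 1)) z)) x y = 0 :=
    fun y ↦ map_zero _
  rw [h1, riemDiv]
  simp [h2]

/-- The divergence theorem in the split coordinates of a chart, on one side of a graph. -/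
lemma setIntegral_riemDiv_eq_graphFlux {Y : (x : M) → TangentSpace (𝓡 (m + 1)) x} {p : M}
    {i : Fin (m + 1)} {a b : ℝ} {x₀ : 𝔼 m} {ρ : ℝ} {w : 𝔼 m → ℝ}
    (hY : ∀ x, ContDiffFieldAt 2 Y x)
    (hB : Ioo a b ×ˢ Metric.ball x₀ ρ ⊆ splitCoord i ⁻¹' (extChartAt (𝓡 (m + 1)) p).target)
    {K : Set M} (hK : IsCompact K) (hKB : K ⊆ splitPoint p i '' (Ioo a b ×ˢ Metric.ball x₀ ρ))
    (hYK : ∀ x ∉ K, Y x = 0)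
    (hw : ContDiffOn ℝ 1 w (Metric.ball x₀ ρ)) (hwab : MapsTo w (Metric.ball x₀ ρ) (Ioo a b))
    {σ : ℝ} (hσ : σ = 1 ∨ σ = -1) {Ω : Set M} (hΩ : IsOpen Ω)
    (hside : ∀ q ∈ Ioo a b ×ˢ Metric.ball x₀ ρ, splitPoint p i q ∈ Ω ↔ σ * (q.1 - w q.2) < 0) :
    ∫ x in Ω, riemDiv (m + 1) Y x ∂μHE[m + 1] =
      σ * ∫ x in Metric.ball x₀ ρ, graphFlux Y p i w x := by
  set B := Ioo a b ×ˢ Metric.ball x₀ ρ with hBdef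
  have hBo : IsOpen B := isOpen_Ioo.prod Metric.isOpen_ball
  have hsrc : ∀ q ∈ B, splitPoint p i q ∈ (extChartAt (𝓡 (m + 1)) p).source := fun q hq ↦
    (extChartAt (𝓡 (m + 1)) p).map_target (hB hq)
  set K' := splitChart p i '' K with hK'def
  have hK' : IsCompact K' := by
    refine hK.image_of_continuousOn ((contMDiffOn_splitChart (k := 0) p i).continuousOn.mono ?_)
    intro x hx
    obtain ⟨q, hq, rfl⟩ := hKB hx
    exact hsrc q hq
  have hK'B : K' ⊆ B := by
    rintro _ ⟨x, hx, rfl⟩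
    obtain ⟨q, hq, rfl⟩ := hKB hx
    rwa [splitChart_splitPoint (hB hq)]
  have hK'mem : ∀ q ∈ B, splitPoint p i q ∈ K → q ∈ K' := fun q hq h ↦
    ⟨_, h, splitChart_splitPoint (hB hq)⟩
  set P : Fin (m + 1) → 𝔼 (m + 1) → ℝ := fun j y ↦
    metricDensity (m + 1) p y * coordComponents (m + 1) Y p y j with hP
  -- The vector density is extended by zero outside the box. It remains `C¹`, since it vanishes off
  -- the compact set `K'` inside the box; its `i`-th component is the vertical one.
  set W : Fin (m + 1) → ℝ × 𝔼 m → ℝ := fun j ↦ B.indicator (P j ∘ splitCoord i) with hW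
  have hcomp : ∀ y ∈ (extChartAt (𝓡 (m + 1)) p).target, ContDiffAt ℝ 2 (coordComponents (m + 1) Y p) y := by
    intro y hy
    have := hY _ p ((extChartAt (𝓡 (m + 1)) p).map_target hy)
    rwa [(extChartAt (𝓡 (m + 1)) p).right_inv hy] at this
  have hPd : ∀ j, ∀ y ∈ (extChartAt (𝓡 (m + 1)) p).target, ContDiffAt ℝ 1 (P j) y := by
    intro j y hy
    have h1 : ContDiffAt ℝ 1 (metricDensity (m + 1) p) y :=
      ((contDiffOn_metricDensity p).contDiffAt ((isOpen_target p).mem_nhds hy)).of_le le_top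
    have h2 := contDiffAt_euclidean.1 (hcomp y hy) j
    exact h1.mul (h2.of_le (by norm_num))
  have hWK : ∀ j, ∀ q ∉ K', W j q = 0 := by
    intro j q hq
    by_cases hqB : q ∈ B
    · have h0 := hYK _ fun h ↦ hq (hK'mem q hqB h)
      have h1 : coordComponents (m + 1) Y p (splitCoord i q) = 0 := by
        rw [coordComponents]
        erw [h0]
        exact map_zero _
      simp [hW, hP, hqB, h1]
    · simp [hW, hqB]
  have hWB : ∀ j, ∀ q ∈ B, W j =ᶠ[𝓝 q] P j ∘ splitCoord i := by
    intro j q hq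
    filter_upwards [hBo.mem_nhds hq] with q' hq'
    simp [hW, hq']
  have hWd : ∀ j, ContDiff ℝ 1 (W j) := by
    intro j
    rw [contDiff_iff_contDiffAt]
    intro q
    by_cases hq : q ∈ B
    · exact ((hPd j _ (hB hq)).comp q (splitCoord i).contDiff.contDiffAt).congr_of_eventuallyEq
        (hWB j q hq)
    · refine contDiffAt_const (c := (0 : ℝ)) |>.congr_of_eventuallyEq ?_
      filter_upwards [hK'.isClosed.isOpen_compl.mem_nhds fun h ↦ hq (hK'B h)] with q' hq'
      exact hWK j q' hq'
  have hWs : ∀ j, HasCompactSupport (W j) := fun j ↦ HasCompactSupport.intro hK' (hWK j)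
  have hWt : ∀ j, tsupport (W j) ⊆ K' := fun j ↦ closure_minimal (fun q hq ↦ by
    by_contra h
    exact hq (hWK j q h)) hK'.isClosed
  have hWf : ∀ j, ∀ q ∉ K', fderiv ℝ (W j) q = 0 := by
    intro j q hq
    by_contra h
    exact hq (hWt j (support_fderiv_subset ℝ h))
  have hWfB : ∀ j, ∀ q ∈ B, ∀ v, fderiv ℝ (W j) q v = fderiv ℝ (P j) (splitCoord i q) (splitCoord i v) := by
    intro j q hq v
    rw [(hWB j q hq).fderiv_eq]
    have h1 := ((hPd j _ (hB hq)).differentiableAt (by simp)).hasFDerivAt.comp q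
      (splitCoord i : (ℝ × 𝔼 m) →L[ℝ] 𝔼 (m + 1)).hasFDerivAt
    have h2 : fderiv ℝ (P j ∘ splitCoord i) q = _ := h1.fderiv
    rw [h2]
    rfl
  have hzero : ∀ x ∉ K, riemDiv (m + 1) Y x = 0 := fun x hx ↦
    riemDiv_eq_zero_of_notMem hK.isClosed hYK hx
  set s' : Set (ℝ × 𝔼 m) := {q | q ∈ B ∧ σ * (q.1 - w q.2) < 0} with hs'
  have hs'o : IsOpen s' := by
    have hc : ContinuousOn (fun q : ℝ × 𝔼 m ↦ σ * (q.1 - w q.2)) B :=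
      continuousOn_const.mul (continuousOn_fst.sub (hw.continuousOn.comp continuousOn_snd
        fun q hq ↦ hq.2))
    exact hc.isOpen_inter_preimage hBo (isOpen_Iio (a := (0 : ℝ)))
  set s : Set (𝔼 (m + 1)) := (splitCoord i).symm ⁻¹' s' with hs
  have hso : IsOpen s := hs'o.preimage (splitCoord i).symm.continuous
  have hsT : s ⊆ (extChartAt (𝓡 (m + 1)) p).target := by
    intro y hy
    have := hB hy.1
    simpa using this
  have hmeas : Measurable (riemDiv (m + 1) Y) := by
    refine Continuous.measurable (continuous_iff_continuousAt.2 fun x ↦ ?_)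
    exact (contMDiffAt_riemDiv (k := 1) (Eventually.of_forall fun y ↦ (hY y).of_le (by norm_num))).continuousAt
  have himg : ∀ x, x ∈ (extChartAt (𝓡 (m + 1)) p).symm '' s ↔ x ∈ Ω ∧ x ∈ splitPoint p i '' B := by
    intro x
    constructor
    · rintro ⟨y, hy, rfl⟩
      have hy' : (extChartAt (𝓡 (m + 1)) p).symm y = splitPoint p i ((splitCoord i).symm y) := by
        simp [splitPoint]
      rw [hy']
      exact ⟨(hside _ hy.1).2 hy.2, _, hy.1, rfl⟩
    · rintro ⟨hx, q, hq, rfl⟩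
      exact ⟨splitCoord i q, by simpa [hs] using ⟨hq, (hside q hq).1 hx⟩, rfl⟩
  have e1 : ∫ x in Ω, riemDiv (m + 1) Y x ∂μHE[m + 1] =
      ∫ x in (extChartAt (𝓡 (m + 1)) p).symm '' s, riemDiv (m + 1) Y x ∂μHE[m + 1] := by
    refine setIntegral_eq_of_subset_of_forall_sdiff_eq_zero hΩ.measurableSet
      (fun x hx ↦ ((himg x).1 hx).1) fun x hx ↦ hzero x fun h ↦ hx.2 ((himg x).2 ⟨hx.1, hKB h⟩)
  rw [e1, (isMetricImmersion_symm p).setIntegral_image hso.measurableSet hsT hmeas]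
  have e2 : ∫ y in s, metricDensity (m + 1) p y *
      riemDiv (m + 1) Y ((extChartAt (𝓡 (m + 1)) p).symm y) =
      ∫ y in s, ∑ j, fderiv ℝ (P j) y (EuclideanSpace.single j 1) := by
    refine setIntegral_congr_fun hso.measurableSet fun y hy ↦ ?_
    rw [← chartDiv_eq_riemDiv (hsT hy) ((hcomp y (hsT hy)).differentiableAt (by simp))
      ((hY _).differentiableAt (by simp)), chartDiv,
      mul_inv_cancel_left₀ (metricDensity_pos (hsT hy)).ne']
  rw [e2, ← (measurePreserving_splitCoord i).setIntegral_preimage_emb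
    (splitCoord i).toHomeomorph.measurableEmbedding]
  have hpre : splitCoord i ⁻¹' s = s' := by
    ext q
    simp [hs]
  rw [hpre]
  have e3 : ∫ q in s', ∑ j, fderiv ℝ (P j) (splitCoord i q) (EuclideanSpace.single j 1) =
      ∫ q in {q : ℝ × 𝔼 m | q.2 ∈ Metric.ball x₀ ρ ∧ σ * (q.1 - w q.2) < 0},
        (fderiv ℝ (W i) q (1, 0) +
          ∑ j, fderiv ℝ (W (i.succAbove j)) q (0, EuclideanSpace.single j 1)) := by
    have hmeas' : MeasurableSet {q : ℝ × 𝔼 m | q.2 ∈ Metric.ball x₀ ρ ∧ σ * (q.1 - w q.2) < 0} := by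
      have hc : ContinuousOn (fun q : ℝ × 𝔼 m ↦ σ * (q.1 - w q.2)) (univ ×ˢ Metric.ball x₀ ρ) :=
        continuousOn_const.mul (continuousOn_fst.sub (hw.continuousOn.comp continuousOn_snd
          fun q hq ↦ hq.2))
      have := hc.isOpen_inter_preimage (isOpen_univ.prod Metric.isOpen_ball)
        (isOpen_Iio (a := (0 : ℝ)))
      convert this.measurableSet using 1
      ext q
      simp
    rw [setIntegral_eq_of_subset_of_forall_sdiff_eq_zero hmeas' (s := s') (fun q hq ↦ ⟨hq.1.2, hq.2⟩)]
    · refine setIntegral_congr_fun hs'o.measurableSet fun q hq ↦ ?_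
      rw [Fin.sum_univ_succAbove _ i, hWfB i q hq.1, splitCoord_one_zero]
      congr 1
      refine Finset.sum_congr rfl fun j _ ↦ ?_
      rw [hWfB _ q hq.1]
      congr 1
      ext j'
      refine Fin.succAboveCases i ?_ (fun j' ↦ ?_) j' <;> simp [splitCoord_apply, Pi.single_apply]
    · intro q hq
      have : q ∉ K' := fun h ↦ hq.2 ⟨hK'B h, hq.1.2⟩
      simp [hWf _ q this]
  rw [e3, setIntegral_div_of_graphOn hw (hWd i) (hWs i) (fun j ↦ hWd _) (fun j ↦ hWs _)
    (fun q hq ↦ ⟨mem_univ _, (hK'B (hWt _ hq)).2⟩)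
    (fun j q hq ↦ ⟨mem_univ _, (hK'B (hWt _ hq)).2⟩) hσ]
  congr 1
  refine setIntegral_congr_fun measurableSet_ball fun x hx ↦ ?_
  have hxB : (w x, x) ∈ B := ⟨hwab hx, hx⟩
  simp only [hW, indicator_of_mem hxB, graphFlux, hP, Function.comp_apply]
  rw [fderiv_apply_eq_sum (fderiv ℝ w x), mul_sub, Finset.mul_sum]
  congr 1
  refine Finset.sum_congr rfl fun j _ ↦ ?_
  rw [splitComponents, splitCoord_symm_snd, graphMap]
  ring

end ChartFlux

/-! ### Local Lipschitz bounds for maps into the manifold. -/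

section LocalLipschitz

variable {n : ℕ} {M : Type*} [MetricSpace M] [ChartedSpace (𝔼 n) M]
  [RiemannianBundle (fun x : M ↦ TangentSpace (𝓡 n) x)] [IsManifold (𝓡 n) ω M]
  [IsContMDiffRiemannianBundle (𝓡 n) ω (𝔼 n) (fun x : M ↦ TangentSpace (𝓡 n) x)]
  [IsRiemannianManifold (𝓡 n) M] {E : Type*} [NormedAddCommGroup E] [NormedSpace ℝ E]

lemma exists_lipschitzOnWith_extChartAt_symm {p : M} {y : 𝔼 n}
    (hy : y ∈ (extChartAt (𝓡 n) p).target) :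
    ∃ K, ∃ U ∈ 𝓝 y, LipschitzOnWith K (extChartAt (𝓡 n) p).symm U := by
  obtain ⟨r, hr, -, hb⟩ := exists_ball_dist_symm hy (ε := 1 / 2) (by norm_num) (by norm_num)
  obtain ⟨A, hA, -, -⟩ := exists_coordModel hy
  refine ⟨(3 / 2) * ‖A‖₊, Metric.ball y r, Metric.ball_mem_nhds y hr, ?_⟩
  refine LipschitzOnWith.of_dist_le_mul fun z hz z' hz' ↦ ((hb z hz z' hz').2).trans ?_
  rw [← hA, dist_eq_norm]
  have := A.le_opNorm (z - z')
  push_cast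
  linarith

lemma ContMDiffAt.exists_lipschitzOnWith {f : E → M} {x : E}
    (hf : ContMDiffAt 𝓘(ℝ, E) (𝓡 n) 1 f x) : ∃ K, ∃ U ∈ 𝓝 x, LipschitzOnWith K f U := by
  have hsrc := mem_extChartAt_source (I := 𝓡 n) (f x)
  have hg : ContDiffAt ℝ 1 (extChartAt (𝓡 n) (f x) ∘ f) x :=
    ((contMDiffAt_extChartAt (I := 𝓡 n) (n := 1)).comp x hf).contDiffAt
  obtain ⟨K₁, U₁, hU₁, h₁⟩ := hg.exists_lipschitzOnWith
  obtain ⟨K₂, U₂, hU₂, h₂⟩ := exists_lipschitzOnWith_extChartAt_symm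
    ((extChartAt (𝓡 n) (f x)).map_source hsrc)
  have hs : f ⁻¹' (extChartAt (𝓡 n) (f x)).source ∈ 𝓝 x :=
    hf.continuousAt.preimage_mem_nhds (extChartAt_source_mem_nhds (I := 𝓡 n) (f x))
  have hp : (extChartAt (𝓡 n) (f x) ∘ f) ⁻¹' U₂ ∈ 𝓝 x := hg.continuousAt.preimage_mem_nhds hU₂
  refine ⟨K₂ * K₁, _, inter_mem (inter_mem hU₁ hp) hs, ?_⟩
  have h3 := (h₂.comp (h₁.mono (s := U₁ ∩ (extChartAt (𝓡 n) (f x) ∘ f) ⁻¹' U₂ ∩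
    f ⁻¹' (extChartAt (𝓡 n) (f x)).source) fun z hz ↦ hz.1.1) fun z hz ↦ hz.1.2)
  refine fun z hz z' hz' ↦ ?_
  have := h3 hz hz'
  simp only [Function.comp_apply] at this
  rwa [(extChartAt (𝓡 n) (f x)).left_inv hz.2, (extChartAt (𝓡 n) (f x)).left_inv hz'.2] at this

end LocalLipschitz

/-! ### Parametrizations of the hypersurface and bounds on variations. -/

section Parametrization

variable {m : ℕ} {M : Type*} [MetricSpace M] [ChartedSpace (𝔼 (m + 1)) M]
  [RiemannianBundle (fun x : M ↦ TangentSpace (𝓡 (m + 1)) x)] [IsManifold (𝓡 (m + 1)) ω M]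
  [IsContMDiffRiemannianBundle (𝓡 (m + 1)) ω (𝔼 (m + 1))
    (fun x : M ↦ TangentSpace (𝓡 (m + 1)) x)]

/-- `a` parametrizes the set `S` near `p` by the coordinates of the preferred chart at `p` other
than the `i`-th one. -/
structure IsParametrization (S : Set M) (p : M) (i : Fin (m + 1)) (a : 𝔼 m → M) (ρ : ℝ) :
    Prop where
  pos : 0 < ρ
  smooth : ContMDiffOn 𝓘(ℝ, 𝔼 m) (𝓡 (m + 1)) ∞ a (Metric.ball (splitChart p i p).2 ρ)
  mapsTo : MapsTo a (Metric.ball (splitChart p i p).2 ρ) S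
  mapsTo_source : MapsTo a (Metric.ball (splitChart p i p).2 ρ) (extChartAt (𝓡 (m + 1)) p).source
  snd : ∀ x ∈ Metric.ball (splitChart p i p).2 ρ, (splitChart p i (a x)).2 = x
  apply_snd : ∀ᶠ z in 𝓝 p, z ∈ S → a (splitChart p i z).2 = z
  apply_self : a (splitChart p i p).2 = p

lemma IsHypersurface.exists_isParametrization {S : Set M} (hS : IsHypersurface (m + 1) S) {p : M}
    (hp : p ∈ S) : ∃ (i : Fin (m + 1)) (a : 𝔼 m → M) (ρ : ℝ), IsParametrization S p i a ρ := by
  obtain ⟨U, h, hpU, H⟩ := hS p hp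
  obtain ⟨i, e, δ, he, heU⟩ := H.exists_adapted hp hpU (univ_mem (f := 𝓝 p))
  have heU' : e.source ⊆ U := fun x hx ↦ (heU hx).1
  refine ⟨i, fun x ↦ e.symm (0, x), δ, he.pos, ?_, fun x hx ↦ he.symm_zero_mem H heU' hx,
    fun x hx ↦ he.source_subset (e.map_target (he.zero_mem_target hx)),
    fun x hx ↦ he.splitChart_symm (he.zero_mem_target hx), ?_, ?_⟩
  · have h1 : ContMDiff 𝓘(ℝ, 𝔼 m) 𝓘(ℝ, ℝ × 𝔼 m) ∞ fun x : 𝔼 m ↦ ((0 : ℝ), x) :=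
      (contDiff_const.prodMk contDiff_id).contMDiff
    exact he.smooth_symm.comp h1.contMDiffOn fun x hx ↦ he.zero_mem_target hx
  · filter_upwards [e.open_source.mem_nhds he.mem] with z hz hzS
    have h1 := (he.symm_zero_of_mem H heU' hz hzS).2
    rw [he.apply z hz] at h1
    exact h1
  · have h1 := (he.symm_zero_of_mem H heU' he.mem hp).2
    rwa [he.apply_self] at h1

namespace IsParametrization

variable {S : Set M} {p : M} {i : Fin (m + 1)} {a : 𝔼 m → M} {ρ : ℝ} {ε : ℝ} {F : ℝ → M → M}

lemma tendsto_snd (p : M) (i : Fin (m + 1)) :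
    Tendsto (fun z ↦ (splitChart p i z).2) (𝓝 p) (𝓝 (splitChart p i p).2) := by
  have h := (contMDiffOn_splitChart (k := 0) p i).continuousOn.continuousAt
    (extChartAt_source_mem_nhds (I := 𝓡 (m + 1)) p)
  exact h.snd.tendsto

lemma contMDiffOn_variation (ha : IsParametrization S p i a ρ) (hF : IsVariation (m + 1) S ε F) :
    ContMDiffOn 𝓘(ℝ, ℝ × 𝔼 m) (𝓡 (m + 1)) ∞ (fun q : ℝ × 𝔼 m ↦ F q.1 (a q.2))
      (Ioo (-ε) ε ×ˢ Metric.ball (splitChart p i p).2 ρ) := by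
  have h1 : ContMDiffOn 𝓘(ℝ, ℝ × 𝔼 m) (𝓘(ℝ, ℝ).prod (𝓡 (m + 1))) ∞
      (fun q : ℝ × 𝔼 m ↦ (q.1, a q.2)) (Ioo (-ε) ε ×ˢ Metric.ball (splitChart p i p).2 ρ) := by
    refine ContMDiffOn.prodMk (contDiff_fst.contMDiff.contMDiffOn) ?_
    exact ha.smooth.comp (contDiff_snd.contMDiff.contMDiffOn) fun q hq ↦ hq.2
  exact hF.smooth.comp h1 fun q hq ↦ ⟨hq.1, ha.mapsTo hq.2⟩

variable [IsRiemannianManifold (𝓡 (m + 1)) M]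

/-- In a parametrization the variation is Lipschitz jointly in time and position near `(0, p)`, and
it fixes `S` at time `0`. -/
lemma exists_dist_le (ha : IsParametrization S p i a ρ) (hF : IsVariation (m + 1) S ε F) :
    ∃ C : ℝ, ∃ δ > 0, ∀ᶠ z in 𝓝[S] p, ∀ t : ℝ, |t| < δ → dist (F t z) z ≤ C * |t| := by
  have hx₀ := Metric.mem_ball_self (x := (splitChart p i p).2) ha.pos
  have h0 : (0 : ℝ) ∈ Ioo (-ε) ε := ⟨by linarith [hF.pos], hF.pos⟩
  have hs := ((ha.contMDiffOn_variation hF).contMDiffAt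
    ((isOpen_Ioo.prod Metric.isOpen_ball).mem_nhds (mk_mem_prod h0 hx₀))).of_le (show (1 : WithTop ℕ∞) ≤ ∞ by norm_cast)
  obtain ⟨K, U, hU, hK⟩ := hs.exists_lipschitzOnWith
  obtain ⟨δ, hδ, hb⟩ := Metric.mem_nhds_iff.1 hU
  refine ⟨K, δ, hδ, ?_⟩
  have h1 := (tendsto_snd p i).eventually (Metric.ball_mem_nhds _ hδ)
  rw [eventually_nhdsWithin_iff]
  filter_upwards [h1, ha.apply_snd] with z hz hza hzS t ht
  have hm : ∀ t : ℝ, |t| < δ → (t, (splitChart p i z).2) ∈ U := fun t ht ↦ hb (by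
    rw [Metric.mem_ball, Prod.dist_eq, max_lt_iff]
    exact ⟨by simpa using ht, hz⟩)
  have h2 := hK.dist_le_mul _ (hm t ht) _ (hm 0 (by simpa using hδ))
  simp only [hza hzS, hF.zero z hzS, Prod.dist_eq, dist_self, Real.dist_eq, sub_zero] at h2
  simpa using h2

/-- A Lipschitz image of a ball has finite measure. `F t` need not be an immersion, so all times in
the interval are covered. -/
lemma exists_measure_image_ne_top [MeasurableSpace M] [BorelSpace M]
    (ha : IsParametrization S p i a ρ) (hF : IsVariation (m + 1) S ε F) {t : ℝ}
    (ht : t ∈ Ioo (-ε) ε) : ∃ V ∈ 𝓝[S] p, μHE[m] (F t '' V) ≠ ⊤ := by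
  have hx₀ := Metric.mem_ball_self (x := (splitChart p i p).2) ha.pos
  have hs := ((ha.contMDiffOn_variation hF).contMDiffAt
    ((isOpen_Ioo.prod Metric.isOpen_ball).mem_nhds (mk_mem_prod ht hx₀))).of_le (show (1 : WithTop ℕ∞) ≤ ∞ by norm_cast)
  have hs' : ContMDiffAt 𝓘(ℝ, 𝔼 m) (𝓡 (m + 1)) 1 (fun x ↦ F t (a x)) (splitChart p i p).2 :=
    ContMDiffAt.comp (f := fun x : 𝔼 m ↦ (t, x)) (splitChart p i p).2 hs
      ((contDiff_const.prodMk contDiff_id).contMDiff.contMDiffAt)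
  obtain ⟨K, U, hU, hK⟩ := hs'.exists_lipschitzOnWith
  obtain ⟨r, hr, hb⟩ := Metric.mem_nhds_iff.1 hU
  refine ⟨{z ∈ S | (splitChart p i z).2 ∈ Metric.ball (splitChart p i p).2 r ∧
    a (splitChart p i z).2 = z}, ?_, ?_⟩
  · have : ∀ᶠ z in 𝓝[S] p, z ∈ S ∧ (splitChart p i z).2 ∈ Metric.ball (splitChart p i p).2 r ∧
        a (splitChart p i z).2 = z := by
      rw [eventually_nhdsWithin_iff]
      filter_upwards [(tendsto_snd p i).eventually (Metric.ball_mem_nhds _ hr), ha.apply_snd]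
        with z hz hza hzS
      exact ⟨hzS, hz, hza hzS⟩
    exact this
  · refine ne_top_of_le_ne_top ?_ ((measure_mono (t := (fun x ↦ F t (a x)) ''
      Metric.ball (splitChart p i p).2 r) ?_).trans
        ((hK.mono hb).euclideanHausdorffMeasure_image_le m))
    · refine ENNReal.mul_ne_top (by simp) ?_
      rw [EuclideanSpace.euclideanHausdorffMeasure_eq_volume]
      exact measure_ball_lt_top.ne
    · rintro _ ⟨z, ⟨-, hz, hza⟩, rfl⟩
      exact ⟨_, hz, by simp only [hza]⟩

end IsParametrization

variable [IsRiemannianManifold (𝓡 (m + 1)) M] {S : Set M} {ε : ℝ} {F : ℝ → M → M}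

/-- A variation of a compact hypersurface moves every point by at most a multiple of `|t|`. -/
lemma IsVariation.exists_dist_le (hF : IsVariation (m + 1) S ε F) (hS : IsHypersurface (m + 1) S)
    (hc : IsCompact S) :
    ∃ C > 0, ∃ δ > 0, ∀ t : ℝ, |t| < δ → ∀ z ∈ S, dist (F t z) z ≤ C * |t| := by
  refine hc.induction_on (p := fun A ↦ ∃ C > 0, ∃ δ > 0, ∀ t : ℝ, |t| < δ → ∀ z ∈ A,
    dist (F t z) z ≤ C * |t|) ?_ ?_ ?_ ?_
  · exact ⟨1, one_pos, 1, one_pos, by simp⟩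
  · rintro A B hAB ⟨C, hC, δ, hδ, h⟩
    exact ⟨C, hC, δ, hδ, fun t ht z hz ↦ h t ht z (hAB hz)⟩
  · rintro A B ⟨C, hC, δ, hδ, h⟩ ⟨C', hC', δ', hδ', h'⟩
    refine ⟨max C C', lt_max_of_lt_left hC, min δ δ', lt_min hδ hδ', fun t ht z hz ↦ ?_⟩
    rcases hz with hz | hz
    · exact (h t (ht.trans_le (min_le_left _ _)) z hz).trans
        (mul_le_mul_of_nonneg_right (le_max_left _ _) (abs_nonneg t))
    · exact (h' t (ht.trans_le (min_le_right _ _)) z hz).trans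
        (mul_le_mul_of_nonneg_right (le_max_right _ _) (abs_nonneg t))
  · intro p hp
    obtain ⟨i, a, ρ, ha⟩ := hS.exists_isParametrization hp
    obtain ⟨C, δ, hδ, h⟩ := ha.exists_dist_le hF
    refine ⟨_, h, max C 1, lt_max_of_lt_right one_pos, δ, hδ, fun t ht z hz ↦ ?_⟩
    exact (hz t ht).trans (mul_le_mul_of_nonneg_right (le_max_left _ _) (abs_nonneg t))

lemma IsVariation.measure_image_ne_top [MeasurableSpace M] [BorelSpace M]
    (hF : IsVariation (m + 1) S ε F) (hS : IsHypersurface (m + 1) S) (hc : IsCompact S) {t : ℝ}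
    (ht : t ∈ Ioo (-ε) ε) : μHE[m] (F t '' S) ≠ ⊤ := by
  refine hc.induction_on (p := fun A ↦ μHE[m] (F t '' A) ≠ ⊤) (by simp) ?_ ?_ ?_
  · intro A B hAB h
    exact ne_top_of_le_ne_top h (measure_mono (image_mono hAB))
  · intro A B hA hB
    rw [image_union]
    exact ne_top_of_le_ne_top (ENNReal.add_ne_top.2 ⟨hA, hB⟩) (measure_union_le _ _)
  · intro p hp
    obtain ⟨i, a, ρ, ha⟩ := hS.exists_isParametrization hp
    exact ha.exists_measure_image_ne_top hF ht

end Parametrization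

/-! ### The varied hypersurfaces as graphs. -/

section GraphFamily

variable {m : ℕ} {M : Type*} [MetricSpace M] [ChartedSpace (𝔼 (m + 1)) M]

/-- Near `p`, in the box `(a, b) × B(x₀, ρ)` of split coordinates, the sets `F t '' S` with
`-δ < t < δ` are the graphs of the functions `w t`. -/
structure IsGraphFamily (S : Set M) (F : ℝ → M → M) (p : M) (i : Fin (m + 1)) (a b : ℝ)
    (x₀ : 𝔼 m) (ρ δ : ℝ) (w : ℝ → 𝔼 m → ℝ) : Prop where
  radius_pos : 0 < ρ
  time_pos : 0 < δ
  subset_target : Ioo a b ×ˢ Metric.ball x₀ ρ ⊆ splitCoord i ⁻¹' (extChartAt (𝓡 (m + 1)) p).target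
  mem_nhds : splitPoint p i '' (Ioo a b ×ˢ Metric.ball x₀ ρ) ∈ 𝓝 p
  smooth : ContDiffOn ℝ ∞ (fun q : ℝ × 𝔼 m ↦ w q.1 q.2) (Ioo (-δ) δ ×ˢ Metric.ball x₀ ρ)
  mapsTo : ∀ t ∈ Ioo (-δ) δ, MapsTo (w t) (Metric.ball x₀ ρ) (Ioo a b)
  mem_iff : ∀ t ∈ Ioo (-δ) δ, ∀ q ∈ Ioo a b ×ˢ Metric.ball x₀ ρ,
    splitPoint p i q ∈ F t '' S ↔ q.1 = w t q.2

variable [RiemannianBundle (fun x : M ↦ TangentSpace (𝓡 (m + 1)) x)] [IsManifold (𝓡 (m + 1)) ω M]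
  [IsContMDiffRiemannianBundle (𝓡 (m + 1)) ω (𝔼 (m + 1))
    (fun x : M ↦ TangentSpace (𝓡 (m + 1)) x)]
  {S : Set M} {p : M} {i : Fin (m + 1)} {ε : ℝ} {F : ℝ → M → M}

lemma splitPoint_image_mem_nhds {U : Set (ℝ × 𝔼 m)} (hU : U ∈ 𝓝 (splitChart p i p)) :
    splitPoint p i '' U ∈ 𝓝 p := by
  have hch : ContinuousAt (splitChart p i) p :=
    (contMDiffOn_splitChart (k := 0) p i).continuousOn.continuousAt
      (extChartAt_source_mem_nhds (I := 𝓡 (m + 1)) p)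
  filter_upwards [hch.preimage_mem_nhds hU, extChartAt_source_mem_nhds (I := 𝓡 (m + 1)) p]
    with z hz hzs
  exact ⟨_, hz, splitPoint_splitChart hzs i⟩

lemma exists_prod_ball_subset {X Y : Type*} [PseudoMetricSpace X] [PseudoMetricSpace Y] {x : X}
    {y : Y} {U : Set (X × Y)} (hU : U ∈ 𝓝 (x, y)) :
    ∃ r > 0, Metric.ball x r ×ˢ Metric.ball y r ⊆ U := by
  obtain ⟨r, hr, h⟩ := Metric.mem_nhds_iff.1 hU
  exact ⟨r, hr, (ball_prod_same x y r).symm ▸ h⟩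

/-- At time `0` the map `(t, x) ↦ (t, (splitChart p i (F t (a x))).2)` is the identity in `x`, so
its derivative at the base point is an invertible shear. `W` is the split-off coordinate of the
moving point, as a function of time and of its other coordinates. -/
lemma IsParametrization.exists_inverse {a : 𝔼 m → M} {ρ : ℝ} (ha : IsParametrization S p i a ρ)
    (hF : IsVariation (m + 1) S ε F) :
    ∃ (Φ : OpenPartialHomeomorph (ℝ × 𝔼 m) (ℝ × 𝔼 m)) (W : ℝ × 𝔼 m → ℝ),
      ((0 : ℝ), (splitChart p i p).2) ∈ Φ.source ∧ ((0 : ℝ), (splitChart p i p).2) ∈ Φ.target ∧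
      W (0, (splitChart p i p).2) = (splitChart p i p).1 ∧ ContDiffOn ℝ ∞ W Φ.target ∧
      (∀ q, Φ q = (q.1, (splitChart p i (F q.1 (a q.2))).2)) ∧
      (∀ q ∈ Φ.source, q.2 ∈ Metric.ball (splitChart p i p).2 ρ ∧
        F q.1 (a q.2) ∈ (extChartAt (𝓡 (m + 1)) p).source ∧
        W (Φ q) = (splitChart p i (F q.1 (a q.2))).1) := by
  set x₀ := (splitChart p i p).2 with hx₀
  have hx₀m := Metric.mem_ball_self (x := x₀) ha.pos
  have h0 : (0 : ℝ) ∈ Ioo (-ε) ε := ⟨by linarith [hF.pos], hF.pos⟩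
  have hv := ha.contMDiffOn_variation hF
  set O : Set (ℝ × 𝔼 m) := (Ioo (-ε) ε ×ˢ Metric.ball x₀ ρ) ∩
    (fun q : ℝ × 𝔼 m ↦ F q.1 (a q.2)) ⁻¹' (extChartAt (𝓡 (m + 1)) p).source with hO
  have hOo : IsOpen O := hv.continuousOn.isOpen_inter_preimage (isOpen_Ioo.prod Metric.isOpen_ball)
    (isOpen_extChartAt_source p)
  set G : ℝ × 𝔼 m → ℝ × 𝔼 m := fun q ↦ splitChart p i (F q.1 (a q.2)) with hG
  have hGs : ContDiffOn ℝ ∞ G O :=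
    ((contMDiffOn_splitChart p i).comp (hv.mono inter_subset_left) fun q hq ↦ hq.2).contDiffOn
  have hG0 : ∀ x ∈ Metric.ball x₀ ρ, G (0, x) = splitChart p i (a x) := fun x hx ↦ by
    simp only [hG, hF.zero _ (ha.mapsTo hx)]
  have h0O : ((0 : ℝ), x₀) ∈ O := by
    refine ⟨⟨h0, hx₀m⟩, ?_⟩
    simp only [mem_preimage, hF.zero _ (ha.mapsTo hx₀m)]
    exact ha.mapsTo_source hx₀m
  set Q : ℝ × 𝔼 m → ℝ × 𝔼 m := fun q ↦ (q.1, (G q).2) with hQ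
  have hQs : ContDiffOn ℝ ∞ Q O := contDiff_fst.contDiffOn.prodMk hGs.snd
  have hGd : HasFDerivAt (fun q ↦ (G q).2) (fderiv ℝ (fun q ↦ (G q).2) (0, x₀)) (0, x₀) :=
    ((hGs.snd.contDiffAt (hOo.mem_nhds h0O)).differentiableAt (by simp)).hasFDerivAt
  set L := fderiv ℝ (fun q ↦ (G q).2) (0, x₀) with hL
  have hL0 : ∀ v, L (0, v) = v := by
    intro v
    have h1 := hGd.comp (f := fun x ↦ ((0 : ℝ), x)) x₀ ((hasFDerivAt_const 0 x₀).prodMk (hasFDerivAt_id x₀))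
    have h2 : HasFDerivAt (id : 𝔼 m → 𝔼 m) (L.comp ((0 : 𝔼 m →L[ℝ] ℝ).prod (ContinuousLinearMap.id ℝ (𝔼 m)))) x₀ := by
      refine h1.congr_of_eventuallyEq ?_
      filter_upwards [Metric.isOpen_ball.mem_nhds hx₀m] with x hx
      simp only [Function.comp_apply, hG0 x hx, ha.snd x hx, id]
    have h3 := congrArg (fun A : 𝔼 m →L[ℝ] 𝔼 m ↦ A v) (h2.unique (hasFDerivAt_id x₀))
    simpa using h3
  have hLsplit : ∀ q : ℝ × 𝔼 m, L q = q.1 • L (1, 0) + q.2 := by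
    intro q
    conv_lhs => rw [show q = q.1 • ((1 : ℝ), (0 : 𝔼 m)) + (0, q.2) by ext <;> simp]
    rw [map_add, map_smul, hL0]
  let A : (ℝ × 𝔼 m) ≃L[ℝ] (ℝ × 𝔼 m) := ContinuousLinearEquiv.equivOfInverse
    ((ContinuousLinearMap.fst ℝ ℝ (𝔼 m)).prod L)
    ((ContinuousLinearMap.fst ℝ ℝ (𝔼 m)).prod (ContinuousLinearMap.snd ℝ ℝ (𝔼 m) -
      (ContinuousLinearMap.fst ℝ ℝ (𝔼 m)).smulRight (L (1, 0))))
    (fun q ↦ by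
      refine Prod.ext (by simp) ?_
      simp [hLsplit q])
    (fun q ↦ by
      refine Prod.ext (by simp) ?_
      change L (q.1, q.2 - q.1 • L (1, 0)) = q.2
      rw [hLsplit]
      simp)
  obtain ⟨Φ, h0Φ, hΦO, hΦQ, hΦs⟩ := exists_smooth_inverse hOo hQs h0O A
    ((hasFDerivAt_fst.prodMk hGd).fderiv)
  have hΦ0 : Φ (0, x₀) = (0, x₀) := by
    rw [hΦQ, hQ]
    simp only [hG0 x₀ hx₀m, ha.snd x₀ hx₀m]
  refine ⟨Φ, fun q ↦ (G (Φ.symm q)).1, h0Φ, hΦ0 ▸ Φ.map_source h0Φ, ?_, ?_, fun q ↦ hΦQ q,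
    fun q hq ↦ ⟨(hΦO hq).1.2, (hΦO hq).2, ?_⟩⟩
  · have : Φ.symm (0, x₀) = (0, x₀) := by
      conv_lhs => rw [← hΦ0]
      exact Φ.left_inv h0Φ
    change (G (Φ.symm (0, x₀))).1 = _
    rw [this, hG0 x₀ hx₀m, show a x₀ = p from ha.apply_self]
  · exact (hGs.comp hΦs fun q hq ↦ hΦO (Φ.map_target hq)).fst
  · simp only [Φ.left_inv hq, hG]

variable [IsRiemannianManifold (𝓡 (m + 1)) M]

/-- For small times the varied hypersurfaces are graphs near every point of the hypersurface. -/
lemma IsVariation.exists_isGraphFamily (hF : IsVariation (m + 1) S ε F)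
    (hS : IsHypersurface (m + 1) S) (hc : IsCompact S) (hp : p ∈ S) {V : Set M} (hV : V ∈ 𝓝 p) :
    ∃ (i : Fin (m + 1)) (a b : ℝ) (x₀ : 𝔼 m) (ρ δ : ℝ) (w : ℝ → 𝔼 m → ℝ),
      IsGraphFamily S F p i a b x₀ ρ δ w ∧ δ ≤ ε ∧
        splitPoint p i '' (Ioo a b ×ˢ Metric.ball x₀ ρ) ⊆ V := by
  obtain ⟨i, α, ρ₀, ha⟩ := hS.exists_isParametrization hp
  obtain ⟨C, hC, δ₁, hδ₁, hdist⟩ := hF.exists_dist_le hS hc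
  obtain ⟨Φ, W, h0Φ, h0T, hW0, hWs, hΦ, hΦW⟩ := ha.exists_inverse hF
  set s₀ := (splitChart p i p).1 with hs₀
  set x₀ := (splitChart p i p).2 with hx₀
  have hpsrc := mem_extChartAt_source (I := 𝓡 (m + 1)) p
  obtain ⟨r₁, hr₁, hb₁⟩ := exists_prod_ball_subset (Φ.open_source.mem_nhds h0Φ)
  -- Points of `S` within `r₂` of `p` lie in the parametrized piece. The box is kept within `r₂ / 2`
  -- of `p` and, by the choice of `δ`, displacements are below `r₂ / 2`; so no other part of `S` can
  -- enter the box.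
  obtain ⟨r₂, hr₂, hb₂⟩ := Metric.eventually_nhds_iff_ball.1
    (((IsParametrization.tendsto_snd p i).eventually (Metric.ball_mem_nhds _ hr₁)).and ha.apply_snd)
  have hsp0 : splitPoint p i (s₀, x₀) = p := splitPoint_splitChart hpsrc i
  have hT0 : (s₀, x₀) ∈ splitCoord i ⁻¹' (extChartAt (𝓡 (m + 1)) p).target := by
    have : splitCoord i (s₀, x₀) = extChartAt (𝓡 (m + 1)) p p :=
      (splitCoord i).apply_symm_apply _
    rw [mem_preimage, this]
    exact (extChartAt (𝓡 (m + 1)) p).map_source hpsrc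
  have hTo : IsOpen (splitCoord i ⁻¹' (extChartAt (𝓡 (m + 1)) p).target) :=
    (isOpen_target p).preimage (splitCoord i).continuous
  have hspc : ContinuousAt (splitPoint p i) (s₀, x₀) :=
    (contMDiffOn_splitPoint (k := 0) p i).continuousOn.continuousAt (hTo.mem_nhds hT0)
  have hspV : splitPoint p i ⁻¹' (V ∩ Metric.ball p (r₂ / 2)) ∈ 𝓝 (s₀, x₀) :=
    hspc.preimage_mem_nhds (by
      rw [hsp0]
      exact inter_mem hV (Metric.ball_mem_nhds p (half_pos hr₂)))
  obtain ⟨r₃, hr₃, hb₃⟩ := exists_prod_ball_subset (inter_mem (hTo.mem_nhds hT0) hspV)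
  have hWc : W ⁻¹' Metric.ball s₀ r₃ ∈ 𝓝 ((0 : ℝ), x₀) :=
    (hWs.continuousOn.continuousAt (Φ.open_target.mem_nhds h0T)).preimage_mem_nhds (by
      rw [hW0]
      exact Metric.ball_mem_nhds s₀ hr₃)
  obtain ⟨r₄, hr₄, hb₄⟩ := exists_prod_ball_subset (inter_mem (Φ.open_target.mem_nhds h0T) hWc)
  obtain ⟨ρ, hρpos, hρ3, hρ4⟩ : ∃ ρ > 0, ρ ≤ r₃ ∧ ρ ≤ r₄ :=
    ⟨min r₃ r₄, lt_min hr₃ hr₄, min_le_left _ _, min_le_right _ _⟩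
  obtain ⟨δ, hδpos, hδε, hδr₁, hδr₄, hδδ₁, hδC⟩ : ∃ δ > 0, δ ≤ ε ∧ δ ≤ r₁ ∧ δ ≤ r₄ ∧ δ ≤ δ₁ ∧
      δ ≤ r₂ / 2 / C :=
    ⟨min (min ε (min r₁ r₄)) (min δ₁ (r₂ / 2 / C)),
      lt_min (lt_min hF.pos (lt_min hr₁ hr₄)) (lt_min hδ₁ (by positivity)), by simp, by simp,
      by simp, by simp, by simp⟩
  have hbox : Ioo (s₀ - r₃) (s₀ + r₃) ×ˢ Metric.ball x₀ ρ ⊆ Metric.ball s₀ r₃ ×ˢ Metric.ball x₀ r₃ := by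
    rw [← Real.ball_eq_Ioo]
    exact prod_mono le_rfl (Metric.ball_subset_ball hρ3)
  have hdom : Ioo (-δ) δ ×ˢ Metric.ball x₀ ρ ⊆ Metric.ball (0 : ℝ) r₄ ×ˢ Metric.ball x₀ r₄ := by
    refine prod_mono (fun t ht ↦ ?_) (Metric.ball_subset_ball hρ4)
    rw [mem_ball_zero_iff, Real.norm_eq_abs]
    exact (abs_lt.2 ht).trans_le hδr₄
  refine ⟨i, s₀ - r₃, s₀ + r₃, x₀, ρ, δ, fun t x ↦ W (t, x), ⟨hρpos, hδpos,
    fun q hq ↦ (hb₃ (hbox hq)).1, ?_, ?_, ?_, ?_⟩, hδε, ?_⟩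
  · exact splitPoint_image_mem_nhds (i := i) ((isOpen_Ioo.prod Metric.isOpen_ball).mem_nhds
      ⟨⟨by linarith, by linarith⟩, Metric.mem_ball_self hρpos⟩)
  · exact hWs.mono fun q hq ↦ (hb₄ (hdom hq)).1
  · intro t ht x hx
    rw [← Real.ball_eq_Ioo]
    exact (hb₄ (hdom (mk_mem_prod ht hx))).2
  · intro t ht q hq
    have habs := abs_lt.2 ht
    constructor
    · rintro ⟨z, hzS, hz⟩
      have h1 : dist (F t z) z ≤ C * |t| := hdist t
        (habs.trans_le hδδ₁) z hzS
      have h2 : C * |t| < r₂ / 2 := by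
        have := habs.trans_le hδC
        rwa [lt_div_iff₀ hC, mul_comm] at this
      have h3 : dist (F t z) p < r₂ / 2 := by
        rw [hz]
        exact (hb₃ (hbox hq)).2.2
      obtain ⟨h4, h5⟩ := hb₂ z (by
        rw [Metric.mem_ball]
        calc dist z p ≤ dist z (F t z) + dist (F t z) p := dist_triangle _ _ _
          _ < r₂ := by rw [dist_comm z]; linarith)
      have h5 := h5 hzS
      have h6 : (t, (splitChart p i z).2) ∈ Φ.source := hb₁ ⟨by
        rw [mem_ball_zero_iff, Real.norm_eq_abs]
        exact habs.trans_le hδr₁, h4⟩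
      have h7 := (hΦW _ h6).2.2
      rw [hΦ] at h7
      simp only [h5, hz, splitChart_splitPoint (hb₃ (hbox hq)).1] at h7
      exact h7.symm
    · intro hqw
      have hT := (hb₄ (hdom (mk_mem_prod ht hq.2))).1
      have hs := Φ.map_target hT
      obtain ⟨h1, h2, h3⟩ := hΦW _ hs
      have h4 := hΦ (Φ.symm (t, q.2))
      rw [Φ.right_inv hT] at h3 h4
      have h5 : (Φ.symm (t, q.2)).1 = t := (congrArg Prod.fst h4).symm
      have h6 := congrArg Prod.snd h4
      simp only [h5] at h2 h3 h6
      refine ⟨α (Φ.symm (t, q.2)).2, ha.mapsTo h1, ?_⟩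
      rw [← splitPoint_splitChart h2 i]
      congr 1
      refine Prod.ext ?_ h6.symm
      rw [← h3, hqw]
  · rintro _ ⟨q, hq, rfl⟩
    exact (hb₃ (hbox hq)).2.1

end GraphFamily

/-! ### The side of the moving graph on which the enclosed sets lie. -/

section Side

section Enclosed

variable {X : Type*} [TopologicalSpace X] {S Ω : Set X}

lemma Encloses.isOpen (h : Encloses S Ω) : IsOpen Ω := h.2 ▸ isOpen_interior

lemma Encloses.notMem {x : X} (h : Encloses S Ω) (hx : x ∈ S) : x ∉ Ω := fun hxΩ ↦ by
  rw [← h.1, h.isOpen.frontier_eq] at hx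
  exact hx.2 hxΩ

end Enclosed

variable {m : ℕ} {M : Type*} [MetricSpace M] [ChartedSpace (𝔼 (m + 1)) M]
  [RiemannianBundle (fun x : M ↦ TangentSpace (𝓡 (m + 1)) x)] [IsManifold (𝓡 (m + 1)) ω M]
  [IsContMDiffRiemannianBundle (𝓡 (m + 1)) ω (𝔼 (m + 1))
    (fun x : M ↦ TangentSpace (𝓡 (m + 1)) x)]
  {S : Set M} {p : M} {i : Fin (m + 1)} {a b : ℝ} {x₀ : 𝔼 m} {ρ δ : ℝ} {w : ℝ → 𝔼 m → ℝ} {ε : ℝ}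
  {F : ℝ → M → M} {Ω : ℝ → Set M}

lemma IsVariation.image_zero (hF : IsVariation (m + 1) S ε F) : F 0 '' S = S := by
  ext x
  constructor
  · rintro ⟨z, hz, rfl⟩
    rwa [hF.zero z hz]
  · exact fun hx ↦ ⟨x, hx, hF.zero x hx⟩

namespace IsGraphFamily

lemma zero_mem (G : IsGraphFamily S F p i a b x₀ ρ δ w) : (0 : ℝ) ∈ Ioo (-δ) δ :=
  ⟨by linarith [G.time_pos], G.time_pos⟩

lemma segment_mem (G : IsGraphFamily S F p i a b x₀ ρ δ w) {c : ℝ} (hc : c = a ∨ c = b) {t : ℝ}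
    (ht : t ∈ Ioo (-δ) δ) {x : 𝔼 m} (hx : x ∈ Metric.ball x₀ ρ) {θ : ℝ} (hθ : θ ∈ Ioo (0 : ℝ) 1) :
    (w t x + θ * (c - w t x), x) ∈ Ioo a b ×ˢ Metric.ball x₀ ρ ∧ θ * (c - w t x) ≠ 0 := by
  obtain ⟨h1, h2⟩ := G.mapsTo t ht hx
  obtain ⟨h3, h4⟩ := hθ
  refine ⟨⟨?_, hx⟩, mul_ne_zero h3.ne' ?_⟩
  · rcases hc with rfl | rfl
    · exact ⟨by nlinarith, by nlinarith⟩
    · exact ⟨by nlinarith, by nlinarith⟩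
  · rcases hc with rfl | rfl
    · exact (sub_neg.2 h1).ne
    · exact (sub_pos.2 h2).ne'

/-- The points strictly between the moving graph and one face of the box, for all times together,
are parametrized by a connected set and avoid the moving hypersurface. Membership in `Ω t` is
locally constant there, hence constant. -/
lemma exists_segment_mem_iff (G : IsGraphFamily S F p i a b x₀ ρ δ w) (hδ : δ ≤ ε)
    (hΩ : IsEnclosedFamily S ε F Ω) {c : ℝ} (hc : c = a ∨ c = b) :
    ∃ P : Prop, ∀ t ∈ Ioo (-δ) δ, ∀ x ∈ Metric.ball x₀ ρ, ∀ θ ∈ Ioo (0 : ℝ) 1,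
      splitPoint p i (w t x + θ * (c - w t x), x) ∈ Ω t ↔ P := by
  set D : Set ((ℝ × 𝔼 m) × ℝ) := (Ioo (-δ) δ ×ˢ Metric.ball x₀ ρ) ×ˢ Ioo (0 : ℝ) 1 with hD
  have hDo : IsOpen D := (isOpen_Ioo.prod Metric.isOpen_ball).prod isOpen_Ioo
  have hDp : IsPreconnected D :=
    (((convex_Ioo _ _).prod (convex_ball _ _)).prod (convex_Ioo _ _)).isPreconnected
  have hw : ContinuousOn (fun d : (ℝ × 𝔼 m) × ℝ ↦ w d.1.1 d.1.2) D :=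
    G.smooth.continuousOn.comp continuousOn_fst fun d hd ↦ hd.1
  let γ : (ℝ × 𝔼 m) × ℝ → ℝ × 𝔼 m := fun d ↦ (w d.1.1 d.1.2 + d.2 * (c - w d.1.1 d.1.2), d.1.2)
  have hγ : ContinuousOn γ D :=
    (hw.add (continuousOn_snd.mul (continuousOn_const.sub hw))).prodMk
      (continuousOn_snd.comp continuousOn_fst fun d hd ↦ mem_univ _)
  have hγm : MapsTo γ D (Ioo a b ×ˢ Metric.ball x₀ ρ) := fun d hd ↦
    (G.segment_mem hc hd.1.1 hd.1.2 hd.2).1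
  have hsp : ContinuousOn (fun d ↦ splitPoint p i (γ d)) D :=
    (contMDiffOn_splitPoint (k := 0) p i).continuousOn.comp hγ fun d hd ↦ G.subset_target (hγm hd)
  have hloc : ∀ d ∈ D, ∀ᶠ d' in 𝓝 d, d' ∈ D →
      (splitPoint p i (γ d') ∈ Ω d'.1.1) = (splitPoint p i (γ d) ∈ Ω d.1.1) := by
    intro d hd
    have hnot : splitPoint p i (γ d) ∉ F d.1.1 '' S := fun h ↦ by
      have h1 := (G.mem_iff _ hd.1.1 _ (hγm hd)).1 h
      have h2 : d.2 * (c - w d.1.1 d.1.2) = 0 := by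
        simp only [γ] at h1
        linarith
      exact (G.segment_mem hc hd.1.1 hd.1.2 hd.2).2 h2
    have h1 := hΩ.continuous d.1.1 ⟨by linarith [hd.1.1.1], hd.1.1.2.trans_le hδ⟩ _ hnot
    have h2 : ContinuousAt (fun d' : (ℝ × 𝔼 m) × ℝ ↦ (d'.1.1, splitPoint p i (γ d'))) d :=
      (continuous_fst.comp continuous_fst).continuousAt.prodMk (hsp.continuousAt (hDo.mem_nhds hd))
    filter_upwards [h2.tendsto.eventually h1] with d' hd' _
    exact propext hd'
  rcases D.eq_empty_or_nonempty with h | ⟨d₀, hd₀⟩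
  · refine ⟨True, fun t ht x hx θ hθ ↦ ?_⟩
    have : ((t, x), θ) ∈ D := ⟨⟨ht, hx⟩, hθ⟩
    rw [h] at this
    exact this.elim
  · refine ⟨splitPoint p i (γ d₀) ∈ Ω d₀.1.1, fun t ht x hx θ hθ ↦ ?_⟩
    have : ((t, x), θ) ∈ D := ⟨⟨ht, hx⟩, hθ⟩
    exact iff_of_eq (hDp.eq_of_eventually_eq hloc this hd₀)

/-- The enclosed sets lie on one side of the graphs, always the same. -/
lemma exists_side (G : IsGraphFamily S F p i a b x₀ ρ δ w) (hδ : δ ≤ ε)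
    (hF : IsVariation (m + 1) S ε F) (hΩ : IsEnclosedFamily S ε F Ω) (hp : p ∈ S) :
    ∃ σ : ℝ, (σ = 1 ∨ σ = -1) ∧ ∀ t ∈ Ioo (-δ) δ, ∀ q ∈ Ioo a b ×ˢ Metric.ball x₀ ρ,
      splitPoint p i q ∈ Ω t ↔ σ * (q.1 - w t q.2) < 0 := by
  have hmem : ∀ t ∈ Ioo (-δ) δ, t ∈ Ioo (-ε) ε := fun t ht ↦
    ⟨by linarith [ht.1], ht.2.trans_le hδ⟩
  have hon : ∀ t ∈ Ioo (-δ) δ, ∀ q ∈ Ioo a b ×ˢ Metric.ball x₀ ρ, q.1 = w t q.2 →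
      splitPoint p i q ∉ Ω t := fun t ht q hq h ↦
    (hΩ.encloses t (hmem t ht)).notMem ((G.mem_iff t ht q hq).2 h)
  obtain ⟨P, hP⟩ := G.exists_segment_mem_iff hδ hΩ (c := a) (Or.inl rfl)
  obtain ⟨P', hP'⟩ := G.exists_segment_mem_iff hδ hΩ (c := b) (Or.inr rfl)
  have hlow : ∀ t ∈ Ioo (-δ) δ, ∀ q ∈ Ioo a b ×ˢ Metric.ball x₀ ρ, q.1 < w t q.2 →
      (splitPoint p i q ∈ Ω t ↔ P) := by
    intro t ht q hq h
    have h1 := hq.1.1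
    have h2 : 0 < w t q.2 - a := by linarith
    have h3 := hP t ht q.2 hq.2 ((w t q.2 - q.1) / (w t q.2 - a))
      ⟨div_pos (by linarith) h2, (div_lt_one h2).2 (by linarith)⟩
    have h4 : w t q.2 + (w t q.2 - q.1) / (w t q.2 - a) * (a - w t q.2) = q.1 := by
      field_simp
      ring
    rwa [h4] at h3
  have hup : ∀ t ∈ Ioo (-δ) δ, ∀ q ∈ Ioo a b ×ˢ Metric.ball x₀ ρ, w t q.2 < q.1 →
      (splitPoint p i q ∈ Ω t ↔ P') := by
    intro t ht q hq h
    have h1 := hq.1.2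
    have h2 : 0 < b - w t q.2 := by linarith
    have h3 := hP' t ht q.2 hq.2 ((q.1 - w t q.2) / (b - w t q.2))
      ⟨div_pos (by linarith) h2, (div_lt_one h2).2 (by linarith)⟩
    have h4 : w t q.2 + (q.1 - w t q.2) / (b - w t q.2) * (b - w t q.2) = q.1 := by
      field_simp
      ring
    rwa [h4] at h3
  have h0 := G.zero_mem
  have henc := hΩ.encloses 0 (hmem 0 h0)
  rw [hF.image_zero] at henc
  have hpcl : p ∈ closure (Ω 0) := frontier_subset_closure (henc.1.symm ▸ hp)
  -- If both sides belonged to `Ω 0`, then `p` would be interior to its closure and so lie in `Ω 0`;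
  -- if neither did, `p` would not be in the closure. At time `0` exactly one side remains, and `P`
  -- and `P'` do not depend on time.
  by_cases hPt : P <;> by_cases hPt' : P'
  · exfalso
    refine henc.notMem hp ?_
    rw [← henc.2]
    refine mem_interior_iff_mem_nhds.2 (Filter.mem_of_superset G.mem_nhds ?_)
    rintro _ ⟨q, hq, rfl⟩
    rcases lt_trichotomy q.1 (w 0 q.2) with h | h | h
    · exact subset_closure ((hlow 0 h0 q hq h).2 hPt)
    · have h1 := (G.mem_iff 0 h0 q hq).2 h
      rw [hF.image_zero, ← henc.1] at h1
      exact frontier_subset_closure h1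
    · exact subset_closure ((hup 0 h0 q hq h).2 hPt')
  · refine ⟨1, Or.inl rfl, fun t ht q hq ↦ ?_⟩
    rw [one_mul, sub_neg]
    rcases lt_trichotomy q.1 (w t q.2) with h | h | h
    · exact iff_of_true ((hlow t ht q hq h).2 hPt) h
    · exact iff_of_false (hon t ht q hq h) h.not_lt
    · exact iff_of_false (fun h1 ↦ hPt' ((hup t ht q hq h).1 h1)) h.not_gt
  · refine ⟨-1, Or.inr rfl, fun t ht q hq ↦ ?_⟩
    rw [neg_one_mul, neg_sub, sub_neg]
    rcases lt_trichotomy q.1 (w t q.2) with h | h | h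
    · exact iff_of_false (fun h1 ↦ hPt ((hlow t ht q hq h).1 h1)) h.not_gt
    · exact iff_of_false (hon t ht q hq h) h.not_gt
    · exact iff_of_true ((hup t ht q hq h).2 hPt') h
  · exfalso
    obtain ⟨z, hz, hzΩ⟩ := mem_closure_iff_nhds.1 hpcl _ G.mem_nhds
    obtain ⟨q, hq, rfl⟩ := hz
    rcases lt_trichotomy q.1 (w 0 q.2) with h | h | h
    · exact hPt ((hlow 0 h0 q hq h).1 hzΩ)
    · exact hon 0 h0 q hq h hzΩ
    · exact hPt' ((hup 0 h0 q hq h).1 hzΩ)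

end IsGraphFamily

end Side

/-! ### A defining function oriented by the enclosed set. -/

section OrientedRoot

variable {m : ℕ} {M : Type*} [MetricSpace M] [ChartedSpace (𝔼 (m + 1)) M]
  [RiemannianBundle (fun x : M ↦ TangentSpace (𝓡 (m + 1)) x)] [IsManifold (𝓡 (m + 1)) ω M]
  [IsContMDiffRiemannianBundle (𝓡 (m + 1)) ω (𝔼 (m + 1))
    (fun x : M ↦ TangentSpace (𝓡 (m + 1)) x)]
  {S Ω U W : Set M} {f g h : M → ℝ} {c : ℝ} {k : ℕ} {p : M} {i : Fin (m + 1)}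
  {e : OpenPartialHomeomorph M (ℝ × 𝔼 m)} {δ : ℝ}

lemma IsPreconnected.forall_mem_iff {X : Type*} [TopologicalSpace X] {A Ω : Set X}
    (hA : IsPreconnected A) (h : Disjoint A (frontier Ω)) :
    (∀ x ∈ A, x ∈ Ω) ∨ ∀ x ∈ A, x ∉ Ω := by
  have hloc : ∀ q ∈ A, ∀ᶠ x in 𝓝 q, x ∈ A → (x ∈ Ω) = (q ∈ Ω) := by
    intro q hq
    have h1 : q ∉ frontier Ω := disjoint_left.1 h hq
    by_cases hqΩ : q ∈ Ω
    · have h2 : q ∈ interior Ω := by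
        by_contra h3
        exact h1 ⟨subset_closure hqΩ, h3⟩
      filter_upwards [mem_interior_iff_mem_nhds.1 h2] with x hx _
      exact propext (iff_of_true hx hqΩ)
    · have h2 : q ∉ closure Ω := fun h3 ↦ h1 ⟨h3, fun h4 ↦ hqΩ (interior_subset h4)⟩
      filter_upwards [isClosed_closure.isOpen_compl.mem_nhds h2] with x hx _
      exact propext (iff_of_false (fun h3 ↦ hx (subset_closure h3)) hqΩ)
  by_contra! hcon
  obtain ⟨⟨x, hx, hxΩ⟩, y, hy, hyΩ⟩ := hcon
  exact hxΩ ((hA.eq_of_eventually_eq hloc hx hy).symm ▸ hyΩ)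

/-- A set enclosed by `S` is locally one of the two sides of `S`. -/
lemma IsAdaptedChart.exists_side (he : IsAdaptedChart p h i e δ)
    (H : IsLocalDefiningFunction (m + 1) S U h) (heU : e.source ⊆ U) (hp : p ∈ S)
    (hΩ : Encloses S Ω) :
    ∃ σ : ℝ, (σ = 1 ∨ σ = -1) ∧ ∀ x ∈ e.source, x ∈ Ω ↔ σ * h x < 0 := by
  have hside : ∀ I ⊆ Ioo (-δ) δ, Convex ℝ I → (0 : ℝ) ∉ I →
      (∀ x ∈ e.source, h x ∈ I → x ∈ Ω) ∨ ∀ x ∈ e.source, h x ∈ I → x ∉ Ω := by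
    intro I hI hIc hI0
    have hsub : I ×ˢ Metric.ball (splitChart p i p).2 δ ⊆ e.target := by
      rw [he.target]
      exact prod_mono hI le_rfl
    have hpre : IsPreconnected (e.symm '' (I ×ˢ Metric.ball (splitChart p i p).2 δ)) :=
      (hIc.prod (convex_ball _ _)).isPreconnected.image _ (e.continuousOn_symm.mono hsub)
    have hmem : ∀ x ∈ e.source, h x ∈ I → x ∈ e.symm '' (I ×ˢ Metric.ball (splitChart p i p).2 δ) := by
      intro x hx hxI
      refine ⟨e x, ⟨?_, (he.mem_target.1 (e.map_source hx)).2⟩, e.left_inv hx⟩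
      rw [he.apply x hx]
      exact hxI
    have hdisj : Disjoint (e.symm '' (I ×ˢ Metric.ball (splitChart p i p).2 δ)) (frontier Ω) := by
      rw [hΩ.1, disjoint_left]
      rintro _ ⟨q, hq, rfl⟩ hqS
      have h1 := (H.eq_zero_iff (heU (e.map_target (hsub hq)))).2 hqS
      rw [he.apply_symm (hsub hq)] at h1
      exact hI0 (h1 ▸ hq.1)
    rcases hpre.forall_mem_iff hdisj with h1 | h1
    · exact Or.inl fun x hx hxI ↦ h1 x (hmem x hx hxI)
    · exact Or.inr fun x hx hxI ↦ h1 x (hmem x hx hxI)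
  have hbd : ∀ x ∈ e.source, h x ∈ Ioo (-δ) δ := by
    intro x hx
    have := (he.mem_target.1 (e.map_source hx)).1
    rwa [he.apply x hx] at this
  have hzero : ∀ x ∈ e.source, h x = 0 → x ∈ S := fun x hx h0 ↦ (H.eq_zero_iff (heU hx)).1 h0
  have hlow := hside (Ioo (-δ) 0) (Ioo_subset_Ioo_right he.pos.le) (convex_Ioo _ _) (by simp)
  have hup := hside (Ioo 0 δ) (Ioo_subset_Ioo_left (by linarith [he.pos])) (convex_Ioo _ _) (by simp)
  have hpn : e.source ∈ 𝓝 p := e.open_source.mem_nhds he.mem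
  rcases hlow with hlow | hlow <;> rcases hup with hup | hup
  · exfalso
    refine hΩ.notMem hp ?_
    rw [← hΩ.2]
    refine mem_interior_iff_mem_nhds.2 (Filter.mem_of_superset hpn fun x hx ↦ ?_)
    rcases lt_trichotomy (h x) 0 with h1 | h1 | h1
    · exact subset_closure (hlow x hx ⟨(hbd x hx).1, h1⟩)
    · have h2 := hzero x hx h1
      rw [← hΩ.1] at h2
      exact frontier_subset_closure h2
    · exact subset_closure (hup x hx ⟨h1, (hbd x hx).2⟩)
  · refine ⟨1, Or.inl rfl, fun x hx ↦ ?_⟩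
    rw [one_mul]
    rcases lt_trichotomy (h x) 0 with h1 | h1 | h1
    · exact iff_of_true (hlow x hx ⟨(hbd x hx).1, h1⟩) h1
    · exact iff_of_false (hΩ.notMem (hzero x hx h1)) h1.not_lt
    · exact iff_of_false (hup x hx ⟨h1, (hbd x hx).2⟩) h1.not_gt
  · refine ⟨-1, Or.inr rfl, fun x hx ↦ ?_⟩
    rw [neg_one_mul, neg_lt_zero]
    rcases lt_trichotomy (h x) 0 with h1 | h1 | h1
    · exact iff_of_false (hlow x hx ⟨(hbd x hx).1, h1⟩) h1.not_gt
    · exact iff_of_false (hΩ.notMem (hzero x hx h1)) h1.not_gt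
    · exact iff_of_true (hup x hx ⟨h1, (hbd x hx).2⟩) h1
  · exfalso
    obtain ⟨x, hx, hxΩ⟩ := mem_closure_iff_nhds.1
      (frontier_subset_closure (hΩ.1.symm ▸ hp) : p ∈ closure Ω) _ hpn
    rcases lt_trichotomy (h x) 0 with h1 | h1 | h1
    · exact hlow x hx ⟨(hbd x hx).1, h1⟩ hxΩ
    · exact hΩ.notMem (hzero x hx h1) hxΩ
    · exact hup x hx ⟨h1, (hbd x hx).2⟩ hxΩ

lemma IsLocalRoot.exists_oriented (G : IsLocalRoot (m := m) S f c k W g) (hpW : p ∈ W)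
    (hp : p ∈ S) (hΩ : Encloses S Ω) :
    ∃ W' g', p ∈ W' ∧ IsLocalRoot (m := m) S f c k W' g' ∧ ∀ x ∈ W', x ∈ Ω ↔ g' x < 0 := by
  obtain ⟨i, e, δ, he, hes⟩ := G.1.exists_adapted hp hpW univ_mem
  have hes' : e.source ⊆ W := fun x hx ↦ (hes hx).1
  obtain ⟨σ, hσ, hside⟩ := he.exists_side G.1 hes' hp hΩ
  rcases hσ with rfl | rfl
  · exact ⟨e.source, g, he.mem, G.mono e.open_source hes', by simpa using hside⟩
  · exact ⟨e.source, fun x ↦ -g x, he.mem, (G.mono e.open_source hes').neg, by simpa using hside⟩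

/-- If `f - c` has local roots, then the compact hypersurface `S` has a defining function in a
neighbourhood, which is negative exactly in the enclosed set `Ω` and whose unit gradient has
constant divergence along `S`. -/
lemma exists_oriented_defining (hf : IsEquilibriumFunction (m + 1) f) (hk : 1 ≤ k)
    (hS : IsPreconnected S) (hroot : ∀ q ∈ S, ∃ W g, q ∈ W ∧ IsLocalRoot (m := m) S f c k W g)
    (hΩ : Encloses S Ω) :
    ∃ (W : Set M) (g : M → ℝ) (H : ℝ), S ⊆ W ∧ IsLocalDefiningFunction (m + 1) S W g ∧
      (∀ x ∈ W, x ∈ Ω ↔ g x < 0) ∧ ∀ x ∈ S, riemDiv (m + 1) (unitGrad (m + 1) g) x = H := by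
  classical
  have hor : ∀ q ∈ S, ∃ W g, q ∈ W ∧ IsLocalRoot (m := m) S f c k W g ∧ ∀ x ∈ W, x ∈ Ω ↔ g x < 0 := by
    intro q hq
    obtain ⟨W, g, hqW, G⟩ := hroot q hq
    exact G.exists_oriented hqW hq hΩ
  choose! W g hqW G hside using hor
  -- The function `|f - c| ^ (1 / k)`, with its sign prescribed by `Ω`, makes no local choice, so it
  -- glues all oriented local roots.
  let γ : M → ℝ := fun x ↦ if x ∈ Ω then -|f x - c| ^ ((k : ℝ)⁻¹) else |f x - c| ^ ((k : ℝ)⁻¹)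
  have hγ : ∀ q ∈ S, ∀ x ∈ W q, γ x = g q x := by
    intro q hq x hx
    have h1 : |f x - c| ^ ((k : ℝ)⁻¹) = |g q x| := by
      rw [(G q hq).abs_pow hx, Real.pow_rpow_inv_natCast (abs_nonneg _) (by omega)]
    simp only [γ, h1]
    split_ifs with h2
    · rw [abs_of_neg ((hside q hq x hx).1 h2), neg_neg]
    · exact abs_of_nonneg (not_lt.1 fun h3 ↦ h2 ((hside q hq x hx).2 h3))
  have hγe : ∀ q ∈ S, ∀ x ∈ W q, γ =ᶠ[𝓝 x] g q := fun q hq x hx ↦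
    Filter.mem_of_superset ((G q hq).1.isOpen.mem_nhds hx) fun y hy ↦ hγ q hq y hy
  have hconst : ∀ q ∈ S, ∀ᶠ x in 𝓝 q, x ∈ S → riemDiv (m + 1) (unitGrad (m + 1) γ) x =
      riemDiv (m + 1) (unitGrad (m + 1) γ) q := by
    intro q hq
    filter_upwards [(G q hq).eventually_riemDiv_eq hf hk (hqW q hq) hq,
      (G q hq).1.isOpen.mem_nhds (hqW q hq)] with x hx hxW hxS
    rw [riemDiv_unitGrad_congr (hγe q hq x hxW), riemDiv_unitGrad_congr (hγe q hq q (hqW q hq)),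
      hx hxS]
  refine ⟨⋃ q ∈ S, W q, γ, ?_⟩
  have hmem : ∀ {x}, x ∈ ⋃ q ∈ S, W q ↔ ∃ q ∈ S, x ∈ W q := by simp
  have hdef : IsLocalDefiningFunction (m + 1) S (⋃ q ∈ S, W q) γ := by
    refine ⟨isOpen_biUnion fun q hq ↦ (G q hq).1.isOpen, fun x hx ↦ ?_, ?_, fun x hx ↦ ?_⟩
    · obtain ⟨q, hq, hxq⟩ := hmem.1 hx
      exact (((G q hq).1.contMDiffAt hxq).congr_of_eventuallyEq (hγe q hq x hxq)).contMDiffWithinAt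
    · ext x
      constructor
      · rintro ⟨hxS, hx⟩
        obtain ⟨q, hq, hxq⟩ := hmem.1 hx
        exact ⟨hx, by rw [hγ q hq x hxq]; exact ((G q hq).1.eq_zero_iff hxq).2 hxS⟩
      · rintro ⟨hx, h0⟩
        obtain ⟨q, hq, hxq⟩ := hmem.1 hx
        rw [hγ q hq x hxq] at h0
        exact ⟨((G q hq).1.eq_zero_iff hxq).1 h0, hx⟩
    · obtain ⟨q, hq, hxq⟩ := hmem.1 hx
      rw [mvfderiv_congr (hγe q hq x hxq)]
      exact (G q hq).1.regular x hxq
  have hsub : S ⊆ ⋃ q ∈ S, W q := fun q hq ↦ hmem.2 ⟨q, hq, hqW q hq⟩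
  have hsgn : ∀ x ∈ ⋃ q ∈ S, W q, x ∈ Ω ↔ γ x < 0 := by
    intro x hx
    obtain ⟨q, hq, hxq⟩ := hmem.1 hx
    rw [hγ q hq x hxq]
    exact hside q hq x hxq
  rcases S.eq_empty_or_nonempty with h0 | ⟨q₀, hq₀⟩
  · refine ⟨0, hsub, hdef, hsgn, fun x hx ↦ ?_⟩
    rw [h0] at hx
    exact hx.elim
  · exact ⟨_, hsub, hdef, hsgn, fun x hx ↦ hS.eq_of_eventually_eq hconst hx hq₀⟩

end OrientedRoot

/-! ### Cut-off unit gradient fields. -/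

section UnitGradField

variable {n : ℕ} {M : Type*} [TopologicalSpace M] [ChartedSpace (𝔼 n) M]
  [RiemannianBundle (fun x : M ↦ TangentSpace (𝓡 n) x)] [IsManifold (𝓡 n) ω M]
  [IsContMDiffRiemannianBundle (𝓡 n) ω (𝔼 n) (fun x : M ↦ TangentSpace (𝓡 n) x)]

lemma contDiffFieldAt_zero {k : WithTop ℕ∞} {X : (x : M) → TangentSpace (𝓡 n) x} {x : M}
    (h : ∀ᶠ y in 𝓝 x, X y = 0) : ContDiffFieldAt k X x := by
  intro p hp
  refine contDiffAt_const (c := (0 : 𝔼 n)) |>.congr_of_eventuallyEq ?_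
  have h1 : ∀ᶠ z in 𝓝 (extChartAt (𝓡 n) p x), X ((extChartAt (𝓡 n) p).symm z) = 0 := by
    refine Tendsto.eventually (p := fun y ↦ X y = 0)
      (continuousAt_symm ((extChartAt (𝓡 n) p).map_source hp)) ?_
    rwa [(extChartAt (𝓡 n) p).left_inv hp]
  filter_upwards [h1] with z hz
  rw [coordComponents, hz]
  exact map_zero _

lemma IsLocalDefiningFunction.contDiffFieldAt_unitGrad {S W : Set M} {g : M → ℝ}
    (G : IsLocalDefiningFunction n S W g) {x : M} (hx : x ∈ W) :
    ContDiffFieldAt ∞ (unitGrad n g) x := by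
  have hh : ∀ᶠ y in 𝓝 x, ContMDiffAt (𝓡 n) 𝓘(ℝ, ℝ) ∞ g y :=
    (G.isOpen.eventually_mem hx).mono fun y hy ↦ G.smooth.contMDiffAt (G.isOpen.mem_nhds hy)
  have h1 := contMDiffAt_norm_grad_sq hh
  have h2 : ‖grad n g x‖ ^ 2 ≠ 0 :=
    pow_ne_zero 2 (norm_ne_zero_iff.2 (grad_ne_zero_iff.2 (G.regular x hx)))
  have h3 : ContDiffAt ℝ ∞ (fun r : ℝ ↦ (√r)⁻¹) (‖grad n g x‖ ^ 2) :=
    (Real.contDiffAt_sqrt h2).inv (by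
      rw [Real.sqrt_ne_zero']
      positivity)
  have h4 : ContMDiffAt (𝓡 n) 𝓘(ℝ, ℝ) ∞ (fun y ↦ ‖grad n g y‖⁻¹) x := by
    have h5 := ContMDiffAt.comp (g := fun r : ℝ ↦ (√r)⁻¹) x h3.contMDiffAt h1
    simpa only [Function.comp_def, Real.sqrt_sq (norm_nonneg _)] using h5
  exact (contDiffFieldAt_grad (k := ∞) (l := ∞) (by simp) hh).smul h4

lemma IsLocalDefiningFunction.contDiffFieldAt_smul_unitGrad {S W : Set M} {g χ : M → ℝ}
    (G : IsLocalDefiningFunction n S W g) (hχ : ContMDiff (𝓡 n) 𝓘(ℝ, ℝ) ∞ χ)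
    (hχW : tsupport χ ⊆ W) (x : M) : ContDiffFieldAt ∞ (fun y ↦ χ y • unitGrad n g y) x := by
  by_cases hx : x ∈ tsupport χ
  · exact (G.contDiffFieldAt_unitGrad (hχW hx)).smul hχ.contMDiffAt
  · refine contDiffFieldAt_zero ?_
    filter_upwards [notMem_tsupport_iff_eventuallyEq.1 hx] with y hy
    rw [hy]
    exact zero_smul ℝ _

end UnitGradField

/-! ### Weighted area of the moving graphs. -/

section GraphArea

variable {m : ℕ} {M : Type*} [MetricSpace M] [ChartedSpace (𝔼 (m + 1)) M]
  [RiemannianBundle (fun x : M ↦ TangentSpace (𝓡 (m + 1)) x)] [IsManifold (𝓡 (m + 1)) ω M]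
  [IsContMDiffRiemannianBundle (𝓡 (m + 1)) ω (𝔼 (m + 1))
    (fun x : M ↦ TangentSpace (𝓡 (m + 1)) x)] [IsRiemannianManifold (𝓡 (m + 1)) M]
  {S : Set M} {p : M} {i : Fin (m + 1)} {a b : ℝ} {x₀ : 𝔼 m} {ρ δ : ℝ} {w : ℝ → 𝔼 m → ℝ} {ε : ℝ}
  {F : ℝ → M → M} {χ : M → ℝ} {t : ℝ} {x : 𝔼 m}

namespace IsGraphFamily

lemma contDiffOn (G : IsGraphFamily S F p i a b x₀ ρ δ w) (ht : t ∈ Ioo (-δ) δ) :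
    ContDiffOn ℝ ∞ (w t) (Metric.ball x₀ ρ) :=
  G.smooth.comp (contDiff_const.prodMk contDiff_id).contDiffOn fun _ hx ↦ mk_mem_prod ht hx

lemma differentiableAt (G : IsGraphFamily S F p i a b x₀ ρ δ w) (ht : t ∈ Ioo (-δ) δ)
    (hx : x ∈ Metric.ball x₀ ρ) : DifferentiableAt ℝ (w t) x :=
  ((G.contDiffOn ht).contDiffAt (Metric.isOpen_ball.mem_nhds hx)).differentiableAt (by simp)

lemma graph_mem (G : IsGraphFamily S F p i a b x₀ ρ δ w) (ht : t ∈ Ioo (-δ) δ)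
    (hx : x ∈ Metric.ball x₀ ρ) : (w t x, x) ∈ Ioo a b ×ˢ Metric.ball x₀ ρ :=
  mk_mem_prod (G.mapsTo t ht hx) hx

lemma isMetricImmersion (G : IsGraphFamily S F p i a b x₀ ρ δ w) (ht : t ∈ Ioo (-δ) δ) :
    IsMetricImmersion (fun x ↦ splitPoint p i (w t x, x)) (Metric.ball x₀ ρ)
      (areaDensity p (graphMap i (w t))) := by
  refine isMetricImmersion_symm_comp (φ := graphMap i (w t)) Metric.isOpen_ball ?_
    (fun x hx ↦ G.subset_target (G.graph_mem ht hx)) ?_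
    (fun x hx ↦ injective_fderiv_graphMap i (G.differentiableAt ht hx))
  · exact (splitCoord i).contDiff.comp_contDiffOn
      (((G.contDiffOn ht).of_le (by norm_cast)).prodMk contDiffOn_id)
  · intro x _ x' _ h
    exact congrArg Prod.snd ((splitCoord i).injective h)

/-- Inside the box the hypersurface is a graph and the area formula applies; outside it `χ`
vanishes. -/
lemma setIntegral_image_eq [MeasurableSpace M] [BorelSpace M]
    (G : IsGraphFamily S F p i a b x₀ ρ δ w) (ht : t ∈ Ioo (-δ) δ)
    (hS : MeasurableSet (F t '' S)) (hχ : Continuous χ)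
    (hχB : tsupport χ ⊆ splitPoint p i '' (Ioo a b ×ˢ Metric.ball x₀ ρ)) :
    ∫ z in F t '' S, χ z ∂μHE[m] = ∫ x in Metric.ball x₀ ρ,
      areaDensity p (graphMap i (w t)) x * χ (splitPoint p i (w t x, x)) := by
  rw [← (G.isMetricImmersion ht).setIntegral_image measurableSet_ball le_rfl hχ.measurable]
  refine setIntegral_eq_of_subset_of_forall_sdiff_eq_zero hS ?_ ?_
  · rintro _ ⟨x, hx, rfl⟩
    exact (G.mem_iff t ht _ (G.graph_mem ht hx)).2 rfl
  · rintro z ⟨hz, hz'⟩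
    by_contra h
    obtain ⟨q, hq, rfl⟩ := hχB (subset_tsupport χ h)
    refine hz' ⟨q.2, hq.2, ?_⟩
    simp only [← (G.mem_iff t ht q hq).1 hz]

lemma contDiffAt_areaDensity [MeasurableSpace M] [BorelSpace M] (G : IsGraphFamily S F p i a b x₀ ρ δ w) (ht : t ∈ Ioo (-δ) δ)
    (hx : x ∈ Metric.ball x₀ ρ) :
    ContDiffAt ℝ ∞ (fun q : ℝ × 𝔼 m ↦ areaDensity p (graphMap i (w q.1)) q.2) (t, x) := by
  have hD : IsOpen (Ioo (-δ) δ ×ˢ Metric.ball x₀ ρ) := isOpen_Ioo.prod Metric.isOpen_ball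
  have hmem : (t, x) ∈ Ioo (-δ) δ ×ˢ Metric.ball x₀ ρ := mk_mem_prod ht hx
  set wu : ℝ × 𝔼 m → ℝ := fun q ↦ w q.1 q.2 with hwu
  have hw : ContDiffAt ℝ ∞ wu (t, x) := G.smooth.contDiffAt (hD.mem_nhds hmem)
  have hφ : ContDiffAt ℝ ∞ (fun q : ℝ × 𝔼 m ↦ graphMap i (w q.1) q.2) (t, x) :=
    (splitCoord i).contDiff.contDiffAt.comp (t, x) (hw.prodMk contDiffAt_snd)
  have hd : ∀ v : 𝔼 m, ContDiffAt ℝ ∞ (fun q : ℝ × 𝔼 m ↦ fderiv ℝ (graphMap i (w q.1)) q.2 v)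
      (t, x) := by
    intro v
    have h1 : ContDiffAt ℝ ∞ (fun q : ℝ × 𝔼 m ↦ splitCoord i (fderiv ℝ wu q (0, v), v)) (t, x) :=
      (splitCoord i).contDiff.contDiffAt.comp (t, x)
        (((hw.fderiv_right (m := ∞) (by simp)).clm_apply contDiffAt_const).prodMk contDiffAt_const)
    refine h1.congr_of_eventuallyEq ?_
    filter_upwards [hD.mem_nhds hmem] with q hq
    rw [fderiv_graphMap i (G.differentiableAt hq.1 hq.2)]
    have h2 := ((G.smooth.contDiffAt (hD.mem_nhds hq)).differentiableAt (by simp)).hasFDerivAt.comp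
      (f := fun x ↦ (q.1, x)) q.2 ((hasFDerivAt_const q.1 q.2).prodMk (hasFDerivAt_id q.2))
    have h3 : fderiv ℝ (w q.1) q.2 = _ := h2.fderiv
    rw [h3]
    rfl
  have hdet := ContDiffWithinAt.matrix_det (k := ∞) (s := univ) (x := ((t, x) : ℝ × 𝔼 m))
    (A := fun q : ℝ × 𝔼 m ↦ Matrix.of fun j j' : Fin m ↦
      inner ℝ (coordDeriv p (graphMap i (w q.1) q.2)
        (fderiv ℝ (graphMap i (w q.1)) q.2 (EuclideanSpace.single j 1)))
      (coordDeriv p (graphMap i (w q.1) q.2)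
        (fderiv ℝ (graphMap i (w q.1)) q.2 (EuclideanSpace.single j' 1)))) fun j j' ↦
    contDiffWithinAt_inner_coordDeriv (G.subset_target (G.graph_mem ht hx)) hφ.contDiffWithinAt
      (hd _).contDiffWithinAt (hd _).contDiffWithinAt
  rw [contDiffWithinAt_univ] at hdet
  refine hdet.sqrt ?_
  have hpos := (G.isMetricImmersion ht).density_pos hx
  exact (Real.sqrt_pos.1 hpos).ne'

/-- The integral of a function supported in the box over the moving hypersurface is differentiable
in time. -/
lemma differentiableAt_setIntegral [MeasurableSpace M] [BorelSpace M]
    (G : IsGraphFamily S F p i a b x₀ ρ δ w) (hS : ∀ t ∈ Ioo (-δ) δ, MeasurableSet (F t '' S))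
    (hχ : ContMDiff (𝓡 (m + 1)) 𝓘(ℝ, ℝ) ∞ χ) (hχc : HasCompactSupport χ)
    (hχB : tsupport χ ⊆ splitPoint p i '' (Ioo a b ×ˢ Metric.ball x₀ ρ)) :
    DifferentiableAt ℝ (fun t ↦ ∫ z in F t '' S, χ z ∂μHE[m]) 0 := by
  classical
  set B := Ioo a b ×ˢ Metric.ball x₀ ρ with hB
  have hD : IsOpen (Ioo (-δ) δ ×ˢ Metric.ball x₀ ρ) := isOpen_Ioo.prod Metric.isOpen_ball
  have hsrc : ∀ q ∈ B, splitPoint p i q ∈ (extChartAt (𝓡 (m + 1)) p).source := fun q hq ↦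
    (extChartAt (𝓡 (m + 1)) p).map_target (G.subset_target hq)
  set k : Set (𝔼 m) := (fun z ↦ (splitChart p i z).2) '' tsupport χ with hk
  have hkc : IsCompact k := by
    refine hχc.isCompact.image_of_continuousOn (continuous_snd.comp_continuousOn
      ((contMDiffOn_splitChart (k := 0) p i).continuousOn.mono fun z hz ↦ ?_))
    obtain ⟨q, hq, rfl⟩ := hχB hz
    exact hsrc q hq
  have hkB : k ⊆ Metric.ball x₀ ρ := by
    rintro _ ⟨z, hz, rfl⟩
    obtain ⟨q, hq, rfl⟩ := hχB hz
    simp only [splitChart_splitPoint (G.subset_target hq)]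
    exact hq.2
  have hk0 : ∀ t ∈ Ioo (-δ) δ, ∀ x ∈ Metric.ball x₀ ρ, x ∉ k → χ (splitPoint p i (w t x, x)) = 0 := by
    intro t ht x hx hxk
    by_contra h
    refine hxk ⟨_, subset_tsupport χ h, ?_⟩
    simp only [splitChart_splitPoint (G.subset_target (G.graph_mem ht hx))]
  -- Extended by zero off the ball, the integrand vanishes outside one compact set `k` for all
  -- times, so it is smooth on the whole space and its integral depends smoothly on time.
  let g : ℝ → 𝔼 m → ℝ := fun t x ↦ (Metric.ball x₀ ρ).indicator
    (fun x ↦ areaDensity p (graphMap i (w t)) x * χ (splitPoint p i (w t x, x))) x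
  have hg0 : ∀ t x, t ∈ Ioo (-δ) δ → x ∉ k → g t x = 0 := by
    intro t x ht hx
    by_cases hxB : x ∈ Metric.ball x₀ ρ
    · simp only [g, indicator_of_mem hxB, hk0 t ht x hxB hx, mul_zero]
    · exact indicator_of_notMem hxB _
  have hg : ContDiffOn ℝ ∞ (fun q : ℝ × 𝔼 m ↦ g q.1 q.2) (Ioo (-δ) δ ×ˢ univ) := by
    rintro ⟨t, x⟩ ⟨ht, -⟩
    by_cases hxB : x ∈ Metric.ball x₀ ρ
    · have hw : ContDiffAt ℝ ∞ (fun q : ℝ × 𝔼 m ↦ (w q.1 q.2, q.2)) (t, x) :=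
        (G.smooth.contDiffAt (hD.mem_nhds (mk_mem_prod ht hxB))).prodMk contDiffAt_snd
      have hsp : ContMDiffAt 𝓘(ℝ, ℝ × 𝔼 m) (𝓡 (m + 1)) ∞ (splitPoint p i) (w t x, x) :=
        (contMDiffOn_splitPoint p i).contMDiffAt
          (((isOpen_target p).preimage (splitCoord i).continuous).mem_nhds
            (G.subset_target (G.graph_mem ht hxB)))
      have hχs : ContDiffAt ℝ ∞ (χ ∘ splitPoint p i) (w t x, x) :=
        (hχ.contMDiffAt.comp _ hsp).contDiffAt
      have h1 : ContDiffAt ℝ ∞ (fun q : ℝ × 𝔼 m ↦ areaDensity p (graphMap i (w q.1)) q.2 *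
          (χ ∘ splitPoint p i) (w q.1 q.2, q.2)) (t, x) :=
        (G.contDiffAt_areaDensity ht hxB).mul (ContDiffAt.comp (g := χ ∘ splitPoint p i)
          (f := fun q : ℝ × 𝔼 m ↦ (w q.1 q.2, q.2)) (t, x) hχs hw)
      refine (h1.congr_of_eventuallyEq ?_).contDiffWithinAt
      filter_upwards [hD.mem_nhds (mk_mem_prod ht hxB)] with q hq
      exact indicator_of_mem hq.2 _
    · have h1 : IsOpen (Ioo (-δ) δ ×ˢ kᶜ) := isOpen_Ioo.prod hkc.isClosed.isOpen_compl
      refine ((contDiffAt_const (c := (0 : ℝ))).congr_of_eventuallyEq ?_).contDiffWithinAt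
      filter_upwards [h1.mem_nhds (mk_mem_prod ht fun h ↦ hxB (hkB h))] with q hq
      exact hg0 _ _ hq.1 hq.2
  have hint := contDiffOn_integral_of_compact (μ := (volume : Measure (𝔼 m))) isOpen_Ioo hkc hg0 hg
  have h0 := isOpen_Ioo.mem_nhds G.zero_mem
  refine ((hint.contDiffAt h0).differentiableAt (by simp)).congr_of_eventuallyEq ?_
  filter_upwards [h0] with t ht
  rw [G.setIntegral_image_eq ht (hS t ht) hχ.continuous hχB, ← integral_indicator measurableSet_ball]

end IsGraphFamily

end GraphArea

/-! ### Pointwise comparison of flux and area for the unit gradient field. -/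

section Calibration

variable {m : ℕ} {M : Type*} [MetricSpace M] [ChartedSpace (𝔼 (m + 1)) M]
  [RiemannianBundle (fun x : M ↦ TangentSpace (𝓡 (m + 1)) x)] [IsManifold (𝓡 (m + 1)) ω M]
  [IsContMDiffRiemannianBundle (𝓡 (m + 1)) ω (𝔼 (m + 1))
    (fun x : M ↦ TangentSpace (𝓡 (m + 1)) x)] [IsRiemannianManifold (𝓡 (m + 1)) M]
  {S W Ω₀ : Set M} {p : M} {i : Fin (m + 1)} {a b : ℝ} {x₀ : 𝔼 m} {ρ δ : ℝ} {w : ℝ → 𝔼 m → ℝ}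
  {ε : ℝ} {F : ℝ → M → M} {χ g : M → ℝ} {t : ℝ} {x : 𝔼 m} {σ : ℝ}

lemma nonneg_of_hasDerivAt_of_nonneg {h : ℝ → ℝ} {h' s : ℝ} (hd : HasDerivAt h h' s)
    (h0 : h s = 0) (hn : ∀ᶠ r in 𝓝[>] s, 0 ≤ h r) : 0 ≤ h' := by
  have h1 : Tendsto (slope h s) (𝓝[>] s) (𝓝 h') :=
    hd.tendsto_slope.mono_left (nhdsWithin_mono _ fun r (hr : s < r) ↦ hr.ne')
  refine ge_of_tendsto h1 ?_
  filter_upwards [hn, self_mem_nhdsWithin] with r hr hrs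
  rw [slope_def_field, h0, sub_zero]
  exact div_nonneg hr (sub_pos.2 hrs).le

lemma norm_smul_unitGrad (hχ : ∀ z, 0 ≤ χ z) {z : M} (hz : mvfderiv (𝓡 (m + 1)) g z ≠ 0) :
    ‖χ z • unitGrad (m + 1) g z‖ = χ z := by
  rw [norm_smul, norm_unitGrad hz, mul_one, Real.norm_eq_abs, abs_of_nonneg (hχ z)]

namespace IsGraphFamily

lemma abs_graphFlux_smul_unitGrad_le (G : IsGraphFamily S F p i a b x₀ ρ δ w)
    (ht : t ∈ Ioo (-δ) δ) (hx : x ∈ Metric.ball x₀ ρ) (hχ : ∀ z, 0 ≤ χ z)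
    (hg : mvfderiv (𝓡 (m + 1)) g (splitPoint p i (w t x, x)) ≠ 0) :
    |graphFlux (fun z ↦ χ z • unitGrad (m + 1) g z) p i (w t) x| ≤
      areaDensity p (graphMap i (w t)) x * χ (splitPoint p i (w t x, x)) := by
  have h1 := abs_graphFlux_le (Y := fun z ↦ χ z • unitGrad (m + 1) g z) (p := p) (i := i)
    (w := w t) (x := x) (G.subset_target (G.graph_mem ht hx)) (G.differentiableAt ht hx)
  have h2 := norm_smul_unitGrad hχ hg
  have h3 : ‖χ ((extChartAt (𝓡 (m + 1)) p).symm (graphMap i (w t) x)) •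
      unitGrad (m + 1) g ((extChartAt (𝓡 (m + 1)) p).symm (graphMap i (w t) x))‖ =
      χ (splitPoint p i (w t x, x)) := h2
  rw [h3, mul_comm] at h1
  exact h1

/-- On `S` the field is normal, so the flux has absolute value `χ` times the area density. It
remains to see that its sign is `σ`, which holds because `g` is negative exactly on the side given
by `σ`. -/
lemma mul_graphFlux_smul_unitGrad_eq (G : IsGraphFamily S F p i a b x₀ ρ δ w)
    (hS : F 0 '' S = S) (H : IsLocalDefiningFunction (m + 1) S W g)
    (hBW : splitPoint p i '' (Ioo a b ×ˢ Metric.ball x₀ ρ) ⊆ W) (hσ : σ = 1 ∨ σ = -1)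
    (hside : ∀ q ∈ Ioo a b ×ˢ Metric.ball x₀ ρ, g (splitPoint p i q) < 0 ↔ σ * (q.1 - w 0 q.2) < 0)
    (hx : x ∈ Metric.ball x₀ ρ) (hχ : ∀ z, 0 ≤ χ z) :
    σ * graphFlux (fun z ↦ χ z • unitGrad (m + 1) g z) p i (w 0) x =
      areaDensity p (graphMap i (w 0)) x * χ (splitPoint p i (w 0 x, x)) := by
  have ht := G.zero_mem
  have hq := G.graph_mem ht hx
  have hy : graphMap i (w 0) x ∈ (extChartAt (𝓡 (m + 1)) p).target := G.subset_target hq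
  have hw := G.differentiableAt ht hx
  set z := (extChartAt (𝓡 (m + 1)) p).symm (graphMap i (w 0) x) with hz
  have hzW : z ∈ W := hBW ⟨_, hq, rfl⟩
  have hgd : MDifferentiableAt (𝓡 (m + 1)) 𝓘(ℝ, ℝ) g z := (H.contMDiffAt hzW).mdifferentiableAt (by simp)
  have hγd : DifferentiableAt ℝ (g ∘ (extChartAt (𝓡 (m + 1)) p).symm) (graphMap i (w 0) x) :=
    (contDiffAt_comp_symm hy (H.contMDiffAt hzW)).differentiableAt (by simp)
  set γ : ℝ × 𝔼 m → ℝ := fun q ↦ g (splitPoint p i q) with hγ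
  have hγL : HasFDerivAt γ ((fderiv ℝ (g ∘ (extChartAt (𝓡 (m + 1)) p).symm)
      (graphMap i (w 0) x)).comp (splitCoord i : (ℝ × 𝔼 m) →L[ℝ] 𝔼 (m + 1))) (w 0 x, x) :=
    HasFDerivAt.comp (g := g ∘ (extChartAt (𝓡 (m + 1)) p).symm) (f := splitCoord i) (w 0 x, x)
      hγd.hasFDerivAt (splitCoord i : (ℝ × 𝔼 m) →L[ℝ] 𝔼 (m + 1)).hasFDerivAt
  set L := (fderiv ℝ (g ∘ (extChartAt (𝓡 (m + 1)) p).symm)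
      (graphMap i (w 0) x)).comp (splitCoord i : (ℝ × 𝔼 m) →L[ℝ] 𝔼 (m + 1)) with hL
  have hLd : ∀ q, mvfderiv (𝓡 (m + 1)) g z (coordDeriv p (graphMap i (w 0) x) (splitCoord i q)) = L q :=
    fun q ↦ mvfderiv_coordDeriv hy hgd (splitCoord i q)
  have hγ0 : ∀ x ∈ Metric.ball x₀ ρ, γ (w 0 x, x) = 0 := by
    intro x hx
    refine (H.eq_zero_iff (hBW ⟨_, G.graph_mem ht hx, rfl⟩)).2 ?_
    rw [← hS]
    exact (G.mem_iff 0 ht _ (G.graph_mem ht hx)).2 rfl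
  have hLt : ∀ v, L (fderiv ℝ (w 0) x v, v) = 0 := by
    intro v
    have h1 := hγL.comp (f := fun x ↦ (w 0 x, x)) x (hw.hasFDerivAt.prodMk (hasFDerivAt_id x))
    have h2 : HasFDerivAt (γ ∘ fun x ↦ (w 0 x, x)) (0 : 𝔼 m →L[ℝ] ℝ) x := by
      refine (hasFDerivAt_const (0 : ℝ) x).congr_of_eventuallyEq ?_
      filter_upwards [Metric.isOpen_ball.mem_nhds hx] with x' hx'
      exact hγ0 x' hx'
    have h3 := congrArg (fun A : 𝔼 m →L[ℝ] ℝ ↦ A v) (h1.unique h2)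
    simpa using h3
  set X := unitGrad (m + 1) g with hX
  set Z := splitComponents X p i (w 0 x, x) with hZ
  have hXZ : coordDeriv p (graphMap i (w 0) x) (splitCoord i Z) = X z := by
    rw [hZ, splitComponents, ContinuousLinearEquiv.apply_symm_apply]
    exact coordDeriv_coordComponents X hy
  have hLZ : 0 < L Z := by
    rw [← hLd, hXZ]
    exact mvfderiv_unitGrad (H.regular z hzW)
  -- `Z` is a vertical vector plus a vector tangent to the graph, and the differential of `g`
  -- annihilates the latter.
  have hLZ' : L Z = L (1, 0) * (Z.1 - fderiv ℝ (w 0) x Z.2) := by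
    have h1 : Z = (Z.1 - fderiv ℝ (w 0) x Z.2) • ((1 : ℝ), (0 : 𝔼 m)) + (fderiv ℝ (w 0) x Z.2, Z.2) := by
      ext <;> simp
    conv_lhs => rw [h1]
    rw [map_add, map_smul, hLt, add_zero, smul_eq_mul, mul_comm]
  -- On the vertical line, `σ g` vanishes on the graph and is non-negative just above it.
  have hpos : 0 ≤ σ * L (1, 0) := by
    have h1 : HasDerivAt (fun s ↦ γ (s, x)) (L (1, 0)) (w 0 x) :=
      hγL.comp_hasDerivAt (f := fun s ↦ (s, x)) (w 0 x)
        ((hasDerivAt_id (w 0 x)).prodMk (hasDerivAt_const (w 0 x) x))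
    refine nonneg_of_hasDerivAt_of_nonneg (h1.const_mul σ) (by rw [hγ0 x hx, mul_zero]) ?_
    have hI : Ioo a b ∈ 𝓝 (w 0 x) := isOpen_Ioo.mem_nhds hq.1
    filter_upwards [nhdsWithin_le_nhds hI, self_mem_nhdsWithin] with s hs hsw
    have h2 := hside (s, x) ⟨hs, hx⟩
    have h3 : w 0 x < s := hsw
    change 0 ≤ σ * g (splitPoint p i (s, x))
    rcases hσ with rfl | rfl
    · simp only [one_mul, sub_neg] at h2 ⊢
      by_contra! h4
      exact h3.not_gt (h2.1 h4)
    · simp only [neg_one_mul, neg_sub, sub_neg] at h2 ⊢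
      linarith [h2.2 h3]
  have hsgn : 0 ≤ σ * (Z.1 - fderiv ℝ (w 0) x Z.2) := by
    rw [hLZ'] at hLZ
    generalize Z.1 - fderiv ℝ (w 0) x Z.2 = ζ at *
    by_contra! hneg
    have h1 : σ * σ = 1 := by rcases hσ with rfl | rfl <;> norm_num
    have h2 : (σ * L (1, 0)) * (σ * ζ) = L (1, 0) * ζ := by linear_combination L (1, 0) * ζ * h1
    linarith [mul_nonpos_of_nonneg_of_nonpos hpos hneg.le]
  have hcomp : splitComponents (fun z ↦ χ z • X z) p i (w 0 x, x) = χ z • Z := by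
    rw [hZ, splitComponents, splitComponents, ← map_smul]
    congr 1
    exact map_smul (mfderiv (𝓡 (m + 1)) 𝓘(ℝ, 𝔼 (m + 1)) (extChartAt (𝓡 (m + 1)) p) z) (χ z) (X z)
  have hflux : graphFlux (fun z ↦ χ z • X z) p i (w 0) x =
      metricDensity (m + 1) p (graphMap i (w 0) x) * χ z * (Z.1 - fderiv ℝ (w 0) x Z.2) := by
    rw [graphFlux, hcomp, Prod.smul_fst, Prod.smul_snd, map_smul, smul_eq_mul, smul_eq_mul]
    ring
  have habs := abs_graphFlux_eq (Y := fun z ↦ χ z • X z) hy hw (fun v ↦ by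
    rw [fderiv_graphMap i hw, ← hz]
    change inner ℝ (χ z • ‖grad (m + 1) g z‖⁻¹ • grad (m + 1) g z) _ = 0
    rw [real_inner_smul_left, real_inner_smul_left, inner_grad, hLd, hLt, mul_zero, mul_zero])
  have hnorm : ‖(fun z ↦ χ z • X z) z‖ = χ z := norm_smul_unitGrad hχ (H.regular z hzW)
  rw [← hz, hnorm, mul_comm] at habs
  rw [show splitPoint p i (w 0 x, x) = z from rfl, ← habs]
  have hnn : 0 ≤ σ * graphFlux (fun z ↦ χ z • X z) p i (w 0) x := by
    rw [hflux, mul_left_comm]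
    exact mul_nonneg (mul_nonneg (metricDensity_pos hy).le (hχ z)) hsgn
  rw [← abs_of_nonneg hnn, abs_mul]
  rcases hσ with rfl | rfl <;> simp

end IsGraphFamily

end Calibration

/-! ### Calibrations supported near a point. -/

section LocalCalibration

variable {m : ℕ} {M : Type*} [MetricSpace M] [MeasurableSpace M] [BorelSpace M]
  [ChartedSpace (𝔼 (m + 1)) M]
  [RiemannianBundle (fun x : M ↦ TangentSpace (𝓡 (m + 1)) x)] [IsManifold (𝓡 (m + 1)) ω M]
  [IsContMDiffRiemannianBundle (𝓡 (m + 1)) ω (𝔼 (m + 1))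
    (fun x : M ↦ TangentSpace (𝓡 (m + 1)) x)] [IsRiemannianManifold (𝓡 (m + 1)) M]
  {S W : Set M} {p : M} {i : Fin (m + 1)} {a b : ℝ} {x₀ : 𝔼 m} {ρ δ : ℝ} {w : ℝ → 𝔼 m → ℝ}
  {ε : ℝ} {F : ℝ → M → M} {Ω : ℝ → Set M} {χ η g : M → ℝ} {t : ℝ}

/-- The field `χ ∇g / ‖∇g‖` calibrates the variation `F t '' S` of `S = ∂(Ω 0)` with respect to
the area weighted by `χ`. -/
structure IsCalibration (S : Set M) (F : ℝ → M → M) (Ω : ℝ → Set M) (g χ : M → ℝ) : Prop where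
  differentiableAt : DifferentiableAt ℝ (fun t ↦ ∫ z in F t '' S, χ z ∂μHE[m]) 0
  eventually_le : ∀ᶠ t in 𝓝 (0 : ℝ),
    ∫ z in Ω t, riemDiv (m + 1) (fun z ↦ χ z • unitGrad (m + 1) g z) z ∂μHE[m + 1] ≤
      ∫ z in F t '' S, χ z ∂μHE[m]
  eq_zero : ∫ z in Ω 0, riemDiv (m + 1) (fun z ↦ χ z • unitGrad (m + 1) g z) z ∂μHE[m + 1] =
      ∫ z in F 0 '' S, χ z ∂μHE[m]

lemma IsVariation.isCompact_image (hF : IsVariation (m + 1) S ε F) (hc : IsCompact S)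
    (ht : t ∈ Ioo (-ε) ε) : IsCompact (F t '' S) := by
  refine hc.image_of_continuousOn ?_
  exact hF.smooth.continuousOn.comp (f := fun z ↦ (t, z)) (by fun_prop) fun z hz ↦ mk_mem_prod ht hz

/-- The integral of the density is the area of a part of the varied hypersurface, which is finite,
and `χ` is bounded. -/
lemma IsGraphFamily.integrableOn_areaDensity_mul (G : IsGraphFamily S F p i a b x₀ ρ δ w)
    (ht : t ∈ Ioo (-δ) δ) (hfin : μHE[m] (F t '' S) ≠ ⊤) (hχ : Continuous χ)
    (hχc : HasCompactSupport χ) :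
    IntegrableOn (fun x ↦ areaDensity p (graphMap i (w t)) x * χ (splitPoint p i (w t x, x)))
      (Metric.ball x₀ ρ) := by
  have hI := G.isMetricImmersion ht
  have hJ : IntegrableOn (areaDensity p (graphMap i (w t))) (Metric.ball x₀ ρ) := by
    refine ⟨hI.continuousOn_density.aestronglyMeasurable measurableSet_ball, ?_⟩
    have h0 : 0 ≤ᵐ[volume.restrict (Metric.ball x₀ ρ)] areaDensity p (graphMap i (w t)) :=
      ae_of_all _ fun x ↦ Real.sqrt_nonneg _
    rw [hasFiniteIntegral_iff_ofReal h0, ← hI.measure_image measurableSet_ball le_rfl]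
    refine (measure_mono ?_).trans_lt hfin.lt_top
    rintro _ ⟨x, hx, rfl⟩
    exact (G.mem_iff t ht _ (G.graph_mem ht hx)).2 rfl
  obtain ⟨C, hC⟩ := hχ.bounded_above_of_compact_support hχc
  refine hJ.mul_bdd (c := C) ?_ (ae_of_all _ fun x ↦ hC _)
  exact (hχ.comp_continuousOn hI.continuousOn).aestronglyMeasurable measurableSet_ball

/-- For a weight supported in the box, both integrals become integrals over the same ball, where the
flux density is at most the weighted area density, with equality at time `0`. -/
lemma exists_local_isCalibration (hF : IsVariation (m + 1) S ε F) (hS : IsHypersurface (m + 1) S)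
    (hc : IsCompact S) (hΩ : IsEnclosedFamily S ε F Ω) (H : IsLocalDefiningFunction (m + 1) S W g)
    (hSW : S ⊆ W) (hneg : ∀ x ∈ W, x ∈ Ω 0 ↔ g x < 0) (hp : p ∈ S) :
    ∃ U ∈ 𝓝 p, U ⊆ W ∧ ∀ χ : M → ℝ, ContMDiff (𝓡 (m + 1)) 𝓘(ℝ, ℝ) ∞ χ → (∀ z, 0 ≤ χ z) →
      HasCompactSupport χ → tsupport χ ⊆ U → IsCalibration (m := m) S F Ω g χ := by
  obtain ⟨i, a, b, x₀, ρ, δ, w, G, hδε, hBW⟩ :=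
    hF.exists_isGraphFamily hS hc hp (H.isOpen.mem_nhds (hSW hp))
  obtain ⟨σ, hσ, hside⟩ := G.exists_side hδε hF hΩ hp
  refine ⟨_, G.mem_nhds, hBW, fun χ hχ hχ0 hχc hχU ↦ ?_⟩
  have hmem : ∀ t ∈ Ioo (-δ) δ, t ∈ Ioo (-ε) ε := fun t ht ↦
    ⟨by linarith [ht.1], ht.2.trans_le hδε⟩
  have hmeas : ∀ t ∈ Ioo (-δ) δ, MeasurableSet (F t '' S) := fun t ht ↦
    (hF.isCompact_image hc (hmem t ht)).isClosed.measurableSet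
  have hY : ∀ x, ContDiffFieldAt 2 (fun z ↦ χ z • unitGrad (m + 1) g z) x := fun x ↦
    (H.contDiffFieldAt_smul_unitGrad hχ (hχU.trans hBW) x).of_le (by norm_cast)
  have hY0 : ∀ x ∉ tsupport χ, χ x • unitGrad (m + 1) g x = 0 := fun x hx ↦ by
    rw [image_eq_zero_of_notMem_tsupport hx]
    exact zero_smul ℝ _
  have hdiv : ∀ t ∈ Ioo (-δ) δ,
      ∫ z in Ω t, riemDiv (m + 1) (fun z ↦ χ z • unitGrad (m + 1) g z) z ∂μHE[m + 1] =
      σ * ∫ x in Metric.ball x₀ ρ, graphFlux (fun z ↦ χ z • unitGrad (m + 1) g z) p i (w t) x :=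
    fun t ht ↦ setIntegral_riemDiv_eq_graphFlux hY G.subset_target hχc.isCompact hχU hY0
      ((G.contDiffOn ht).of_le (by norm_cast)) (G.mapsTo t ht) hσ
      (hΩ.encloses t (hmem t ht)).isOpen (hside t ht)
  have harea : ∀ t ∈ Ioo (-δ) δ, ∫ z in F t '' S, χ z ∂μHE[m] = _ := fun t ht ↦
    G.setIntegral_image_eq ht (hmeas t ht) hχ.continuous hχU
  refine ⟨G.differentiableAt_setIntegral hmeas hχ hχc hχU, ?_, ?_⟩
  · filter_upwards [isOpen_Ioo.mem_nhds G.zero_mem] with t ht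
    rw [hdiv t ht, harea t ht]
    have h1 : ∀ r : ℝ, σ * r ≤ ‖r‖ := fun r ↦ by
      rw [Real.norm_eq_abs]
      rcases hσ with rfl | rfl
      · rw [one_mul]; exact le_abs_self r
      · rw [neg_one_mul]; exact neg_le_abs r
    refine (h1 _).trans ((norm_integral_le_integral_norm _).trans ?_)
    refine integral_mono_of_nonneg (ae_of_all _ fun x ↦ norm_nonneg _)
      (G.integrableOn_areaDensity_mul ht (hF.measure_image_ne_top hS hc (hmem t ht)) hχ.continuous hχc) ?_
    refine (ae_restrict_iff' measurableSet_ball).2 (ae_of_all _ fun x hx ↦ ?_)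
    exact G.abs_graphFlux_smul_unitGrad_le ht hx hχ0
      (H.regular _ (hBW ⟨_, G.graph_mem ht hx, rfl⟩))
  · rw [hdiv 0 G.zero_mem, harea 0 G.zero_mem, ← integral_const_mul]
    refine setIntegral_congr_fun measurableSet_ball fun x hx ↦ ?_
    refine G.mul_graphFlux_smul_unitGrad_eq hF.image_zero H hBW hσ (fun q hq ↦ ?_) hx hχ0
    rw [← hneg _ (hBW ⟨q, hq, rfl⟩)]
    exact hside 0 G.zero_mem q hq

lemma exists_nhds_measure_lt_top (p : M) : ∃ U ∈ 𝓝 p, μHE[m + 1] U < ⊤ := by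
  have hsrc := mem_extChartAt_source (I := 𝓡 (m + 1)) p
  obtain ⟨K, U, hU, hK⟩ := exists_lipschitzOnWith_extChartAt_symm
    ((extChartAt (𝓡 (m + 1)) p).map_source hsrc)
  obtain ⟨r, hr, hb⟩ := Metric.mem_nhds_iff.1 hU
  refine ⟨(extChartAt (𝓡 (m + 1)) p).symm '' Metric.ball (extChartAt (𝓡 (m + 1)) p p) r, ?_, ?_⟩
  · have h1 := (continuousAt_extChartAt (I := 𝓡 (m + 1)) p).preimage_mem_nhds (Metric.ball_mem_nhds _ hr)
    filter_upwards [h1, extChartAt_source_mem_nhds (I := 𝓡 (m + 1)) p] with x hx hxs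
    exact ⟨_, hx, (extChartAt (𝓡 (m + 1)) p).left_inv hxs⟩
  · refine ((hK.mono hb).euclideanHausdorffMeasure_image_le (m + 1)).trans_lt ?_
    refine (ENNReal.mul_ne_top (by simp) ?_).lt_top
    rw [EuclideanSpace.euclideanHausdorffMeasure_eq_volume]
    exact measure_ball_lt_top.ne

instance isLocallyFiniteMeasure_euclideanHausdorffMeasure :
    IsLocallyFiniteMeasure (μHE[m + 1] : Measure M) :=
  ⟨fun p ↦ by
    obtain ⟨U, hU, h⟩ := exists_nhds_measure_lt_top (m := m) p
    exact ⟨U, hU, h⟩⟩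

lemma riemDiv_add {X Y : (x : M) → TangentSpace (𝓡 (m + 1)) x} {x : M}
    (hX : ContDiffFieldAt 1 X x) (hY : ContDiffFieldAt 1 Y x) :
    riemDiv (m + 1) (fun y ↦ X y + Y y) x = riemDiv (m + 1) X x + riemDiv (m + 1) Y x := by
  have hx := mem_extChartAt_source (I := 𝓡 (m + 1)) x
  have hy := (extChartAt (𝓡 (m + 1)) x).map_source hx
  have hD : DifferentiableAt ℝ (metricDensity (m + 1) x) (extChartAt (𝓡 (m + 1)) x x) :=
    ((contDiffOn_metricDensity x).contDiffAt ((isOpen_target x).mem_nhds hy)).differentiableAt (by simp)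
  have h1 : ∀ y i, coordComponents (m + 1) (fun y ↦ X y + Y y) x y i =
      coordComponents (m + 1) X x y i + coordComponents (m + 1) Y x y i := fun y i ↦
    congrArg (fun v : 𝔼 (m + 1) ↦ v i) (map_add (mfderiv (𝓡 (m + 1)) 𝓘(ℝ, 𝔼 (m + 1))
      (extChartAt (𝓡 (m + 1)) x) ((extChartAt (𝓡 (m + 1)) x).symm y)) (X _) (Y _))
  have h2 : ∀ {Z : (x : M) → TangentSpace (𝓡 (m + 1)) x}, ContDiffFieldAt 1 Z x → ∀ i,
      DifferentiableAt ℝ (fun y ↦ metricDensity (m + 1) x y * coordComponents (m + 1) Z x y i)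
        (extChartAt (𝓡 (m + 1)) x x) := fun hZ i ↦
    hD.mul (differentiableAt_euclidean.1 (hZ.differentiableAt (by simp)) i)
  rw [riemDiv, riemDiv, riemDiv, ← mul_add, ← Finset.sum_add_distrib]
  congr 1
  refine Finset.sum_congr rfl fun i _ ↦ ?_
  simp only [h1, mul_add]
  rw [fderiv_fun_add (h2 hX i) (h2 hY i)]
  rfl

lemma continuous_riemDiv {Y : (x : M) → TangentSpace (𝓡 (m + 1)) x}
    (hY : ∀ x, ContDiffFieldAt ∞ Y x) : Continuous (riemDiv (m + 1) Y) :=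
  continuous_iff_continuousAt.2 fun x ↦ (contMDiffAt_riemDiv (k := ∞)
    (Eventually.of_forall fun y ↦ (hY y).of_le (by simp))).continuousAt

lemma IsLocalDefiningFunction.integrable_riemDiv (H : IsLocalDefiningFunction (m + 1) S W g)
    (hχ : ContMDiff (𝓡 (m + 1)) 𝓘(ℝ, ℝ) ∞ χ) (hχW : tsupport χ ⊆ W) (hχc : HasCompactSupport χ) :
    Integrable (riemDiv (m + 1) fun z ↦ χ z • unitGrad (m + 1) g z) (μHE[m + 1] : Measure M) := by
  refine (continuous_riemDiv fun x ↦ H.contDiffFieldAt_smul_unitGrad hχ hχW x).integrable_of_hasCompactSupport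
    (HasCompactSupport.intro hχc.isCompact fun x hx ↦ ?_)
  refine riemDiv_eq_zero_of_notMem (isClosed_tsupport χ) (fun y hy ↦ ?_) hx
  rw [image_eq_zero_of_notMem_tsupport hy]
  exact zero_smul ℝ _

lemma IsVariation.integrableOn_image (hF : IsVariation (m + 1) S ε F)
    (hS : IsHypersurface (m + 1) S) (hc : IsCompact S) (ht : t ∈ Ioo (-ε) ε) (hχ : Continuous χ)
    (hχc : HasCompactSupport χ) : IntegrableOn χ (F t '' S) μHE[m] := by
  obtain ⟨C, hC⟩ := hχ.bounded_above_of_compact_support hχc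
  exact Measure.integrableOn_of_bounded (hF.measure_image_ne_top hS hc ht)
    hχ.aestronglyMeasurable (ae_of_all _ hC)

lemma IsCalibration.add (hF : IsVariation (m + 1) S ε F) (hS : IsHypersurface (m + 1) S)
    (hc : IsCompact S) (H : IsLocalDefiningFunction (m + 1) S W g)
    (hχ : ContMDiff (𝓡 (m + 1)) 𝓘(ℝ, ℝ) ∞ χ) (hχW : tsupport χ ⊆ W) (hχc : HasCompactSupport χ)
    (hη : ContMDiff (𝓡 (m + 1)) 𝓘(ℝ, ℝ) ∞ η) (hηW : tsupport η ⊆ W) (hηc : HasCompactSupport η)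
    (h₁ : IsCalibration (m := m) S F Ω g χ) (h₂ : IsCalibration (m := m) S F Ω g η) :
    IsCalibration (m := m) S F Ω g fun z ↦ χ z + η z := by
  have hε : Ioo (-ε) ε ∈ 𝓝 (0 : ℝ) := isOpen_Ioo.mem_nhds ⟨by linarith [hF.pos], hF.pos⟩
  have hvol : ∀ t, ∫ z in Ω t, riemDiv (m + 1) (fun z ↦ (χ z + η z) • unitGrad (m + 1) g z) z
      ∂μHE[m + 1] =
      ∫ z in Ω t, riemDiv (m + 1) (fun z ↦ χ z • unitGrad (m + 1) g z) z ∂μHE[m + 1] +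
      ∫ z in Ω t, riemDiv (m + 1) (fun z ↦ η z • unitGrad (m + 1) g z) z ∂μHE[m + 1] := by
    intro t
    rw [← integral_add (H.integrable_riemDiv hχ hχW hχc).integrableOn
      (H.integrable_riemDiv hη hηW hηc).integrableOn]
    refine integral_congr_ae (ae_of_all _ fun z ↦ ?_)
    simp only [add_smul]
    exact riemDiv_add ((H.contDiffFieldAt_smul_unitGrad hχ hχW z).of_le (by norm_cast))
      ((H.contDiffFieldAt_smul_unitGrad hη hηW z).of_le (by norm_cast))
  have harea : ∀ t ∈ Ioo (-ε) ε, ∫ z in F t '' S, (χ z + η z) ∂μHE[m] =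
      ∫ z in F t '' S, χ z ∂μHE[m] + ∫ z in F t '' S, η z ∂μHE[m] := fun t ht ↦
    integral_add (hF.integrableOn_image hS hc ht hχ.continuous hχc)
      (hF.integrableOn_image hS hc ht hη.continuous hηc)
  refine ⟨(h₁.differentiableAt.add h₂.differentiableAt).congr_of_eventuallyEq ?_, ?_, ?_⟩
  · filter_upwards [hε] with t ht
    exact harea t ht
  · filter_upwards [hε, h₁.eventually_le, h₂.eventually_le] with t ht h1 h2
    rw [hvol, harea t ht]
    exact add_le_add h1 h2
  · rw [hvol, harea 0 (mem_of_mem_nhds hε), h₁.eq_zero, h₂.eq_zero]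

end LocalCalibration

/-! ### Patching calibrations by compactness. -/

section GlobalCalibration

variable {m : ℕ} {M : Type*} [MetricSpace M] [MeasurableSpace M] [BorelSpace M]
  [ChartedSpace (𝔼 (m + 1)) M]
  [RiemannianBundle (fun x : M ↦ TangentSpace (𝓡 (m + 1)) x)] [IsManifold (𝓡 (m + 1)) ω M]
  [IsContMDiffRiemannianBundle (𝓡 (m + 1)) ω (𝔼 (m + 1))
    (fun x : M ↦ TangentSpace (𝓡 (m + 1)) x)] [IsRiemannianManifold (𝓡 (m + 1)) M]
  {S W : Set M} {p : M} {ε : ℝ} {F : ℝ → M → M} {Ω : ℝ → Set M} {χ g : M → ℝ}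

lemma isCalibration_zero : IsCalibration (m := m) S F Ω g fun _ ↦ 0 := by
  have h : ∀ z, riemDiv (m + 1) (fun z ↦ (0 : ℝ) • unitGrad (m + 1) g z) z = 0 := fun z ↦
    riemDiv_eq_zero_of_notMem isClosed_empty (fun x _ ↦ zero_smul ℝ _) (notMem_empty z)
  constructor
  · simp
  · simp only [h]
    simp
  · simp only [h]
    simp

/-- Calibrations add up, so local ones can be patched. The property carried through the compactness
argument allows a smooth factor `η ≥ 0`: two cutoffs combine to `χ + (1 - χ) ξ`, which is `1` where
either of them is, and the two summands are handled with the factors `η` and `η (1 - χ)`. -/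
lemma exists_isCalibration (hF : IsVariation (m + 1) S ε F) (hS : IsHypersurface (m + 1) S)
    (hc : IsCompact S) (hΩ : IsEnclosedFamily S ε F Ω) (H : IsLocalDefiningFunction (m + 1) S W g)
    (hSW : S ⊆ W) (hneg : ∀ x ∈ W, x ∈ Ω 0 ↔ g x < 0) :
    ∃ χ : M → ℝ, ContMDiff (𝓡 (m + 1)) 𝓘(ℝ, ℝ) ∞ χ ∧ HasCompactSupport χ ∧ tsupport χ ⊆ W ∧
      (∀ z ∈ S, ∀ᶠ x in 𝓝 z, χ x = 1) ∧ IsCalibration (m := m) S F Ω g χ := by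
  have : IsManifold (𝓡 (m + 1)) ∞ M := IsManifold.of_le (n := ω) le_top
  suffices h : ∃ χ : M → ℝ, ContMDiff (𝓡 (m + 1)) 𝓘(ℝ, ℝ) ∞ χ ∧ (∀ z, 0 ≤ χ z ∧ χ z ≤ 1) ∧
      HasCompactSupport χ ∧ tsupport χ ⊆ W ∧ (∀ z ∈ S, ∀ᶠ x in 𝓝 z, χ x = 1) ∧
      ∀ η : M → ℝ, ContMDiff (𝓡 (m + 1)) 𝓘(ℝ, ℝ) ∞ η → (∀ z, 0 ≤ η z) →
        IsCalibration (m := m) S F Ω g fun z ↦ η z * χ z by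
    obtain ⟨χ, h1, -, h3, h4, h5, h6⟩ := h
    refine ⟨χ, h1, h3, h4, h5, ?_⟩
    simpa only [one_mul] using h6 (fun _ ↦ 1) contMDiff_const (fun _ ↦ zero_le_one)
  refine hc.induction_on (p := fun A ↦ ∃ χ : M → ℝ, ContMDiff (𝓡 (m + 1)) 𝓘(ℝ, ℝ) ∞ χ ∧
      (∀ z, 0 ≤ χ z ∧ χ z ≤ 1) ∧
      HasCompactSupport χ ∧ tsupport χ ⊆ W ∧ (∀ z ∈ A, ∀ᶠ x in 𝓝 z, χ x = 1) ∧
      ∀ η : M → ℝ, ContMDiff (𝓡 (m + 1)) 𝓘(ℝ, ℝ) ∞ η → (∀ z, 0 ≤ η z) →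
        IsCalibration (m := m) S F Ω g fun z ↦ η z * χ z) ?_ ?_ ?_ ?_
  · refine ⟨fun _ ↦ 0, contMDiff_const, by simp, HasCompactSupport.zero, ?_, by simp, fun η _ _ ↦ ?_⟩
    · rw [show (fun _ : M ↦ (0 : ℝ)) = 0 from rfl, tsupport_zero]
      exact empty_subset W
    · simpa only [mul_zero] using isCalibration_zero
  · rintro A B hAB ⟨χ, h1, h2, h3, h4, h5, h6⟩
    exact ⟨χ, h1, h2, h3, h4, fun z hz ↦ h5 z (hAB hz), h6⟩
  · rintro A B ⟨χ, h1, h2, h3, h4, h5, h6⟩ ⟨ξ, k1, k2, k3, k4, k5, k6⟩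
    have hsmooth : ContMDiff (𝓡 (m + 1)) 𝓘(ℝ, ℝ) ∞ fun z ↦ 1 - χ z := contMDiff_const.sub h1
    have hsub : ∀ (α β : M → ℝ), tsupport (fun z ↦ α z * β z) ⊆ tsupport β := fun α β ↦
      tsupport_mul_subset_right
    refine ⟨fun z ↦ χ z + (1 - χ z) * ξ z, h1.add (hsmooth.mul k1), fun z ↦ ⟨?_, ?_⟩,
      h3.add (HasCompactSupport.mul_left (f := fun z ↦ 1 - χ z) k3), ?_, ?_, fun η hη hη0 ↦ ?_⟩
    · nlinarith [h2 z, k2 z]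
    · nlinarith [h2 z, k2 z]
    · exact (tsupport_add χ _).trans (union_subset h4 ((hsub _ _).trans k4))
    · rintro z (hz | hz)
      · filter_upwards [h5 z hz] with x hx
        rw [hx]; ring
      · filter_upwards [k5 z hz] with x hx
        rw [hx]; ring
    · have hη' : ContMDiff (𝓡 (m + 1)) 𝓘(ℝ, ℝ) ∞ fun z ↦ η z * (1 - χ z) := hη.mul hsmooth
      have := IsCalibration.add hF hS hc H (hη.mul h1) ((hsub _ _).trans h4)
        (HasCompactSupport.mul_left (f := η) h3) (hη'.mul k1) ((hsub _ _).trans k4)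
        (HasCompactSupport.mul_left (f := fun z ↦ η z * (1 - χ z)) k3) (h6 η hη hη0)
        (k6 _ hη' fun z ↦ mul_nonneg (hη0 z) (by linarith [(h2 z).2]))
      convert this using 2 with z
      change η z * (χ z + (1 - χ z) * ξ z) = η z * χ z + η z * (1 - χ z) * ξ z
      ring
  · intro p hp
    obtain ⟨U, hU, hUW, hcal⟩ := exists_local_isCalibration hF hS hc hΩ H hSW hneg hp
    obtain ⟨ξ, -, hξ⟩ := (SmoothBumpFunction.nhds_basis_tsupport (I := 𝓡 (m + 1)) p).mem_iff.1 hU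
    refine ⟨{z | ∀ᶠ x in 𝓝 z, ξ x = 1},
      mem_nhdsWithin_of_mem_nhds ξ.eventuallyEq_one.eventually_nhds, ξ, ξ.contMDiff,
      fun z ↦ ⟨ξ.nonneg, ξ.le_one⟩, ξ.hasCompactSupport, hξ.trans hUW, fun z hz ↦ hz,
      fun η hη hη0 ↦ ?_⟩
    exact hcal _ (hη.mul ξ.contMDiff) (fun z ↦ mul_nonneg (hη0 z) ξ.nonneg)
      (HasCompactSupport.mul_left (f := η) ξ.hasCompactSupport) (tsupport_mul_subset_right.trans hξ)

end GlobalCalibration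

/-! ### Lipschitz bounds for functions near a compact set. -/

section Lipschitz

variable {n : ℕ} {M : Type*} [MetricSpace M] [ChartedSpace (𝔼 n) M]
  [RiemannianBundle (fun x : M ↦ TangentSpace (𝓡 n) x)] [IsManifold (𝓡 n) ω M]
  [IsContMDiffRiemannianBundle (𝓡 n) ω (𝔼 n) (fun x : M ↦ TangentSpace (𝓡 n) x)]
  [IsRiemannianManifold (𝓡 n) M]

lemma exists_lipschitzOnWith_extChartAt (p : M) :
    ∃ K, ∃ U ∈ 𝓝 p, LipschitzOnWith K (extChartAt (𝓡 n) p) U := by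
  have hy := mem_extChartAt_target (I := 𝓡 n) p
  obtain ⟨r, hr, -, hb⟩ := exists_ball_dist_symm hy (ε := 1 / 2) (by norm_num) (by norm_num)
  obtain ⟨A, hA, hAi, -⟩ := exists_coordModel hy
  obtain ⟨K, hK, hKA⟩ := LinearMap.exists_antilipschitzWith (A : 𝔼 n →ₗ[ℝ] 𝔼 n)
    (LinearMap.ker_eq_bot.2 hAi)
  refine ⟨K * 2, _, inter_mem (extChartAt_source_mem_nhds (I := 𝓡 n) p)
    ((continuousAt_extChartAt (I := 𝓡 n) p).preimage_mem_nhds (Metric.ball_mem_nhds _ hr)), ?_⟩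
  refine LipschitzOnWith.of_dist_le_mul fun x hx x' hx' ↦ ?_
  have h1 := (hb _ hx.2 _ hx'.2).1
  rw [(extChartAt (𝓡 n) p).left_inv hx.1, (extChartAt (𝓡 n) p).left_inv hx'.1, ← hA] at h1
  have h2 := hKA.le_mul_norm (map_zero _) (extChartAt (𝓡 n) p x - extChartAt (𝓡 n) p x')
  rw [dist_eq_norm]
  refine h2.trans ?_
  push_cast
  rw [mul_assoc]
  refine mul_le_mul_of_nonneg_left ?_ K.2
  change ‖A _‖ ≤ _
  linarith

lemma ContMDiffAt.exists_lipschitzOnWith_real {d : M → ℝ} {p : M}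
    (hd : ContMDiffAt (𝓡 n) 𝓘(ℝ, ℝ) 1 d p) : ∃ K, ∃ U ∈ 𝓝 p, LipschitzOnWith K d U := by
  have hy := mem_extChartAt_target (I := 𝓡 n) p
  have h1 := contDiffAt_comp_symm hy (h := d) (k := 1) (by rwa [extChartAt_to_inv])
  obtain ⟨K₁, V, hV, hK₁⟩ := h1.exists_lipschitzOnWith
  obtain ⟨K₂, U, hU, hK₂⟩ := exists_lipschitzOnWith_extChartAt (n := n) p
  have hs := extChartAt_source_mem_nhds (I := 𝓡 n) p
  have hV' := (continuousAt_extChartAt (I := 𝓡 n) p).preimage_mem_nhds hV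
  refine ⟨K₁ * K₂, _, inter_mem (inter_mem hU hs) hV', ?_⟩
  have h3 := hK₁.comp (hK₂.mono (s := U ∩ (extChartAt (𝓡 n) p).source ∩ extChartAt (𝓡 n) p ⁻¹' V)
    fun x hx ↦ hx.1.1) fun x hx ↦ hx.2
  intro x hx x' hx'
  have h4 := h3 hx hx'
  rw [ENNReal.coe_mul] at h4 ⊢
  simpa only [Function.comp_apply, (extChartAt (𝓡 n) p).left_inv hx.1.2,
    (extChartAt (𝓡 n) p).left_inv hx'.1.2] using h4

lemma IsCompact.exists_abs_sub_le {S : Set M} (hc : IsCompact S) {d : M → ℝ}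
    (hd : ContMDiff (𝓡 n) 𝓘(ℝ, ℝ) 1 d) :
    ∃ K ≥ 0, ∃ δ > 0, ∀ z ∈ S, ∀ x, dist x z < δ → |d x - d z| ≤ K * dist x z := by
  refine hc.induction_on (p := fun A ↦ ∃ K ≥ 0, ∃ δ > 0, ∀ z ∈ A, ∀ x, dist x z < δ →
    |d x - d z| ≤ K * dist x z) ⟨0, le_rfl, 1, one_pos, by simp⟩ ?_ ?_ ?_
  · rintro A B hAB ⟨K, hK, δ, hδ, h⟩
    exact ⟨K, hK, δ, hδ, fun z hz ↦ h z (hAB hz)⟩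
  · rintro A B ⟨K, hK, δ, hδ, h⟩ ⟨K', hK', δ', hδ', h'⟩
    refine ⟨max K K', le_max_of_le_left hK, min δ δ', lt_min hδ hδ', ?_⟩
    rintro z (hz | hz) x hx
    · exact (h z hz x (hx.trans_le (min_le_left _ _))).trans
        (mul_le_mul_of_nonneg_right (le_max_left _ _) dist_nonneg)
    · exact (h' z hz x (hx.trans_le (min_le_right _ _))).trans
        (mul_le_mul_of_nonneg_right (le_max_right _ _) dist_nonneg)
  · intro p hp
    obtain ⟨K, U, hU, hK⟩ := (hd p).exists_lipschitzOnWith_real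
    obtain ⟨r, hr, hb⟩ := Metric.mem_nhds_iff.1 hU
    refine ⟨Metric.ball p (r / 2), mem_nhdsWithin_of_mem_nhds (Metric.ball_mem_nhds _ (half_pos hr)),
      K, K.2, r / 2, half_pos hr, fun z hz x hx ↦ ?_⟩
    rw [Metric.mem_ball] at hz
    rw [← Real.dist_eq]
    refine hK.dist_le_mul x (hb ?_) z (hb ?_)
    · rw [Metric.mem_ball]
      linarith [dist_triangle x z p]
    · rw [Metric.mem_ball]
      linarith

end Lipschitz

/-! ### Integrals over the enclosed sets at constant volume. -/

section EnclosedVolume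

variable {m : ℕ} {M : Type*} [MetricSpace M] [MeasurableSpace M] [BorelSpace M]
  [ChartedSpace (𝔼 (m + 1)) M]
  [RiemannianBundle (fun x : M ↦ TangentSpace (𝓡 (m + 1)) x)] [IsManifold (𝓡 (m + 1)) ω M]
  [IsContMDiffRiemannianBundle (𝓡 (m + 1)) ω (𝔼 (m + 1))
    (fun x : M ↦ TangentSpace (𝓡 (m + 1)) x)] [IsRiemannianManifold (𝓡 (m + 1)) M]
  {S : Set M} {ε C H : ℝ} {F : ℝ → M → M} {Ω : ℝ → Set M} {d : M → ℝ}

/-- Between times `0` and `t` the hypersurface stays in the tube, so it never crosses `x`, and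
membership of `x` is locally constant in time. -/
lemma IsEnclosedFamily.mem_iff_of_notMem_cthickening (hΩ : IsEnclosedFamily S ε F Ω) {t : ℝ}
    (ht : t ∈ Ioo (-ε) ε) (hC : 0 ≤ C) (hdist : ∀ s, |s| ≤ |t| → ∀ z ∈ S, dist (F s z) z ≤ C * |s|)
    {x : M} (hx : x ∉ Metric.cthickening (C * |t|) S) : x ∈ Ω t ↔ x ∈ Ω 0 := by
  have hs : ∀ s ∈ uIcc 0 t, |s| ≤ |t| := fun s hs ↦ by
    simpa using abs_sub_left_of_mem_uIcc hs
  have h := (isPreconnected_uIcc (a := (0 : ℝ)) (b := t)).eq_of_eventually_eq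
    (η := fun s ↦ x ∈ Ω s) (fun s hst ↦ ?_) right_mem_uIcc left_mem_uIcc
  · exact iff_of_eq h
  · have hsε : s ∈ Ioo (-ε) ε := abs_lt.1 ((hs s hst).trans_lt (abs_lt.2 ht))
    have hxs : x ∉ F s '' S := by
      rintro ⟨z, hz, rfl⟩
      refine hx (Metric.mem_cthickening_of_dist_le _ z _ _ hz ?_)
      exact (hdist s (hs s hst) z hz).trans (mul_le_mul_of_nonneg_left (hs s hst) hC)
    have hcont : ContinuousAt (fun s' : ℝ ↦ (s', x)) s := by fun_prop
    filter_upwards [hcont.eventually (hΩ.continuous s hsε x hxs)] with s' hs' _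
    exact propext hs'

lemma abs_setIntegral_sub_setIntegral_le {μ : Measure M} {A B T : Set M} {e : M → ℝ} {k : ℝ}
    (hT : MeasurableSet T) (hTfin : μ T < ⊤)
    (hAi : IntegrableOn e A μ) (hBi : IntegrableOn e B μ) (hAB : ∀ x ∉ T, x ∈ A ↔ x ∈ B)
    (hk : ∀ x ∈ T, |e x| ≤ k) :
    |∫ x in A, e x ∂μ - ∫ x in B, e x ∂μ| ≤ 2 * k * μ.real T := by
  have hdiff : A \ T = B \ T := by
    ext x
    exact and_congr_left fun hx ↦ hAB x hx
  rw [← integral_inter_add_sdiff hT hAi, ← integral_inter_add_sdiff hT hBi, hdiff,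
    add_sub_add_right_eq_sub]
  have hbound : ∀ D : Set M, |∫ x in D ∩ T, e x ∂μ| ≤ k * μ.real (D ∩ T) := fun D ↦ by
    rw [← Real.norm_eq_abs]
    exact norm_setIntegral_le_of_norm_le_const ((measure_mono inter_subset_right).trans_lt hTfin)
      fun x hx ↦ hk x hx.2
  have hbound' : ∀ D : Set M, |∫ x in D ∩ T, e x ∂μ| ≤ k * μ.real T := fun D ↦ by
    rcases T.eq_empty_or_nonempty with rfl | ⟨x, hx⟩
    · simp
    · exact (hbound D).trans (mul_le_mul_of_nonneg_left
        (measureReal_mono inter_subset_right hTfin.ne) ((abs_nonneg _).trans (hk x hx)))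
  calc _ ≤ |∫ x in A ∩ T, e x ∂μ| + |∫ x in B ∩ T, e x ∂μ| := abs_sub _ _
    _ ≤ _ := by linarith [hbound' A, hbound' B]

/-- The variation at time `0` shows that `S` has finite `m`-dimensional measure, which forces its
measure one dimension higher to vanish. -/
lemma IsHypersurface.measure_eq_zero (hF : IsVariation (m + 1) S ε F)
    (hS : IsHypersurface (m + 1) S) (hc : IsCompact S) : μHE[m + 1] S = 0 := by
  have h := hF.measure_image_ne_top hS hc ⟨by linarith [hF.pos], hF.pos⟩
  rw [hF.image_zero] at h
  exact (Measure.euclideanHausdorffMeasure_zero_or_top (Nat.lt_succ_self m) S).resolve_right h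

lemma IsCompact.tendsto_euclideanHausdorffMeasure_cthickening (hc : IsCompact S) :
    (∀ᶠ r in 𝓝 (0 : ℝ), μHE[m + 1] (Metric.cthickening r S) < ⊤) ∧
    Tendsto (fun r ↦ (μHE[m + 1] : Measure M) (Metric.cthickening r S)) (𝓝 0) (𝓝 (μHE[m + 1] S)) := by
  obtain ⟨U, hSU, hU, hfin⟩ := hc.exists_open_superset_measure_lt_top (μHE[m + 1] : Measure M)
  obtain ⟨R, hR, hRU⟩ := hc.exists_cthickening_subset_open hU hSU
  constructor
  · filter_upwards [eventually_lt_nhds hR] with r hr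
    exact (measure_mono ((Metric.cthickening_mono hr.le S).trans hRU)).trans_lt hfin
  · exact tendsto_measure_cthickening_of_isClosed
      ⟨R, hR, ((measure_mono hRU).trans_lt hfin).ne⟩ hc.isClosed

/-- Because the volume is constant and finite, `d` may be replaced by `d - H`. The sets `Ω t` and `Ω
0` differ only in a tube of radius `C * |t|` around `S`, where `d - H` is `O(|t|)`; the volume of
the tube tends to that of `S`, which is zero, so the integral changes by `o(t)`. -/
lemma hasDerivAt_setIntegral_zero (hF : IsVariation (m + 1) S ε F) (hS : IsHypersurface (m + 1) S)
    (hc : IsCompact S) (hΩ : IsEnclosedFamily S ε F Ω)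
    (hfin : μHE[m + 1] (Ω 0) ≠ ⊤)
    (hvol : ∀ t ∈ Ioo (-ε) ε, μHE[m + 1] (Ω t) = μHE[m + 1] (Ω 0))
    (hd : ContMDiff (𝓡 (m + 1)) 𝓘(ℝ, ℝ) 1 d) (hdi : Integrable d (μHE[m + 1] : Measure M))
    (hdS : ∀ z ∈ S, d z = H) :
    HasDerivAt (fun t ↦ ∫ z in Ω t, d z ∂μHE[m + 1]) 0 0 := by
  obtain ⟨C, hC, δ, hδ, hdist⟩ := hF.exists_dist_le hS hc
  obtain ⟨K, hK, δ', hδ', hlip⟩ := hc.exists_abs_sub_le hd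
  obtain ⟨hTfin, hTlim⟩ := hc.tendsto_euclideanHausdorffMeasure_cthickening (m := m)
  have hr : Tendsto (fun t : ℝ ↦ C * |t|) (𝓝 0) (𝓝 0) := by
    have : ContinuousAt (fun t : ℝ ↦ C * |t|) 0 := by fun_prop
    simpa [ContinuousAt] using this
  have hv : Tendsto (fun t : ℝ ↦ (μHE[m + 1] : Measure M).real (Metric.cthickening (C * |t|) S))
      (𝓝 0) (𝓝 0) := by
    rw [IsHypersurface.measure_eq_zero hF hS hc] at hTlim
    exact (ENNReal.tendsto_toReal ENNReal.zero_ne_top).comp (hTlim.comp hr)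
  have hmem : Ioo (-ε) ε ∈ 𝓝 (0 : ℝ) := isOpen_Ioo.mem_nhds ⟨by linarith [hF.pos], hF.pos⟩
  have hkey : ∀ᶠ t in 𝓝 (0 : ℝ), |∫ z in Ω t, d z ∂μHE[m + 1] - ∫ z in Ω 0, d z ∂μHE[m + 1]| ≤
      2 * (K * (C * |t|)) * (μHE[m + 1] : Measure M).real (Metric.cthickening (C * |t|) S) := by
    filter_upwards [hmem, hr.eventually hTfin, hr.eventually (eventually_lt_nhds hδ'),
      (continuous_abs.tendsto' (0 : ℝ) 0 abs_zero).eventually (eventually_lt_nhds hδ)]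
      with t ht htT htδ' htδ
    have hint : ∀ s ∈ Ioo (-ε) ε, IntegrableOn (fun z ↦ d z - H) (Ω s) μHE[m + 1] ∧
        ∫ z in Ω s, d z ∂μHE[m + 1] = ∫ z in Ω s, (d z - H) ∂μHE[m + 1] +
          (μHE[m + 1] : Measure M).real (Ω 0) * H := fun s hs ↦ by
      have hcst : IntegrableOn (fun _ : M ↦ H) (Ω s) μHE[m + 1] :=
        integrableOn_const (by rw [hvol s hs]; exact hfin)
      refine ⟨hdi.integrableOn.sub hcst, ?_⟩
      rw [integral_sub hdi.integrableOn hcst, setIntegral_const, measureReal_def, hvol s hs,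
        ← measureReal_def, smul_eq_mul, sub_add_cancel]
    have h0 := mem_of_mem_nhds hmem
    rw [(hint t ht).2, (hint 0 h0).2, add_sub_add_right_eq_sub]
    refine abs_setIntegral_sub_setIntegral_le Metric.isClosed_cthickening.measurableSet htT
      (hint t ht).1 (hint 0 h0).1 (fun x hx ↦ ?_) fun x hx ↦ ?_
    · exact hΩ.mem_iff_of_notMem_cthickening ht hC.le
        (fun s hs ↦ hdist s (hs.trans_lt htδ)) hx
    · rw [hc.cthickening_eq_biUnion_closedBall (by positivity)] at hx
      obtain ⟨z, hz, hle⟩ := mem_iUnion₂.1 hx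
      rw [Metric.mem_closedBall] at hle
      rw [← hdS z hz]
      exact (hlip z hz x (hle.trans_lt htδ')).trans (mul_le_mul_of_nonneg_left hle hK)
  rw [hasDerivAt_iff_isLittleO]
  have hlittle := (Asymptotics.isBigO_refl (fun t : ℝ ↦ t) (𝓝 0)).mul_isLittleO
    ((Asymptotics.isLittleO_one_iff ℝ).2 hv)
  simp only [mul_one] at hlittle
  simp only [smul_zero, sub_zero]
  refine Asymptotics.IsBigO.trans_isLittleO (Asymptotics.IsBigO.of_bound (2 * K * C) ?_) hlittle
  filter_upwards [hkey] with t ht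
  rw [Real.norm_eq_abs]
  refine ht.trans (le_of_eq ?_)
  rw [norm_mul, Real.norm_eq_abs, Real.norm_of_nonneg measureReal_nonneg]
  ring

end EnclosedVolume

/-! ### Vanishing of the first variation of area. -/

section FirstVariation

variable {m : ℕ} {M : Type*} [MetricSpace M] [MeasurableSpace M] [BorelSpace M]
  [ChartedSpace (𝔼 (m + 1)) M]
  [RiemannianBundle (fun x : M ↦ TangentSpace (𝓡 (m + 1)) x)] [IsManifold (𝓡 (m + 1)) ω M]
  [IsContMDiffRiemannianBundle (𝓡 (m + 1)) ω (𝔼 (m + 1))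
    (fun x : M ↦ TangentSpace (𝓡 (m + 1)) x)] [IsRiemannianManifold (𝓡 (m + 1)) M]
  {S W : Set M} {ε H : ℝ} {F : ℝ → M → M} {Ω : ℝ → Set M} {g χ : M → ℝ}

lemma IsVariation.eventually_toReal_measure_image_eq (hF : IsVariation (m + 1) S ε F)
    (hS : IsHypersurface (m + 1) S) (hc : IsCompact S) (hχ : ∀ z ∈ S, ∀ᶠ x in 𝓝 z, χ x = 1) :
    ∀ᶠ t in 𝓝 (0 : ℝ), (μHE[m] (F t '' S)).toReal = ∫ z in F t '' S, χ z ∂μHE[m] := by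
  obtain ⟨C, hC, δ, hδ, hdist⟩ := hF.exists_dist_le hS hc
  obtain ⟨R, hR, hRχ⟩ := hc.exists_cthickening_subset_open (isOpen_setOfPred_eventually_nhds)
    (fun z hz ↦ hχ z hz)
  have hr : Tendsto (fun t : ℝ ↦ C * |t|) (𝓝 0) (𝓝 0) := by
    have : ContinuousAt (fun t : ℝ ↦ C * |t|) 0 := by fun_prop
    simpa [ContinuousAt] using this
  filter_upwards [isOpen_Ioo.mem_nhds (show (0 : ℝ) ∈ Ioo (-ε) ε from ⟨by linarith [hF.pos], hF.pos⟩),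
    hr.eventually (eventually_lt_nhds hR),
    (continuous_abs.tendsto' (0 : ℝ) 0 abs_zero).eventually (eventually_lt_nhds hδ)] with t ht htR htδ
  rw [setIntegral_congr_fun (g := fun _ ↦ (1 : ℝ)) (hF.isCompact_image hc ht).isClosed.measurableSet,
    setIntegral_const, smul_eq_mul, mul_one, measureReal_def]
  rintro _ ⟨z, hz, rfl⟩
  have h : ∀ᶠ x in 𝓝 (F t z), χ x = 1 := hRχ (Metric.mem_cthickening_of_dist_le _ z _ _ hz ((hdist t htδ z hz).trans htR.le))
  exact h.self_of_nhds

/-- By calibration, the weighted area minus the integral of the divergence over `Ω t` has a local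
minimum at `0`. Both terms are differentiable there and the second has derivative zero, hence so has
the first, which for small times is the area. -/
lemma hasDerivAt_measure_image_zero (hF : IsVariation (m + 1) S ε F)
    (hS : IsHypersurface (m + 1) S) (hc : IsCompact S)
    (hΩ : IsEnclosedFamily S ε F Ω) (hfin : μHE[m + 1] (Ω 0) ≠ ⊤)
    (hvol : ∀ t ∈ Ioo (-ε) ε, μHE[m + 1] (Ω t) = μHE[m + 1] (Ω 0))
    (G : IsLocalDefiningFunction (m + 1) S W g) (hSW : S ⊆ W)
    (hneg : ∀ x ∈ W, x ∈ Ω 0 ↔ g x < 0)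
    (hH : ∀ x ∈ S, riemDiv (m + 1) (unitGrad (m + 1) g) x = H) :
    HasDerivAt (fun t ↦ (μHE[m] (F t '' S)).toReal) 0 0 := by
  obtain ⟨χ, hχ, hχc, hχW, hχ1, hcal⟩ := exists_isCalibration hF hS hc hΩ G hSW hneg
  have hfield := G.contDiffFieldAt_smul_unitGrad hχ hχW
  have hΦ := hasDerivAt_setIntegral_zero (H := H) hF hS hc hΩ hfin hvol
    (d := riemDiv (m + 1) fun z ↦ χ z • unitGrad (m + 1) g z)
    (fun x ↦ contMDiffAt_riemDiv (k := 1)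
      (Eventually.of_forall fun y ↦ (hfield y).of_le (by norm_cast)))
    (G.integrable_riemDiv hχ hχW hχc) (fun z hz ↦ by
      rw [← hH z hz]
      refine riemDiv_congr ?_
      filter_upwards [hχ1 z hz] with x hx
      rw [hx]
      exact one_smul ℝ _)
  have hA := hcal.differentiableAt.hasDerivAt
  have hmin : IsLocalMin (fun t ↦ ∫ z in F t '' S, χ z ∂μHE[m] -
      ∫ z in Ω t, riemDiv (m + 1) (fun z ↦ χ z • unitGrad (m + 1) g z) z ∂μHE[m + 1]) 0 := by
    filter_upwards [hcal.eventually_le] with t ht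
    rw [hcal.eq_zero, sub_self]
    exact sub_nonneg.2 ht
  have h0 := hmin.hasDerivAt_eq_zero (hA.sub hΦ)
  rw [sub_zero] at h0
  rw [h0] at hA
  exact hA.congr_of_eventuallyEq (hF.eventually_toReal_measure_image_eq hS hc hχ1)

end FirstVariation

/-- In dimension zero every differential vanishes, so no local defining function can be regular. -/
lemma IsHypersurface.ne_zero {n : ℕ} {M : Type*} [TopologicalSpace M] [ChartedSpace (𝔼 n) M]
    [RiemannianBundle (fun x : M ↦ TangentSpace (𝓡 n) x)] {S : Set M} (hS : IsHypersurface n S)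
    (hne : S.Nonempty) : n ≠ 0 := by
  rintro rfl
  obtain ⟨p, hp⟩ := hne
  obtain ⟨U, h, hpU, H⟩ := hS p hp
  refine H.regular p hpU (ContinuousLinearMap.ext fun v ↦ ?_)
  have hv : v = 0 := Subsingleton.elim (α := 𝔼 0) _ _
  rw [hv, map_zero, map_zero]

end

theorem mainTheorem8 (n : ℕ) {M : Type*} [MetricSpace M] [MeasurableSpace M] [BorelSpace M]
    [ChartedSpace (EuclideanSpace ℝ (Fin n)) M] [IsManifold (𝓡 n) ω M]
    [RiemannianBundle (fun x : M ↦ TangentSpace (𝓡 n) x)]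
    [IsContMDiffRiemannianBundle (𝓡 n) ω (EuclideanSpace ℝ (Fin n))
      (fun x : M ↦ TangentSpace (𝓡 n) x)]
    [IsRiemannianManifold (𝓡 n) M] [CompleteSpace M] [ConnectedSpace M]
    (S : Set M) (hS : IsEquilibriumHypersurface n S) (hcompact : IsCompact S) :
    HasConstantMeanCurvature n S ∧
    ∀ (ε : ℝ) (F : ℝ → M → M) (Ω : ℝ → Set M),
      IsVariation n S ε F → IsEnclosedFamily S ε F Ω → μHE[n] (Ω 0) ≠ ⊤ →
      (∀ t ∈ Ioo (-ε) ε, μHE[n] (Ω t) = μHE[n] (Ω 0)) →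
      (∀ t ∈ Ioo (-ε) ε, μHE[n - 1] (F t '' S) ≠ ⊤) ∧
      HasDerivAt (fun t ↦ (μHE[n - 1] (F t '' S)).toReal) 0 0 := by
  obtain ⟨hyp, f, hf, p₀, hSl⟩ := hS
  have hne : S.Nonempty := ⟨p₀, hSl ▸ mem_connectedComponentIn rfl⟩
  obtain ⟨m, rfl⟩ := Nat.exists_eq_succ_of_ne_zero (hyp.ne_zero hne)
  have hpre : IsPreconnected S := hSl ▸ isPreconnected_connectedComponentIn
  obtain ⟨k, hk, hroot⟩ := exists_forall_isLocalRoot hf hSl hyp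
  refine ⟨hasConstantMeanCurvature_of_isLocalRoot hf hk hpre hroot,
    fun ε F Ω hF hΩ hfin hvol ↦ ⟨fun t ht ↦ hF.measure_image_ne_top (m := m) hyp hcompact ht, ?_⟩⟩
  have henc : Encloses S (Ω 0) := by
    have := hΩ.encloses 0 ⟨by linarith [hF.pos], hF.pos⟩
    rwa [hF.image_zero] at this
  obtain ⟨W, g, H, hSW, G, hneg, hH⟩ := exists_oriented_defining hf hk hpre hroot henc
  exact hasDerivAt_measure_image_zero (m := m) hF hyp hcompact hΩ hfin hvol G hSW hneg hH
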